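/- Let $F$ be a field of characteristic $2$ (for instance $\mathbb F_2$). All DG categories, DG algebras and DG modules are over $F$; since the characteristic is $2$, all Koszul signs are trivial. For a DG category $\mathcal A$ with shifts, $H(\mathcal A)$ is its $0$th cohomology category; the distinguished triangles in it are the triangles isomorphic to those of mapping cones of closed degree-$0$ morphisms, and, when they make $H(\mathcal A)$ triangulated, $K_0(\mathcal A)$ is the Grothendieck group of $H(\mathcal A)$. **The category $\mathcal I$.** Let $\mathcal I'$ be the following graded monoidal category. Its elementary objects are $Q^k$, $k\ge 0$, and $\mathrm{Hom}(Q^k,Q^l)$ is the $F$-vector space spanned by the diagrams from $k$ to $l$ points obtained by stacking vertical strands, cups $\mathbf 1\to Q^2$ (degree $-1$), caps $Q^2\to\mathbf 1$ (degree $1$) and half strands $\mathrm{hf}:\mathbf 1\to Q$ (degree $0$), modulo: isotopy (interchange of heights of disjoint diagrams and both zigzag relations), $\mathrm{cup}\circ\mathrm{cap}=\mathrm{id}_{Q^2}$, $\mathrm{cap}\circ\mathrm{cup}=\mathrm{id}_{\mathbf 1}$, and $\mathrm{hf}\otimes\mathrm{id}_Q=\mathrm{id}_Q\otimes\mathrm{hf}$.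 Composition is vertical stacking, $\otimes$ is horizontal juxtaposition, the differential is zero, and finite formal direct sums of shifts $Q^k[m]$ are adjoined. Let $\mathcal I$ be the monoidal DG category of one-sided twisted complexes over $\mathcal I'$. **The category $DGP(R)$.** Let $R$ be the unital graded $F$-algebra with trivial differential generated by $e(x),e(y),a,b$, of degree $0$ except $\mathrm{gr}(b)=1$, with relations $e(z)e(z')=\delta_{z,z'}e(z)$ for $z,z'\in\{x,y\}$, $e(x)+e(y)=1$, $e(x)a=ae(y)=a$, $e(y)b=be(x)=b$, $aba=bab=0$. Let $P(x)=Re(x)$ and $P(y)=Re(y)$, DG left $R$-modules with trivial differential. Let $DGP(R)$ be the smallest full subcategory of the DG category of DG left $R$-modules which contains $P(x)$, $P(y)$ and the zero modules and is closed under isomorphisms (closed, of degree $0$), shifts $[n]$, $n\in\mathbb Z$, and mapping cones. **The bimodule $M$.** As a left DG module $M=P(y)\oplus P(x)[1]$, with generators $m$ of $P(y)$ (degree $0$) and $m'$ of $P(x)[1]$ (degree $-1$), zero differential, and right action determined by $m\,e(x)=m$, $m'\,e(y)=m'$, $m\,a=b\,m'$, $m'\,b=a\,m$ and $m\,e(y)=m\,b=0$,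 $m'\,e(x)=m'\,a=0$. **Theorem.** 1. $P(x)$ and $P(y)$ are projective DG modules, i.e. the complex of homomorphisms from $P(z)$ to any acyclic DG module is acyclic. 2. $H(\mathcal I)$ and $H(DGP(R))$ are triangulated. 3. $M\otimes_R M\cong R[1]$ as DG $R$-bimodules. 4. There is an isomorphism $\varphi:K_0(DGP(R))\to\mathbb Z^2=\mathbb Z\langle x,y\rangle$ with $\varphi[P(x)]=x$ and $\varphi[P(y)]=y$. 5. There is an isomorphism $\gamma:\mathbb Z[i]\to K_0(\mathcal I)$ with $\gamma(1)=[Q^0]$ and $\gamma(i)=[Q]$, under which the multiplication of $\mathbb Z[i]$ corresponds to the tensor product of $\mathcal I$. 6. There is a categorical action $\eta:\mathcal I\times DGP(R)\to DGP(R)$, i.e. a bilinear DG bifunctor (preserving degrees and commuting with the differentials) with closed degree-$0$ natural isomorphisms $(A\otimes B)\odot X\cong A\odot(B\odot X)$ and $\mathbf 1\odot X\cong X$ satisfying the usual coherence conditions of an action of a monoidal category, such that $Q$ acts by tensoring with $M$: there are closed degree-$0$ isomorphisms $Q\odot X\cong M\otimes_R X$ natural in $X\in DGP(R)$. 7. This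 action lifts the action of $\mathbb Z[i]$ on $\mathbb Z\langle x,y\rangle$ given by $i\cdot x=y$, $i\cdot y=-x$: there is a biadditive map $\kappa:K_0(\mathcal I)\times K_0(DGP(R))\to K_0(DGP(R))$ with $\kappa([A],[X])=[A\odot X]$ for all objects $A$, $X$, and $\varphi(\kappa(\gamma(z),v))=z\cdot\varphi(v)$ for all $z\in\mathbb Z[i]$ and $v\in K_0(DGP(R))$. -/

import Mathlib

open CategoryTheory

universe u v w

section Grading

variable {F : Type*} [Field F] {V : Type*} [AddCommGroup V] [Module F V]

theorem isInternal_of_components (gr : ℤ → Submodule F V) (D : V →ₗ[F] (ℤ →₀ V))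
    (h1 : ∀ v n, D v n ∈ gr n) (h2 : ∀ n, ∀ v ∈ gr n, D v = Finsupp.single n v)
    (h3 : ∀ v, (D v).sum (fun _ x => x) = v) : DirectSum.IsInternal gr := by
  classical
  rw [DirectSum.isInternal_submodule_iff_iSupIndep_and_iSup_eq_top]
  constructor
  · rw [iSupIndep_iff_dfinsupp_lsum_injective]
    have key : ∀ (x : Π₀ n, gr n) (n : ℤ),
        D (DFinsupp.lsum ℕ (fun i => (gr i).subtype) x) n = x n := by
      intro x n
      induction x using DFinsupp.induction with
      | h0 => simp
      | ha i b f hb hf ih =>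
        rw [map_add, map_add, Finsupp.add_apply, ih]
        simp only [DFinsupp.lsum_single, Submodule.subtype_apply, DFinsupp.add_apply,
          Submodule.coe_add]
        rw [h2 i b b.2, Finsupp.single_apply]
        congr 1
        split_ifs with h
        · subst h; simp
        · rw [DFinsupp.single_eq_of_ne (Ne.symm h)]; simp
    intro x y hxy
    ext n
    rw [← key x n, ← key y n]
    exact congrArg (fun z => D z n) hxy
  · rw [eq_top_iff]
    intro v _
    rw [← h3 v]
    exact Submodule.sum_mem _ (fun n _ => Submodule.mem_iSup_of_mem n (h1 v n))

/-- The map sending a vector to the family of its homogeneous components. -/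
noncomputable def components {gr : ℤ → Submodule F V} (h : DirectSum.IsInternal gr) :
    V →ₗ[F] (ℤ →₀ V) :=
  (DirectSum.toModule F ℤ (ℤ →₀ V) (fun n => (Finsupp.lsingle n).comp (gr n).subtype)).comp
    (LinearEquiv.ofBijective (DirectSum.coeLinearMap gr) h).symm.toLinearMap

theorem components_of_mem {gr : ℤ → Submodule F V} (h : DirectSum.IsInternal gr) {n : ℤ} {v : V}
    (hv : v ∈ gr n) : components h v = Finsupp.single n v := by
  have : (LinearEquiv.ofBijective (DirectSum.coeLinearMap gr) h).symm v =
      DirectSum.lof F ℤ (fun n => gr n) n ⟨v, hv⟩ := by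
    rw [LinearEquiv.symm_apply_eq]
    exact (DirectSum.coeLinearMap_lof gr n ⟨v, hv⟩).symm
  rw [components, LinearMap.comp_apply, LinearEquiv.coe_coe, this, DirectSum.toModule_lof]
  rfl

theorem homogeneous_induction {gr : ℤ → Submodule F V} (h : DirectSum.IsInternal gr)
    {p : V → Prop} (hg : ∀ n, ∀ v ∈ gr n, p v) (h0 : p 0)
    (ha : ∀ v w, p v → p w → p (v + w)) (v : V) : p v :=
  Submodule.iSup_induction (p := gr) (motive := p)
    (by rw [h.submodule_iSup_eq_top]; trivial) hg h0 ha

theorem components_mem {gr : ℤ → Submodule F V} (h : DirectSum.IsInternal gr) (v : V) (n : ℤ) :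
    components h v n ∈ gr n := by
  induction v using homogeneous_induction h with
  | hg m v hv =>
    rw [components_of_mem h hv, Finsupp.single_apply]
    split_ifs with hmn
    · exact hmn ▸ hv
    · exact zero_mem _
  | h0 => simp
  | ha v w hv hw => rw [map_add]; exact add_mem hv hw

theorem components_sum {gr : ℤ → Submodule F V} (h : DirectSum.IsInternal gr) (v : V) :
    (components h v).sum (fun _ x => x) = v := by
  induction v using homogeneous_induction h with
  | hg m v hv => rw [components_of_mem h hv]; simp
  | h0 => simp
  | ha v w hv hw => rw [map_add, Finsupp.sum_add_index' (by simp) (by simp), hv, hw]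

theorem isInternal_reindex {gr : ℤ → Submodule F V} (h : DirectSum.IsInternal gr) (m : ℤ) :
    DirectSum.IsInternal (fun n => gr (n + m)) := by
  rw [DirectSum.isInternal_submodule_iff_iSupIndep_and_iSup_eq_top]
  exact ⟨h.submodule_iSupIndep.comp (add_left_injective m),
    ((Equiv.addRight m).iSup_comp (g := gr)).trans h.submodule_iSup_eq_top⟩

theorem isInternal_pi {ι : Type*} [Fintype ι] {W : ι → Type*}
    [∀ i, AddCommGroup (W i)] [∀ i, Module F (W i)] {gr : ∀ i, ℤ → Submodule F (W i)}
    (h : ∀ i, DirectSum.IsInternal (gr i)) :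
    DirectSum.IsInternal (fun n => Submodule.pi Set.univ (fun i => gr i n)) := by
  classical
  have hD : ∀ (v : ∀ i, W i) (n : ℤ) (j : ι),
      (∑ i, (Finsupp.mapRange.linearMap (LinearMap.single F W i)).comp
        ((components (h i)).comp (LinearMap.proj i))) v n j = components (h j) (v j) n := by
    intro v n j
    simp only [LinearMap.sum_apply, LinearMap.comp_apply, LinearMap.proj_apply,
      Finsupp.finsetSum_apply, Finset.sum_apply, Finsupp.mapRange.linearMap_apply,
      Finsupp.mapRange_apply, LinearMap.coe_single]
    rw [Finset.sum_eq_single j]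
    · simp
    · intro i _ hij; exact Pi.single_eq_of_ne (Ne.symm hij) _
    · simp
  refine isInternal_of_components _ (∑ i, (Finsupp.mapRange.linearMap (LinearMap.single F W i)).comp
        ((components (h i)).comp (LinearMap.proj i))) ?_ ?_ ?_
  · intro v n j _
    rw [hD]
    exact components_mem _ _ _
  · intro n v hv
    ext m j
    rw [hD, components_of_mem (h j) (hv j trivial), Finsupp.single_apply, Finsupp.single_apply]
    split_ifs <;> rfl
  · intro v
    have key : ∀ D : ℤ →₀ (∀ i, W i), ∀ j,
        (D.sum fun _ x => x) j = (D.mapRange (fun x => x j) rfl).sum fun _ x => x := by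
      intro D j
      rw [Finsupp.sum_mapRange_index (by simp), Finsupp.sum, Finset.sum_apply, Finsupp.sum]
    funext j
    rw [key]
    refine Eq.trans ?_ (components_sum (h j) (v j))
    congr 1
    ext n
    rw [Finsupp.mapRange_apply, hD]

end Grading

section DGCategories

/-- A DG category over a field of characteristic two: an `F`-linear category whose spaces of
morphisms are `ℤ`-graded and carry a differential of degree one which is a derivation for
composition. Since the characteristic is two, the usual Koszul signs are all equal to one. -/
class DGCategory (F : Type u) [Field F] [CharP F 2] (C : Type w) [Category.{v} C]
    [Preadditive C] [Linear F C] where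
  gr (X Y : C) : ℤ → Submodule F (X ⟶ Y)
  isInternal (X Y : C) : DirectSum.IsInternal (gr X Y)
  d (X Y : C) : (X ⟶ Y) →ₗ[F] (X ⟶ Y)
  id_mem (X : C) : 𝟙 X ∈ gr X X 0
  comp_mem {X Y Z : C} {p q : ℤ} {f : X ⟶ Y} {g : Y ⟶ Z} :
    f ∈ gr X Y p → g ∈ gr Y Z q → f ≫ g ∈ gr X Z (p + q)
  d_mem {X Y : C} {n : ℤ} {f : X ⟶ Y} : f ∈ gr X Y n → d X Y f ∈ gr X Y (n + 1)
  d_d {X Y : C} (f : X ⟶ Y) : d X Y (d X Y f) = 0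
  leibniz {X Y Z : C} (f : X ⟶ Y) (g : Y ⟶ Z) :
    d X Z (f ≫ g) = d X Y f ≫ g + f ≫ d Y Z g

variable (F : Type u) [Field F] [CharP F 2] (C : Type w) [Category.{v} C]
    [Preadditive C] [Linear F C] [DGCategory F C]

namespace DGCategory

variable {C}

/-- The closed morphisms of degree zero. -/
def cycles (X Y : C) : Submodule F (X ⟶ Y) := gr X Y 0 ⊓ LinearMap.ker (d (F := F) X Y)

/-- The exact morphisms of degree zero, as a subspace of the closed ones. -/
def boundaries (X Y : C) : Submodule F (cycles F X Y) :=
  ((gr X Y (-1)).map (d (F := F) X Y)).comap (cycles F X Y).subtype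

theorem d_id (X : C) : d (F := F) X X (𝟙 X) = 0 := by
  have h := leibniz (F := F) (𝟙 X) (𝟙 X)
  simpa using h

theorem id_mem_cycles (X : C) : 𝟙 X ∈ cycles F X X := ⟨id_mem X, d_id F X⟩

variable {F}

theorem comp_mem_cycles {X Y Z : C} {f : X ⟶ Y} {g : Y ⟶ Z} (hf : f ∈ cycles F X Y)
    (hg : g ∈ cycles F Y Z) : f ≫ g ∈ cycles F X Z := by
  refine ⟨by simpa using comp_mem hf.1 hg.1, ?_⟩
  have h1 : d (F := F) X Y f = 0 := hf.2
  have h2 : d (F := F) Y Z g = 0 := hg.2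
  change d (F := F) X Z (f ≫ g) = 0
  rw [leibniz, h1, h2]
  simp

theorem comp_mem_boundaries_left {X Y Z : C} {f : X ⟶ Y} {g : Y ⟶ Z}
    (hf : f ∈ (gr X Y (-1)).map (d (F := F) X Y)) (hg : g ∈ cycles F Y Z) :
    f ≫ g ∈ (gr X Z (-1)).map (d (F := F) X Z) := by
  obtain ⟨h, hh, rfl⟩ := hf
  refine ⟨h ≫ g, by simpa using comp_mem hh hg.1, ?_⟩
  have h2 : d (F := F) Y Z g = 0 := hg.2
  rw [leibniz, h2]
  simp

theorem comp_mem_boundaries_right {X Y Z : C} {f : X ⟶ Y} {g : Y ⟶ Z} (hf : f ∈ cycles F X Y)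
    (hg : g ∈ (gr Y Z (-1)).map (d (F := F) Y Z)) :
    f ≫ g ∈ (gr X Z (-1)).map (d (F := F) X Z) := by
  obtain ⟨h, hh, rfl⟩ := hg
  refine ⟨f ≫ h, by simpa using comp_mem hf.1 hh, ?_⟩
  have h2 : d (F := F) X Y f = 0 := hf.2
  rw [leibniz, h2]
  simp

theorem mem_cycles_of_degree {X Y : C} {n : ℤ} {f : X ⟶ Y} (h : f ∈ gr (F := F) X Y n)
    (hn : n = 0) (hd : d (F := F) X Y f = 0) : f ∈ cycles F X Y := by
  subst hn
  exact ⟨h, hd⟩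

end DGCategory

open DGCategory

/-- The objects of the zeroth cohomology category of a DG category. -/
structure H0 (F : Type u) (C : Type w) where of ::
  obj : C

namespace H0

variable {F C}

/-- Morphisms of the zeroth cohomology category: closed morphisms of degree zero modulo
exact ones. -/
def Hom (X Y : H0 F C) : Type v := cycles F X.obj Y.obj ⧸ boundaries F X.obj Y.obj

instance (X Y : H0 F C) : AddCommGroup (Hom X Y) :=
  inferInstanceAs (AddCommGroup (cycles F X.obj Y.obj ⧸ boundaries F X.obj Y.obj))

/-- The class of a closed morphism of degree zero. -/
def mk {X Y : C} (f : X ⟶ Y) (hf : f ∈ cycles F X Y) : Hom (F := F) ⟨X⟩ ⟨Y⟩ :=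
  Submodule.Quotient.mk ⟨f, hf⟩

theorem mk_eq_mk {X Y : C} {f g : X ⟶ Y} {hf : f ∈ cycles F X Y} {hg : g ∈ cycles F X Y} :
    mk f hf = mk g hg ↔ f - g ∈ (gr X Y (-1)).map (d (F := F) X Y) :=
  Submodule.Quotient.eq _

theorem mk_add {X Y : C} {f g : X ⟶ Y} (hf : f ∈ cycles F X Y) (hg : g ∈ cycles F X Y) :
    mk f hf + mk g hg = mk (f + g) (add_mem hf hg) := rfl

theorem ind {X Y : H0 F C} {p : Hom X Y → Prop}
    (h : ∀ (f : X.obj ⟶ Y.obj) (hf : f ∈ cycles F X.obj Y.obj), p (mk f hf)) (f : Hom X Y) :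
    p f :=
  Submodule.Quotient.induction_on _ f (fun x => h x.1 x.2)

/-- Composition of classes of closed morphisms. -/
def comp {X Y Z : H0 F C} (f : Hom X Y) (g : Hom Y Z) : Hom X Z :=
  Quotient.liftOn₂ f g
    (fun f g => mk (f.1 ≫ g.1) (comp_mem_cycles f.2 g.2))
    (by
      intro f g f' g' hf hg
      rw [← Quotient.eq_iff_equiv] at hf hg
      have h1 := (Submodule.Quotient.eq (boundaries F X.obj Y.obj)).1 hf
      have h2 := (Submodule.Quotient.eq (boundaries F Y.obj Z.obj)).1 hg
      refine mk_eq_mk.2 ?_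
      have e : f.1 ≫ g.1 - f'.1 ≫ g'.1 = (f.1 - f'.1) ≫ g.1 + f'.1 ≫ (g.1 - g'.1) := by
        simp
      rw [e]
      exact add_mem (comp_mem_boundaries_left h1 g.2) (comp_mem_boundaries_right f'.2 h2))

theorem mk_comp_mk {X Y Z : C} {f : X ⟶ Y} {g : Y ⟶ Z} (hf : f ∈ cycles F X Y)
    (hg : g ∈ cycles F Y Z) : comp (mk f hf) (mk g hg) = mk (f ≫ g) (comp_mem_cycles hf hg) :=
  rfl

instance : Category (H0 F C) where
  Hom := Hom
  id X := mk (𝟙 X.obj) (id_mem_cycles F X.obj)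
  comp := comp
  id_comp f := by
    induction f using ind with | h f hf
    simp only [mk_comp_mk, Category.id_comp]
  comp_id f := by
    induction f using ind with | h f hf
    simp only [mk_comp_mk, Category.comp_id]
  assoc f g h := by
    induction f using ind with | h f hf
    induction g using ind with | h g hg
    induction h using ind with | h h hh
    simp only [mk_comp_mk, Category.assoc]

instance : Preadditive (H0 F C) where
  homGroup X Y := inferInstanceAs (AddCommGroup (Hom X Y))
  add_comp X Y Z f f' g := by
    induction f using ind with | h f hf
    induction f' using ind with | h f' hf'
    induction g using ind with | h g hg
    change comp (mk f hf + mk f' hf') (mk g hg) =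
      comp (mk f hf) (mk g hg) + comp (mk f' hf') (mk g hg)
    simp only [mk_add, mk_comp_mk, Preadditive.add_comp]
  comp_add X Y Z f g g' := by
    induction f using ind with | h f hf
    induction g using ind with | h g hg
    induction g' using ind with | h g' hg'
    change comp (mk f hf) (mk g hg + mk g' hg') =
      comp (mk f hf) (mk g hg) + comp (mk f hf) (mk g' hg')
    simp only [mk_add, mk_comp_mk, Preadditive.comp_add]

end H0

/-- Shifts in a DG category: for all `n` and `X` an object `X[n]` with mutually inverse closed
morphisms `X ⟶ X[n]` of degree `-n` and `X[n] ⟶ X` of degree `n`. -/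
class DGShift where
  sh : ℤ → C → C
  up (n : ℤ) (X : C) : X ⟶ sh n X
  down (n : ℤ) (X : C) : sh n X ⟶ X
  up_mem (n : ℤ) (X : C) : up n X ∈ gr (F := F) X (sh n X) (-n)
  down_mem (n : ℤ) (X : C) : down n X ∈ gr (F := F) (sh n X) X n
  d_up (n : ℤ) (X : C) : d (F := F) X (sh n X) (up n X) = 0
  d_down (n : ℤ) (X : C) : d (F := F) (sh n X) X (down n X) = 0
  up_down (n : ℤ) (X : C) : up n X ≫ down n X = 𝟙 X
  down_up (n : ℤ) (X : C) : down n X ≫ up n X = 𝟙 (sh n X)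

namespace DGShift

attribute [simp] up_down down_up d_up d_down

variable [DGShift F C]

variable {C}

@[simp]
theorem up_down_assoc (n : ℤ) {X Y : C} (f : X ⟶ Y) : up (F := F) n X ≫ down (F := F) n X ≫ f = f := by
  rw [← Category.assoc, up_down, Category.id_comp]

@[simp]
theorem down_up_assoc (n : ℤ) {X Y : C} (f : sh (F := F) n X ⟶ Y) : down (F := F) n X ≫ up (F := F) n X ≫ f = f := by
  rw [← Category.assoc, down_up, Category.id_comp]

variable {F}

theorem shift_mem (n : ℤ) {X Y : C} {f : X ⟶ Y} (hf : f ∈ cycles F X Y) :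
    down (F := F) n X ≫ f ≫ up (F := F) n Y ∈ cycles F (sh (F := F) n X) (sh (F := F) n Y) := by
  have h1 : d (F := F) X Y f = 0 := hf.2
  refine ⟨?_, by simp [leibniz, h1]⟩
  have h := comp_mem (down_mem (F := F) n X) (comp_mem hf.1 (up_mem (F := F) n Y))
  have e : n + (0 + -n) = 0 := by omega
  rwa [e] at h

variable (F C)

/-- The functor induced on the zeroth cohomology category by the shift. -/
def shiftF (n : ℤ) : H0 F C ⥤ H0 F C where
  obj X := ⟨sh (F := F) n X.obj⟩
  map {X Y} f := Quotient.liftOn f (fun f => H0.mk (down (F := F) n X.obj ≫ f.1 ≫ up (F := F) n Y.obj)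
      (shift_mem n f.2)) (by
    intro f f' hf
    rw [← Quotient.eq_iff_equiv] at hf
    obtain ⟨h, hh, e⟩ := (Submodule.Quotient.eq (boundaries F X.obj Y.obj)).1 hf
    refine H0.mk_eq_mk.2 ⟨down (F := F) n X.obj ≫ h ≫ up (F := F) n Y.obj, ?_, ?_⟩
    · have h' := comp_mem (down_mem (F := F) n X.obj) (comp_mem hh (up_mem (F := F) n Y.obj))
      have e : n + (-1 + -n) = -1 := by omega
      rwa [e] at h'
    · have e' : d (F := F) X.obj Y.obj h = f.1 - f'.1 := e
      simp [leibniz, e'])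
  map_id X := by
    change H0.mk _ _ = H0.mk _ _
    congr 1
    simp
  map_comp {X Y Z} f g := by
    induction f using H0.ind with | h f hf
    induction g using H0.ind with | h g hg
    change H0.mk _ _ = H0.mk _ _
    congr 1
    simp

variable {F C}

@[simp]
theorem shiftF_obj (n : ℤ) (X : H0 F C) : (shiftF F C n).obj X = ⟨sh (F := F) n X.obj⟩ := rfl

theorem shiftF_map_mk (n : ℤ) {X Y : C} {f : X ⟶ Y} (hf : f ∈ cycles F X Y) :
    (shiftF F C n).map (X := ⟨X⟩) (Y := ⟨Y⟩) (H0.mk f hf) =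
      H0.mk (down (F := F) n X ≫ f ≫ up (F := F) n Y) (shift_mem n hf) := rfl

theorem eqToHom_sh {X : C} {m n : ℤ} (h : m = n)
    (e : (⟨sh (F := F) m X⟩ : H0 F C) = ⟨sh (F := F) n X⟩) :
    eqToHom e = H0.mk (down (F := F) m X ≫ up (F := F) n X)
      (mem_cycles_of_degree (comp_mem (down_mem m X) (up_mem n X)) (by omega)
        (by simp [leibniz])) := by
  subst h
  change H0.mk _ _ = H0.mk _ _
  congr 1
  simp

theorem shiftAdd_hom_mem (n m : ℤ) (X : C) :
    down (F := F) (n + m) X ≫ up (F := F) n X ≫ up (F := F) m (sh (F := F) n X) ∈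
      cycles F (sh (F := F) (n + m) X) (sh (F := F) m (sh (F := F) n X)) :=
  mem_cycles_of_degree (comp_mem (down_mem _ _) (comp_mem (up_mem _ _) (up_mem _ _)))
    (by omega) (by simp [leibniz])

theorem shiftAdd_inv_mem (n m : ℤ) (X : C) :
    down (F := F) m (sh (F := F) n X) ≫ down (F := F) n X ≫ up (F := F) (n + m) X ∈
      cycles F (sh (F := F) m (sh (F := F) n X)) (sh (F := F) (n + m) X) :=
  mem_cycles_of_degree (comp_mem (down_mem _ _) (comp_mem (down_mem _ _) (up_mem _ _)))
    (by omega) (by simp [leibniz])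

variable (F C)

/-- The isomorphism between `X[0]` and `X` in the zeroth cohomology category. -/
def shiftZero : shiftF F C 0 ≅ 𝟭 (H0 F C) :=
  NatIso.ofComponents (fun X =>
    { hom := H0.mk (down (F := F) 0 X.obj)
        (mem_cycles_of_degree (down_mem 0 X.obj) rfl (d_down 0 X.obj))
      inv := H0.mk (up (F := F) 0 X.obj)
        (mem_cycles_of_degree (up_mem 0 X.obj) rfl (d_up 0 X.obj))
      hom_inv_id := by
        change H0.mk _ _ = H0.mk _ _
        congr 1
        dsimp only [shiftF_obj, Functor.id_obj, Functor.comp_obj]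
        simp
      inv_hom_id := by
        change H0.mk _ _ = H0.mk _ _
        congr 1
        dsimp only [shiftF_obj, Functor.id_obj, Functor.comp_obj]
        simp })
    (by
      intro X Y f
      induction f using H0.ind with | h f hf
      change H0.mk _ _ = H0.mk _ _
      congr 1
      dsimp only [shiftF_obj, Functor.id_obj, Functor.comp_obj]
      simp)

/-- The isomorphism between `X[n + m]` and `X[n][m]` in the zeroth cohomology category. -/
def shiftAdd (n m : ℤ) : shiftF F C (n + m) ≅ shiftF F C n ⋙ shiftF F C m :=
  NatIso.ofComponents (fun X =>
    { hom := H0.mk (down (F := F) (n + m) X.obj ≫ up (F := F) n X.obj ≫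
          up (F := F) m (sh (F := F) n X.obj))
        (shiftAdd_hom_mem n m X.obj)
      inv := H0.mk (down (F := F) m (sh (F := F) n X.obj) ≫ down (F := F) n X.obj ≫
          up (F := F) (n + m) X.obj)
        (shiftAdd_inv_mem n m X.obj)
      hom_inv_id := by
        change H0.mk _ _ = H0.mk _ _
        congr 1
        dsimp only [shiftF_obj, Functor.id_obj, Functor.comp_obj]
        simp
      inv_hom_id := by
        change H0.mk _ _ = H0.mk _ _
        congr 1
        dsimp only [shiftF_obj, Functor.id_obj, Functor.comp_obj]
        simp })
    (by
      intro X Y f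
      induction f using H0.ind with | h f hf
      change H0.mk _ _ = H0.mk _ _
      congr 1
      dsimp only [shiftF_obj, Functor.id_obj, Functor.comp_obj]
      simp)

noncomputable instance : HasShift (H0 F C) ℤ :=
  hasShiftMk _ _
    { F := shiftF F C
      zero := shiftZero F C
      add := shiftAdd F C
      assoc_hom_app := by
        intro m₁ m₂ m₃ X
        erw [eqToHom_sh (add_assoc m₁ m₂ m₃)]
        change H0.mk _ _ = H0.mk _ _
        congr 1
        dsimp only [shiftF_obj, Functor.id_obj, Functor.comp_obj]
        simp
      zero_add_hom_app := by
        intro n X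
        erw [eqToHom_sh (zero_add n)]
        change H0.mk _ _ = H0.mk _ _
        congr 1
        dsimp only [shiftF_obj, Functor.id_obj, Functor.comp_obj]
        simp
      add_zero_hom_app := by
        intro n X
        erw [eqToHom_sh (add_zero n)]
        change H0.mk _ _ = H0.mk _ _
        congr 1
        dsimp only [shiftF_obj, Functor.id_obj, Functor.comp_obj]
        simp }

instance (n : ℤ) : (shiftFunctor (H0 F C) n).Additive where
  map_add {X Y f g} := by
    induction f using H0.ind with | h f hf
    induction g using H0.ind with | h g hg
    change H0.mk (down (F := F) n X.obj ≫ (f + g) ≫ up (F := F) n Y.obj) _ =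
      H0.mk (down (F := F) n X.obj ≫ f ≫ up (F := F) n Y.obj +
        down (F := F) n X.obj ≫ g ≫ up (F := F) n Y.obj) _
    congr 1
    simp

end DGShift

open DGShift

variable {C} in
/-- `Z` is a mapping cone of the closed morphism `f : X ⟶ Y` of degree zero, with structural
morphisms `i : Y ⟶ Z` and `p : Z ⟶ X` of degrees zero and one: disregarding differentials, `Z`
is the direct sum of `Y` and `X[1]` (with the remaining injection `s : X ⟶ Z` of degree `-1` and
projection `q : Z ⟶ Y` of degree zero), and its differential is given by those of `Y` and `X[1]`
together with `f`. -/
structure IsMappingCone {X Y Z : C} (f : X ⟶ Y) (i : Y ⟶ Z) (p : Z ⟶ X) : Prop where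
  f_mem : f ∈ cycles F X Y
  i_mem : i ∈ cycles F Y Z
  p_mem : p ∈ gr (F := F) Z X 1
  d_p : d (F := F) Z X p = 0
  exists_splitting : ∃ (s : X ⟶ Z) (q : Z ⟶ Y), s ∈ gr (F := F) X Z (-1) ∧
    q ∈ gr (F := F) Z Y 0 ∧ i ≫ q = 𝟙 Y ∧ s ≫ p = 𝟙 X ∧ i ≫ p = 0 ∧ s ≫ q = 0 ∧
    q ≫ i + p ≫ s = 𝟙 Z ∧ d (F := F) X Z s = f ≫ i ∧ d (F := F) Z Y q = p ≫ f

variable {F C} in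
/-- The triangle `X ⟶ Y ⟶ Z ⟶ X[1]` in the zeroth cohomology category defined by a mapping
cone `Z` of `f : X ⟶ Y`. -/
noncomputable def IsMappingCone.triangle [DGShift F C] {X Y Z : C} {f : X ⟶ Y} {i : Y ⟶ Z}
    {p : Z ⟶ X} (h : IsMappingCone F f i p) : Pretriangulated.Triangle (H0 F C) :=
  Pretriangulated.Triangle.mk (X := (⟨X⟩ : H0 F C)) (Y := ⟨Y⟩) (Z := ⟨Z⟩)
    (H0.mk f h.f_mem) (H0.mk i h.i_mem)
    (H0.mk (p ≫ up (F := F) 1 X)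
      (mem_cycles_of_degree (comp_mem h.p_mem (up_mem 1 X)) (by omega) (by simp [leibniz, h.d_p])))

/-- The distinguished triangles of the zeroth cohomology category: those isomorphic to the
triangle of a mapping cone. -/
def coneTriangles [DGShift F C] : Set (Pretriangulated.Triangle (H0 F C)) :=
  {T | ∃ (X Y Z : C) (f : X ⟶ Y) (i : Y ⟶ Z) (p : Z ⟶ X) (h : IsMappingCone F f i p),
    Nonempty (T ≅ h.triangle)}

/-- The zeroth cohomology category, with the shift and the cones of the DG category, is a
triangulated category. -/
def H0IsTriangulated [DGShift F C] : Prop :=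
  ∃ (_ : Limits.HasZeroObject (H0 F C)) (T : Pretriangulated (H0 F C)),
    T.distinguishedTriangles = coneTriangles F C ∧ IsTriangulated (H0 F C)

/-- The Grothendieck group of the zeroth cohomology category: the abelian group generated by
the objects, with a relation `[Y] = [X] + [Z]` for every distinguished triangle
`X ⟶ Y ⟶ Z ⟶ X[1]`. -/
def K0 [DGShift F C] : Type w :=
  FreeAbelianGroup C ⧸ AddSubgroup.closure
    {r : FreeAbelianGroup C | ∃ T ∈ coneTriangles F C, r = FreeAbelianGroup.of T.obj₂.obj -
      (FreeAbelianGroup.of T.obj₁.obj + FreeAbelianGroup.of T.obj₃.obj)}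

instance [DGShift F C] : AddCommGroup (K0 F C) :=
  inferInstanceAs (AddCommGroup (FreeAbelianGroup C ⧸ AddSubgroup.closure _))

variable {C} in
/-- The class of an object in the Grothendieck group. -/
def K0.cls [DGShift F C] (X : C) : K0 F C := QuotientAddGroup.mk (FreeAbelianGroup.of X)

variable {C} in
/-- The class of objects generated by a class of objects `S`: the smallest class which contains
`S` and the zero objects and is closed under isomorphisms (closed and of degree zero, with closed
inverse), shifts and mapping cones. -/
inductive DGGenerated [DGShift F C] (S : C → Prop) : C → Prop
  | of (X : C) (h : S X) : DGGenerated S X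
  | zero (X : C) (h : 𝟙 X = 0) : DGGenerated S X
  | iso {X Y : C} (e : X ≅ Y) (h : e.hom ∈ cycles F X Y) (h' : e.inv ∈ cycles F Y X)
      (hX : DGGenerated S X) : DGGenerated S Y
  | shift (n : ℤ) (X : C) (hX : DGGenerated S X) : DGGenerated S (sh (F := F) n X)
  | cone {X Y Z : C} {f : X ⟶ Y} {i : Y ⟶ Z} {p : Z ⟶ X} (h : IsMappingCone F f i p)
      (hX : DGGenerated S X) (hY : DGGenerated S Y) : DGGenerated S Z

end DGCategories

section Diagrams

/-- The elementary diagrams: cup, cap and half strand. -/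
inductive Elem
  | cup
  | cap
  | hf

namespace Elem

/-- The number of bottom endpoints. -/
def src : Elem → ℕ
  | cup => 0
  | cap => 2
  | hf => 0

/-- The number of top endpoints. -/
def tgt : Elem → ℕ
  | cup => 2
  | cap => 0
  | hf => 1

/-- The cohomological grading. -/
def deg : Elem → ℤ
  | cup => -1
  | cap => 1
  | hf => 0

end Elem

/-- A generating diagram: an elementary diagram with `p` vertical strands on its left
(the number of strands on its right is determined by the number of endpoints). -/
abbrev GenDiag := Elem × ℕ

/-- `Runs k w l`: the generating diagrams in the list `w` can be stacked, the first one at the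
bottom, to a diagram from `k` points to `l` points. -/
def Runs : ℕ → List GenDiag → ℕ → Prop
  | k, [], l => k = l
  | k, g :: w, l => g.2 + g.1.src ≤ k ∧ Runs (k - g.1.src + g.1.tgt) w l

/-- The local relations: isotopy of disjoint diagrams, isotopy of a strand (in its two forms),
`cup ∘ cap = id`, `cap ∘ cup = id` (a loop is the empty diagram), and commutativity of a half
strand with a vertical strand. -/
inductive LocalRel : List GenDiag → List GenDiag → Prop
  | isotopy (g h : Elem) (p m : ℕ) :
      LocalRel [(g, p), (h, p + g.tgt + m)] [(h, p + g.src + m), (g, p)]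
  | zigzag (p : ℕ) : LocalRel [(Elem.cup, p + 1), (Elem.cap, p)] []
  | zigzag_mirror (p : ℕ) : LocalRel [(Elem.cup, p), (Elem.cap, p + 1)] []
  | slide (p : ℕ) : LocalRel [(Elem.cap, p), (Elem.cup, p)] []
  | loop (p : ℕ) : LocalRel [(Elem.cup, p), (Elem.cap, p)] []
  | half (p : ℕ) : LocalRel [(Elem.hf, p)] [(Elem.hf, p + 1)]

/-- Diagrams from `k` points to `l` points modulo the local relations. -/
def Diag (k l : ℕ) : Type :=
  Quot (fun w w' : {w : List GenDiag // Runs k w l} => ∃ u v x y, LocalRel x y ∧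
    w.1 = u ++ x ++ v ∧ w'.1 = u ++ y ++ v)

/-- Adding `c` vertical strands on the left. -/
def shiftWord (c : ℕ) (w : List GenDiag) : List GenDiag := w.map (fun g => (g.1, c + g.2))

/-- The cohomological grading of a stack of generating diagrams. -/
def wordDeg (w : List GenDiag) : ℤ := (w.map (fun g => g.1.deg)).sum

theorem shiftWord_append (c : ℕ) (w w' : List GenDiag) :
    shiftWord c (w ++ w') = shiftWord c w ++ shiftWord c w' := List.map_append

theorem shiftWord_shiftWord (c c' : ℕ) (w : List GenDiag) :
    shiftWord c (shiftWord c' w) = shiftWord (c + c') w := by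
  simp [shiftWord, add_assoc]

theorem shiftWord_zero (w : List GenDiag) : shiftWord 0 w = w := by
  simp [shiftWord]

theorem Runs.append {k l m : ℕ} {w w' : List GenDiag} (h : Runs k w l) (h' : Runs l w' m) :
    Runs k (w ++ w') m := by
  induction w generalizing k with
  | nil => cases h; exact h'
  | cons g w ih => exact ⟨h.1, ih h.2⟩

theorem Runs.add_right {k l : ℕ} {w : List GenDiag} (h : Runs k w l) (c : ℕ) :
    Runs (k + c) w (l + c) := by
  induction w generalizing k with
  | nil => cases h; rfl
  | cons g w ih =>
    refine ⟨h.1.trans (Nat.le_add_right _ _), ?_⟩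
    have h1 := h.1
    have e : k + c - g.1.src + g.1.tgt = k - g.1.src + g.1.tgt + c := by omega
    rw [e]
    exact ih h.2

theorem Runs.shift {k l : ℕ} {w : List GenDiag} (h : Runs k w l) (c : ℕ) :
    Runs (c + k) (shiftWord c w) (c + l) := by
  induction w generalizing k with
  | nil => cases h; rfl
  | cons g w ih =>
    have h1 := h.1
    refine ⟨by dsimp only; omega, ?_⟩
    have e : c + k - g.1.src + g.1.tgt = c + (k - g.1.src + g.1.tgt) := by omega
    dsimp only
    rw [e]
    exact ih h.2

theorem LocalRel.shift {x y : List GenDiag} (h : LocalRel x y) (c : ℕ) :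
    LocalRel (shiftWord c x) (shiftWord c y) := by
  cases h with
  | isotopy g h p m =>
    have := LocalRel.isotopy g h (c + p) m
    simpa [shiftWord, add_assoc] using this
  | zigzag p => exact LocalRel.zigzag (c + p)
  | zigzag_mirror p => exact LocalRel.zigzag_mirror (c + p)
  | slide p => exact LocalRel.slide (c + p)
  | loop p => exact LocalRel.loop (c + p)
  | half p => exact LocalRel.half (c + p)

theorem LocalRel.wordDeg_eq {x y : List GenDiag} (h : LocalRel x y) : wordDeg x = wordDeg y := by
  cases h <;> simp [wordDeg, Elem.deg, add_comm]

namespace Diag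

/-- The class of a stack of generating diagrams. -/
def mk {k l : ℕ} (w : List GenDiag) (h : Runs k w l) : Diag k l := Quot.mk _ ⟨w, h⟩

theorem ind {k l : ℕ} {p : Diag k l → Prop} (h : ∀ w hw, p (mk w hw)) (x : Diag k l) : p x :=
  Quot.ind (fun w => h w.1 w.2) x

theorem mk_eq_of_localRel {k l : ℕ} {x y : List GenDiag} (u v : List GenDiag) (h : LocalRel x y)
    (hx : Runs k (u ++ x ++ v) l) (hy : Runs k (u ++ y ++ v) l) : mk _ hx = mk _ hy :=
  Quot.sound ⟨u, v, x, y, h, rfl, rfl⟩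

/-- Vertical composition: `f` is stacked below `g`. -/
def comp {k l m : ℕ} (f : Diag k l) (g : Diag l m) : Diag k m :=
  Quot.map₂ (fun w w' => ⟨w.1 ++ w'.1, w.2.append w'.2⟩)
    (by
      rintro w w₁ w₂ ⟨u, v, x, y, h, h1, h2⟩
      exact ⟨w.1 ++ u, v, x, y, h, by simp [h1], by simp [h2]⟩)
    (by
      rintro w₁ w₂ w ⟨u, v, x, y, h, h1, h2⟩
      exact ⟨u, v ++ w.1, x, y, h, by simp [h1], by simp [h2]⟩) f g

/-- Horizontal composition: `f` is placed on the left of `g`. -/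
def tens {k l k' l' : ℕ} (f : Diag k l) (g : Diag k' l') : Diag (k + k') (l + l') :=
  Quot.map₂ (fun w w' => ⟨w.1 ++ shiftWord l w'.1, (w.2.add_right k').append (w'.2.shift l)⟩)
    (by
      rintro w w₁ w₂ ⟨u, v, x, y, h, h1, h2⟩
      exact ⟨w.1 ++ shiftWord l u, shiftWord l v, _, _, h.shift l,
        by simp [h1, shiftWord_append], by simp [h2, shiftWord_append]⟩)
    (by
      rintro w₁ w₂ w ⟨u, v, x, y, h, h1, h2⟩
      exact ⟨u, v ++ shiftWord l w.1, x, y, h, by simp [h1], by simp [h2]⟩) f g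

/-- The identity diagram, for possibly different expressions of the number of strands. -/
def one {k l : ℕ} (h : k = l) : Diag k l := mk [] h

/-- The cohomological grading of a diagram. -/
def deg {k l : ℕ} (f : Diag k l) : ℤ :=
  Quot.lift (fun w => wordDeg w.1) (by
    rintro w₁ w₂ ⟨u, v, x, y, h, h1, h2⟩
    have e := h.wordDeg_eq
    simp only [wordDeg] at e
    simp [wordDeg, h1, h2, e]) f

theorem comp_mk {k l m : ℕ} {w w' : List GenDiag} (h : Runs k w l) (h' : Runs l w' m) :
    comp (mk w h) (mk w' h') = mk (w ++ w') (h.append h') := rfl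

theorem tens_mk {k l k' l' : ℕ} {w w' : List GenDiag} (h : Runs k w l) (h' : Runs k' w' l') :
    tens (mk w h) (mk w' h') =
      mk (w ++ shiftWord l w') ((h.add_right k').append (h'.shift l)) := rfl

theorem mk_congr {k l : ℕ} {w w' : List GenDiag} (h : Runs k w l) (e : w = w') :
    mk w h = mk w' (e ▸ h) := by subst e; rfl

theorem comp_assoc {k l m n : ℕ} (f : Diag k l) (g : Diag l m) (h : Diag m n) :
    comp (comp f g) h = comp f (comp g h) := by
  induction f using ind with | h f hf
  induction g using ind with | h g hg
  induction h using ind with | h h hh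
  exact mk_congr _ (by simp)

theorem one_comp {k l : ℕ} (f : Diag k l) : comp (one rfl) f = f := by
  induction f using ind with | h f hf
  rfl

theorem comp_one {k l : ℕ} (f : Diag k l) : comp f (one rfl) = f := by
  induction f using ind with | h f hf
  exact mk_congr _ (by simp)

theorem one_comp_one {k l m : ℕ} (h : k = l) (h' : l = m) :
    comp (one h) (one h') = one (h.trans h') := rfl

theorem tens_one_one {k l k' l' : ℕ} (h : k = l) (h' : k' = l') :
    tens (one h) (one h') = one (congrArg₂ (· + ·) h h') := rfl

theorem swap_letter (g : Elem) (p k : ℕ) (hp : p + g.src ≤ k) (v : List GenDiag) {a b : ℕ} :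
    ∀ (u z : List GenDiag)
      (h : Runs a (u ++ ((g, p) :: (shiftWord (k - g.src + g.tgt) v ++ z))) b),
      ∃ h' : Runs a (u ++ (shiftWord k v ++ (g, p) :: z)) b, mk _ h = mk _ h' := by
  induction v with
  | nil => intro u z h; exact ⟨h, rfl⟩
  | cons x v ih =>
    intro u z h
    obtain ⟨x, q⟩ := x
    have key : ∀ (c : ℕ) (t : List GenDiag),
        Runs c ((g, p) :: (x, k - g.src + g.tgt + q) :: t) b →
          Runs c ((x, k + q) :: (g, p) :: t) b := by
      rintro c t ⟨h1, h2, h3⟩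
      dsimp only at h1 h2 h3
      refine ⟨by dsimp only; omega, by dsimp only; omega, ?_⟩
      dsimp only
      have e : c - x.src + x.tgt - g.src + g.tgt = c - g.src + g.tgt - x.src + x.tgt := by omega
      rwa [e]
    have key2 : ∀ (u : List GenDiag) (c : ℕ) (t : List GenDiag),
        Runs c (u ++ ((g, p) :: (x, k - g.src + g.tgt + q) :: t)) b →
          Runs c (u ++ ((x, k + q) :: (g, p) :: t)) b := by
      intro u
      induction u with
      | nil => exact key
      | cons y u ihu => intro c t h; exact ⟨h.1, ihu _ _ h.2⟩
    have h1 := key2 u a (shiftWord (k - g.src + g.tgt) v ++ z) h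
    have e1 : mk _ h = mk _ h1 := by
      have hl := LocalRel.isotopy g x p (k - p - g.src + q)
      have e2 : p + g.tgt + (k - p - g.src + q) = k - g.src + g.tgt + q := by omega
      have e3 : p + g.src + (k - p - g.src + q) = k + q := by omega
      rw [e2, e3] at hl
      exact Quot.sound ⟨u, shiftWord (k - g.src + g.tgt) v ++ z, _, _, hl,
        by simp [shiftWord], by simp⟩
    have h2 : Runs a ((u ++ [(x, k + q)]) ++
        ((g, p) :: (shiftWord (k - g.src + g.tgt) v ++ z))) b := by simpa using h1
    obtain ⟨h3, e3⟩ := ih (u ++ [(x, k + q)]) z h2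
    refine ⟨by simpa [shiftWord] using h3, ?_⟩
    rw [e1]
    refine (mk_congr h1 (by simp)).trans (e3.trans (mk_congr h3 (by simp [shiftWord])))

theorem swap_word (w v : List GenDiag) {a b : ℕ} :
    ∀ {k l : ℕ} (_ : Runs k w l) (u z : List GenDiag)
      (h : Runs a (u ++ (w ++ (shiftWord l v ++ z))) b),
      ∃ h' : Runs a (u ++ (shiftWord k v ++ (w ++ z))) b, mk _ h = mk _ h' := by
  induction w with
  | nil => intro k l hw u z h; cases hw; exact ⟨h, rfl⟩
  | cons x w ih =>
    intro k l hw u z h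
    obtain ⟨g, p⟩ := x
    have h1 : Runs a ((u ++ [(g, p)]) ++ (w ++ (shiftWord l v ++ z))) b := by simpa using h
    obtain ⟨h2, e2⟩ := ih hw.2 (u ++ [(g, p)]) z h1
    have h3 : Runs a (u ++ ((g, p) :: (shiftWord (k - g.src + g.tgt) v ++ (w ++ z)))) b := by
      simpa using h2
    obtain ⟨h4, e4⟩ := swap_letter g p k hw.1 v u (w ++ z) h3
    exact ⟨h4, (mk_congr h (by simp)).trans (e2.trans ((mk_congr h2 (by simp)).trans e4))⟩

theorem tens_comp {k l m k' l' m' : ℕ} (f : Diag k l) (f' : Diag l m) (g : Diag k' l')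
    (g' : Diag l' m') : tens (comp f f') (comp g g') = comp (tens f g) (tens f' g') := by
  induction f using ind with | h f hf
  induction g using ind with | h g hg
  induction f' using ind with | h f' hf'
  induction g' using ind with | h g' hg'
  rw [comp_mk, comp_mk, tens_mk, tens_mk, tens_mk, comp_mk]
  have h : Runs (k + k') (f ++ (f' ++ (shiftWord m g ++ shiftWord m g'))) (m + m') := by
    have := ((hf.append hf').add_right k').append ((hg.append hg').shift m)
    simpa [shiftWord_append] using this
  obtain ⟨h1, e1⟩ := swap_word f' g hf' f (shiftWord m g') h
  exact (mk_congr _ (by simp [shiftWord_append])).trans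
    (e1.trans (mk_congr h1 (by simp)))

theorem tens_assoc {k l k' l' k'' l'' : ℕ} (f : Diag k l) (g : Diag k' l') (h : Diag k'' l'') :
    comp (tens (tens f g) h) (one (add_assoc l l' l'')) =
      comp (one (add_assoc k k' k'')) (tens f (tens g h)) := by
  induction f using ind with | h f hf
  induction g using ind with | h g hg
  induction h using ind with | h h hh
  simp only [one]
  exact mk_congr _ (by simp [shiftWord_append, shiftWord_shiftWord])

theorem one_tens {k l : ℕ} (f : Diag k l) :
    comp (tens (one (rfl : 0 = 0)) f) (one (zero_add l)) = comp (one (zero_add k)) f := by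
  induction f using ind with | h f hf
  simp only [one]
  exact mk_congr _ (by simp [shiftWord_zero])

theorem tens_one {k l : ℕ} (f : Diag k l) :
    comp (tens f (one (rfl : 0 = 0))) (one (add_zero l)) = comp (one (add_zero k)) f := by
  induction f using ind with | h f hf
  simp only [one]
  exact mk_congr _ (by simp [shiftWord])

theorem deg_comp {k l m : ℕ} (f : Diag k l) (g : Diag l m) :
    deg (comp f g) = deg f + deg g := by
  induction f using ind with | h f hf
  induction g using ind with | h g hg
  change wordDeg (f ++ g) = wordDeg f + wordDeg g
  simp [wordDeg]

theorem deg_tens {k l k' l' : ℕ} (f : Diag k l) (g : Diag k' l') :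
    deg (tens f g) = deg f + deg g := by
  induction f using ind with | h f hf
  induction g using ind with | h g hg
  change wordDeg (f ++ shiftWord l g) = wordDeg f + wordDeg g
  simp [wordDeg, shiftWord, Function.comp_def]

theorem deg_one {k l : ℕ} (h : k = l) : deg (one h) = 0 := rfl

end Diag

end Diagrams

section TwistedComplexes

variable (F : Type u) [Field F]

/-- The bilinear extension of a map of sets. -/
noncomputable def bilin {X Y Z : Type*} (φ : X → Y → Z) :
    (X →₀ F) →ₗ[F] (Y →₀ F) →ₗ[F] (Z →₀ F) :=
  Finsupp.linearCombination F (fun x => Finsupp.lmapDomain F F (φ x))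

variable {F}

theorem bilin_single {X Y Z : Type*} (φ : X → Y → Z) (x : X) (y : Y) (a b : F) :
    bilin F φ (Finsupp.single x a) (Finsupp.single y b) = Finsupp.single (φ x y) (a * b) := by
  simp [bilin]

variable (F)

/-- The space of morphisms from `Q^k` to `Q^l`: linear combinations of diagrams modulo the local
relations. -/
abbrev QHom (k l : ℕ) : Type u := Diag k l →₀ F

variable {F}

namespace QHom

/-- Vertical composition. -/
noncomputable def comp {k l m : ℕ} (f : QHom F k l) (g : QHom F l m) : QHom F k m :=
  bilin F Diag.comp f g

/-- Horizontal composition. -/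
noncomputable def tens {k l k' l' : ℕ} (f : QHom F k l) (g : QHom F k' l') :
    QHom F (k + k') (l + l') :=
  bilin F Diag.tens f g

/-- The identity, for possibly different expressions of the number of strands. -/
noncomputable def one {k l : ℕ} (h : k = l) : QHom F k l := Finsupp.single (Diag.one h) 1

variable (F) in
/-- The morphisms of degree `n`. -/
def gr (k l : ℕ) (n : ℤ) : Submodule F (QHom F k l) :=
  Finsupp.supported F F {x | x.deg = n}

theorem add_comp {k l m : ℕ} (f f' : QHom F k l) (g : QHom F l m) :
    comp (f + f') g = comp f g + comp f' g := by simp [comp]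

theorem comp_add {k l m : ℕ} (f : QHom F k l) (g g' : QHom F l m) :
    comp f (g + g') = comp f g + comp f g' := by simp [comp]

theorem zero_comp {k l m : ℕ} (g : QHom F l m) : comp (0 : QHom F k l) g = 0 := by simp [comp]

theorem comp_zero {k l m : ℕ} (f : QHom F k l) : comp f (0 : QHom F l m) = 0 := by simp [comp]

theorem smul_comp {k l m : ℕ} (a : F) (f : QHom F k l) (g : QHom F l m) :
    comp (a • f) g = a • comp f g := by simp [comp]

theorem comp_smul {k l m : ℕ} (a : F) (f : QHom F k l) (g : QHom F l m) :
    comp f (a • g) = a • comp f g := by simp [comp]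

theorem sum_comp {k l m : ℕ} {ι : Type*} (s : Finset ι) (f : ι → QHom F k l) (g : QHom F l m) :
    comp (∑ i ∈ s, f i) g = ∑ i ∈ s, comp (f i) g := by simp [comp]

theorem comp_sum {k l m : ℕ} {ι : Type*} (s : Finset ι) (f : QHom F k l) (g : ι → QHom F l m) :
    comp f (∑ i ∈ s, g i) = ∑ i ∈ s, comp f (g i) := by simp [comp]

theorem zero_tens {k l k' l' : ℕ} (g : QHom F k' l') : tens (0 : QHom F k l) g = 0 := by
  simp [tens]

theorem tens_zero {k l k' l' : ℕ} (f : QHom F k l) : tens f (0 : QHom F k' l') = 0 := by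
  simp [tens]

theorem sum_tens_sum {k l k' l' : ℕ} {ι ι' : Type*} (s : Finset ι) (s' : Finset ι')
    (f : ι → QHom F k l) (g : ι' → QHom F k' l') :
    tens (∑ i ∈ s, f i) (∑ j ∈ s', g j) = ∑ x ∈ s ×ˢ s', tens (f x.1) (g x.2) := by
  simp only [tens, map_sum, LinearMap.sum_apply, Finset.sum_product]
  exact Finset.sum_comm

theorem comp_single {k l m : ℕ} (f : Diag k l) (g : Diag l m) (a b : F) :
    comp (Finsupp.single f a) (Finsupp.single g b) = Finsupp.single (f.comp g) (a * b) :=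
  bilin_single _ _ _ _ _

theorem tens_single {k l k' l' : ℕ} (f : Diag k l) (g : Diag k' l') (a b : F) :
    tens (Finsupp.single f a) (Finsupp.single g b) = Finsupp.single (f.tens g) (a * b) :=
  bilin_single _ _ _ _ _

theorem add_tens {k l k' l' : ℕ} (f f' : QHom F k l) (g : QHom F k' l') :
    tens (f + f') g = tens f g + tens f' g := by simp [tens]

theorem tens_add {k l k' l' : ℕ} (f : QHom F k l) (g g' : QHom F k' l') :
    tens f (g + g') = tens f g + tens f g' := by simp [tens]

theorem comp_assoc {k l m n : ℕ} (f : QHom F k l) (g : QHom F l m) (h : QHom F m n) :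
    comp (comp f g) h = comp f (comp g h) := by
  induction f using Finsupp.induction_linear with
  | zero => simp only [zero_comp]
  | add f f' h1 h2 => simp only [add_comp, h1, h2]
  | single f a =>
  induction g using Finsupp.induction_linear with
  | zero => simp only [zero_comp, comp_zero]
  | add f f' h1 h2 => simp only [add_comp, comp_add, h1, h2]
  | single g b =>
  induction h using Finsupp.induction_linear with
  | zero => simp only [comp_zero]
  | add f f' h1 h2 => simp only [comp_add, h1, h2]
  | single h c => simp only [comp_single, Diag.comp_assoc, mul_assoc]

theorem one_comp {k l : ℕ} (f : QHom F k l) : comp (one rfl) f = f := by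
  induction f using Finsupp.induction_linear with
  | zero => simp only [comp_zero]
  | add f f' h1 h2 => simp only [comp_add, h1, h2]
  | single f a => simp only [one, comp_single, Diag.one_comp, one_mul]

theorem comp_one {k l : ℕ} (f : QHom F k l) : comp f (one rfl) = f := by
  induction f using Finsupp.induction_linear with
  | zero => simp only [zero_comp]
  | add f f' h1 h2 => simp only [add_comp, h1, h2]
  | single f a => simp only [one, comp_single, Diag.comp_one, mul_one]

theorem one_comp_one {k l m : ℕ} (h : k = l) (h' : l = m) :
    comp (one h) (one h') = (one (h.trans h') : QHom F k m) := by
  simp only [one, comp_single, Diag.one_comp_one, mul_one]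

theorem tens_one_one {k l k' l' : ℕ} (h : k = l) (h' : k' = l') :
    tens (one h) (one h') = (one (congrArg₂ (· + ·) h h') : QHom F (k + k') (l + l')) := by
  simp only [one, tens_single, Diag.tens_one_one, mul_one]

theorem tens_comp {k l m k' l' m' : ℕ} (f : QHom F k l) (f' : QHom F l m) (g : QHom F k' l')
    (g' : QHom F l' m') : tens (comp f f') (comp g g') = comp (tens f g) (tens f' g') := by
  induction f using Finsupp.induction_linear with
  | zero => simp only [zero_comp, zero_tens]
  | add f f' h1 h2 => simp only [add_comp, add_tens, h1, h2]
  | single f a =>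
  induction f' using Finsupp.induction_linear with
  | zero => simp only [comp_zero, zero_tens]
  | add f f' h1 h2 => simp only [comp_add, add_tens, h1, h2]
  | single f' a' =>
  induction g using Finsupp.induction_linear with
  | zero => simp only [zero_comp, tens_zero]
  | add f f' h1 h2 => simp only [add_comp, tens_add, h1, h2]
  | single g b =>
  induction g' using Finsupp.induction_linear with
  | zero => simp only [comp_zero, tens_zero]
  | add f f' h1 h2 => simp only [comp_add, tens_add, h1, h2]
  | single g' b' => simp only [comp_single, tens_single, Diag.tens_comp, mul_mul_mul_comm]

theorem tens_assoc {k l k' l' k'' l'' : ℕ} (f : QHom F k l) (g : QHom F k' l')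
    (h : QHom F k'' l'') :
    comp (tens (tens f g) h) (one (add_assoc l l' l'')) =
      comp (one (add_assoc k k' k'')) (tens f (tens g h)) := by
  induction f using Finsupp.induction_linear with
  | zero => simp only [zero_comp, comp_zero, zero_tens]
  | add f f' h1 h2 => simp only [add_comp, comp_add, add_tens, h1, h2]
  | single f a =>
  induction g using Finsupp.induction_linear with
  | zero => simp only [zero_comp, comp_zero, zero_tens, tens_zero]
  | add f f' h1 h2 => simp only [add_comp, comp_add, add_tens, tens_add, h1, h2]
  | single g b =>
  induction h using Finsupp.induction_linear with
  | zero => simp only [zero_comp, comp_zero, tens_zero]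
  | add f f' h1 h2 => simp only [add_comp, comp_add, tens_add, h1, h2]
  | single h c =>
    simp only [one, comp_single, tens_single, Diag.tens_assoc, mul_assoc, mul_one, one_mul]

theorem one_tens {k l : ℕ} (f : QHom F k l) :
    comp (tens (one (rfl : 0 = 0)) f) (one (zero_add l)) = comp (one (zero_add k)) f := by
  induction f using Finsupp.induction_linear with
  | zero => simp only [zero_comp, comp_zero, tens_zero]
  | add f f' h1 h2 => simp only [add_comp, comp_add, tens_add, h1, h2]
  | single f a => simp only [one, comp_single, tens_single, Diag.one_tens, mul_one, one_mul]

theorem tens_one {k l : ℕ} (f : QHom F k l) :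
    comp (tens f (one (rfl : 0 = 0))) (one (add_zero l)) = comp (one (add_zero k)) f := by
  induction f using Finsupp.induction_linear with
  | zero => simp only [zero_comp, comp_zero, zero_tens]
  | add f f' h1 h2 => simp only [add_comp, comp_add, add_tens, h1, h2]
  | single f a => simp only [one, comp_single, tens_single, Diag.tens_one, mul_one, one_mul]

theorem single_mem {k l : ℕ} (x : Diag k l) (a : F) {n : ℤ} (h : x.deg = n) :
    Finsupp.single x a ∈ gr F k l n :=
  Finsupp.single_mem_supported F a h

theorem gr_induction {k l : ℕ} {n : ℤ} {p : QHom F k l → Prop} (h0 : p 0)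
    (ha : ∀ x y, p x → p y → p (x + y)) (hs : ∀ x a, Diag.deg x = n → p (Finsupp.single x a))
    {f : QHom F k l} (hf : f ∈ gr F k l n) : p f := by
  rw [← Finsupp.sum_single f]
  refine Finset.sum_induction _ p ha h0 (fun x hx => hs x _ (hf hx))

theorem comp_mem {k l m : ℕ} {p q : ℤ} {f : QHom F k l} {g : QHom F l m} (hf : f ∈ gr F k l p)
    (hg : g ∈ gr F l m q) : comp f g ∈ gr F k m (p + q) := by
  refine gr_induction (p := fun f => comp f g ∈ _) ?_ ?_ ?_ hf
  · rw [zero_comp]; exact zero_mem _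
  · intro x y hx hy; rw [add_comp]; exact add_mem hx hy
  intro x a hx
  refine gr_induction (p := fun g => comp (Finsupp.single x a) g ∈ _) ?_ ?_ ?_ hg
  · rw [comp_zero]; exact zero_mem _
  · intro x y hx hy; rw [comp_add]; exact add_mem hx hy
  · intro y b hy
    rw [comp_single]
    exact single_mem _ _ (by rw [Diag.deg_comp, hx, hy])

theorem tens_mem {k l k' l' : ℕ} {p q : ℤ} {f : QHom F k l} {g : QHom F k' l'}
    (hf : f ∈ gr F k l p) (hg : g ∈ gr F k' l' q) :
    tens f g ∈ gr F (k + k') (l + l') (p + q) := by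
  refine gr_induction (p := fun f => tens f g ∈ _) ?_ ?_ ?_ hf
  · rw [zero_tens]; exact zero_mem _
  · intro x y hx hy; rw [add_tens]; exact add_mem hx hy
  intro x a hx
  refine gr_induction (p := fun g => tens (Finsupp.single x a) g ∈ _) ?_ ?_ ?_ hg
  · rw [tens_zero]; exact zero_mem _
  · intro x y hx hy; rw [tens_add]; exact add_mem hx hy
  · intro y b hy
    rw [tens_single]
    exact single_mem _ _ (by rw [Diag.deg_tens, hx, hy])

theorem one_mem {k l : ℕ} (h : k = l) : one h ∈ gr F k l 0 := single_mem _ _ (Diag.deg_one h)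

theorem isInternal_gr (k l : ℕ) : DirectSum.IsInternal (gr F k l) := by
  classical
  rw [DirectSum.isInternal_submodule_iff_iSupIndep_and_iSup_eq_top]
  constructor
  · intro n
    have e : (⨆ j, ⨆ (_ : j ≠ n), gr F k l j) ≤ Finsupp.supported F F {x | x.deg ≠ n} :=
      iSup₂_le fun j hj => Finsupp.supported_mono fun x hx hn =>
        hj ((show x.deg = j from hx).symm.trans hn)
    exact (Finsupp.disjoint_supported_supported
      (Set.disjoint_left.2 fun x hx hn => (show ¬ x.deg = n from hn) hx)).mono_right e
  · rw [eq_top_iff]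
    intro f _
    induction f using Finsupp.induction_linear with
    | zero => exact zero_mem _
    | add f g hf hg => exact add_mem (hf trivial) (hg trivial)
    | single x a => exact Submodule.mem_iSup_of_mem x.deg (single_mem x a rfl)

end QHom

end TwistedComplexes

section TwistedComplexesTwo

variable {F : Type u} [Field F]

/-- Matrices of morphisms from `⨁ Q^(k i)` to `⨁ Q^(k' j)`. -/
abbrev QMat (F : Type u) [Field F] {ι κ : Type} (k : ι → ℕ) (k' : κ → ℕ) : Type u :=
  ∀ i j, QHom F (k i) (k' j)

namespace QMat

open QHom

variable {ι₁ ι₂ ι₃ ι₄ κ₁ κ₂ κ₃ : Type}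

/-- Matrix multiplication (`f` is followed by `g`). -/
noncomputable def mul [Fintype ι₂] {k₁ : ι₁ → ℕ} {k₂ : ι₂ → ℕ} {k₃ : ι₃ → ℕ} (f : QMat F k₁ k₂)
    (g : QMat F k₂ k₃) : QMat F k₁ k₃ :=
  fun i l => ∑ j, comp (f i j) (g j l)

open scoped Classical in
/-- The matrix of identities along a map of indices which preserves the numbers of strands. -/
noncomputable def perm {k₁ : ι₁ → ℕ} {k₂ : ι₂ → ℕ} (e : ι₁ → ι₂) (h : ∀ i, k₁ i = k₂ (e i)) :
    QMat F k₁ k₂ :=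
  fun i j => if hj : e i = j then one ((h i).trans (congrArg k₂ hj)) else 0

/-- The identity matrix. -/
noncomputable def id (k : ι₁ → ℕ) : QMat F k k := perm (fun i => i) (fun _ => rfl)

/-- Horizontal composition of matrices. -/
noncomputable def tens {k₁ : ι₁ → ℕ} {k₂ : ι₂ → ℕ} {l₁ : κ₁ → ℕ} {l₂ : κ₂ → ℕ} (f : QMat F k₁ k₂)
    (g : QMat F l₁ l₂) :
    QMat F (fun x : ι₁ × κ₁ => k₁ x.1 + l₁ x.2) (fun x : ι₂ × κ₂ => k₂ x.1 + l₂ x.2) :=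
  fun x y => QHom.tens (f x.1 y.1) (g x.2 y.2)

variable {k₁ : ι₁ → ℕ} {k₂ : ι₂ → ℕ} {k₃ : ι₃ → ℕ} {k₄ : ι₄ → ℕ}
  {l₁ : κ₁ → ℕ} {l₂ : κ₂ → ℕ} {l₃ : κ₃ → ℕ}

theorem perm_apply_self (e : ι₁ → ι₂) (h : ∀ i, k₁ i = k₂ (e i)) (i : ι₁) :
    (perm e h : QMat F k₁ k₂) i (e i) = one (h i) := by simp [perm]

theorem perm_apply_of_ne (e : ι₁ → ι₂) (h : ∀ i, k₁ i = k₂ (e i)) {i : ι₁} {j : ι₂}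
    (hj : e i ≠ j) : (perm e h : QMat F k₁ k₂) i j = 0 := by simp [perm, hj]

theorem perm_mul [Fintype ι₂] (e : ι₁ → ι₂) (h : ∀ i, k₁ i = k₂ (e i)) (g : QMat F k₂ k₃)
    (i : ι₁) (j : ι₃) : mul (perm e h) g i j = comp (one (h i)) (g (e i) j) := by
  rw [mul, Finset.sum_eq_single (e i), perm_apply_self]
  · intro b _ hb
    rw [perm_apply_of_ne _ _ (Ne.symm hb), zero_comp]
  · simp

theorem mul_perm [Fintype ι₂] (e : ι₂ ≃ ι₃) (h : ∀ i, k₂ i = k₃ (e i)) (f : QMat F k₁ k₂)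
    (i : ι₁) (j : ι₂) : mul f (perm e h) i (e j) = comp (f i j) (one (h j)) := by
  rw [mul, Finset.sum_eq_single j, perm_apply_self]
  · intro b _ hb
    rw [perm_apply_of_ne _ _ (fun hbj => hb (e.injective hbj)), comp_zero]
  · simp

theorem assoc [Fintype ι₂] [Fintype ι₃] (f : QMat F k₁ k₂) (g : QMat F k₂ k₃)
    (h : QMat F k₃ k₄) : mul (mul f g) h = mul f (mul g h) := by
  funext i j
  simp only [mul, sum_comp, comp_sum, QHom.comp_assoc]
  exact Finset.sum_comm

theorem id_mul [Fintype ι₁] (g : QMat F k₁ k₂) : mul (id k₁) g = g := by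
  funext i j
  rw [id, perm_mul, QHom.one_comp]

theorem mul_id [Fintype ι₂] (f : QMat F k₁ k₂) : mul f (id k₂) = f := by
  funext i j
  exact (mul_perm (Equiv.refl _) (fun _ => rfl) f i j).trans (QHom.comp_one _)

theorem add_mul [Fintype ι₂] (f f' : QMat F k₁ k₂) (g : QMat F k₂ k₃) :
    mul (f + f') g = mul f g + mul f' g := by
  funext i j
  simp [mul, add_comp, Finset.sum_add_distrib]

theorem mul_add [Fintype ι₂] (f : QMat F k₁ k₂) (g g' : QMat F k₂ k₃) :
    mul f (g + g') = mul f g + mul f g' := by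
  funext i j
  simp [mul, comp_add, Finset.sum_add_distrib]

theorem smul_mul [Fintype ι₂] (a : F) (f : QMat F k₁ k₂) (g : QMat F k₂ k₃) :
    mul (a • f) g = a • mul f g := by
  funext i j
  simp only [mul, Pi.smul_apply, smul_comp, Finset.smul_sum]

theorem mul_smul [Fintype ι₂] (a : F) (f : QMat F k₁ k₂) (g : QMat F k₂ k₃) :
    mul f (a • g) = a • mul f g := by
  funext i j
  simp only [mul, Pi.smul_apply, comp_smul, Finset.smul_sum]

theorem zero_mul [Fintype ι₂] (g : QMat F k₂ k₃) : mul (0 : QMat F k₁ k₂) g = 0 := by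
  funext i j
  simp [mul, zero_comp]

theorem mul_zero [Fintype ι₂] (f : QMat F k₁ k₂) : mul f (0 : QMat F k₂ k₃) = 0 := by
  funext i j
  simp [mul, comp_zero]

theorem zero_tens (g : QMat F l₁ l₂) : tens (0 : QMat F k₁ k₂) g = 0 := by
  funext i j
  exact QHom.zero_tens _

theorem tens_zero (f : QMat F k₁ k₂) : tens f (0 : QMat F l₁ l₂) = 0 := by
  funext i j
  exact QHom.tens_zero _

theorem perm_mul_perm [Fintype ι₂] (e : ι₁ → ι₂) (h : ∀ i, k₁ i = k₂ (e i)) (e' : ι₂ → ι₃)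
    (h' : ∀ i, k₂ i = k₃ (e' i)) :
    mul (perm e h) (perm e' h') =
      (perm (e' ∘ e) (fun i => (h i).trans (h' (e i))) : QMat F k₁ k₃) := by
  funext i j
  rw [perm_mul]
  by_cases hj : e' (e i) = j
  · subst hj
    rw [perm_apply_self, one_comp_one]
    exact (perm_apply_self (F := F) (k₁ := k₁) (k₂ := k₃) (e' ∘ e)
      (fun i => (h i).trans (h' (e i))) i).symm
  · rw [perm_apply_of_ne e' h' hj, comp_zero]
    exact (perm_apply_of_ne (F := F) (e' ∘ e) _ hj).symm

theorem perm_tens_perm (e : ι₁ → ι₂) (h : ∀ i, k₁ i = k₂ (e i)) (e' : κ₁ → κ₂)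
    (h' : ∀ i, l₁ i = l₂ (e' i)) :
    tens (perm e h : QMat F k₁ k₂) (perm e' h' : QMat F l₁ l₂) =
      perm (fun x => (e x.1, e' x.2)) (fun x => congrArg₂ (· + ·) (h x.1) (h' x.2)) := by
  funext ⟨i, j⟩ ⟨i', j'⟩
  simp only [tens]
  by_cases hi : e i = i'
  · subst hi
    by_cases hj : e' j = j'
    · subst hj
      rw [perm_apply_self, perm_apply_self, tens_one_one]
      exact (perm_apply_self (F := F) (k₁ := fun x : ι₁ × κ₁ => k₁ x.1 + l₁ x.2)
        (k₂ := fun x : ι₂ × κ₂ => k₂ x.1 + l₂ x.2) (fun x : ι₁ × κ₁ => (e x.1, e' x.2))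
        (fun x => congrArg₂ (· + ·) (h x.1) (h' x.2)) (i, j)).symm
    · rw [perm_apply_of_ne _ _ hj, perm_apply_of_ne _ _ (fun he => hj (Prod.ext_iff.1 he).2),
        QHom.tens_zero]
  · rw [perm_apply_of_ne _ _ hi, perm_apply_of_ne _ _ (fun he => hi (Prod.ext_iff.1 he).1),
      QHom.zero_tens]

theorem tens_mul_tens [Fintype ι₂] [Fintype κ₂] (f : QMat F k₁ k₂) (f' : QMat F k₂ k₃)
    (g : QMat F l₁ l₂) (g' : QMat F l₂ l₃) :
    tens (mul f f') (mul g g') = mul (tens f g) (tens f' g') := by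
  funext i j
  simp only [tens, mul, sum_tens_sum, QHom.tens_comp]
  rfl

theorem perm_mem {e : ι₁ → ι₂} {h : ∀ i, k₁ i = k₂ (e i)} {i : ι₁} {j : ι₂} {n : ℤ}
    (hn : e i = j → n = 0) : (perm e h : QMat F k₁ k₂) i j ∈ QHom.gr F (k₁ i) (k₂ j) n := by
  by_cases hj : e i = j
  · rw [hn hj, perm]
    simp only [hj, dite_true]
    exact one_mem _
  · rw [perm_apply_of_ne _ _ hj]
    exact zero_mem _

end QMat

/-- One-sided twisted complexes over the additive closure with shifts of the monoidal category of
diagrams. An object consists of a finite formal direct sum of shifted objects `Q^(k i)[m i]`,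
`i : ι`, and of an endomorphism `f` of degree one with `f ∘ f = 0`. The summands are distributed
over levels (the summands of level `p` form the `p`-th term of the twisted complex), and the
nonzero components of `f` strictly increase the level. -/
structure TwI (F : Type u) [Field F] where
  ι : Type
  [fintype : Fintype ι]
  lev : ι → ℕ
  k : ι → ℕ
  m : ι → ℤ
  f : QMat F k k
  f_mem (i j : ι) : f i j ∈ QHom.gr F (k i) (k j) (1 + (m j - m i))
  f_lev (i j : ι) : f i j ≠ 0 → lev i < lev j
  f_sq : QMat.mul f f = 0

attribute [instance] TwI.fintype

namespace TwI

noncomputable instance : Category (TwI F) where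
  Hom A B := QMat F A.k B.k
  id A := QMat.id A.k
  comp f g := QMat.mul f g
  id_comp f := QMat.id_mul f
  comp_id f := QMat.mul_id f
  assoc f g h := QMat.assoc f g h

noncomputable instance : Preadditive (TwI F) where
  homGroup A B := inferInstanceAs (AddCommGroup (QMat F A.k B.k))
  add_comp _ _ _ f f' g := QMat.add_mul f f' g
  comp_add _ _ _ f g g' := QMat.mul_add f g g'

noncomputable instance : Linear F (TwI F) where
  homModule A B := inferInstanceAs (Module F (QMat F A.k B.k))
  smul_comp _ _ _ a f g := QMat.smul_mul a f g
  comp_smul _ _ _ f a g := QMat.mul_smul a f g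

/-- The morphisms of degree `n`: the component from `Q^k[m]` to `Q^k'[m']` has degree
`n + m' - m`. -/
noncomputable def gr (A B : TwI F) (n : ℤ) : Submodule F (QMat F A.k B.k) :=
  Submodule.pi Set.univ (fun i => Submodule.pi Set.univ
    (fun j => QHom.gr F (A.k i) (B.k j) (n + (B.m j - A.m i))))

theorem isInternal_gr (A B : TwI F) : DirectSum.IsInternal (gr A B) := by
  have h (i : A.ι) : DirectSum.IsInternal (fun n => Submodule.pi Set.univ
      (fun j => QHom.gr F (A.k i) (B.k j) (n + (B.m j - A.m i)))) :=
    isInternal_pi (W := fun j => QHom F (A.k i) (B.k j))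
      (gr := fun j n => QHom.gr F (A.k i) (B.k j) (n + (B.m j - A.m i)))
      fun j => isInternal_reindex (V := QHom F (A.k i) (B.k j)) (gr := QHom.gr F (A.k i) (B.k j))
        (QHom.isInternal_gr (A.k i) (B.k j)) (B.m j - A.m i)
  exact isInternal_pi (W := fun i => ∀ j, QHom F (A.k i) (B.k j))
    (gr := fun i n => Submodule.pi Set.univ
      (fun j => QHom.gr F (A.k i) (B.k j) (n + (B.m j - A.m i)))) h

theorem mem_gr {A B : TwI F} {n : ℤ} {f : QMat F A.k B.k} :
    f ∈ gr A B n ↔ ∀ i j, f i j ∈ QHom.gr F (A.k i) (B.k j) (n + (B.m j - A.m i)) := by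
  simp [gr, Submodule.mem_pi]

theorem mul_mem {A B C : TwI F} {p q : ℤ} {f : QMat F A.k B.k} {g : QMat F B.k C.k}
    (hf : f ∈ gr A B p) (hg : g ∈ gr B C q) : QMat.mul f g ∈ gr A C (p + q) := by
  rw [mem_gr] at *
  intro i l
  refine Submodule.sum_mem _ fun j _ => ?_
  have h := QHom.comp_mem (hf i j) (hg j l)
  have e : p + (B.m j - A.m i) + (q + (C.m l - B.m j)) = p + q + (C.m l - A.m i) := by ring
  rwa [e] at h

theorem f_mem_gr (A : TwI F) : A.f ∈ gr A A 1 := mem_gr.2 A.f_mem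

theorem perm_mem_gr {A B : TwI F} {e : A.ι → B.ι} {h : ∀ i, A.k i = B.k (e i)} {n : ℤ}
    (hm : ∀ i, n + (B.m (e i) - A.m i) = 0) : (QMat.perm e h : QMat F A.k B.k) ∈ gr A B n :=
  mem_gr.2 fun i _ => QMat.perm_mem fun hj => hj ▸ hm i

theorem id_mem_gr (A : TwI F) : QMat.id A.k ∈ gr A A 0 := perm_mem_gr fun i => by simp

theorem add_self [CharP F 2] {V : Type*} [AddCommGroup V] [Module F V] (v : V) : v + v = 0 := by
  have h : (1 + 1 : F) = 0 := by rw [one_add_one_eq_two]; exact CharTwo.two_eq_zero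
  rw [← one_smul F v, ← add_smul, h, zero_smul]

/-- The differential `h ↦ h ∘ f + g ∘ h` on the morphisms between twisted complexes. -/
noncomputable def d (A B : TwI F) : QMat F A.k B.k →ₗ[F] QMat F A.k B.k where
  toFun h := QMat.mul A.f h + QMat.mul h B.f
  map_add' h h' := by rw [QMat.mul_add, QMat.add_mul]; abel
  map_smul' a h := by rw [QMat.mul_smul, QMat.smul_mul, smul_add]; rfl

noncomputable instance [CharP F 2] : DGCategory F (TwI F) where
  gr := gr
  isInternal := isInternal_gr
  d := d
  id_mem := id_mem_gr
  comp_mem hf hg := mul_mem hf hg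
  d_mem {A B n f} hf := by
    refine add_mem ?_ (mul_mem hf (f_mem_gr B))
    rw [add_comm n 1]
    exact mul_mem (f_mem_gr A) hf
  d_d {A B} f := by
    change QMat.mul A.f (QMat.mul A.f f + QMat.mul f B.f) +
      QMat.mul (QMat.mul A.f f + QMat.mul f B.f) B.f = 0
    rw [QMat.mul_add, QMat.add_mul, ← QMat.assoc, A.f_sq, QMat.zero_mul,
      QMat.assoc f, B.f_sq, QMat.mul_zero, QMat.assoc, zero_add, add_zero]
    exact add_self (F := F) _
  leibniz {A B C} f g := by
    change QMat.mul A.f (QMat.mul f g) + QMat.mul (QMat.mul f g) C.f =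
      QMat.mul (QMat.mul A.f f + QMat.mul f B.f) g +
        QMat.mul f (QMat.mul B.f g + QMat.mul g C.f)
    rw [QMat.mul_add, QMat.add_mul, QMat.assoc, QMat.assoc, QMat.assoc]
    have h := add_self (F := F) (QMat.mul f (QMat.mul B.f g))
    calc _ = QMat.mul A.f (QMat.mul f g) + (QMat.mul f (QMat.mul B.f g) +
          QMat.mul f (QMat.mul B.f g)) + QMat.mul f (QMat.mul g C.f) := by rw [h, add_zero]
      _ = _ := by abel

/-- The shift of a twisted complex. -/
def shift (n : ℤ) (A : TwI F) : TwI F where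
  ι := A.ι
  lev := A.lev
  k := A.k
  m i := A.m i + n
  f := A.f
  f_mem i j := by
    have e : 1 + (A.m j + n - (A.m i + n)) = 1 + (A.m j - A.m i) := by ring
    rw [e]
    exact A.f_mem i j
  f_lev := A.f_lev
  f_sq := A.f_sq

theorem d_id_shift [CharP F 2] (A : TwI F) :
    QMat.mul A.f (QMat.id A.k) + QMat.mul (QMat.id A.k) A.f = 0 := by
  rw [QMat.mul_id, QMat.id_mul]
  exact add_self (F := F) _

noncomputable instance [CharP F 2] : DGShift F (TwI F) where
  sh := shift
  up n A := QMat.id A.k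
  down n A := QMat.id A.k
  up_mem n A := perm_mem_gr (A := A) (B := shift n A) (e := fun i => i) (h := fun _ => rfl) fun i => by
    simp [shift]
  down_mem n A := perm_mem_gr (A := shift n A) (B := A) (e := fun i => i) (h := fun _ => rfl) fun i => by
    simp [shift]
  d_up n A := d_id_shift A
  d_down n A := d_id_shift A
  up_down n A := QMat.mul_id _
  down_up n A := QMat.mul_id _

/-- The tensor product of twisted complexes. -/
noncomputable def tensorObj [CharP F 2] (A B : TwI F) : TwI F where
  ι := A.ι × B.ι
  lev x := A.lev x.1 + B.lev x.2
  k x := A.k x.1 + B.k x.2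
  m x := A.m x.1 + B.m x.2
  f := QMat.tens A.f (QMat.id B.k) + QMat.tens (QMat.id A.k) B.f
  f_mem x y := by
    refine add_mem ?_ ?_
    · have h := QHom.tens_mem (A.f_mem x.1 y.1)
        (mem_gr.1 (id_mem_gr B) x.2 y.2)
      have e : 1 + (A.m y.1 - A.m x.1) + (0 + (B.m y.2 - B.m x.2)) =
        1 + (A.m y.1 + B.m y.2 - (A.m x.1 + B.m x.2)) := by ring
      rwa [e] at h
    · have h := QHom.tens_mem
        (mem_gr.1 (id_mem_gr A) x.1 y.1) (B.f_mem x.2 y.2)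
      have e : 0 + (A.m y.1 - A.m x.1) + (1 + (B.m y.2 - B.m x.2)) =
        1 + (A.m y.1 + B.m y.2 - (A.m x.1 + B.m x.2)) := by ring
      rwa [e] at h
  f_lev := by
    rintro ⟨i, j⟩ ⟨i', j'⟩ h
    by_contra hlt
    refine h ?_
    change QHom.tens (A.f i i') (QMat.id B.k j j') + QHom.tens (QMat.id A.k i i') (B.f j j') = 0
    have h1 : QHom.tens (A.f i i') (QMat.id B.k j j') = 0 := by
      by_cases hj : j = j'
      · subst hj
        by_cases hi : A.f i i' = 0
        · rw [hi, QHom.zero_tens]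
        · exact absurd (Nat.add_lt_add_right (A.f_lev i i' hi) _) hlt
      · rw [QMat.id, QMat.perm_apply_of_ne _ _ hj, QHom.tens_zero]
    have h2 : QHom.tens (QMat.id A.k i i') (B.f j j') = 0 := by
      by_cases hi : i = i'
      · subst hi
        by_cases hj : B.f j j' = 0
        · rw [hj, QHom.tens_zero]
        · exact absurd (Nat.add_lt_add_left (B.f_lev j j' hj) _) hlt
      · rw [QMat.id, QMat.perm_apply_of_ne _ _ hi, QHom.zero_tens]
    rw [h1, h2, add_zero]
  f_sq := by
    rw [QMat.mul_add, QMat.add_mul, QMat.add_mul, ← QMat.tens_mul_tens, ← QMat.tens_mul_tens,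
      ← QMat.tens_mul_tens, ← QMat.tens_mul_tens, A.f_sq, B.f_sq, QMat.zero_tens, QMat.tens_zero,
      QMat.mul_id, QMat.id_mul, QMat.mul_id, QMat.id_mul, zero_add, add_zero]
    exact add_self (F := F) _

variable (F) in
/-- The twisted complex with the single term `Q^n`. -/
def pow (n : ℕ) : TwI F where
  ι := Unit
  lev _ := 0
  k _ := n
  m _ := 0
  f := 0
  f_mem _ _ := zero_mem _
  f_lev _ _ h := absurd rfl h
  f_sq := QMat.mul_zero _

/-- The isomorphism of twisted complexes given by a bijection of the indices of the summands which
preserves the numbers of strands. -/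
noncomputable def permIso (A B : TwI F) (e : A.ι ≃ B.ι) (h : ∀ i, A.k i = B.k (e i)) : A ≅ B where
  hom := QMat.perm e h
  inv := QMat.perm e.symm (fun i => by rw [h, e.apply_symm_apply])
  hom_inv_id := by
    change QMat.mul _ _ = QMat.id _
    rw [QMat.perm_mul_perm, QMat.id]
    congr 1
    funext i
    simp
  inv_hom_id := by
    change QMat.mul _ _ = QMat.id _
    rw [QMat.perm_mul_perm, QMat.id]
    congr 1
    funext i
    simp

noncomputable instance [CharP F 2] : MonoidalCategoryStruct (TwI F) where
  tensorObj := tensorObj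
  tensorHom f g := QMat.tens f g
  whiskerLeft A _ _ g := QMat.tens (QMat.id A.k) g
  whiskerRight f B := QMat.tens f (QMat.id B.k)
  tensorUnit := pow F 0
  associator A B C := permIso (tensorObj (tensorObj A B) C) (tensorObj A (tensorObj B C))
    (Equiv.prodAssoc A.ι B.ι C.ι) (fun _ => add_assoc _ _ _)
  leftUnitor A := permIso (tensorObj (pow F 0) A) A (Equiv.punitProd A.ι) (fun _ => zero_add _)
  rightUnitor A := permIso (tensorObj A (pow F 0)) A (Equiv.prodPUnit A.ι) (fun _ => add_zero _)

theorem associator_naturality_aux {A₁ A₂ A₃ B₁ B₂ B₃ : TwI F} (f : QMat F A₁.k B₁.k)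
    (g : QMat F A₂.k B₂.k) (h : QMat F A₃.k B₃.k) :
    QMat.mul (QMat.tens (QMat.tens f g) h)
      (QMat.perm (Equiv.prodAssoc B₁.ι B₂.ι B₃.ι) (fun _ => add_assoc _ _ _)) =
    QMat.mul (QMat.perm (k₂ := fun x : A₁.ι × A₂.ι × A₃.ι => A₁.k x.1 + (A₂.k x.2.1 + A₃.k x.2.2))
      (Equiv.prodAssoc A₁.ι A₂.ι A₃.ι) (fun _ => add_assoc _ _ _))
      (QMat.tens f (QMat.tens g h)) := by
  funext ⟨⟨i₁, i₂⟩, i₃⟩ ⟨j₁, j₂, j₃⟩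
  have e1 := QMat.mul_perm (k₃ := fun x : B₁.ι × B₂.ι × B₃.ι => B₁.k x.1 + (B₂.k x.2.1 + B₃.k x.2.2))
    (Equiv.prodAssoc B₁.ι B₂.ι B₃.ι) (fun _ => add_assoc _ _ _)
    (QMat.tens (QMat.tens f g) h) ((i₁, i₂), i₃) ((j₁, j₂), j₃)
  have e2 := QMat.perm_mul (k₂ := fun x : A₁.ι × A₂.ι × A₃.ι => A₁.k x.1 + (A₂.k x.2.1 + A₃.k x.2.2))
    (Equiv.prodAssoc A₁.ι A₂.ι A₃.ι) (fun _ => add_assoc _ _ _)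
    (QMat.tens f (QMat.tens g h)) ((i₁, i₂), i₃) (j₁, j₂, j₃)
  have e3 := QHom.tens_assoc (f i₁ j₁) (g i₂ j₂) (h i₃ j₃)
  exact e1.trans (e3.trans e2.symm)

theorem leftUnitor_naturality_aux {A B : TwI F} (f : QMat F A.k B.k) :
    QMat.mul (QMat.tens (QMat.id (pow F 0).k) f)
      (QMat.perm (Equiv.punitProd B.ι) (fun _ => zero_add _)) =
    QMat.mul (QMat.perm (Equiv.punitProd A.ι) (fun _ => zero_add _)) f := by
  funext x y
  obtain ⟨y, rfl⟩ := (Equiv.punitProd B.ι).surjective y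
  refine (QMat.mul_perm _ _ _ _ _).trans (Eq.trans ?_
    ((QHom.one_tens (f x.2 y.2)).trans
      (QMat.perm_mul (k₂ := A.k) (Equiv.punitProd A.ι) (fun _ => zero_add _) f _ _).symm))
  have e : QMat.id (F := F) (pow F 0).k x.1 y.1 = QHom.one rfl := QMat.perm_apply_self _ _ _
  change QHom.comp (QHom.tens (QMat.id (F := F) (pow F 0).k x.1 y.1) _) _ = _
  rw [e]
  rfl

theorem rightUnitor_naturality_aux {A B : TwI F} (f : QMat F A.k B.k) :
    QMat.mul (QMat.tens f (QMat.id (pow F 0).k))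
      (QMat.perm (Equiv.prodPUnit B.ι) (fun _ => add_zero _)) =
    QMat.mul (QMat.perm (Equiv.prodPUnit A.ι) (fun _ => add_zero _)) f := by
  funext x y
  obtain ⟨y, rfl⟩ := (Equiv.prodPUnit B.ι).surjective y
  refine (QMat.mul_perm _ _ _ _ _).trans (Eq.trans ?_
    ((QHom.tens_one (f x.1 y.1)).trans
      (QMat.perm_mul (k₂ := A.k) (Equiv.prodPUnit A.ι) (fun _ => add_zero _) f _ _).symm))
  have e : QMat.id (F := F) (pow F 0).k x.2 y.2 = QHom.one rfl := QMat.perm_apply_self _ _ _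
  change QHom.comp (QHom.tens _ (QMat.id (F := F) (pow F 0).k x.2 y.2)) _ = _
  rw [e]
  rfl

/-- The associativity matrix. -/
noncomputable def assocM [CharP F 2] (A B C : TwI F) :
    QMat F (tensorObj (tensorObj A B) C).k (tensorObj A (tensorObj B C)).k :=
  QMat.perm (Equiv.prodAssoc A.ι B.ι C.ι) (fun _ => add_assoc _ _ _)

theorem pentagon_aux [CharP F 2] (A B C D : TwI F) :
    QMat.mul (k₁ := (tensorObj (tensorObj (tensorObj A B) C) D).k)
      (k₂ := (tensorObj (tensorObj A (tensorObj B C)) D).k)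
      (k₃ := (tensorObj A (tensorObj B (tensorObj C D))).k)
      (QMat.tens (assocM A B C) (QMat.id D.k))
      (QMat.mul (k₂ := (tensorObj A (tensorObj (tensorObj B C) D)).k)
        (assocM A (tensorObj B C) D) (QMat.tens (QMat.id A.k) (assocM B C D))) =
    QMat.mul (k₂ := (tensorObj (tensorObj A B) (tensorObj C D)).k)
      (assocM (tensorObj A B) C D) (assocM A B (tensorObj C D)) := by
  have e1 := QMat.perm_tens_perm (F := F) (k₁ := (tensorObj (tensorObj A B) C).k)
    (k₂ := (tensorObj A (tensorObj B C)).k) (l₁ := D.k) (l₂ := D.k)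
    (Equiv.prodAssoc A.ι B.ι C.ι) (fun _ => add_assoc _ _ _) (fun i => i) (fun _ => rfl)
  have e2 := QMat.perm_tens_perm (F := F) (l₁ := (tensorObj (tensorObj B C) D).k)
    (l₂ := (tensorObj B (tensorObj C D)).k) (k₁ := A.k) (k₂ := A.k)
    (fun i => i) (fun _ => rfl) (Equiv.prodAssoc B.ι C.ι D.ι) (fun _ => add_assoc _ _ _)
  have e3 := QMat.perm_mul_perm (F := F) (k₁ := (tensorObj (tensorObj A (tensorObj B C)) D).k)
    (k₂ := (tensorObj A (tensorObj (tensorObj B C) D)).k)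
    (k₃ := (tensorObj A (tensorObj B (tensorObj C D))).k)
    (Equiv.prodAssoc A.ι (B.ι × C.ι) D.ι) (fun _ => add_assoc _ _ _)
    (fun x => (x.1, Equiv.prodAssoc B.ι C.ι D.ι x.2))
    (fun x => congrArg (A.k x.1 + ·) (add_assoc _ _ _))
  have e4 := QMat.perm_mul_perm (F := F) (k₁ := (tensorObj (tensorObj (tensorObj A B) C) D).k)
    (k₂ := (tensorObj (tensorObj A (tensorObj B C)) D).k)
    (k₃ := (tensorObj A (tensorObj B (tensorObj C D))).k)
    (fun x => (Equiv.prodAssoc A.ι B.ι C.ι x.1, x.2))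
    (fun x => congrArg (· + D.k x.2) (add_assoc _ _ _))
    ((fun x => (x.1, Equiv.prodAssoc B.ι C.ι D.ι x.2)) ∘ Equiv.prodAssoc A.ι (B.ι × C.ι) D.ι)
    (fun x => (add_assoc _ _ _).trans (congrArg (A.k x.1.1 + ·) (add_assoc _ _ _)))
  have e5 := QMat.perm_mul_perm (F := F) (k₁ := (tensorObj (tensorObj (tensorObj A B) C) D).k)
    (k₂ := (tensorObj (tensorObj A B) (tensorObj C D)).k)
    (k₃ := (tensorObj A (tensorObj B (tensorObj C D))).k)
    (Equiv.prodAssoc (A.ι × B.ι) C.ι D.ι) (fun _ => add_assoc _ _ _)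
    (Equiv.prodAssoc A.ι B.ι (C.ι × D.ι)) (fun _ => add_assoc _ _ _)
  exact (congrArg₂ QMat.mul e1 ((congrArg (QMat.mul _) e2).trans e3)).trans (e4.trans e5.symm)

theorem triangle_aux [CharP F 2] (A B : TwI F) :
    QMat.mul (k₂ := (tensorObj A (tensorObj (pow F 0) B)).k) (assocM A (pow F 0) B)
      (QMat.tens (QMat.id A.k) (QMat.perm (k₁ := (tensorObj (pow F 0) B).k)
        (Equiv.punitProd B.ι) (fun _ => zero_add _))) =
    QMat.tens (QMat.perm (k₁ := (tensorObj A (pow F 0)).k)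
        (Equiv.prodPUnit A.ι) (fun _ => add_zero _)) (QMat.id B.k) := by
  have e1 := QMat.perm_tens_perm (F := F) (l₁ := (tensorObj (pow F 0) B).k)
    (l₂ := B.k) (k₁ := A.k) (k₂ := A.k)
    (fun i => i) (fun _ => rfl) (Equiv.punitProd B.ι) (fun _ => zero_add _)
  have e2 := QMat.perm_tens_perm (F := F) (k₁ := (tensorObj A (pow F 0)).k)
    (k₂ := A.k) (l₁ := B.k) (l₂ := B.k)
    (Equiv.prodPUnit A.ι) (fun _ => add_zero _) (fun i => i) (fun _ => rfl)
  have e3 := QMat.perm_mul_perm (F := F) (k₁ := (tensorObj (tensorObj A (pow F 0)) B).k)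
    (k₂ := (tensorObj A (tensorObj (pow F 0) B)).k)
    (k₃ := (tensorObj A B).k)
    (Equiv.prodAssoc A.ι Unit B.ι) (fun _ => add_assoc _ _ _)
    (fun x => (x.1, Equiv.punitProd B.ι x.2))
    (fun x => congrArg (A.k x.1 + ·) (zero_add _))
  exact (congrArg (QMat.mul _) e1).trans (e3.trans e2.symm)

noncomputable instance [CharP F 2] : MonoidalCategory (TwI F) :=
  MonoidalCategory.ofTensorHom
    (id_tensorHom_id := fun A B => (QMat.perm_tens_perm (F := F) (k₁ := A.k) (k₂ := A.k)
      (l₁ := B.k) (l₂ := B.k) (fun i => i) (fun _ => rfl) (fun i => i) (fun _ => rfl) : _))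
    (id_tensorHom := fun _ _ _ _ => rfl)
    (tensorHom_id := fun _ _ => rfl)
    (tensorHom_comp_tensorHom := fun f g f' g' => (QMat.tens_mul_tens f f' g g').symm)
    (associator_naturality := associator_naturality_aux)
    (leftUnitor_naturality := leftUnitor_naturality_aux)
    (rightUnitor_naturality := rightUnitor_naturality_aux)
    (pentagon := pentagon_aux)
    (triangle := triangle_aux)

end TwI

end TwistedComplexesTwo

section GradingTwo

variable {F : Type*} [Field F] {V W : Type*} [AddCommGroup V] [Module F V]
  [AddCommGroup W] [Module F W]

theorem isInternal_comap {gr : ℤ → Submodule F V} (h : DirectSum.IsInternal gr) (f : W →ₗ[F] V)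
    (hf : Function.Injective f) (hs : ∀ w n, ∃ w', f w' = components h (f w) n) :
    DirectSum.IsInternal (fun n => (gr n).comap f) := by
  rw [DirectSum.isInternal_submodule_iff_iSupIndep_and_iSup_eq_top]
  constructor
  · intro n
    rw [Submodule.disjoint_def]
    intro x hx hx'
    have h1 : (⨆ j, ⨆ (_ : j ≠ n), (gr j).comap f) ≤ (⨆ j, ⨆ (_ : j ≠ n), gr j).comap f :=
      iSup₂_le fun j hj y hy =>
        Submodule.mem_iSup_of_mem j (Submodule.mem_iSup_of_mem hj hy)
    have h2 := (Submodule.disjoint_def.1 (h.submodule_iSupIndep n)) (f x) hx (h1 hx')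
    exact hf (h2.trans (map_zero f).symm)
  · rw [eq_top_iff]
    intro w _
    choose g hg using hs
    have e : w = ∑ n ∈ (components h (f w)).support, g w n := by
      apply hf
      rw [map_sum]
      simp only [hg]
      exact (components_sum h (f w)).symm
    rw [e]
    refine Submodule.sum_mem _ fun n _ => Submodule.mem_iSup_of_mem n ?_
    rw [Submodule.mem_comap, hg]
    exact components_mem h _ _

theorem isInternal_prod {gr : ℤ → Submodule F V} {gr' : ℤ → Submodule F W}
    (h : DirectSum.IsInternal gr) (h' : DirectSum.IsInternal gr') :
    DirectSum.IsInternal (fun n => (gr n).prod (gr' n)) := by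
  rw [DirectSum.isInternal_submodule_iff_iSupIndep_and_iSup_eq_top]
  constructor
  · intro n
    rw [Submodule.disjoint_def]
    rintro ⟨x, y⟩ hx hx'
    have h1 : (⨆ j, ⨆ (_ : j ≠ n), (gr j).prod (gr' j)) ≤
        (⨆ j, ⨆ (_ : j ≠ n), gr j).prod (⨆ j, ⨆ (_ : j ≠ n), gr' j) :=
      iSup₂_le fun j hj y hy =>
        ⟨Submodule.mem_iSup_of_mem j (Submodule.mem_iSup_of_mem hj hy.1),
          Submodule.mem_iSup_of_mem j (Submodule.mem_iSup_of_mem hj hy.2)⟩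
    have h2 := h1 hx'
    exact Prod.ext ((Submodule.disjoint_def.1 (h.submodule_iSupIndep n)) x hx.1 h2.1)
      ((Submodule.disjoint_def.1 (h'.submodule_iSupIndep n)) y hx.2 h2.2)
  · rw [eq_top_iff]
    rintro ⟨v, w⟩ _
    have hv : ∀ v : V, (v, (0 : W)) ∈ ⨆ n, (gr n).prod (gr' n) := by
      intro v
      induction v using homogeneous_induction h with
      | hg n v hv => exact Submodule.mem_iSup_of_mem n ⟨hv, zero_mem _⟩
      | h0 => exact zero_mem _
      | ha v w hv hw =>
        have := add_mem hv hw
        rwa [Prod.mk_add_mk, add_zero] at this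
    have hw : ∀ w : W, ((0 : V), w) ∈ ⨆ n, (gr n).prod (gr' n) := by
      intro w
      induction w using homogeneous_induction h' with
      | hg n v hv => exact Submodule.mem_iSup_of_mem n ⟨zero_mem _, hv⟩
      | h0 => exact zero_mem _
      | ha v w hv hw =>
        have := add_mem hv hw
        rwa [Prod.mk_add_mk, add_zero] at this
    have := add_mem (hv v) (hw w)
    rwa [Prod.mk_add_mk, add_zero, zero_add] at this

end GradingTwo

section QuiverAlgebra

/-- The idempotents and arrows of the quiver with vertices `x`, `y`. -/
inductive KSGen
  | ex
  | ey
  | a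
  | b

/-- The cohomological grading of the generators. -/
def KSGen.deg : KSGen → ℤ
  | ex => 0
  | ey => 0
  | a => 0
  | b => 1

variable (F : Type u) [Field F]

open FreeAlgebra KSGen in
/-- The relations of the quiver algebra. -/
inductive KSRel : FreeAlgebra F KSGen → FreeAlgebra F KSGen → Prop
  | ex_ex : KSRel (ι F ex * ι F ex) (ι F ex)
  | ey_ey : KSRel (ι F ey * ι F ey) (ι F ey)
  | ex_ey : KSRel (ι F ex * ι F ey) 0
  | ey_ex : KSRel (ι F ey * ι F ex) 0
  | ex_add_ey : KSRel (ι F ex + ι F ey) 1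
  | ex_a : KSRel (ι F ex * ι F a) (ι F a)
  | a_ey : KSRel (ι F a * ι F ey) (ι F a)
  | ey_b : KSRel (ι F ey * ι F b) (ι F b)
  | b_ex : KSRel (ι F b * ι F ex) (ι F b)
  | a_b_a : KSRel (ι F a * ι F b * ι F a) 0
  | b_a_b : KSRel (ι F b * ι F a * ι F b) 0

/-- The quiver algebra `R`: a DG algebra with trivial differential. -/
def KSAlg : Type u := RingQuot (KSRel F)

namespace KSAlg

noncomputable instance : Ring (KSAlg F) := inferInstanceAs (Ring (RingQuot (KSRel F)))

noncomputable instance : Algebra F (KSAlg F) :=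
  inferInstanceAs (Algebra F (RingQuot (KSRel F)))

/-- The projection from the free algebra. -/
noncomputable def proj : FreeAlgebra F KSGen →ₐ[F] KSAlg F := RingQuot.mkAlgHom F (KSRel F)

theorem proj_rel {x y : FreeAlgebra F KSGen} (h : KSRel F x y) : proj F x = proj F y :=
  RingQuot.mkAlgHom_rel F h

theorem proj_surjective : Function.Surjective (proj F) :=
  RingQuot.mkAlgHom_surjective F (KSRel F)

/-- The generators of the quiver algebra. -/
noncomputable def gen (g : KSGen) : KSAlg F := proj F (FreeAlgebra.ι F g)

variable {F}

theorem gen_ex_ex : gen F KSGen.ex * gen F KSGen.ex = gen F KSGen.ex := by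
  simpa [gen] using proj_rel F (KSRel.ex_ex (F := F))
theorem gen_ey_ey : gen F KSGen.ey * gen F KSGen.ey = gen F KSGen.ey := by
  simpa [gen] using proj_rel F (KSRel.ey_ey (F := F))
theorem gen_ex_ey : gen F KSGen.ex * gen F KSGen.ey = 0 := by
  simpa [gen] using proj_rel F (KSRel.ex_ey (F := F))
theorem gen_ey_ex : gen F KSGen.ey * gen F KSGen.ex = 0 := by
  simpa [gen] using proj_rel F (KSRel.ey_ex (F := F))
theorem gen_ex_add_ey : gen F KSGen.ex + gen F KSGen.ey = 1 := by
  simpa [gen] using proj_rel F (KSRel.ex_add_ey (F := F))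
theorem gen_ex_a : gen F KSGen.ex * gen F KSGen.a = gen F KSGen.a := by
  simpa [gen] using proj_rel F (KSRel.ex_a (F := F))
theorem gen_a_ey : gen F KSGen.a * gen F KSGen.ey = gen F KSGen.a := by
  simpa [gen] using proj_rel F (KSRel.a_ey (F := F))
theorem gen_ey_b : gen F KSGen.ey * gen F KSGen.b = gen F KSGen.b := by
  simpa [gen] using proj_rel F (KSRel.ey_b (F := F))
theorem gen_b_ex : gen F KSGen.b * gen F KSGen.ex = gen F KSGen.b := by
  simpa [gen] using proj_rel F (KSRel.b_ex (F := F))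
theorem gen_a_b_a : gen F KSGen.a * gen F KSGen.b * gen F KSGen.a = 0 := by
  simpa [gen] using proj_rel F (KSRel.a_b_a (F := F))
theorem gen_b_a_b : gen F KSGen.b * gen F KSGen.a * gen F KSGen.b = 0 := by
  simpa [gen] using proj_rel F (KSRel.b_a_b (F := F))

/-- The universal property of the quiver algebra. -/
noncomputable def lift {A : Type*} [Ring A] [Algebra F A] (φ : KSGen → A)
    (h : ∀ ⦃x y⦄, KSRel F x y → FreeAlgebra.lift F φ x = FreeAlgebra.lift F φ y) :
    KSAlg F →ₐ[F] A :=
  RingQuot.liftAlgHom F ⟨FreeAlgebra.lift F φ, h⟩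

theorem lift_gen {A : Type*} [Ring A] [Algebra F A] (φ : KSGen → A)
    (h : ∀ ⦃x y⦄, KSRel F x y → FreeAlgebra.lift F φ x = FreeAlgebra.lift F φ y) (g : KSGen) :
    lift φ h (gen F g) = φ g := by
  exact (RingQuot.liftAlgHom_mkAlgHom_apply F _ h _).trans (FreeAlgebra.lift_ι_apply φ g)

variable (F) in
/-- The elements of degree `n`: the span of the products of generators of total degree `n`. -/
noncomputable def gr (n : ℤ) : Submodule F (KSAlg F) :=
  Submodule.span F {r | ∃ l : List KSGen, (l.map KSGen.deg).sum = n ∧ r = (l.map (gen F)).prod}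

theorem prod_mem_gr (l : List KSGen) : (l.map (gen F)).prod ∈ gr F (l.map KSGen.deg).sum :=
  Submodule.subset_span ⟨l, rfl, rfl⟩

theorem gen_mem_gr (g : KSGen) : gen F g ∈ gr F g.deg := by
  simpa using prod_mem_gr (F := F) [g]

theorem one_mem_gr : (1 : KSAlg F) ∈ gr F 0 := by
  simpa using prod_mem_gr (F := F) []

theorem mul_mem_gr {p q : ℤ} {r s : KSAlg F} (hr : r ∈ gr F p) (hs : s ∈ gr F q) :
    r * s ∈ gr F (p + q) := by
  induction hr using Submodule.span_induction with
  | zero => rw [zero_mul]; exact zero_mem _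
  | add x y _ _ hx hy => rw [add_mul]; exact add_mem hx hy
  | smul a x _ hx => rw [smul_mul_assoc]; exact Submodule.smul_mem _ _ hx
  | mem x hx =>
  obtain ⟨l, rfl, rfl⟩ := hx
  induction hs using Submodule.span_induction with
  | zero => rw [mul_zero]; exact zero_mem _
  | add x y _ _ hx hy => rw [mul_add]; exact add_mem hx hy
  | smul a x _ hx => rw [mul_smul_comm]; exact Submodule.smul_mem _ _ hx
  | mem x hx =>
  obtain ⟨l', rfl, rfl⟩ := hx
  have := prod_mem_gr (F := F) (l ++ l')
  simpa using this

/-- Induction on words in the generators. -/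
theorem induction {p : KSAlg F → Prop} (hw : ∀ l : List KSGen, p (l.map (gen F)).prod)
    (ha : ∀ r s, p r → p s → p (r + s)) (hs : ∀ (c : F) r, p r → p (c • r)) (r : KSAlg F) :
    p r := by
  have h : ∀ x : FreeAlgebra F KSGen, proj F x ∈
      Submodule.span F (Set.range fun l : List KSGen => (l.map (gen F)).prod) := by
    intro x
    induction x using FreeAlgebra.induction with
    | grade0 c =>
      rw [AlgHom.commutes, Algebra.algebraMap_eq_smul_one]
      exact Submodule.smul_mem _ _ (Submodule.subset_span ⟨[], rfl⟩)
    | grade1 g => exact Submodule.subset_span ⟨[g], by simp [gen]⟩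
    | mul x y hx hy =>
      rw [map_mul]
      have := Submodule.mul_mem_mul hx hy
      rw [Submodule.span_mul_span] at this
      refine Submodule.span_mono ?_ this
      rintro _ ⟨_, ⟨l, rfl⟩, _, ⟨l', rfl⟩, rfl⟩
      exact ⟨l ++ l', by simp⟩
    | add x y hx hy => rw [map_add]; exact add_mem hx hy
  obtain ⟨x, rfl⟩ := proj_surjective F r
  have h0 : p 0 := by simpa using hs 0 _ (hw [])
  refine Submodule.span_induction (p := fun r _ => p r) ?_ h0 ?_ ?_ (h x)
  · rintro _ ⟨l, rfl⟩; exact hw l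
  · intro r s _ _ hr hs; exact ha r s hr hs
  · intro c r _ hr; exact hs c r hr

variable (F) in
/-- The decomposition into homogeneous components, as a homomorphism of algebras. -/
noncomputable def grading : KSAlg F →ₐ[F] AddMonoidAlgebra (KSAlg F) ℤ :=
  lift (fun g => AddMonoidAlgebra.single g.deg (gen F g)) (by
    intro x y h
    cases h <;> simp only [map_mul, map_add, map_one, map_zero, FreeAlgebra.lift_ι_apply,
      AddMonoidAlgebra.single_mul_single, gen_ex_ex, gen_ey_ey, gen_ex_ey, gen_ey_ex, gen_ex_a,
      gen_a_ey, gen_ey_b, gen_b_ex, gen_a_b_a, gen_b_a_b, KSGen.deg, add_zero, zero_add,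
      AddMonoidAlgebra.single_zero]
    rw [← AddMonoidAlgebra.single_add, gen_ex_add_ey]
    rfl)

theorem grading_prod (l : List KSGen) : grading F (l.map (gen F)).prod =
    AddMonoidAlgebra.single (l.map KSGen.deg).sum (l.map (gen F)).prod := by
  induction l with
  | nil => simp only [List.map_nil, List.prod_nil, map_one, List.sum_nil]; rfl
  | cons g l ih =>
    simp only [List.map_cons, List.prod_cons, List.sum_cons, map_mul, ih]
    rw [grading, lift_gen, AddMonoidAlgebra.single_mul_single]

theorem grading_of_mem {n : ℤ} {r : KSAlg F} (hr : r ∈ gr F n) :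
    grading F r = AddMonoidAlgebra.single n r := by
  induction hr using Submodule.span_induction with
  | zero => simp
  | add x y _ _ hx hy => rw [map_add, hx, hy, AddMonoidAlgebra.single_add]
  | smul a x _ hx => rw [map_smul, hx, AddMonoidAlgebra.smul_single]
  | mem x hx =>
  obtain ⟨l, rfl, rfl⟩ := hx
  exact grading_prod l

theorem isInternal_gr : DirectSum.IsInternal (gr F) := by
  refine isInternal_of_components (gr F)
    ((AddMonoidAlgebra.coeffLinearEquiv F).toLinearMap.comp (grading F).toLinearMap) ?_ ?_ ?_
  · intro r n
    induction r using induction with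
    | hw l =>
      have e : ((AddMonoidAlgebra.coeffLinearEquiv F).toLinearMap.comp (grading F).toLinearMap)
          (l.map (gen F)).prod = Finsupp.single (l.map KSGen.deg).sum (l.map (gen F)).prod :=
        congrArg AddMonoidAlgebra.coeff (grading_prod l)
      rw [e, Finsupp.single_apply]
      split_ifs with h
      · exact h ▸ prod_mem_gr l
      · exact zero_mem _
    | ha r s hr hs => rw [map_add]; exact add_mem hr hs
    | hs c r hr => rw [map_smul]; exact Submodule.smul_mem _ _ hr
  · intro n r hr
    exact congrArg AddMonoidAlgebra.coeff (grading_of_mem hr)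
  · intro r
    induction r using induction with
    | hw l =>
      have e : ((AddMonoidAlgebra.coeffLinearEquiv F).toLinearMap.comp (grading F).toLinearMap)
          (l.map (gen F)).prod = Finsupp.single (l.map KSGen.deg).sum (l.map (gen F)).prod :=
        congrArg AddMonoidAlgebra.coeff (grading_prod l)
      rw [e]
      simp
    | ha r s hr hs => rw [map_add, Finsupp.sum_add_index' (by simp) (by simp), hr, hs]
    | hs c r hr =>
      rw [map_smul, Finsupp.sum_smul_index' (by simp), ← Finsupp.smul_sum, hr]

end KSAlg

end QuiverAlgebra

section DGModules

theorem components_map {F : Type*} [Field F] {V W : Type*} [AddCommGroup V] [Module F V]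
    [AddCommGroup W] [Module F W] {gr : ℤ → Submodule F V} (h : DirectSum.IsInternal gr)
    {gr' : ℤ → Submodule F W} (h' : DirectSum.IsInternal gr') (φ : V →ₗ[F] W)
    (hφ : ∀ n, ∀ v ∈ gr n, φ v ∈ gr' n) (v : V) (n : ℤ) :
    components h' (φ v) n = φ (components h v n) := by
  induction v using homogeneous_induction h with
  | hg m v hv =>
    rw [components_of_mem h hv, components_of_mem h' (hφ m v hv), Finsupp.single_apply,
      Finsupp.single_apply]
    split_ifs
    · rfl
    · rw [map_zero]
  | h0 => simp
  | ha v w hv hw => simp only [map_add, Finsupp.add_apply, hv, hw]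

/-- A DG left module over the quiver algebra `R`. The differential of `R` vanishes and the
characteristic is two, so the Leibniz rule says that the differential is `R`-linear. -/
structure DGMod (F : Type u) [Field F] where
  V : Type u
  [addCommGroup : AddCommGroup V]
  [module : Module F V]
  act : KSAlg F →ₐ[F] Module.End F V
  gr : ℤ → Submodule F V
  isInternal : DirectSum.IsInternal gr
  act_mem {i j : ℤ} {r : KSAlg F} {v : V} : r ∈ KSAlg.gr F i → v ∈ gr j → act r v ∈ gr (i + j)
  d : V →ₗ[F] V
  d_mem {n : ℤ} {v : V} : v ∈ gr n → d v ∈ gr (n + 1)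
  d_act (r : KSAlg F) (v : V) : d (act r v) = act r (d v)
  d_d (v : V) : d (d v) = 0

attribute [instance] DGMod.addCommGroup DGMod.module

namespace DGMod

variable {F : Type u} [Field F]

/-- The homomorphisms of degree `n`: the `R`-linear maps which raise degrees by `n`. -/
def homDeg (X Y : DGMod F) (n : ℤ) : Submodule F (X.V →ₗ[F] Y.V) where
  carrier := {f | (∀ r v, f (X.act r v) = Y.act r (f v)) ∧
    ∀ i, ∀ v ∈ X.gr i, f v ∈ Y.gr (n + i)}
  add_mem' {f g} hf hg := ⟨fun r v => by simp [hf.1, hg.1],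
    fun i v hv => add_mem (hf.2 i v hv) (hg.2 i v hv)⟩
  zero_mem' := ⟨fun r v => by simp, fun i v _ => zero_mem _⟩
  smul_mem' a f hf := ⟨fun r v => by simp [hf.1],
    fun i v hv => Submodule.smul_mem _ a (hf.2 i v hv)⟩

/-- The space of homomorphisms: finite sums of homogeneous homomorphisms. -/
def HomSpace (X Y : DGMod F) : Submodule F (X.V →ₗ[F] Y.V) := ⨆ n, homDeg X Y n

theorem homSpace_induction {X Y : DGMod F} {p : (X.V →ₗ[F] Y.V) → Prop} {f : X.V →ₗ[F] Y.V}
    (hf : f ∈ HomSpace X Y) (hg : ∀ n, ∀ f ∈ homDeg X Y n, p f) (h0 : p 0)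
    (ha : ∀ f g, p f → p g → p (f + g)) : p f :=
  Submodule.iSup_induction (p := homDeg X Y) (motive := p) hf hg h0 ha

theorem mem_homSpace {X Y : DGMod F} {n : ℤ} {f : X.V →ₗ[F] Y.V} (hf : f ∈ homDeg X Y n) :
    f ∈ HomSpace X Y := Submodule.mem_iSup_of_mem n hf

theorem id_mem_homDeg (X : DGMod F) : LinearMap.id ∈ homDeg X X 0 :=
  ⟨fun _ _ => rfl, fun i v hv => by simpa using hv⟩

theorem comp_mem_homDeg {X Y Z : DGMod F} {p q : ℤ} {f : X.V →ₗ[F] Y.V} {g : Y.V →ₗ[F] Z.V}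
    (hf : f ∈ homDeg X Y p) (hg : g ∈ homDeg Y Z q) : g ∘ₗ f ∈ homDeg X Z (p + q) := by
  refine ⟨fun r v => by simp [hf.1, hg.1], fun i v hv => ?_⟩
  have h := hg.2 _ _ (hf.2 i v hv)
  have e : q + (p + i) = p + q + i := by ring
  rwa [e] at h

theorem d_mem_homDeg (X : DGMod F) : X.d ∈ homDeg X X 1 :=
  ⟨X.d_act, fun i v hv => by rw [add_comm]; exact X.d_mem hv⟩

theorem comp_mem_homSpace {X Y Z : DGMod F} {f : X.V →ₗ[F] Y.V} {g : Y.V →ₗ[F] Z.V}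
    (hf : f ∈ HomSpace X Y) (hg : g ∈ HomSpace Y Z) : g ∘ₗ f ∈ HomSpace X Z := by
  refine homSpace_induction (p := fun f => g ∘ₗ f ∈ HomSpace X Z) hf (fun p f hf => ?_) ?_ ?_
  · refine homSpace_induction (p := fun g => g ∘ₗ f ∈ HomSpace X Z) hg (fun q g hg => ?_) ?_ ?_
    · exact mem_homSpace (comp_mem_homDeg hf hg)
    · rw [LinearMap.zero_comp]; exact zero_mem _
    · intro g g' h h'
      rw [LinearMap.add_comp]; exact add_mem h h'
  · rw [LinearMap.comp_zero]; exact zero_mem _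
  · intro f f' h h'
    rw [LinearMap.comp_add]; exact add_mem h h'

instance : Category (DGMod F) where
  Hom X Y := HomSpace X Y
  id X := ⟨LinearMap.id, mem_homSpace (id_mem_homDeg X)⟩
  comp f g := ⟨g.1 ∘ₗ f.1, comp_mem_homSpace f.2 g.2⟩

instance : Preadditive (DGMod F) where
  homGroup X Y := inferInstanceAs (AddCommGroup (HomSpace X Y))
  add_comp _ _ _ _ _ g := Subtype.ext (LinearMap.comp_add _ _ g.1)
  comp_add _ _ _ f _ _ := Subtype.ext (LinearMap.add_comp f.1 _ _)

instance : Linear F (DGMod F) where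
  homModule X Y := inferInstanceAs (Module F (HomSpace X Y))
  smul_comp _ _ _ a f g := Subtype.ext (LinearMap.comp_smul g.1 a f.1)
  comp_smul _ _ _ f a g := Subtype.ext (LinearMap.smul_comp a g.1 f.1)

/-- The underlying linear map of a homomorphism. -/
def toLin {X Y : DGMod F} (f : X ⟶ Y) : X.V →ₗ[F] Y.V := Subtype.val f

/-- The homomorphism with a given underlying linear map. -/
def ofLin {X Y : DGMod F} (f : X.V →ₗ[F] Y.V) (hf : f ∈ HomSpace X Y) : X ⟶ Y := ⟨f, hf⟩

@[ext]
theorem hom_ext {X Y : DGMod F} {f g : X ⟶ Y} (h : toLin f = toLin g) : f = g := Subtype.ext h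

/-- The morphisms of degree `n`. -/
def homGr (X Y : DGMod F) (n : ℤ) : Submodule F (HomSpace X Y) :=
  (homDeg X Y n).comap (HomSpace X Y).subtype

/-- The homogeneous component of degree `n` of a homomorphism, evaluated on a vector of degree
`i`. -/
theorem components_apply {X Y : DGMod F} {f : X.V →ₗ[F] Y.V} {n : ℤ} (hf : f ∈ homDeg X Y n)
    {i m : ℤ} {v : X.V} (hv : v ∈ X.gr i) :
    components Y.isInternal (f v) (m + i) = if n = m then f v else 0 := by
  rw [components_of_mem _ (hf.2 i v hv), Finsupp.single_apply]
  simp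

theorem iSupIndep_homDeg (X Y : DGMod F) : iSupIndep (homDeg X Y) := by
  intro n
  rw [Submodule.disjoint_def]
  intro f hf hf'
  ext v
  induction v using homogeneous_induction X.isInternal with
  | h0 => simp
  | ha v w hv hw => simp only [map_add, hv, hw]
  | hg i v hv =>
  have h1 := components_apply hf (m := n) hv
  rw [if_pos rfl] at h1
  rw [← h1, LinearMap.zero_apply]
  have key : (⨆ j, ⨆ (_ : j ≠ n), homDeg X Y j) ≤ LinearMap.ker
      ((Finsupp.lapply (n + i)).comp ((components Y.isInternal).comp
        (LinearMap.applyₗ (R := F) (M₂ := Y.V) v))) := by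
    refine iSup₂_le fun j hj g hg => ?_
    change components Y.isInternal (g v) (n + i) = 0
    rw [components_apply hg hv, if_neg hj]
  exact key hf'

theorem isInternal_homGr (X Y : DGMod F) : DirectSum.IsInternal (homGr X Y) := by
  rw [DirectSum.isInternal_submodule_iff_iSupIndep_and_iSup_eq_top]
  constructor
  · intro n
    rw [Submodule.disjoint_def]
    intro f hf hf'
    have h1 : (⨆ j, ⨆ (_ : j ≠ n), homGr X Y j) ≤
        (⨆ j, ⨆ (_ : j ≠ n), homDeg X Y j).comap (HomSpace X Y).subtype :=
      iSup₂_le fun j hj g hg => Submodule.mem_iSup_of_mem j (Submodule.mem_iSup_of_mem hj hg)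
    exact Subtype.ext ((Submodule.disjoint_def.1 (iSupIndep_homDeg X Y n)) f.1 hf (h1 hf'))
  · rw [eq_top_iff]
    rintro ⟨f, hf⟩ _
    have h : ∀ f ∈ HomSpace X Y, f ∈ (⨆ n, homGr X Y n).map (HomSpace X Y).subtype := by
      intro f hf
      refine homSpace_induction
        (p := fun f => f ∈ (⨆ n, homGr X Y n).map (HomSpace X Y).subtype) hf ?_ ?_ ?_
      · exact fun n f hf =>
          ⟨⟨f, mem_homSpace hf⟩, Submodule.mem_iSup_of_mem (p := homGr X Y) n hf, rfl⟩
      · exact zero_mem _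
      · exact fun f g hf hg => add_mem hf hg
    obtain ⟨g, hg, rfl⟩ := h f hf
    exact hg

/-- The differential of a homomorphism `f` is the commutator `d ∘ f + f ∘ d`. -/
def homD (X Y : DGMod F) : HomSpace X Y →ₗ[F] HomSpace X Y where
  toFun f := ⟨Y.d ∘ₗ f.1 + f.1 ∘ₗ X.d,
    add_mem (comp_mem_homSpace f.2 (mem_homSpace (d_mem_homDeg Y)))
      (comp_mem_homSpace (mem_homSpace (d_mem_homDeg X)) f.2)⟩
  map_add' f g := Subtype.ext (by
    change Y.d ∘ₗ (f.1 + g.1) + (f.1 + g.1) ∘ₗ X.d =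
      (Y.d ∘ₗ f.1 + f.1 ∘ₗ X.d) + (Y.d ∘ₗ g.1 + g.1 ∘ₗ X.d)
    rw [LinearMap.comp_add, LinearMap.add_comp]
    abel)
  map_smul' a f := Subtype.ext (by
    change Y.d ∘ₗ (a • f.1) + (a • f.1) ∘ₗ X.d = a • (Y.d ∘ₗ f.1 + f.1 ∘ₗ X.d)
    rw [LinearMap.comp_smul, LinearMap.smul_comp, smul_add])

/-- The shift `X[n]` of a DG module: `X[n]` has in degree `p` the component of `X` of
degree `p + n`. -/
def shift (n : ℤ) (X : DGMod F) : DGMod F where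
  V := X.V
  act := X.act
  gr p := X.gr (p + n)
  isInternal := isInternal_reindex X.isInternal n
  act_mem {i j r v} hr hv := by rw [add_assoc]; exact X.act_mem hr hv
  d := X.d
  d_mem {p v} hv := by
    have e : p + 1 + n = p + n + 1 := by ring
    rw [e]
    exact X.d_mem hv
  d_act := X.d_act
  d_d := X.d_d

theorem id_mem_up (n : ℤ) (X : DGMod F) : (LinearMap.id : X.V →ₗ[F] X.V) ∈
    homDeg X (shift n X) (-n) :=
  ⟨fun _ _ => rfl, fun i v hv => by
    change v ∈ X.gr (-n + i + n)
    rwa [neg_add_eq_sub, sub_add_cancel]⟩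

theorem id_mem_down (n : ℤ) (X : DGMod F) : (LinearMap.id : X.V →ₗ[F] X.V) ∈
    homDeg (shift n X) X n :=
  ⟨fun _ _ => rfl, fun i v hv => by
    change v ∈ X.gr (n + i)
    rw [add_comm]
    exact hv⟩

variable [CharP F 2]

instance : DGCategory F (DGMod F) where
  gr := homGr
  isInternal := isInternal_homGr
  d := homD
  id_mem := id_mem_homDeg
  comp_mem hf hg := comp_mem_homDeg hf hg
  d_mem {X Y n f} hf := by
    refine add_mem (comp_mem_homDeg hf (d_mem_homDeg Y)) ?_
    rw [add_comm n 1]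
    exact comp_mem_homDeg (d_mem_homDeg X) hf
  d_d {X Y} f := Subtype.ext (by
    ext v
    change Y.d (Y.d (f.1 v) + f.1 (X.d v)) + (Y.d (f.1 (X.d v)) + f.1 (X.d (X.d v))) = 0
    rw [map_add, Y.d_d, X.d_d, map_zero, add_zero, zero_add]
    exact TwI.add_self (F := F) _)
  leibniz {X Y Z} f g := Subtype.ext (by
    ext v
    change Z.d (g.1 (f.1 v)) + g.1 (f.1 (X.d v)) =
      g.1 (Y.d (f.1 v) + f.1 (X.d v)) + (Z.d (g.1 (f.1 v)) + g.1 (Y.d (f.1 v)))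
    have h := TwI.add_self (F := F) (g.1 (Y.d (f.1 v)))
    rw [map_add]
    calc _ = (g.1 (Y.d (f.1 v)) + g.1 (Y.d (f.1 v))) + (Z.d (g.1 (f.1 v)) + g.1 (f.1 (X.d v))) := by
          rw [h, zero_add]
      _ = _ := by abel)

instance : DGShift F (DGMod F) where
  sh := shift
  up n X := ofLin (X := X) (Y := shift n X) LinearMap.id (mem_homSpace (id_mem_up n X))
  down n X := ofLin (X := shift n X) (Y := X) LinearMap.id (mem_homSpace (id_mem_down n X))
  up_mem n X := id_mem_up n X
  down_mem n X := id_mem_down n X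
  d_up _ X := hom_ext (LinearMap.ext fun v => TwI.add_self (F := F) (X.d v))
  d_down _ X := hom_ext (LinearMap.ext fun v => TwI.add_self (F := F) (X.d v))
  up_down _ _ := rfl
  down_up _ _ := rfl

end DGMod

end DGModules

section Projectives

open DGCategory DGShift

/-- The vertices of the quiver. -/
inductive KSVertex
  | x
  | y

/-- The idempotent of a vertex. -/
def KSVertex.e : KSVertex → KSGen
  | x => KSGen.ex
  | y => KSGen.ey

variable (F : Type u) [Field F]

namespace KSAlg

variable {F}

theorem e_mul_e (z : KSVertex) : gen F z.e * gen F z.e = gen F z.e := by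
  cases z
  · exact gen_ex_ex
  · exact gen_ey_ey

theorem e_mem (z : KSVertex) : gen F z.e ∈ gr F 0 := by
  cases z
  · exact gen_mem_gr KSGen.ex
  · exact gen_mem_gr KSGen.ey

variable (F) in
/-- The left ideal `R e(z)`. -/
noncomputable def leftIdeal (z : KSVertex) : Submodule F (KSAlg F) :=
  LinearMap.range (LinearMap.mulRight F (gen F z.e))

theorem mul_e_mem (z : KSVertex) (r : KSAlg F) : r * gen F z.e ∈ leftIdeal F z := ⟨r, rfl⟩

theorem mul_e_of_mem {z : KSVertex} {r : KSAlg F} (h : r ∈ leftIdeal F z) :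
    r * gen F z.e = r := by
  obtain ⟨s, rfl⟩ := h
  rw [LinearMap.mulRight_apply, mul_assoc, e_mul_e]

theorem mul_mem_leftIdeal {z : KSVertex} (r : KSAlg F) {s : KSAlg F} (h : s ∈ leftIdeal F z) :
    r * s ∈ leftIdeal F z := by
  rw [← mul_e_of_mem h, ← mul_assoc]
  exact mul_e_mem z _

variable (F) in
/-- The elements of degree `n` of the left ideal `R e(z)`. -/
noncomputable def idealGr (z : KSVertex) (n : ℤ) : Submodule F (leftIdeal F z) :=
  (gr F n).comap (leftIdeal F z).subtype

theorem isInternal_idealGr (z : KSVertex) : DirectSum.IsInternal (idealGr F z) := by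
  refine isInternal_comap isInternal_gr (leftIdeal F z).subtype
    (Submodule.subtype_injective _) fun w n => ?_
  refine ⟨⟨components isInternal_gr w.1 n * gen F z.e, mul_e_mem z _⟩, ?_⟩
  have h := components_map (isInternal_gr (F := F)) isInternal_gr
    (LinearMap.mulRight F (gen F z.e))
    (fun m v hv => by simpa using mul_mem_gr hv (e_mem z)) w.1 n
  rw [LinearMap.mulRight_apply, LinearMap.mulRight_apply, mul_e_of_mem w.2] at h
  exact h.symm

variable (F) in
/-- The action of `R` on the left ideal `R e(z)` by left multiplication. -/
noncomputable def idealAct (z : KSVertex) : KSAlg F →ₐ[F] Module.End F (leftIdeal F z) where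
  toFun r := (LinearMap.mulLeft F r).restrict fun _ h => mul_mem_leftIdeal r h
  map_one' := LinearMap.ext fun v => Subtype.ext (one_mul v.1)
  map_mul' r s := LinearMap.ext fun v => Subtype.ext (mul_assoc r s v.1)
  map_zero' := LinearMap.ext fun v => Subtype.ext (zero_mul v.1)
  map_add' r s := LinearMap.ext fun v => Subtype.ext (add_mul r s v.1)
  commutes' c := LinearMap.ext fun v => Subtype.ext (Algebra.smul_def c v.1).symm

end KSAlg

/-- The projective DG module `P(z) = R e(z)`, with trivial differential. -/
noncomputable def DGMod.P (z : KSVertex) : DGMod F where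
  V := KSAlg.leftIdeal F z
  act := KSAlg.idealAct F z
  gr := KSAlg.idealGr F z
  isInternal := KSAlg.isInternal_idealGr z
  act_mem hr hv := KSAlg.mul_mem_gr hr hv
  d := 0
  d_mem _ := zero_mem _
  d_act _ _ := (map_zero _).symm
  d_d _ := rfl

variable [CharP F 2]

/-- The DG category generated by `P(x)` and `P(y)`: the full subcategory of the DG category of
DG modules whose objects are generated by `P(x)` and `P(y)` under shifts and mapping cones. -/
structure DGP where
  obj : DGMod F
  prop : DGGenerated F (fun X : DGMod F => ∃ z, X = DGMod.P F z) obj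

namespace DGP

variable {F}

instance : Category (DGP F) where
  Hom X Y := X.obj ⟶ Y.obj
  id X := 𝟙 X.obj
  comp {X Y Z} f g := CategoryStruct.comp (X := X.obj) (Y := Y.obj) (Z := Z.obj) f g
  id_comp {X Y} f := Category.id_comp (X := X.obj) (Y := Y.obj) f
  comp_id {X Y} f := Category.comp_id (X := X.obj) (Y := Y.obj) f
  assoc {W X Y Z} f g h := Category.assoc (W := W.obj) (X := X.obj) (Y := Y.obj) (Z := Z.obj) f g h

/-- A morphism, as a morphism of DG modules. -/
def toMod {X Y : DGP F} (f : X ⟶ Y) : X.obj ⟶ Y.obj := f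

/-- A morphism of DG modules, as a morphism of the full subcategory. -/
def ofMod {X Y : DGP F} (f : X.obj ⟶ Y.obj) : X ⟶ Y := f

instance : Preadditive (DGP F) where
  homGroup X Y := inferInstanceAs (AddCommGroup (X.obj ⟶ Y.obj))
  add_comp X Y Z f f' g :=
    Preadditive.add_comp X.obj Y.obj Z.obj (toMod f) (toMod f') (toMod g)
  comp_add X Y Z f g g' :=
    Preadditive.comp_add X.obj Y.obj Z.obj (toMod f) (toMod g) (toMod g')

instance : Linear F (DGP F) where
  homModule X Y := inferInstanceAs (Module F (X.obj ⟶ Y.obj))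
  smul_comp X Y Z a f g := Linear.smul_comp X.obj Y.obj Z.obj a (toMod f) (toMod g)
  comp_smul X Y Z f a g := Linear.comp_smul X.obj Y.obj Z.obj (toMod f) a (toMod g)

instance : DGCategory F (DGP F) where
  gr X Y := gr X.obj Y.obj
  isInternal X Y := isInternal X.obj Y.obj
  d X Y := d X.obj Y.obj
  id_mem X := id_mem X.obj
  comp_mem {X Y Z _ _ f g} hf hg :=
    comp_mem (X := X.obj) (Y := Y.obj) (Z := Z.obj) (f := toMod f) (g := toMod g) hf hg
  d_mem {X Y _ f} hf := d_mem (X := X.obj) (Y := Y.obj) (f := toMod f) hf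
  d_d {X Y} f := d_d (X := X.obj) (Y := Y.obj) f
  leibniz {X Y Z} f g := leibniz (X := X.obj) (Y := Y.obj) (Z := Z.obj) f g

instance : DGShift F (DGP F) where
  sh n X := ⟨sh (F := F) n X.obj, DGGenerated.shift n X.obj X.prop⟩
  up n X := up (F := F) n X.obj
  down n X := down (F := F) n X.obj
  up_mem n X := up_mem n X.obj
  down_mem n X := down_mem n X.obj
  d_up n X := d_up n X.obj
  d_down n X := d_down n X.obj
  up_down n X := up_down n X.obj
  down_up n X := down_up n X.obj

variable (F) in
/-- The object `P(z)` of the generated category. -/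
noncomputable def P (z : KSVertex) : DGP F := ⟨DGMod.P F z, DGGenerated.of _ ⟨z, rfl⟩⟩

end DGP

end Projectives

section Bimodules

open MulOpposite TensorProduct

/-- A DG bimodule over the quiver algebra `R`. -/
structure DGBimod (F : Type u) [Field F] extends DGMod F where
  right : (KSAlg F)ᵐᵒᵖ →ₐ[F] Module.End F V
  right_act (r : KSAlg F) (s : (KSAlg F)ᵐᵒᵖ) (v : V) : right s (act r v) = act r (right s v)
  right_mem {i j : ℤ} {s : KSAlg F} {v : V} :
    v ∈ gr i → s ∈ KSAlg.gr F j → right (op s) v ∈ gr (i + j)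
  d_right (s : (KSAlg F)ᵐᵒᵖ) (v : V) : d (right s v) = right s (d v)

namespace DGBimod

variable {F : Type u} [Field F]

/-- Isomorphisms of DG bimodules. -/
structure Iso (M N : DGBimod F) where
  e : M.V ≃ₗ[F] N.V
  map_act (r : KSAlg F) (v : M.V) : e (M.act r v) = N.act r (e v)
  map_right (s : (KSAlg F)ᵐᵒᵖ) (v : M.V) : e (M.right s v) = N.right s (e v)
  map_d (v : M.V) : e (M.d v) = N.d (e v)
  map_mem (n : ℤ) (v : M.V) : e v ∈ N.gr n ↔ v ∈ M.gr n

/-- The shift of a DG bimodule. -/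
def shift (n : ℤ) (M : DGBimod F) : DGBimod F where
  toDGMod := M.toDGMod.shift n
  right := M.right
  right_act := M.right_act
  right_mem {i j s v} hv hs := by
    change M.right (op s) v ∈ M.gr (i + j + n)
    rw [add_right_comm]
    exact M.right_mem hv hs
  d_right := M.d_right

variable (F) in
/-- The regular bimodule `R`. -/
noncomputable def regular : DGBimod F where
  V := KSAlg F
  act := Algebra.lmul F (KSAlg F)
  gr := KSAlg.gr F
  isInternal := KSAlg.isInternal_gr
  act_mem hr hv := KSAlg.mul_mem_gr hr hv
  d := 0
  d_mem _ := zero_mem _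
  d_act _ _ := (map_zero _).symm
  d_d _ := rfl
  right :=
    { toFun := fun s => LinearMap.mulRight F s.unop
      map_one' := LinearMap.ext fun v => mul_one v
      map_mul' := fun s t => LinearMap.ext fun v => (mul_assoc v t.unop s.unop).symm
      map_zero' := LinearMap.ext fun v => mul_zero v
      map_add' := fun s t => LinearMap.ext fun v => mul_add v s.unop t.unop
      commutes' := fun c => LinearMap.ext fun v =>
        (Algebra.commutes c v).symm.trans (Algebra.smul_def c v).symm }
  right_act r s v := mul_assoc r v s.unop
  right_mem hv hs := KSAlg.mul_mem_gr hv hs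
  d_right _ _ := (map_zero _).symm

/-- The relations `m r ⊗ x = m ⊗ r x`. -/
def tensRel (M : DGBimod F) (X : DGMod F) : Submodule F (M.V ⊗[F] X.V) :=
  Submodule.span F {t | ∃ (m : M.V) (r : KSAlg F) (x : X.V),
    t = M.right (op r) m ⊗ₜ[F] x - m ⊗ₜ[F] X.act r x}

/-- The space `M ⊗_R X`. -/
abbrev TensSpace (M : DGBimod F) (X : DGMod F) : Type u := (M.V ⊗[F] X.V) ⧸ tensRel M X

variable {M N : DGBimod F} {X Y : DGMod F}

variable (M X) in
/-- The class of `m ⊗ x`. -/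
def cls : M.V →ₗ[F] X.V →ₗ[F] TensSpace M X :=
  (TensorProduct.mk F M.V X.V).compr₂ (tensRel M X).mkQ

theorem cls_right (m : M.V) (r : KSAlg F) (x : X.V) :
    cls M X (M.right (op r) m) x = cls M X m (X.act r x) :=
  (Submodule.Quotient.eq _).2 (Submodule.subset_span ⟨m, r, x, rfl⟩)

theorem tens_induction {p : TensSpace M X → Prop} (hc : ∀ m x, p (cls M X m x))
    (ha : ∀ s t, p s → p t → p (s + t)) (t : TensSpace M X) : p t := by
  obtain ⟨t, rfl⟩ := Submodule.mkQ_surjective _ t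
  induction t using TensorProduct.induction_on with
  | zero => simpa using hc 0 0
  | tmul m x => exact hc m x
  | add s t hs ht => rw [map_add]; exact ha _ _ hs ht

theorem tens_ext {W : Type*} [AddCommGroup W] [Module F W] {f g : TensSpace M X →ₗ[F] W}
    (h : ∀ m x, f (cls M X m x) = g (cls M X m x)) : f = g := by
  refine LinearMap.ext fun t => ?_
  induction t using tens_induction with
  | hc m x => exact h m x
  | ha s t hs ht => rw [map_add, map_add, hs, ht]

/-- The universal property of `M ⊗_R X`. -/
def tensLift {W : Type*} [AddCommGroup W] [Module F W] (φ : M.V →ₗ[F] X.V →ₗ[F] W)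
    (h : ∀ m r x, φ (M.right (op r) m) x = φ m (X.act r x)) : TensSpace M X →ₗ[F] W :=
  (tensRel M X).liftQ (TensorProduct.lift φ) (Submodule.span_le.2 (by
    rintro _ ⟨m, r, x, rfl⟩
    simp [h]))

theorem tensLift_cls {W : Type*} [AddCommGroup W] [Module F W] (φ : M.V →ₗ[F] X.V →ₗ[F] W)
    (h : ∀ m r x, φ (M.right (op r) m) x = φ m (X.act r x)) (m : M.V) (x : X.V) :
    tensLift φ h (cls M X m x) = φ m x := rfl

/-- The map `f ⊗ g`. -/
def mapT (f : M.V →ₗ[F] N.V) (g : X.V →ₗ[F] Y.V)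
    (hf : ∀ r m, f (M.right r m) = N.right r (f m)) (hg : ∀ r x, g (X.act r x) = Y.act r (g x)) :
    TensSpace M X →ₗ[F] TensSpace N Y :=
  tensLift ((cls N Y).compl₁₂ f g) fun m r x => by
    simp only [LinearMap.compl₁₂_apply, hf, hg]
    exact cls_right _ _ _

theorem mapT_cls (f : M.V →ₗ[F] N.V) (g : X.V →ₗ[F] Y.V)
    (hf : ∀ r m, f (M.right r m) = N.right r (f m)) (hg : ∀ r x, g (X.act r x) = Y.act r (g x))
    (m : M.V) (x : X.V) : mapT f g hf hg (cls M X m x) = cls N Y (f m) (g x) := rfl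

variable (M X) in
/-- The elements of degree `n` of `M ⊗_R X`, spanned by the elements `m ⊗ x` with `m` and `x`
homogeneous of degrees with sum `n`. -/
def tensGr (n : ℤ) : Submodule F (TensSpace M X) :=
  Submodule.span F {t | ∃ (i j : ℤ) (m : M.V) (x : X.V), i + j = n ∧ m ∈ M.gr i ∧ x ∈ X.gr j ∧
    t = cls M X m x}

theorem cls_mem {i j : ℤ} {m : M.V} {x : X.V} (hm : m ∈ M.gr i) (hx : x ∈ X.gr j) :
    cls M X m x ∈ tensGr M X (i + j) :=
  Submodule.subset_span ⟨i, j, m, x, rfl, hm, hx, rfl⟩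

theorem map_mem_of_cls {W : Type*} [AddCommGroup W] [Module F W] {f : TensSpace M X →ₗ[F] W}
    {S : Submodule F W} {n : ℤ}
    (h : ∀ i j m x, i + j = n → m ∈ M.gr i → x ∈ X.gr j → f (cls M X m x) ∈ S)
    {t : TensSpace M X} (ht : t ∈ tensGr M X n) : f t ∈ S := by
  have : tensGr M X n ≤ S.comap f := Submodule.span_le.2 (by
    rintro _ ⟨i, j, m, x, hn, hm, hx, rfl⟩
    exact h i j m x hn hm hx)
  exact this ht

theorem tens_homogeneous_induction {p : TensSpace M X → Prop}
    (hc : ∀ i j m x, m ∈ M.gr i → x ∈ X.gr j → p (cls M X m x))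
    (ha : ∀ s t, p s → p t → p (s + t)) (t : TensSpace M X) : p t := by
  have h0 : p 0 := by simpa using hc 0 0 0 0 (zero_mem _) (zero_mem _)
  induction t using tens_induction with
  | ha s t hs ht => exact ha s t hs ht
  | hc m x =>
  induction m using homogeneous_induction M.isInternal with
  | h0 => rwa [map_zero, LinearMap.zero_apply]
  | ha v w hv hw => rw [map_add, LinearMap.add_apply]; exact ha _ _ hv hw
  | hg i m hm =>
  induction x using homogeneous_induction X.isInternal with
  | h0 => rwa [map_zero]
  | ha v w hv hw => rw [map_add]; exact ha _ _ hv hw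
  | hg j x hx => exact hc i j m x hm hx

/-- The sum of the terms `m ⊗ x`, placed in the degree of `m ⊗ x`, over the homogeneous
components. -/
noncomputable def tensComponentsAux (M : DGBimod F) (X : DGMod F) :
    M.V →ₗ[F] X.V →ₗ[F] (ℤ →₀ TensSpace M X) :=
  LinearMap.compl₁₂ (Finsupp.lsum F fun i : ℤ => LinearMap.flip (Finsupp.lsum F fun j : ℤ =>
    ((cls M X).compr₂ (Finsupp.lsingle (i + j))).flip))
    (components M.isInternal) (components X.isInternal)

theorem tensComponentsAux_apply {i j : ℤ} {m : M.V} {x : X.V} (hm : m ∈ M.gr i)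
    (hx : x ∈ X.gr j) :
    tensComponentsAux M X m x = Finsupp.single (i + j) (cls M X m x) := by
  rw [tensComponentsAux, LinearMap.compl₁₂_apply, components_of_mem _ hm, components_of_mem _ hx]
  simp

/-- The decomposition of the elements of `M ⊗_R X` into homogeneous components. -/
noncomputable def tensComponents (M : DGBimod F) (X : DGMod F) :
    TensSpace M X →ₗ[F] (ℤ →₀ TensSpace M X) :=
  tensLift (tensComponentsAux M X) (by
    intro m r x
    induction m using homogeneous_induction M.isInternal with
    | h0 => simp
    | ha v w hv hw => simp only [map_add, LinearMap.add_apply, hv, hw]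
    | hg i m hm =>
    induction x using homogeneous_induction X.isInternal with
    | h0 => simp
    | ha v w hv hw => simp only [map_add, hv, hw]
    | hg j x hx =>
    induction r using homogeneous_induction (KSAlg.isInternal_gr (F := F)) with
    | h0 => simp
    | ha v w hv hw =>
      have e : op (v + w) = op v + op w := rfl
      simp only [e, map_add, LinearMap.add_apply, hv, hw]
    | hg k r hr =>
    rw [tensComponentsAux_apply (M.right_mem hm hr) hx,
      tensComponentsAux_apply hm (X.act_mem hr hx), cls_right, add_assoc])

theorem tensComponents_cls {i j : ℤ} {m : M.V} {x : X.V} (hm : m ∈ M.gr i)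
    (hx : x ∈ X.gr j) :
    tensComponents M X (cls M X m x) = Finsupp.single (i + j) (cls M X m x) :=
  tensComponentsAux_apply hm hx

theorem isInternal_tensGr (M : DGBimod F) (X : DGMod F) :
    DirectSum.IsInternal (tensGr M X) := by
  refine isInternal_of_components _ (tensComponents M X) (fun t n => ?_) (fun n t ht => ?_)
    fun t => ?_
  · induction t using tens_homogeneous_induction with
    | hc i j m x hm hx =>
      rw [tensComponents_cls hm hx, Finsupp.single_apply]
      split_ifs with h
      · exact h ▸ cls_mem hm hx
      · exact zero_mem _
    | ha s t hs ht => rw [map_add]; exact add_mem hs ht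
  · rw [← sub_eq_zero]
    have h := map_mem_of_cls (M := M) (X := X)
      (f := tensComponents M X - Finsupp.lsingle n) (S := ⊥) (n := n) (by
        intro i j m x hn hm hx
        rw [Submodule.mem_bot, LinearMap.sub_apply, tensComponents_cls hm hx, hn]
        exact sub_self _) ht
    exact h
  · induction t using tens_homogeneous_induction with
    | hc i j m x hm hx => rw [tensComponents_cls hm hx]; simp
    | ha s t hs ht => rw [map_add, Finsupp.sum_add_index' (by simp) (by simp), hs, ht]

/-- The left action on `M ⊗_R X`. -/
noncomputable def tensLeft (M : DGBimod F) (X : DGMod F) : KSAlg F →ₐ[F] Module.End F (TensSpace M X) where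
  toFun r := mapT (M.act r) LinearMap.id (fun s m => (M.right_act r s m).symm) fun _ _ => rfl
  map_one' := tens_ext (M := M) (X := X) fun m x => by
    rw [mapT_cls, map_one]; rfl
  map_mul' r s := tens_ext (M := M) (X := X) fun m x => by
    rw [mapT_cls, map_mul]; rfl
  map_zero' := tens_ext (M := M) (X := X) fun m x => by
    rw [mapT_cls, map_zero, LinearMap.zero_apply, map_zero]; rfl
  map_add' r s := tens_ext (M := M) (X := X) fun m x => by
    rw [mapT_cls, map_add, LinearMap.add_apply, map_add]; rfl
  commutes' c := tens_ext (M := M) (X := X) fun m x => by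
    rw [mapT_cls, AlgHom.commutes, Module.algebraMap_end_apply, Module.algebraMap_end_apply,
      map_smul]; rfl

/-- The right action on `M ⊗_R N`. -/
noncomputable def tensRight (M N : DGBimod F) :
    (KSAlg F)ᵐᵒᵖ →ₐ[F] Module.End F (TensSpace M N.toDGMod) where
  toFun s := mapT LinearMap.id (N.right s) (fun _ _ => rfl) fun r x => N.right_act r s x
  map_one' := tens_ext (M := M) (X := N.toDGMod) fun m x => by
    rw [mapT_cls, map_one]; rfl
  map_mul' r s := tens_ext (M := M) (X := N.toDGMod) fun m x => by
    rw [mapT_cls, map_mul]; rfl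
  map_zero' := tens_ext (M := M) (X := N.toDGMod) fun m x => by
    rw [mapT_cls, map_zero, LinearMap.zero_apply, map_zero]; rfl
  map_add' r s := tens_ext (M := M) (X := N.toDGMod) fun m x => by
    rw [mapT_cls, map_add, LinearMap.add_apply, map_add]; rfl
  commutes' c := tens_ext (M := M) (X := N.toDGMod) fun m x => by
    rw [mapT_cls, AlgHom.commutes, Module.algebraMap_end_apply, Module.algebraMap_end_apply,
      map_smul]; rfl

/-- The differential `d ⊗ id + id ⊗ d` on `M ⊗_R X`. -/
def tensD (M : DGBimod F) (X : DGMod F) : TensSpace M X →ₗ[F] TensSpace M X :=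
  mapT M.d LinearMap.id M.d_right (fun _ _ => rfl) +
    mapT LinearMap.id X.d (fun _ _ => rfl) X.d_act

theorem tensLeft_cls (r : KSAlg F) (m : M.V) (x : X.V) :
    tensLeft M X r (cls M X m x) = cls M X (M.act r m) x := rfl

theorem tensRight_cls (s : (KSAlg F)ᵐᵒᵖ) (m : M.V) (x : N.V) :
    tensRight M N s (cls M N.toDGMod m x) = cls M N.toDGMod m (N.right s x) := rfl

theorem tensD_cls (m : M.V) (x : X.V) :
    tensD M X (cls M X m x) = cls M X (M.d m) x + cls M X m (X.d x) := rfl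

theorem act_of_mem_homSpace {f : X.V →ₗ[F] Y.V} (hf : f ∈ DGMod.HomSpace X Y) (r : KSAlg F)
    (x : X.V) : f (X.act r x) = Y.act r (f x) :=
  DGMod.homSpace_induction (p := fun f => f (X.act r x) = Y.act r (f x)) hf
    (fun _ _ hf => hf.1 r x) (by simp) fun f g hf hg => by
      rw [LinearMap.add_apply, LinearMap.add_apply, map_add, hf, hg]

variable [CharP F 2]

/-- The DG module `M ⊗_R X`. -/
noncomputable def tens (M : DGBimod F) (X : DGMod F) : DGMod F where
  V := TensSpace M X
  act := tensLeft M X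
  gr := tensGr M X
  isInternal := isInternal_tensGr M X
  act_mem {k n r t} hr ht := by
    refine map_mem_of_cls (f := tensLeft M X r) (fun i j m x hn hm hx => ?_) ht
    have h := cls_mem (X := X) (M.act_mem hr hm) hx
    rw [add_assoc, hn] at h
    exact h
  d := tensD M X
  d_mem {n t} ht := by
    refine map_mem_of_cls (f := tensD M X) (fun i j m x hn hm hx => ?_) ht
    have h := cls_mem (X := X) (M.d_mem hm) hx
    have h' := cls_mem (M := M) hm (X.d_mem hx)
    rw [← add_assoc, hn] at h'
    rw [add_right_comm, hn] at h
    exact add_mem h h'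
  d_act r t := by
    induction t using tens_induction with
    | hc m x =>
      rw [tensLeft_cls, tensD_cls, tensD_cls, map_add, tensLeft_cls, tensLeft_cls, M.d_act]
    | ha s t hs ht => rw [map_add, map_add, map_add, map_add, hs, ht]
  d_d t := by
    induction t using tens_induction with
    | hc m x =>
      rw [tensD_cls, map_add, tensD_cls, tensD_cls, M.d_d, X.d_d, map_zero,
        LinearMap.zero_apply, zero_add, map_zero, add_zero]
      exact TwI.add_self (F := F) _
    | ha s t hs ht => rw [map_add, map_add, hs, ht, add_zero]

/-- The tensor product over `R` of DG bimodules. -/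
noncomputable def tensBimod (M N : DGBimod F) : DGBimod F where
  toDGMod := tens M N.toDGMod
  right := tensRight M N
  right_act r s t := by
    change tensRight M N s (tensLeft M N.toDGMod r t) = tensLeft M N.toDGMod r (tensRight M N s t)
    induction t using tens_induction with
    | hc m x => rw [tensLeft_cls, tensRight_cls, tensRight_cls, tensLeft_cls]
    | ha t t' h h' => rw [map_add, map_add, map_add, map_add, h, h']
  right_mem {n k s t} ht hs := by
    refine map_mem_of_cls (f := tensRight M N (op s)) (fun i j m x hn hm hx => ?_) ht
    have h := cls_mem (M := M) (X := N.toDGMod) hm (N.right_mem hx hs)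
    rw [← add_assoc, hn] at h
    exact h
  d_right s t := by
    change tensD M N.toDGMod (tensRight M N s t) = tensRight M N s (tensD M N.toDGMod t)
    induction t using tens_induction with
    | hc m x =>
      rw [tensRight_cls, tensD_cls, tensD_cls, map_add, tensRight_cls, tensRight_cls, N.d_right]
    | ha t t' h h' => rw [map_add, map_add, map_add, map_add, h, h']

theorem mapT_mem_homSpace (M : DGBimod F) {f : X.V →ₗ[F] Y.V} (hf : f ∈ DGMod.HomSpace X Y) :
    (mapT LinearMap.id f (fun _ _ => rfl) (act_of_mem_homSpace hf) :
      TensSpace M X →ₗ[F] TensSpace M Y) ∈ DGMod.HomSpace (tens M X) (tens M Y) := by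
  suffices h : ∃ hg, (mapT LinearMap.id f (fun _ _ => rfl) hg :
      TensSpace M X →ₗ[F] TensSpace M Y) ∈ DGMod.HomSpace (tens M X) (tens M Y) from h.2
  refine DGMod.homSpace_induction (p := fun f => ∃ hg, (mapT LinearMap.id f (fun _ _ => rfl) hg :
      TensSpace M X →ₗ[F] TensSpace M Y) ∈ DGMod.HomSpace (tens M X) (tens M Y)) hf ?_ ?_ ?_
  · intro n f hf
    have hl := hf.1
    refine ⟨hl, DGMod.mem_homSpace (n := n) ⟨fun r t => ?_, fun k t ht => ?_⟩⟩
    · change mapT LinearMap.id f _ hl (tensLeft M X r t) =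
        tensLeft M Y r (mapT LinearMap.id f _ hl t)
      induction t using tens_induction with
      | hc m x => rfl
      | ha s t hs ht => rw [map_add, map_add, map_add, map_add, hs, ht]
    · refine map_mem_of_cls (f := mapT LinearMap.id f (fun _ _ => rfl) hl)
        (fun i j m x hn hm hx => ?_) ht
      have h := cls_mem (M := M) hm (hf.2 j x hx)
      have e : i + (n + j) = n + k := by rw [← hn]; ring
      rw [e] at h
      exact h
  · refine ⟨by simp, ?_⟩
    have e : (mapT LinearMap.id (0 : X.V →ₗ[F] Y.V) (fun _ _ => rfl) (by simp) :
        TensSpace M X →ₗ[F] TensSpace M Y) = 0 :=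
      tens_ext fun m x => map_zero (cls M Y m)
    rw [e]
    exact zero_mem (DGMod.HomSpace (tens M X) (tens M Y))
  · rintro f g ⟨hf, hf'⟩ ⟨hg, hg'⟩
    refine ⟨fun r x => by simp [hf, hg], ?_⟩
    have e : (mapT LinearMap.id (f + g) (fun _ _ => rfl) (fun r x => by simp [hf, hg]) :
        TensSpace M X →ₗ[F] TensSpace M Y) = mapT LinearMap.id f (fun _ _ => rfl) hf +
          mapT LinearMap.id g (fun _ _ => rfl) hg :=
      tens_ext fun m x => map_add (cls M Y m) (f x) (g x)
    rw [e]
    exact add_mem hf' hg'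

/-- The homomorphism `id ⊗ f : M ⊗_R X ⟶ M ⊗_R Y`. -/
noncomputable def tensMap (M : DGBimod F) {X Y : DGMod F} (f : X ⟶ Y) : tens M X ⟶ tens M Y :=
  DGMod.ofLin _ (mapT_mem_homSpace M f.2)

end DGBimod

end Bimodules

section TheBimodule

open MulOpposite KSAlg

variable {F : Type u} [Field F]

namespace KSAlg

/-- Right multiplication `R e(z) → R e(z')` by an element `s` with `s e(z') = s`. -/
noncomputable def idealMul {z z' : KSVertex} (s : KSAlg F) (h : s * gen F z'.e = s) :
    leftIdeal F z →ₗ[F] leftIdeal F z' :=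
  ((LinearMap.mulRight F s).comp (leftIdeal F z).subtype).codRestrict (leftIdeal F z') fun r => by
    change r.1 * s ∈ leftIdeal F z'
    rw [← h, ← mul_assoc]
    exact mul_e_mem z' _

/-- The underlying vector space of the bimodule `M = P(y) ⊕ P(x)[1]`. -/
abbrev BimodSpace (F : Type u) [Field F] : Type u :=
  leftIdeal F KSVertex.y × leftIdeal F KSVertex.x

/-- The right action of the generators on `M`. The generators `m` of `P(y)` and `m'` of `P(x)[1]`
satisfy `m e(x) = m`, `m' e(y) = m'`, `m a = b m'` and `m' b = a m`. -/
noncomputable def rightGen : KSGen → Module.End F (BimodSpace F)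
  | KSGen.ex => (LinearMap.inl F _ _).comp (LinearMap.fst F _ _)
  | KSGen.ey => (LinearMap.inr F _ _).comp (LinearMap.snd F _ _)
  | KSGen.a => (LinearMap.inr F _ _).comp
      ((idealMul (gen F KSGen.b) gen_b_ex).comp (LinearMap.fst F _ _))
  | KSGen.b => (LinearMap.inl F _ _).comp
      ((idealMul (gen F KSGen.a) gen_a_ey).comp (LinearMap.snd F _ _))

variable (F) in
/-- The right action of `R` on `M`. -/
noncomputable def rightAction : (KSAlg F)ᵐᵒᵖ →ₐ[F] Module.End F (BimodSpace F) :=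
  AlgHom.opComm (KSAlg.lift (fun g => op (rightGen g)) (by
    intro x y h
    cases h <;> simp only [map_mul, map_add, map_one, map_zero, FreeAlgebra.lift_ι_apply]
    · rfl
    · rfl
    · rfl
    · rfl
    · exact congrArg op (LinearMap.ext fun v => Prod.ext (add_zero v.1) (zero_add v.2))
    · rfl
    · rfl
    · rfl
    · rfl
    · refine congrArg op (LinearMap.ext fun v => Prod.ext rfl (Subtype.ext ?_))
      change v.1.1 * gen F KSGen.b * gen F KSGen.a * gen F KSGen.b = 0
      rw [mul_assoc, mul_assoc, ← mul_assoc (gen F KSGen.b), gen_b_a_b, mul_zero]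
    · refine congrArg op (LinearMap.ext fun v => Prod.ext (Subtype.ext ?_) rfl)
      change v.2.1 * gen F KSGen.a * gen F KSGen.b * gen F KSGen.a = 0
      rw [mul_assoc, mul_assoc, ← mul_assoc (gen F KSGen.a), gen_a_b_a, mul_zero]))

theorem rightAction_gen (g : KSGen) : rightAction F (op (gen F g)) = rightGen g := by
  change unop (KSAlg.lift _ _ (gen F g)) = _
  rw [KSAlg.lift_gen]
  rfl

theorem rightAction_mul (r s : KSAlg F) (v : BimodSpace F) :
    rightAction F (op (r * s)) v = rightAction F (op s) (rightAction F (op r) v) := by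
  rw [MulOpposite.op_mul, map_mul]
  rfl

/-- The elements of degree `n` of `M = P(y) ⊕ P(x)[1]`. -/
noncomputable def bimodGr (n : ℤ) : Submodule F (BimodSpace F) :=
  (idealGr F KSVertex.y n).prod (idealGr F KSVertex.x (n + 1))

theorem rightGen_mem {n : ℤ} {v : BimodSpace F} (hv : v ∈ bimodGr n) (g : KSGen) :
    rightGen g v ∈ bimodGr (n + g.deg) := by
  cases g with
  | ex =>
    refine ⟨?_, zero_mem _⟩
    change v.1 ∈ idealGr F KSVertex.y (n + 0)
    rw [add_zero]
    exact hv.1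
  | ey =>
    refine ⟨zero_mem _, ?_⟩
    change v.2 ∈ idealGr F KSVertex.x (n + 0 + 1)
    rw [add_zero]
    exact hv.2
  | a =>
    refine ⟨zero_mem _, ?_⟩
    have h := mul_mem_gr (r := v.1.1) hv.1 (gen_mem_gr (F := F) KSGen.b)
    change v.1.1 * gen F KSGen.b ∈ gr F (n + 0 + 1)
    rw [add_zero]
    exact h
  | b =>
    refine ⟨?_, zero_mem _⟩
    have h := mul_mem_gr (r := v.2.1) hv.2 (gen_mem_gr (F := F) KSGen.a)
    change v.2.1 * gen F KSGen.a ∈ gr F (n + 1)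
    rw [← add_zero (n + 1)]
    exact h

theorem rightAction_prod_mem (l : List KSGen) : ∀ {n : ℤ} {v : BimodSpace F}, v ∈ bimodGr n →
    rightAction F (op (l.map (gen F)).prod) v ∈ bimodGr (n + (l.map KSGen.deg).sum) := by
  induction l with
  | nil => intro n v hv; simpa using hv
  | cons g l ih =>
    intro n v hv
    rw [List.map_cons, List.map_cons, List.prod_cons, List.sum_cons, rightAction_mul,
      rightAction_gen, ← add_assoc]
    exact ih (rightGen_mem hv g)

/-- The left action of `R` on `M`. -/
noncomputable def leftAction (F : Type u) [Field F] :
    KSAlg F →ₐ[F] Module.End F (BimodSpace F) where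
  toFun r := (idealAct F KSVertex.y r).prodMap (idealAct F KSVertex.x r)
  map_one' := by rw [map_one, map_one]; rfl
  map_mul' r s := by rw [map_mul, map_mul]; rfl
  map_zero' := by rw [map_zero, map_zero]; rfl
  map_add' r s := by rw [map_add, map_add]; rfl
  commutes' c := by rw [AlgHom.commutes, AlgHom.commutes]; rfl

theorem rightGen_leftAction (r : KSAlg F) (g : KSGen) (v : BimodSpace F) :
    rightGen g (leftAction F r v) = leftAction F r (rightGen g v) := by
  cases g with
  | ex => exact congrArg (Prod.mk _) (map_zero (idealAct F KSVertex.x r)).symm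
  | ey => exact congrArg (fun t => (t, _)) (map_zero (idealAct F KSVertex.y r)).symm
  | a =>
    exact congrArg₂ Prod.mk (map_zero (idealAct F KSVertex.y r)).symm (Subtype.ext (mul_assoc r v.1.1 (gen F KSGen.b)))
  | b =>
    exact congrArg₂ Prod.mk (Subtype.ext (mul_assoc r v.2.1 (gen F KSGen.a)))
      (map_zero (idealAct F KSVertex.x r)).symm

theorem rightAction_leftAction (r : KSAlg F) (s : (KSAlg F)ᵐᵒᵖ) (v : BimodSpace F) :
    rightAction F s (leftAction F r v) = leftAction F r (rightAction F s v) := by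
  obtain ⟨s, rfl⟩ := op_surjective s
  induction s using KSAlg.induction with
  | hw l =>
    induction l generalizing v with
    | nil => simp
    | cons g l ih =>
      rw [List.map_cons, List.prod_cons, rightAction_mul, rightAction_mul, rightAction_gen,
        rightGen_leftAction, ih]
  | ha s t hs ht =>
    have e : op (s + t) = op s + op t := rfl
    rw [e, map_add, LinearMap.add_apply, LinearMap.add_apply, map_add, hs, ht]
  | hs c s hs =>
    have e : op (c • s) = c • op s := rfl
    rw [e, map_smul, LinearMap.smul_apply, LinearMap.smul_apply, map_smul, hs]

end KSAlg

variable (F) in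
/-- The DG bimodule `M`: as a left DG module it is `P(y) ⊕ P(x)[1]`. -/
noncomputable def DGBimod.M : DGBimod F where
  V := BimodSpace F
  act := leftAction F
  gr := bimodGr
  isInternal := isInternal_prod (isInternal_idealGr KSVertex.y)
    (isInternal_reindex (isInternal_idealGr KSVertex.x) 1)
  act_mem {i j r v} hr hv := by
    refine ⟨mul_mem_gr (s := v.1.1) hr hv.1, ?_⟩
    have h := mul_mem_gr (s := v.2.1) hr hv.2
    rw [← add_assoc] at h
    exact h
  d := 0
  d_mem _ := zero_mem _
  d_act _ _ := (map_zero _).symm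
  d_d _ := rfl
  right := rightAction F
  right_act r s v := rightAction_leftAction r s v
  right_mem {i j s v} hv hs := by
    induction hs using Submodule.span_induction with
    | zero => rw [MulOpposite.op_zero, map_zero]; exact zero_mem _
    | add x y _ _ hx hy => rw [MulOpposite.op_add, map_add]; exact add_mem hx hy
    | smul c x _ hx => rw [MulOpposite.op_smul, map_smul]; exact Submodule.smul_mem _ _ hx
    | mem x hx =>
    obtain ⟨l, rfl, rfl⟩ := hx
    exact rightAction_prod_mem l hv
  d_right _ _ := (map_zero _).symm

end TheBimodule

section Actions

open DGCategory MonoidalCategory MonoidalLeftAction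

/-- A DG module `P` is projective if the complex of homomorphisms from `P` to any acyclic DG
module is acyclic. -/
def DGMod.IsProjective {F : Type u} [Field F] (P : DGMod F) : Prop :=
  ∀ N : DGMod F, (∀ v, N.d v = 0 → ∃ w, N.d w = v) →
    ∀ f : P ⟶ N, DGMod.homD P N f = 0 → ∃ h : P ⟶ N, DGMod.homD P N h = f

/-- An action of a monoidal DG category `C` on a DG category `D`: the bifunctor `C × D ⥤ D` is a
bilinear functor of DG categories, and the structural isomorphisms are closed of degree zero. -/
structure IsDGAction (F : Type u) [Field F] [CharP F 2] (C D : Type*) [Category* C]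
    [Preadditive C] [Linear F C] [DGCategory F C] [MonoidalCategory C] [Category* D]
    [Preadditive D] [Linear F D] [DGCategory F D] [MonoidalLeftAction C D] : Prop where
  add_left {A B : C} (f f' : A ⟶ B) (X : D) : (f + f') ⊵ₗ X = f ⊵ₗ X + f' ⊵ₗ X
  smul_left {A B : C} (a : F) (f : A ⟶ B) (X : D) : (a • f) ⊵ₗ X = a • (f ⊵ₗ X)
  add_right (A : C) {X Y : D} (g g' : X ⟶ Y) : A ⊴ₗ (g + g') = A ⊴ₗ g + A ⊴ₗ g'
  smul_right (A : C) {X Y : D} (a : F) (g : X ⟶ Y) : A ⊴ₗ (a • g) = a • (A ⊴ₗ g)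
  left_mem {A B : C} {n : ℤ} {f : A ⟶ B} (X : D) : f ∈ gr (F := F) A B n →
    f ⊵ₗ X ∈ gr (F := F) (A ⊙ₗ X) (B ⊙ₗ X) n
  right_mem (A : C) {X Y : D} {n : ℤ} {g : X ⟶ Y} : g ∈ gr (F := F) X Y n →
    A ⊴ₗ g ∈ gr (F := F) (A ⊙ₗ X) (A ⊙ₗ Y) n
  d_left {A B : C} (f : A ⟶ B) (X : D) :
    d (F := F) (A ⊙ₗ X) (B ⊙ₗ X) (f ⊵ₗ X) = d (F := F) A B f ⊵ₗ X
  d_right (A : C) {X Y : D} (g : X ⟶ Y) :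
    d (F := F) (A ⊙ₗ X) (A ⊙ₗ Y) (A ⊴ₗ g) = A ⊴ₗ d (F := F) X Y g
  assoc_hom_mem (A B : C) (X : D) :
    (actionAssocIso A B X).hom ∈ cycles F ((A ⊗ B) ⊙ₗ X) (A ⊙ₗ (B ⊙ₗ X))
  assoc_inv_mem (A B : C) (X : D) :
    (actionAssocIso A B X).inv ∈ cycles F (A ⊙ₗ (B ⊙ₗ X)) ((A ⊗ B) ⊙ₗ X)
  unit_hom_mem (X : D) : (actionUnitIso (C := C) X).hom ∈ cycles F ((𝟙_ C) ⊙ₗ X) X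
  unit_inv_mem (X : D) : (actionUnitIso (C := C) X).inv ∈ cycles F X ((𝟙_ C) ⊙ₗ X)

variable {F : Type u} [Field F] [CharP F 2]

/-- The object `A` acts on the DG category generated by `P(x)` and `P(y)` by tensoring with the
bimodule `M`: there are closed isomorphisms `A ⊙ X ≅ M ⊗_R X` of degree zero, natural for the
morphisms of the DG category. -/
def ActsByTensor [MonoidalLeftAction (TwI F) (DGP F)] (A : TwI F) (M : DGBimod F) : Prop :=
  ∃ e : ∀ X : DGP F, (A ⊙ₗ X : DGP F).obj ≅ DGBimod.tens M X.obj,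
    (∀ X : DGP F, (e X).hom ∈ cycles F (A ⊙ₗ X : DGP F).obj (DGBimod.tens M X.obj) ∧
      (e X).inv ∈ cycles F (DGBimod.tens M X.obj) (A ⊙ₗ X : DGP F).obj) ∧
    ∀ (X Y : DGP F) (f : X ⟶ Y),
      DGP.toMod (A ⊴ₗ f) ≫ (e Y).hom = (e X).hom ≫ DGBimod.tensMap M (DGP.toMod f)

/-- The action of the Gaussian integers on `ℤ x ⊕ ℤ y` with `i x = y` and `i y = - x`. -/
def gaussAct (z : GaussianInt) (v : ℤ × ℤ) : ℤ × ℤ :=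
  (z.re * v.1 - z.im * v.2, z.im * v.1 + z.re * v.2)

end Actions

open MonoidalCategory MonoidalLeftAction

/-! ### The zeroth cohomology category of a DG category with cones is triangulated. -/

section TriangulatedStructure

open DGCategory DGShift Limits Pretriangulated

variable {F : Type u} [Field F] [CharP F 2] {C : Type w} [Category.{v} C]
    [Preadditive C] [Linear F C] [DGCategory F C]

namespace DGCategory

/-! The central observation is that the bimodule M is a twisted copy of R. The algebra R has an
automorphism `swap` exchanging x with y and a with b, and sending the sum u of the two generators of
M to 1 identifies M with R in such a way that u r = swap(r) u (`bimodEquiv_rightAction`). Hence M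
⊗_R X is X with R acting through `swap` (`twistEquiv`). The automorphism does not respect degrees,
since a and b have degrees 0 and 1; the defect is absorbed by shifting the components at x and at y
by different amounts, `KSVertex.offset`. Two twists give back the original action and shift both
components by one, whence M ⊗_R M ≅ R[1].

This gives a strict model of the action. A twisted complex A with summands Q^(k i)[m i] sends X to
the space of families `A.ι → X.V`, whose i-th term carries the (k i)-fold twisted action and
grading. Cups and caps act as the identity of the underlying space, and a half strand acts by a + b,
which intertwines the identity with `swap` and is fixed by `swap`. A diagram therefore acts by the
power of a + b that counts its half strands, and the local relations hold because they preserve this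
count. Associativity of the action is currying, and the coherence conditions are computations with
permutation matrices.

Triangulatedness is a general fact, `h0IsTriangulated`: it holds for a DG category with shifts, a
zero object and mapping cones. A cone is characterised by identities between morphisms (`ConeData`),
so each axiom reduces to writing down maps between cones and a homotopy; characteristic two removes
all signs. For the same reason DG functors preserve cones, and a DG action descends to Grothendieck
groups.

The group K_0 of DGP(R) is generated by [P(x)] and [P(y)] because every object is built from them.
The two classes are independent because the Euler characteristic of e(z)X is additive on cones and
vanishes on contractible modules: e(y)Re(x) is spanned by b in degree 1, e(x)Re(y) by a in degree 0,
while in e(x)Re(x) and e(y)Re(y) the idempotent cancels against ab and ba.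

For K_0 of the twisted complexes, one-sidedness makes every object an iterated cone of shifts of the
objects Q^n (`TwI.induction`), and cup and cap give Q^(n+2) ≅ Q^n[1]; so [Q^0] and [Q] generate.
Independence needs no knowledge of the morphism spaces: Q sends P(x) to P(y) and P(y) to P(x)[1], so
p + q i sends [P(x)] to p x + q y, and this orbit map is injective. Since the action respects tensor
products, the same orbit map shows that the tensor product corresponds to multiplication of Gaussian
integers. -/

theorem mem_gr_of_eq {X Y : C} {m n : ℤ} {f : X ⟶ Y} (h : f ∈ gr (F := F) X Y m) (e : m = n) :
    f ∈ gr (F := F) X Y n := e ▸ h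

theorem eq_of_add_eq_zero (F : Type u) [Field F] [CharP F 2] {V : Type*} [AddCommGroup V]
    [Module F V] {f g : V} (h : f + g = 0) : f = g := by
  rw [← add_zero f, ← TwI.add_self (F := F) g, ← add_assoc, h, zero_add]

/-- The usual way in which the matrix identities below are closed: once everything is on one side,
`abel_nf` collects repeated terms into multiples by 2, and these vanish. -/
theorem two_zsmul_hom (F : Type u) [Field F] [CharP F 2] {C : Type w} [Category.{v} C]
    [Preadditive C] [Linear F C] {X Y : C} (f : X ⟶ Y) : (2 : ℤ) • f = 0 := by
  rw [two_zsmul]; exact TwI.add_self (F := F) f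

theorem neg_eq_self (F : Type u) [Field F] [CharP F 2] {V : Type*} [AddCommGroup V]
    [Module F V] (f : V) : -f = f :=
  neg_eq_of_add_eq_zero_left (TwI.add_self (F := F) f)

variable (F) in
/-- The matrix identities of a mapping cone with chosen splitting. -/
structure ConeData {X Y Z : C} (f : X ⟶ Y) (i : Y ⟶ Z) (p : Z ⟶ X) (s : X ⟶ Z) (q : Z ⟶ Y) :
    Prop where
  f_mem : f ∈ gr (F := F) X Y 0
  i_mem : i ∈ gr (F := F) Y Z 0
  p_mem : p ∈ gr (F := F) Z X 1
  s_mem : s ∈ gr (F := F) X Z (-1)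
  q_mem : q ∈ gr (F := F) Z Y 0
  d_f : d (F := F) X Y f = 0
  d_i : d (F := F) Y Z i = 0
  d_p : d (F := F) Z X p = 0
  d_s : d (F := F) X Z s = f ≫ i
  d_q : d (F := F) Z Y q = p ≫ f
  iq : i ≫ q = 𝟙 Y
  sp : s ≫ p = 𝟙 X
  ip : i ≫ p = 0
  sq : s ≫ q = 0
  total : q ≫ i + p ≫ s = 𝟙 Z

namespace ConeData

variable {X Y Z : C} {f : X ⟶ Y} {i : Y ⟶ Z} {p : Z ⟶ X} {s : X ⟶ Z} {q : Z ⟶ Y}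

theorem iq_assoc (h : ConeData F f i p s q) {W : C} (g : Y ⟶ W) : i ≫ q ≫ g = g := by
  rw [← Category.assoc, h.iq, Category.id_comp]

theorem sp_assoc (h : ConeData F f i p s q) {W : C} (g : X ⟶ W) : s ≫ p ≫ g = g := by
  rw [← Category.assoc, h.sp, Category.id_comp]

theorem ip_assoc (h : ConeData F f i p s q) {W : C} (g : X ⟶ W) : i ≫ p ≫ g = 0 := by
  rw [← Category.assoc, h.ip, zero_comp]

theorem sq_assoc (h : ConeData F f i p s q) {W : C} (g : Y ⟶ W) : s ≫ q ≫ g = 0 := by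
  rw [← Category.assoc, h.sq, zero_comp]

/-- The completeness relation solved for `p ≫ s`, so that it can serve as a rewriting rule bringing
composites of the structural morphisms to a normal form. -/
theorem ps (h : ConeData F f i p s q) : p ≫ s = 𝟙 Z + q ≫ i :=
  eq_of_add_eq_zero F (by
    rw [← h.total]
    abel_nf
    simp only [two_zsmul_hom F, add_zero])

theorem ps_assoc (h : ConeData F f i p s q) {W : C} (g : Z ⟶ W) : p ≫ s ≫ g = g + q ≫ i ≫ g := by
  rw [← Category.assoc, h.ps, Preadditive.add_comp, Category.id_comp, Category.assoc]

theorem isMappingCone (h : ConeData F f i p s q) : IsMappingCone F f i p :=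
  ⟨⟨h.f_mem, h.d_f⟩, ⟨h.i_mem, h.d_i⟩, h.p_mem, h.d_p, s, q, h.s_mem, h.q_mem, h.iq, h.sp, h.ip,
    h.sq, h.total, h.d_s, h.d_q⟩

end ConeData

theorem _root_.IsMappingCone.exists_coneData {X Y Z : C} {f : X ⟶ Y} {i : Y ⟶ Z} {p : Z ⟶ X}
    (h : IsMappingCone F f i p) : ∃ s q, ConeData F f i p s q := by
  obtain ⟨s, q, h1, h2, h3, h4, h5, h6, h7, h8, h9⟩ := h.exists_splitting
  exact ⟨s, q, h.f_mem.1, h.i_mem.1, h.p_mem, h1, h2, h.f_mem.2, h.i_mem.2, h.d_p, h8, h9, h3, h4,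
    h5, h6, h7⟩

end DGCategory

namespace H0

/-- The class of a closed morphism of degree zero, as a morphism of the zeroth cohomology
category. -/
def cl {X Y : C} (f : X ⟶ Y) (hf : f ∈ cycles F X Y) : (⟨X⟩ : H0 F C) ⟶ ⟨Y⟩ := mk f hf

theorem exists_cl {X Y : H0 F C} (f : X ⟶ Y) :
    ∃ (g : X.obj ⟶ Y.obj) (hg : g ∈ cycles F X.obj Y.obj), f = cl g hg := by
  induction f using ind with | h f hf
  exact ⟨f, hf, rfl⟩

/-- A difference is a sum in characteristic two, so a homotopy can be stated without signs. -/
theorem cl_eq_cl {X Y : C} {f g : X ⟶ Y} {hf : f ∈ cycles F X Y} {hg : g ∈ cycles F X Y} :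
    cl f hf = cl g hg ↔ ∃ h ∈ gr (F := F) X Y (-1), d (F := F) X Y h = f + g := by
  have e : f - g = f + g := by rw [sub_eq_add_neg, neg_eq_self F]
  exact (mk_eq_mk (hf := hf) (hg := hg)).trans (by rw [e]; rfl)

theorem neg_cl {X Y : H0 F C} (f : X ⟶ Y) : -f = f := by
  obtain ⟨g, hg, rfl⟩ := exists_cl f
  refine neg_eq_of_add_eq_zero_left ?_
  change cl (g + g) (add_mem hg hg) = cl 0 (zero_mem _)
  congr 1
  exact TwI.add_self (F := F) g

theorem isZero_of_homotopy {X : C} (h : X ⟶ X) (hh : h ∈ gr (F := F) X X (-1))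
    (e : d (F := F) X X h = 𝟙 X) : IsZero (⟨X⟩ : H0 F C) := by
  rw [IsZero.iff_id_eq_zero]
  exact cl_eq_cl.2 ⟨h, hh, by rw [e, add_zero]⟩

theorem isZero_of_id_eq_zero {X : C} (h : 𝟙 X = 0) : IsZero (⟨X⟩ : H0 F C) :=
  isZero_of_homotopy 0 (zero_mem _) (by rw [map_zero, h])

theorem exists_homotopy_of_isZero {X : C} (h : IsZero (⟨X⟩ : H0 F C)) :
    ∃ h ∈ gr (F := F) X X (-1), d (F := F) X X h = 𝟙 X := by
  rw [IsZero.iff_id_eq_zero] at h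
  obtain ⟨k, hk, e⟩ := (cl_eq_cl (hf := id_mem_cycles F X) (hg := zero_mem _)).1 h
  exact ⟨k, hk, by rw [e, add_zero]⟩

/-- Mutually inverse homotopy equivalences give an isomorphism. -/
def isoOfHomotopy {X Y : C} {f : X ⟶ Y} {g : Y ⟶ X} (hf : f ∈ cycles F X Y)
    (hg : g ∈ cycles F Y X) (hfg : ∃ h ∈ gr (F := F) X X (-1), d (F := F) X X h = f ≫ g + 𝟙 X)
    (hgf : ∃ h ∈ gr (F := F) Y Y (-1), d (F := F) Y Y h = g ≫ f + 𝟙 Y) :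
    (⟨X⟩ : H0 F C) ≅ ⟨Y⟩ where
  hom := cl f hf
  inv := cl g hg
  hom_inv_id := cl_eq_cl.2 hfg
  inv_hom_id := cl_eq_cl.2 hgf

/-- A closed isomorphism of degree zero gives an isomorphism. -/
def isoOfIso {X Y : C} (e : X ≅ Y) (h : e.hom ∈ cycles F X Y) (h' : e.inv ∈ cycles F Y X) :
    (⟨X⟩ : H0 F C) ≅ ⟨Y⟩ :=
  isoOfHomotopy h h' ⟨0, zero_mem _, by rw [e.hom_inv_id, map_zero]; exact (TwI.add_self (F := F)
      (𝟙 X)).symm⟩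
    ⟨0, zero_mem _, by rw [e.inv_hom_id, map_zero]; exact (TwI.add_self (F := F) (𝟙 Y)).symm⟩

end H0

variable [DGShift F C]

theorem coneTriangles_of_iso {T T' : Triangle (H0 F C)} (h : T ∈ coneTriangles F C) (e : T' ≅ T) :
    T' ∈ coneTriangles F C := by
  obtain ⟨X, Y, Z, f, i, p, hc, ⟨e'⟩⟩ := h
  exact ⟨X, Y, Z, f, i, p, hc, ⟨e ≪≫ e'⟩⟩

theorem IsMappingCone.triangle_mem {X Y Z : C} {f : X ⟶ Y} {i : Y ⟶ Z} {p : Z ⟶ X}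
    (h : IsMappingCone F f i p) : h.triangle ∈ coneTriangles F C :=
  ⟨X, Y, Z, f, i, p, h, ⟨Iso.refl _⟩⟩

variable (F C) in
/-- Every closed morphism of degree zero has a mapping cone. -/
def HasMappingCones : Prop :=
  ∀ ⦃X Y : C⦄ (f : X ⟶ Y), f ∈ cycles F X Y → ∃ (Z : C) (i : Y ⟶ Z) (p : Z ⟶ X),
    IsMappingCone F f i p

theorem up_mem_cycles {X Y : C} {p : X ⟶ Y} {n : ℤ} (h : p ∈ gr (F := F) X Y n)
    (hd : d (F := F) X Y p = 0) : p ≫ up (F := F) n Y ∈ cycles F X (sh (F := F) n Y) :=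
  mem_cycles_of_degree (comp_mem h (up_mem n Y)) (by omega) (by simp [leibniz, hd])

/-- The cone of an identity is contracted by `q ≫ s`: the two terms of the differential of this
morphism are `p ≫ s` and `q ≫ i`, whose sum is the identity. -/
theorem contractible_mem [HasZeroObject (H0 F C)] (hC : HasMappingCones F C) (X : H0 F C) :
    contractibleTriangle X ∈ coneTriangles F C := by
  obtain ⟨X⟩ := X
  obtain ⟨Z, i, p, h⟩ := hC (𝟙 X) (id_mem_cycles F X)
  obtain ⟨s, q, hs⟩ := h.exists_coneData
  have hZ : IsZero (⟨Z⟩ : H0 F C) := H0.isZero_of_homotopy (q ≫ s)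
    (mem_gr_of_eq (comp_mem hs.q_mem hs.s_mem) (by omega)) (by
      rw [leibniz, hs.d_q, hs.d_s, Category.comp_id, Category.id_comp, add_comm, hs.total])
  exact ⟨X, X, Z, _, i, p, h, ⟨Triangle.isoMk _ _ (Iso.refl _) (Iso.refl _) hZ.isoZero.symm
    (by rfl) (hZ.eq_of_tgt _ _) ((isZero_zero _).eq_of_src _ _)⟩⟩

theorem exists_cone_triangle (hC : HasMappingCones F C) {X Y : H0 F C} (f : X ⟶ Y) :
    ∃ (Z : H0 F C) (g : Y ⟶ Z) (h : Z ⟶ X⟦(1 : ℤ)⟧), Triangle.mk f g h ∈ coneTriangles F C := by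
  obtain ⟨f, hf, rfl⟩ := H0.exists_cl f
  obtain ⟨Z, i, p, h⟩ := hC f hf
  exact ⟨⟨Z⟩, _, _, h.triangle_mem⟩

/-- The recognition criterion for distinguished triangles used in the rotation and octahedron
arguments: the third object need only be homotopy equivalent to the cone. Strict compatibility is
required of ψ with the incoming map and of φ with the outgoing one; the square for φ and the
incoming map follows because φ and ψ are inverse to each other in cohomology. -/
theorem mk_mem_coneTriangles {X Y Z W : C} {f : X ⟶ Y} {i : Y ⟶ W} {p : W ⟶ X}
    (hc : IsMappingCone F f i p) {g : Y ⟶ Z} (hg : g ∈ cycles F Y Z) {h : Z ⟶ sh (F := F) 1 X}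
    (hh : h ∈ cycles F Z (sh (F := F) 1 X)) {φ : Z ⟶ W} {ψ : W ⟶ Z}
    (hφ : φ ∈ cycles F Z W) (hψ : ψ ∈ cycles F W Z) (hg' : i ≫ ψ = g) (hh' : φ ≫ p ≫ up (F :=
        F) 1 X = h)
    (hφψ : ∃ k ∈ gr (F := F) Z Z (-1), d (F := F) Z Z k = φ ≫ ψ + 𝟙 Z)
    (hψφ : ∃ k ∈ gr (F := F) W W (-1), d (F := F) W W k = ψ ≫ φ + 𝟙 W) :
    Triangle.mk (X := (⟨X⟩ : H0 F C)) (Y := ⟨Y⟩) (Z := ⟨Z⟩) (H0.cl f hc.f_mem) (H0.cl g hg)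
      (H0.cl h hh) ∈ coneTriangles F C := by
  subst hg' hh'
  let e : (⟨Z⟩ : H0 F C) ≅ ⟨W⟩ := H0.isoOfHomotopy hφ hψ hφψ hψφ
  have h1 : (H0.cl (i ≫ ψ) hg : (⟨Y⟩ : H0 F C) ⟶ ⟨Z⟩) ≫ e.hom = H0.cl i hc.i_mem := by
    have : (H0.cl (i ≫ ψ) hg : (⟨Y⟩ : H0 F C) ⟶ ⟨Z⟩) = H0.cl i hc.i_mem ≫ e.inv := rfl
    rw [this, Category.assoc, e.inv_hom_id, Category.comp_id]
  have h2 : (H0.cl (φ ≫ p ≫ up (F := F) 1 X) hh : (⟨Z⟩ : H0 F C) ⟶ ⟨sh (F := F) 1 X⟩) =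
      e.hom ≫ H0.cl (p ≫ up (F := F) 1 X) (up_mem_cycles hc.p_mem hc.d_p) := rfl
  refine ⟨X, Y, W, f, i, p, hc, ⟨Triangle.isoMk _ _ (Iso.refl _) (Iso.refl _) e ?_ ?_ ?_⟩⟩
  · exact (Category.comp_id _).trans (Category.id_comp _).symm
  · exact h1.trans (Category.id_comp _).symm
  · exact (congrArg _ ((shiftFunctor (H0 F C) (1 : ℤ)).map_id _)).trans
      ((Category.comp_id _).trans h2)

/-- Disregarding differentials, the cone W of `i : Y ⟶ Z` is Y ⊕ X[1] ⊕ Y[1]. The two copies of Y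
cancel, which leaves X[1]. -/
theorem rotate_cone_mem (hC : HasMappingCones F C) {X Y Z : C} {f : X ⟶ Y} {i : Y ⟶ Z} {p : Z ⟶ X}
    (h : IsMappingCone F f i p) : h.triangle.rotate ∈ coneTriangles F C := by
  obtain ⟨W, i', p', h'⟩ := hC i h.i_mem
  obtain ⟨s, q, H⟩ := h.exists_coneData
  obtain ⟨s', q', H'⟩ := h'.exists_coneData
  have h1 : q' ≫ p ≫ up (F := F) 1 X ∈ cycles F W (sh (F := F) 1 X) :=
    mem_cycles_of_degree (comp_mem H'.q_mem (comp_mem H.p_mem (up_mem 1 X))) (by omega)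
      (by simp [leibniz, H.d_p, H'.d_q, H.ip_assoc])
  -- The inclusion `s` is not closed: its differential is `f ≫ i`. The term `f ≫ s'` has
  -- differential `f ≫ i ≫ i'` and compensates for it.
  have h2 : down (F := F) 1 X ≫ (s ≫ i' + f ≫ s') ∈ cycles F (sh (F := F) 1 X) W :=
    mem_cycles_of_degree (comp_mem (down_mem 1 X) (add_mem
      (mem_gr_of_eq (comp_mem H.s_mem H'.i_mem) (add_zero _))
      (mem_gr_of_eq (comp_mem H.f_mem H'.s_mem) (zero_add _)))) (by omega)
      (by
        simp only [leibniz, map_add, d_down, H.d_s, H'.d_i, H.d_f, H'.d_s, zero_comp, comp_zero,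
          zero_add, add_zero, Category.assoc]
        rw [TwI.add_self (F := F), comp_zero])
  have key := mk_mem_coneTriangles h' (up_mem_cycles H.p_mem H.d_p)
    (shift_mem 1 h.f_mem) h2 h1
    (by rw [H'.iq_assoc])
    (by simp only [Category.assoc, Preadditive.add_comp, H'.ip_assoc, H'.sp_assoc, comp_zero,
          zero_add])
    ⟨0, zero_mem _, by
      simp only [map_zero, Preadditive.add_comp, Category.assoc, H'.iq_assoc, H'.sq_assoc,
        H.sp_assoc, comp_zero, add_zero, down_up]
      exact (TwI.add_self (F := F) _).symm⟩
    -- The homotopy carries the copy of Y inside Z to the copy Y[1], which is what cancels the two.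
    ⟨q' ≫ q ≫ s', mem_gr_of_eq (comp_mem H'.q_mem (comp_mem H.q_mem H'.s_mem)) (by omega), by
      simp only [leibniz, H'.d_q, H.d_q, H'.d_s, Preadditive.comp_add, Category.assoc,
        up_down_assoc, H.iq_assoc, H.ps_assoc, H'.ps]
      refine eq_of_add_eq_zero F ?_
      abel_nf
      simp only [two_zsmul_hom F, add_zero]⟩
  -- The sign in the third map of a rotated triangle disappears, since morphisms equal their
  -- negatives.
  have e : h.triangle.rotate = Triangle.mk (X := (⟨Y⟩ : H0 F C)) (Y := ⟨Z⟩)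
      (Z := ⟨sh (F := F) 1 X⟩) (H0.cl i h.i_mem) (H0.cl _ (up_mem_cycles H.p_mem H.d_p))
      (H0.cl (down (F := F) 1 X ≫ f ≫ up (F := F) 1 Y) (shift_mem 1 h.f_mem)) :=
    congrArg (Triangle.mk _ _) (H0.neg_cl _)
  rw [e]
  exact key

/-- The cone of Z[-1] ⟶ X is X ⊕ Y ⊕ X[1], and here the two copies of X cancel, leaving Y. The
morphism `k` is the identification of Z with Z[-1][1], needed because a triangle starting at Z[-1]
must end there. -/
theorem invRotate_cone_mem (hC : HasMappingCones F C) {X Y Z : C} {f : X ⟶ Y} {i : Y ⟶ Z}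
    {p : Z ⟶ X} (h : IsMappingCone F f i p) {g : sh (F := F) (-1) Z ⟶ X}
    (hg : g ∈ cycles F (sh (F := F) (-1) Z) X) (e : g = down (F := F) (-1) Z ≫ p)
    {k : Z ⟶ sh (F := F) 1 (sh (F := F) (-1) Z)} (hk : k ∈ cycles F Z _)
    (e' : k = up (F := F) (-1) Z ≫ up (F := F) 1 (sh (F := F) (-1) Z)) :
    Triangle.mk (X := (⟨sh (F := F) (-1) Z⟩ : H0 F C)) (Y := ⟨X⟩) (Z := ⟨Y⟩) (H0.cl g hg)
      (H0.cl f h.f_mem) (H0.cl (i ≫ k) (comp_mem_cycles h.i_mem hk)) ∈ coneTriangles F C := by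
  subst e e'
  obtain ⟨W, i', p', h'⟩ := hC _ hg
  obtain ⟨s, q, H⟩ := h.exists_coneData
  obtain ⟨s', q', H'⟩ := h'.exists_coneData
  have h1 : i ≫ up (F := F) (-1) Z ≫ s' ∈ cycles F Y W :=
    mem_cycles_of_degree (comp_mem H.i_mem (comp_mem (up_mem (-1) Z) H'.s_mem)) (by omega)
      (by simp [leibniz, H.d_i, H'.d_s, H.ip_assoc])
  have h2 : q' ≫ f + p' ≫ down (F := F) (-1) Z ≫ q ∈ cycles F W Y := by
    refine ⟨add_mem (mem_gr_of_eq (comp_mem H'.q_mem H.f_mem) (add_zero _))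
      (mem_gr_of_eq (comp_mem H'.p_mem (comp_mem (down_mem (-1) Z) H.q_mem)) (by omega)), ?_⟩
    change d (F := F) _ _ _ = 0
    simp only [leibniz, map_add, d_down, H.d_f, H'.d_q, H.d_q, H'.d_p, zero_comp, comp_zero,
      zero_add, add_zero, Category.assoc]
    exact TwI.add_self (F := F) _
  refine mk_mem_coneTriangles h' h.f_mem _ h1 h2 ?_ ?_ ?_ ?_
  · simp only [Preadditive.comp_add, H'.iq_assoc, H'.ip_assoc, add_zero]
  · simp only [Category.assoc, H'.sp_assoc]
    rfl
  · refine ⟨0, zero_mem _, ?_⟩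
    simp only [map_zero, Preadditive.comp_add, Category.assoc, H'.sq_assoc, H'.sp_assoc,
      comp_zero, zero_add, up_down_assoc, H.iq]
    exact (TwI.add_self (F := F) _).symm
  -- The homotopy carries the summand X of the cone to the summand X[1] of Z.
  · refine ⟨q' ≫ s ≫ up (F := F) (-1) Z ≫ s', mem_gr_of_eq (comp_mem H'.q_mem
      (comp_mem H.s_mem (comp_mem (up_mem (-1) Z) H'.s_mem))) (by omega), ?_⟩
    simp only [leibniz, H'.d_q, H.d_s, H'.d_s, d_up, Preadditive.comp_add, Preadditive.add_comp,
      Category.assoc, up_down_assoc, H.ps_assoc, H'.ps, zero_comp, H.sp_assoc, zero_add,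
      down_up_assoc]
    refine eq_of_add_eq_zero F ?_
    abel_nf
    simp only [two_zsmul_hom F, add_zero]

/-- Conjugation by the shift morphisms turns a homotopy between maps X[1] ⟶ U[1] into one between
maps X ⟶ U. The right-hand side is left in the form in which `mem_of_rotate_mem` meets it, with X
identified with X[1][-1]. -/
theorem d_unshift {X Y U W : C} {f : X ⟶ Y} {β : Y ⟶ U} {α : sh (F := F) 1 X ⟶ W} {p : W ⟶ U}
    {k : sh (F := F) 1 X ⟶ sh (F := F) 1 U}
    (ek : d (F := F) _ _ k = (down (F := F) 1 X ≫ f ≫ up (F := F) 1 Y) ≫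
      down (F := F) 1 Y ≫ β ≫ up (F := F) 1 U + α ≫ p ≫ up (F := F) 1 U) :
    d (F := F) _ _ (up (F := F) 1 X ≫ k ≫ down (F := F) 1 U) =
      f ≫ β + ((up (F := F) 1 X ≫ up (F := F) (-1) (sh (F := F) 1 X)) ≫
        down (F := F) (-1) (sh (F := F) 1 X) ≫ α ≫ up (F := F) (-1) W) ≫
          down (F := F) (-1) W ≫ p := by
  simp only [leibniz, d_up, d_down, ek, zero_comp, comp_zero, zero_add, add_zero, up_down,
      up_down_assoc,
    Preadditive.add_comp, Preadditive.comp_add, Category.assoc, Category.comp_id]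

theorem d_shift_shift {X V W Z : C} {h : Z ⟶ sh (F := F) 1 X} {α : sh (F := F) 1 X ⟶ W}
    {γ : Z ⟶ V} {i : V ⟶ W} {k : Z ⟶ W} (ek : d (F := F) _ _ k = h ≫ α + γ ≫ i) :
    d (F := F) _ _ (k ≫ up (F := F) (-1) W ≫ up (F := F) 1 _) =
      h ≫ (down (F := F) 1 X ≫ ((up (F := F) 1 X ≫ up (F := F) (-1) (sh (F := F) 1 X)) ≫
        down (F := F) (-1) (sh (F := F) 1 X) ≫ α ≫ up (F := F) (-1) W) ≫ up (F := F) 1 _) +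
      γ ≫ i ≫ up (F := F) (-1) W ≫ up (F := F) 1 _ := by
  simp only [leibniz, d_up, ek, zero_comp, comp_zero, add_zero, up_down_assoc, down_up_assoc,
    Preadditive.add_comp, Category.assoc]

/-- If the rotation of T is the triangle of a cone W of U ⟶ V, then T is isomorphic to the inverse
rotation W[-1] ⟶ U ⟶ V, through X ≅ X[1][-1] ≅ W[-1] on the first vertex. The squares meeting that
vertex commute up to the homotopies of the given isomorphism, conjugated by shifts. -/
theorem mem_of_rotate_mem (hC : HasMappingCones F C) {T : Triangle (H0 F C)}
    (hT : T.rotate ∈ coneTriangles F C) : T ∈ coneTriangles F C := by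
  obtain ⟨U, V, W, f, i, p, h, ⟨e⟩⟩ := hT
  obtain ⟨⟨X⟩, ⟨Y⟩, ⟨Z⟩, f₀, g₀, h₀⟩ := T
  have hg : down (F := F) (-1) W ≫ p ∈ cycles F (sh (F := F) (-1) W) U :=
    mem_cycles_of_degree (comp_mem (down_mem _ _) h.p_mem) (by omega) (by simp [leibniz, h.d_p])
  have hk : up (F := F) (-1) W ≫ up (F := F) 1 (sh (F := F) (-1) W) ∈ cycles F W _ :=
    mem_cycles_of_degree (comp_mem (up_mem _ _) (up_mem _ _)) (by omega) (by simp [leibniz])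
  refine coneTriangles_of_iso (invRotate_cone_mem hC h hg rfl hk rfl) ?_
  let e₁ : (⟨Y⟩ : H0 F C) ≅ ⟨U⟩ := Triangle.π₁.mapIso e
  let e₂ : (⟨Z⟩ : H0 F C) ≅ ⟨V⟩ := Triangle.π₂.mapIso e
  let e₃ : (⟨sh (F := F) 1 X⟩ : H0 F C) ≅ ⟨W⟩ := Triangle.π₃.mapIso e
  have c₁ : g₀ ≫ e₂.hom = e₁.hom ≫ H0.cl f h.f_mem := e.hom.comm₁
  have c₂ : h₀ ≫ e₃.hom = e₂.hom ≫ H0.cl i h.i_mem := e.hom.comm₂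
  have c₃ : (shiftF F C 1).map f₀ ≫ (shiftF F C 1).map e₁.hom =
      e₃.hom ≫ H0.cl (p ≫ up (F := F) 1 U) (up_mem_cycles h.p_mem h.d_p) :=
    (congrArg (· ≫ _) (H0.neg_cl ((shiftF F C 1).map f₀))).symm.trans e.hom.comm₃
  let a : (⟨X⟩ : H0 F C) ≅ ⟨sh (F := F) (-1) (sh (F := F) 1 X)⟩ :=
    H0.isoOfIso ⟨up (F := F) 1 X ≫ up (F := F) (-1) _, down (F := F) (-1) _ ≫ down (F := F) 1 X,
      by simp, by simp⟩
      (mem_cycles_of_degree (comp_mem (up_mem _ _) (up_mem _ _)) (by omega) (by simp [leibniz]))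
      (mem_cycles_of_degree (comp_mem (down_mem _ _) (down_mem _ _)) (by omega)
        (by simp [leibniz]))
  refine Triangle.isoMk _ _ (a ≪≫ (shiftF F C (-1)).mapIso e₃) e₁ e₂ ?_ c₁ ?_
  · obtain ⟨β, hβ, eβ⟩ := H0.exists_cl e₁.hom
    obtain ⟨α, hα, eα⟩ := H0.exists_cl e₃.hom
    obtain ⟨f', hf', ef⟩ := H0.exists_cl f₀
    rw [eβ, eα, ef] at c₃
    obtain ⟨k, hk, ek⟩ := H0.cl_eq_cl.1 c₃
    refine (congrArg₂ (· ≫ ·) ef eβ).trans (Eq.trans ?_ (congrArg (fun t =>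
      (a.hom ≫ (shiftF F C (-1)).map t) ≫ H0.cl _ hg) eα).symm)
    refine H0.cl_eq_cl.2 ⟨up (F := F) 1 X ≫ k ≫ down (F := F) 1 U, mem_gr_of_eq
      (comp_mem (up_mem _ _) (comp_mem hk (down_mem _ _))) (by omega), d_unshift ek⟩
  · obtain ⟨α, hα, eα⟩ := H0.exists_cl e₃.hom
    obtain ⟨γ, hγ, eγ⟩ := H0.exists_cl e₂.hom
    obtain ⟨h', hh', eh⟩ := H0.exists_cl h₀
    rw [eγ, eα, eh] at c₂
    obtain ⟨k, hk, ek⟩ := H0.cl_eq_cl.1 c₂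
    refine Eq.trans (congrArg₂ (fun s t => s ≫ (shiftF F C 1).map (a.hom ≫ (shiftF F C (-1)).map t))
      eh eα) (Eq.trans ?_ (congrArg (· ≫ H0.cl _ _) eγ).symm)
    refine H0.cl_eq_cl.2 ⟨k ≫ up (F := F) (-1) W ≫ up (F := F) 1 _, mem_gr_of_eq
      (comp_mem hk (comp_mem (up_mem _ _) (up_mem _ _))) (by omega), d_shift_shift ek⟩

/-- Completing a square to a morphism of triangles is a property invariant under isomorphism, so it
has to be verified only for triangles of cones. -/
theorem exists_triangle_map_of_iso {D : Type*} [Category* D] [HasShift D ℤ]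
    {T₁ T₂ S₁ S₂ : Triangle D} (e₁ : T₁ ≅ S₁) (e₂ : T₂ ≅ S₂)
    (h : ∀ (a : S₁.obj₁ ⟶ S₂.obj₁) (b : S₁.obj₂ ⟶ S₂.obj₂) (_ : S₁.mor₁ ≫ b = a ≫ S₂.mor₁),
      ∃ c : S₁.obj₃ ⟶ S₂.obj₃, S₁.mor₂ ≫ c = b ≫ S₂.mor₂ ∧ S₁.mor₃ ≫ a⟦1⟧' = c ≫ S₂.mor₃)
    (a : T₁.obj₁ ⟶ T₂.obj₁) (b : T₁.obj₂ ⟶ T₂.obj₂) (hab : T₁.mor₁ ≫ b = a ≫ T₂.mor₁) :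
    ∃ c : T₁.obj₃ ⟶ T₂.obj₃, T₁.mor₂ ≫ c = b ≫ T₂.mor₂ ∧ T₁.mor₃ ≫ a⟦1⟧' = c ≫ T₂.mor₃ := by
  obtain ⟨c, h1, h2⟩ := h (e₁.inv.hom₁ ≫ a ≫ e₂.hom.hom₁) (e₁.inv.hom₂ ≫ b ≫ e₂.hom.hom₂) (by
    rw [← Category.assoc, e₁.inv.comm₁, Category.assoc, Category.assoc, Category.assoc,
      ← e₂.hom.comm₁, ← Category.assoc T₁.mor₁, hab, Category.assoc])
  refine ⟨e₁.hom.hom₃ ≫ c ≫ e₂.inv.hom₃, ?_, ?_⟩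
  · rw [← Category.assoc, e₁.hom.comm₂, Category.assoc, ← Category.assoc _ c, h1]
    simp only [Category.assoc, e₂.inv.comm₂, Iso.hom_inv_id_triangle_hom₂_assoc]
  · rw [Category.assoc, Category.assoc, ← e₂.inv.comm₃, ← Category.assoc c, ← h2]
    simp only [Category.assoc, Functor.map_comp]
    rw [← Category.assoc e₁.hom.hom₃, ← e₁.hom.comm₃]
    simp only [Category.assoc, ← Functor.map_comp, Iso.hom_inv_id_triangle_hom₁,
      Iso.hom_inv_id_triangle_hom₁_assoc, Category.comp_id]

/-- A square that commutes in cohomology commutes up to a homotopy `k`, and `k` is exactly the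
off-diagonal entry needed to make the map of cones with diagonal entries `b` and `a` closed. -/
theorem exists_cone_map {X Y Z X' Y' Z' : C} {f : X ⟶ Y} {i : Y ⟶ Z} {p : Z ⟶ X} {f' : X' ⟶ Y'}
    {i' : Y' ⟶ Z'} {p' : Z' ⟶ X'} (h : IsMappingCone F f i p) (h' : IsMappingCone F f' i' p')
    (a : (⟨X⟩ : H0 F C) ⟶ ⟨X'⟩) (b : (⟨Y⟩ : H0 F C) ⟶ ⟨Y'⟩)
    (hab : H0.cl f h.f_mem ≫ b = a ≫ H0.cl f' h'.f_mem) :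
    ∃ c : (⟨Z⟩ : H0 F C) ⟶ ⟨Z'⟩, H0.cl i h.i_mem ≫ c = b ≫ H0.cl i' h'.i_mem ∧
      H0.cl _ (up_mem_cycles h.p_mem h.d_p) ≫ (shiftF F C 1).map a =
        c ≫ H0.cl _ (up_mem_cycles h'.p_mem h'.d_p) := by
  obtain ⟨s, q, H⟩ := h.exists_coneData
  obtain ⟨s', q', H'⟩ := h'.exists_coneData
  obtain ⟨a, ha, rfl⟩ := H0.exists_cl a
  obtain ⟨b, hb, rfl⟩ := H0.exists_cl b
  obtain ⟨k, hk, ek⟩ := H0.cl_eq_cl.1 hab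
  change d (F := F) X Y' k = f ≫ b + a ≫ f' at ek
  change k ∈ gr (F := F) X Y' (-1) at hk
  change a ∈ cycles F X X' at ha
  change b ∈ cycles F Y Y' at hb
  have da : d (F := F) _ _ a = 0 := ha.2
  have db : d (F := F) _ _ b = 0 := hb.2
  -- In matrix terms: `b` from Y to Y', `a` from X[1] to X'[1], and `k` from X[1] to Y'.
  have hc : q ≫ b ≫ i' + p ≫ a ≫ s' + p ≫ k ≫ i' ∈ cycles F Z Z' := by
    refine ⟨add_mem (add_mem (mem_gr_of_eq (comp_mem H.q_mem (comp_mem hb.1 H'.i_mem)) (by omega))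
      (mem_gr_of_eq (comp_mem H.p_mem (comp_mem ha.1 H'.s_mem)) (by omega)))
      (mem_gr_of_eq (comp_mem H.p_mem (comp_mem hk H'.i_mem)) (by omega)), ?_⟩
    change d (F := F) _ _ _ = 0
    simp only [map_add, leibniz, H.d_q, H.d_p, H'.d_i, H'.d_s, da, db, ek, zero_comp, comp_zero,
      add_zero, zero_add, Preadditive.add_comp, Preadditive.comp_add, Category.assoc]
    abel_nf
    simp only [two_zsmul_hom F, add_zero]
  refine ⟨H0.cl _ hc, ?_, ?_⟩
  · change H0.cl _ _ = H0.cl _ _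
    congr 1
    simp only [Preadditive.comp_add, H.iq_assoc, H.ip_assoc, add_zero]
  · change H0.cl ((p ≫ up (F := F) 1 X) ≫ down (F := F) 1 X ≫ a ≫ up (F := F) 1 X') _ =
      H0.cl ((q ≫ b ≫ i' + p ≫ a ≫ s' + p ≫ k ≫ i') ≫ p' ≫ up (F := F) 1 X') _
    congr 1
    simp only [Preadditive.add_comp, Category.assoc, H'.ip_assoc, H'.sp_assoc, comp_zero, zero_add,
      add_zero, up_down_assoc]

/-- The pretriangulated structure of the zeroth cohomology category. -/
noncomputable abbrev pretriangulatedH0 [HasZeroObject (H0 F C)] (hC : HasMappingCones F C) :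
    Pretriangulated (H0 F C) where
  distinguishedTriangles := coneTriangles F C
  isomorphic_distinguished _ h _ e := coneTriangles_of_iso h e
  contractible_distinguished := contractible_mem hC
  distinguished_cocone_triangle := exists_cone_triangle hC
  rotate_distinguished_triangle T := ⟨fun ⟨_, _, _, _, _, _, h, ⟨e⟩⟩ =>
    coneTriangles_of_iso (rotate_cone_mem hC h) ((rotate (H0 F C)).mapIso e), mem_of_rotate_mem hC⟩
  complete_distinguished_triangle_morphism := by
    rintro T₁ T₂ ⟨_, _, _, _, _, _, h, ⟨e⟩⟩ ⟨_, _, _, _, _, _, h', ⟨e'⟩⟩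
    exact exists_triangle_map_of_iso e e' (exists_cone_map h h')

/-- The cone E of the map A ⟶ D is Z ⊕ X[1] ⊕ Y[1] ⊕ X[2] without its differential. The two summands
coming from X cancel, leaving Z ⊕ Y[1], which is B. -/
theorem octahedron_mem (hC : HasMappingCones F C) {X Y Z A B D : C} {f : X ⟶ Y} {g : Y ⟶ Z}
    {iA : Y ⟶ A} {pA : A ⟶ X} {sA : X ⟶ A} {qA : A ⟶ Y} (hA : ConeData F f iA pA sA qA)
    {iB : Z ⟶ B} {pB : B ⟶ Y} {sB : Y ⟶ B} {qB : B ⟶ Z} (hB : ConeData F g iB pB sB qB)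
    {iD : Z ⟶ D} {pD : D ⟶ X} {sD : X ⟶ D} {qD : D ⟶ Z} (hD : ConeData F (f ≫ g) iD pD sD qD)
    (h₁ : qA ≫ g ≫ iD + pA ≫ sD ∈ cycles F A D) (h₂ : qD ≫ iB + pD ≫ f ≫ sB ∈ cycles F D B)
    (h₃ : pB ≫ iA ≫ up (F := F) 1 A ∈ cycles F B (sh (F := F) 1 A)) :
    Triangle.mk (X := (⟨A⟩ : H0 F C)) (Y := ⟨D⟩) (Z := ⟨B⟩) (H0.cl _ h₁) (H0.cl _ h₂)
      (H0.cl _ h₃) ∈ coneTriangles F C := by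
  obtain ⟨E, i, p, h⟩ := hC _ h₁
  obtain ⟨s, q, H⟩ := h.exists_coneData
  have hφ : qB ≫ iD ≫ i + pB ≫ iA ≫ s ∈ cycles F B E := by
    refine ⟨add_mem (mem_gr_of_eq (comp_mem hB.q_mem (comp_mem hD.i_mem H.i_mem)) (by omega))
      (mem_gr_of_eq (comp_mem hB.p_mem (comp_mem hA.i_mem H.s_mem)) (by omega)), ?_⟩
    change d (F := F) _ _ _ = 0
    simp only [map_add, leibniz, hB.d_q, hB.d_p, hD.d_i, H.d_i, hA.d_i, H.d_s, zero_comp,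
      comp_zero, add_zero, zero_add, Preadditive.add_comp, Preadditive.comp_add, Category.assoc,
      hA.iq_assoc, hA.ip_assoc]
    exact TwI.add_self (F := F) _
  have hψ : q ≫ (qD ≫ iB + pD ≫ f ≫ sB) + p ≫ qA ≫ sB ∈ cycles F E B := by
    refine ⟨add_mem (mem_gr_of_eq (comp_mem H.q_mem h₂.1) (by omega))
      (mem_gr_of_eq (comp_mem H.p_mem (comp_mem hA.q_mem hB.s_mem)) (by omega)), ?_⟩
    have d₂ : d (F := F) _ _ (qD ≫ iB + pD ≫ f ≫ sB) = 0 := h₂.2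
    change d (F := F) _ _ _ = 0
    rw [map_add, leibniz, d₂, H.d_q]
    simp only [leibniz, H.d_p, hA.d_q, hB.d_s, zero_comp, comp_zero, add_zero, zero_add,
      Preadditive.add_comp, Preadditive.comp_add, Category.assoc, hD.iq_assoc, hD.ip_assoc,
      hD.sq_assoc, hD.sp_assoc]
    abel_nf
    simp only [two_zsmul_hom F, add_zero]
  refine mk_mem_coneTriangles h h₂ h₃ hφ hψ ?_ ?_ ?_ ?_
  · simp only [Preadditive.comp_add, H.iq_assoc, H.ip_assoc, add_zero]
  · simp only [Preadditive.add_comp, Category.assoc, H.ip_assoc, H.sp_assoc, comp_zero, zero_add]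
  · refine ⟨0, zero_mem _, ?_⟩
    simp only [map_zero, Preadditive.add_comp, Preadditive.comp_add, Category.assoc, H.iq_assoc,
      H.ip_assoc, H.sq_assoc, H.sp_assoc, hD.iq_assoc, hD.ip_assoc, hA.iq_assoc, hB.ps, comp_zero,
      add_zero, zero_add]
    refine eq_of_add_eq_zero F ?_
    abel_nf
    simp only [two_zsmul_hom F, add_zero]
  -- The homotopy carries X[1] inside D to X[2] inside A[1].
  · refine ⟨q ≫ pD ≫ sA ≫ s, mem_gr_of_eq (comp_mem H.q_mem (comp_mem hD.p_mem
      (comp_mem hA.s_mem H.s_mem))) (by omega), ?_⟩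
    simp only [leibniz, H.d_q, hD.d_p, hA.d_s, H.d_s, zero_comp, comp_zero, zero_add, add_zero,
      Preadditive.add_comp, Preadditive.comp_add, Category.assoc, hB.iq_assoc, hB.ip_assoc,
      hB.sq_assoc, hB.sp_assoc, hD.ip_assoc, hD.sp_assoc, hA.sq_assoc, hA.sp_assoc, hA.ps_assoc,
      hD.ps_assoc, H.ps]
    refine eq_of_add_eq_zero F ?_
    abel_nf
    simp only [two_zsmul_hom F, add_zero]

/-- The octahedron may be checked for one representative of each composable pair. Here both maps and
their composite are represented strictly, by closed `f`, `g` and `f ≫ g`, with arbitrary cones of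
these. -/
theorem h0IsTriangulated (hC : HasMappingCones F C) (h0 : ∃ X : C, 𝟙 X = 0) :
    H0IsTriangulated F C := by
  have hz : HasZeroObject (H0 F C) := by
    obtain ⟨X, hX⟩ := h0
    exact ⟨⟨X⟩, H0.isZero_of_id_eq_zero hX⟩
  let _ := pretriangulatedH0 hC
  refine ⟨hz, pretriangulatedH0 hC, rfl, IsTriangulated.mk' fun X Y Z f g => ?_⟩
  obtain ⟨f, hf, rfl⟩ := H0.exists_cl f
  obtain ⟨g, hg, rfl⟩ := H0.exists_cl g
  obtain ⟨A, iA, pA, hA⟩ := hC f hf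
  obtain ⟨B, iB, pB, hB⟩ := hC g hg
  obtain ⟨D, iD, pD, hD⟩ := hC (f ≫ g) (comp_mem_cycles hf hg)
  obtain ⟨sA, qA, HA⟩ := hA.exists_coneData
  obtain ⟨sB, qB, HB⟩ := hB.exists_coneData
  obtain ⟨sD, qD, HD⟩ := hD.exists_coneData
  -- The map of cones A ⟶ D induced by `(𝟙 X, g)`; the next one, D ⟶ B, is induced by `(f, 𝟙 Z)`.
  -- Both underlying squares commute strictly, so no homotopy term appears.
  have h₁ : qA ≫ g ≫ iD + pA ≫ sD ∈ cycles F A D := by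
    refine ⟨add_mem (mem_gr_of_eq (comp_mem HA.q_mem (comp_mem hg.1 HD.i_mem)) (by omega))
      (mem_gr_of_eq (comp_mem HA.p_mem HD.s_mem) (by omega)), ?_⟩
    have dg : d (F := F) _ _ g = 0 := hg.2
    change d (F := F) _ _ _ = 0
    simp only [map_add, leibniz, HA.d_q, HA.d_p, HD.d_i, HD.d_s, dg, zero_comp, comp_zero,
      add_zero, zero_add, Category.assoc]
    exact TwI.add_self (F := F) _
  have h₂ : qD ≫ iB + pD ≫ f ≫ sB ∈ cycles F D B := by
    refine ⟨add_mem (mem_gr_of_eq (comp_mem HD.q_mem HB.i_mem) (by omega))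
      (mem_gr_of_eq (comp_mem HD.p_mem (comp_mem hf.1 HB.s_mem)) (by omega)), ?_⟩
    have df : d (F := F) _ _ f = 0 := hf.2
    change d (F := F) _ _ _ = 0
    simp only [map_add, leibniz, HD.d_q, HD.d_p, HB.d_i, HB.d_s, df, zero_comp, comp_zero,
      add_zero, zero_add, Category.assoc]
    exact TwI.add_self (F := F) _
  have h₃ : pB ≫ iA ≫ up (F := F) 1 A ∈ cycles F B (sh (F := F) 1 A) :=
    mem_cycles_of_degree (comp_mem HB.p_mem (comp_mem HA.i_mem (up_mem _ _))) (by omega)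
      (by simp [leibniz, HB.d_p, HA.d_i])
  have h₁' : (qA ≫ g ≫ iD + pA ≫ sD) ≫ pD ≫ up (F := F) 1 X.obj = pA ≫ up (F := F) 1 X.obj := by
    simp only [Preadditive.add_comp, Category.assoc, HD.ip_assoc, HD.sp_assoc, comp_zero, zero_add]
  refine ⟨X, Y, Z, ⟨A⟩, ⟨B⟩, ⟨D⟩, H0.cl f hf, H0.cl g hg, Iso.refl _, Iso.refl _, Iso.refl _,
    (Category.comp_id _).trans (Category.id_comp _).symm,
    (Category.comp_id _).trans (Category.id_comp _).symm, _, _, hA.triangle_mem, _, _,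
    hB.triangle_mem, _, _, hD.triangle_mem,
    ⟨⟨H0.cl _ h₁, H0.cl _ h₂, ?_, ?_, ?_, ?_, ?_⟩⟩⟩
  · change H0.cl _ _ = H0.cl _ _
    congr 1
    rw [Preadditive.comp_add, HA.iq_assoc, HA.ip_assoc, add_zero]
  · change H0.cl _ _ = H0.cl _ _
    congr 1
  · change H0.cl _ _ = H0.cl _ _
    congr 1
    simp only [Preadditive.comp_add, HD.iq_assoc, HD.ip_assoc, add_zero]
  · change H0.cl ((pD ≫ up (F := F) 1 X.obj) ≫ down (F := F) 1 X.obj ≫ f ≫ up (F := F) 1 Y.obj) _ =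
      H0.cl ((qD ≫ iB + pD ≫ f ≫ sB) ≫ pB ≫ up (F := F) 1 Y.obj) _
    congr 1
    simp only [Preadditive.add_comp, Category.assoc, HB.ip_assoc, HB.sp_assoc, comp_zero, zero_add,
      up_down_assoc]
  -- The connecting map B ⟶ A[1] is the composite of B ⟶ Y[1] with the shifted inclusion of Y into
  -- A; the shift morphisms of Y cancel.
  · have key := octahedron_mem hC HA HB HD h₁ h₂ h₃
    have e : (H0.cl _ (up_mem_cycles hB.p_mem hB.d_p) : (⟨B⟩ : H0 F C) ⟶ ⟨sh (F := F) 1 Y.obj⟩) ≫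
        (shiftF F C 1).map (H0.cl iA hA.i_mem) = H0.cl _ h₃ := by
      change H0.cl ((pB ≫ up (F := F) 1 Y.obj) ≫ down (F := F) 1 Y.obj ≫ iA ≫ up (F := F) 1 A) _ =
        H0.cl _ _
      congr 1
      simp only [Category.assoc, up_down_assoc]
    exact e ▸ key

end TriangulatedStructure

/-! ### Additive functions on objects and the Grothendieck group. -/

section GrothendieckGroup

open DGCategory DGShift Limits Pretriangulated

variable {F : Type u} [Field F] [CharP F 2] {C : Type w} [Category.{v} C]
    [Preadditive C] [Linear F C] [DGCategory F C] [DGShift F C]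

theorem IsMappingCone.isZero_of_isIso (hT : H0IsTriangulated F C) {X Y Z : C} {f : X ⟶ Y}
    {i : Y ⟶ Z} {p : Z ⟶ X} (h : IsMappingCone F f i p) (e : (⟨X⟩ : H0 F C) ≅ ⟨Y⟩)
    (he : e.hom = H0.cl f h.f_mem) : IsZero (⟨Z⟩ : H0 F C) := by
  obtain ⟨_, T, hT, _⟩ := hT
  have h1 : h.triangle ∈ distTriang (H0 F C) := hT ▸ h.triangle_mem
  refine h.triangle.isZero₃_of_isIso₁ h1 ?_
  change IsIso (H0.cl f h.f_mem)
  rw [← he]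
  infer_instance

/-- An isomorphism in cohomology is represented by a closed map whose cone is contractible, so
additivity forces equality. This invariance is needed because distinguished triangles are only
isomorphic to triangles of cones. -/
theorem eq_of_iso_of_additive {G : Type*} [AddCommGroup G] (hC : HasMappingCones F C)
    (hT : H0IsTriangulated F C) (χ : C → G)
    (hcone : ∀ {X Y Z : C} {f : X ⟶ Y} {i : Y ⟶ Z} {p : Z ⟶ X}, IsMappingCone F f i p →
      χ Y = χ X + χ Z)
    (hzero : ∀ X : C, IsZero (⟨X⟩ : H0 F C) → χ X = 0) {X Y : C}
    (e : (⟨X⟩ : H0 F C) ≅ ⟨Y⟩) : χ X = χ Y := by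
  obtain ⟨f, hf, he⟩ := H0.exists_cl e.hom
  obtain ⟨Z, i, p, h⟩ := hC f hf
  have h1 : χ Y = χ X + χ Z := hcone h
  rw [h1, hzero Z (h.isZero_of_isIso hT e he), add_zero]

namespace K0

/-- The homomorphism on the Grothendieck group induced by an additive function on objects which
vanishes on contractible objects. -/
noncomputable def lift {G : Type*} [AddCommGroup G] (hC : HasMappingCones F C)
    (hT : H0IsTriangulated F C) (χ : C → G)
    (hcone : ∀ {X Y Z : C} {f : X ⟶ Y} {i : Y ⟶ Z} {p : Z ⟶ X}, IsMappingCone F f i p →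
      χ Y = χ X + χ Z)
    (hzero : ∀ X : C, IsZero (⟨X⟩ : H0 F C) → χ X = 0) : K0 F C →+ G :=
  QuotientAddGroup.lift _ (FreeAbelianGroup.lift χ) ((AddSubgroup.closure_le _).2 (by
    rintro _ ⟨T, ⟨X, Y, Z, f, i, p, h, ⟨e⟩⟩, rfl⟩
    have h1 := eq_of_iso_of_additive hC hT χ hcone hzero (Triangle.π₁.mapIso e)
    have h2 := eq_of_iso_of_additive hC hT χ hcone hzero (Triangle.π₂.mapIso e)
    have h3 := eq_of_iso_of_additive hC hT χ hcone hzero (Triangle.π₃.mapIso e)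
    have h4 := hcone h
    change FreeAbelianGroup.lift χ _ = 0
    rw [map_sub, map_add, FreeAbelianGroup.lift_apply_of, FreeAbelianGroup.lift_apply_of,
      FreeAbelianGroup.lift_apply_of, h1, h2, h3, sub_eq_zero]
    exact h4))

theorem ind {p : K0 F C → Prop} (hc : ∀ X, p (cls F X)) (h0 : p 0) (hneg : ∀ a, p a → p (-a))
    (hadd : ∀ a b, p a → p b → p (a + b)) (a : K0 F C) : p a := by
  obtain ⟨a, rfl⟩ := QuotientAddGroup.mk_surjective a
  induction a using FreeAbelianGroup.induction_on with
  | zero => exact h0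
  | of X => exact hc X
  | neg X h => exact hneg _ h
  | add x y hx hy => exact hadd _ _ hx hy

theorem cls_of_mem {T : Triangle (H0 F C)} (h : T ∈ coneTriangles F C) :
    cls F T.obj₂.obj = cls F T.obj₁.obj + cls F T.obj₃.obj := by
  have h1 : (QuotientAddGroup.mk (FreeAbelianGroup.of T.obj₂.obj -
      (FreeAbelianGroup.of T.obj₁.obj + FreeAbelianGroup.of T.obj₃.obj)) : K0 F C) = 0 :=
    (QuotientAddGroup.eq_zero_iff _).2 (AddSubgroup.subset_closure ⟨T, h, rfl⟩)
  exact sub_eq_zero.1 h1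

theorem cls_cone {X Y Z : C} {f : X ⟶ Y} {i : Y ⟶ Z} {p : Z ⟶ X} (h : IsMappingCone F f i p) :
    cls F Y = cls F X + cls F Z :=
  cls_of_mem h.triangle_mem

/-- For a zero object the triangle X ⟶ X ⟶ X is distinguished, so [X] = [X] + [X]. -/
theorem cls_eq_zero (hT : H0IsTriangulated F C) (X : C) (h : IsZero (⟨X⟩ : H0 F C)) :
    cls F X = 0 := by
  obtain ⟨_, T, hT, _⟩ := hT
  have h1 : contractibleTriangle (⟨X⟩ : H0 F C) ∈ coneTriangles F C :=
    hT ▸ contractible_distinguished _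
  have h2 : Triangle.mk (X := (⟨X⟩ : H0 F C)) (Y := ⟨X⟩) (Z := ⟨X⟩) 0 0 0 ∈ coneTriangles F C :=
    coneTriangles_of_iso h1 (Triangle.isoMk _ _ (Iso.refl _) (Iso.refl _) h.isoZero
      (h.eq_of_src _ _) (h.eq_of_src _ _) (h.eq_of_src _ _))
  exact (left_eq_add.1 (cls_of_mem h2))

theorem cls_eq_of_iso (hC : HasMappingCones F C) (hT : H0IsTriangulated F C) {X Y : C}
    (e : (⟨X⟩ : H0 F C) ≅ ⟨Y⟩) : cls F X = cls F Y :=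
  eq_of_iso_of_additive hC hT (cls F) cls_cone (cls_eq_zero hT) e

/-- Exhibits X[1] as the cone of X ⟶ 0; this is the source of the sign of a shift in the
Grothendieck group. -/
theorem isMappingCone_shift {X O : C} (hO : 𝟙 O = 0) :
    IsMappingCone F (0 : X ⟶ O) (0 : O ⟶ sh (F := F) 1 X) (down (F := F) 1 X) :=
  ⟨zero_mem _, zero_mem _, down_mem 1 X, d_down 1 X, up (F := F) 1 X, 0, up_mem 1 X, zero_mem _,
    by rw [zero_comp, hO], up_down 1 X, zero_comp, comp_zero, by rw [zero_comp, zero_add, down_up],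
    by rw [d_up, zero_comp], by rw [map_zero, comp_zero]⟩

theorem cls_shift_one (hT : H0IsTriangulated F C) (h0 : ∃ X : C, 𝟙 X = 0) (X : C) :
    cls F (sh (F := F) 1 X) = -cls F X := by
  obtain ⟨O, hO⟩ := h0
  have h := cls_cone (isMappingCone_shift (F := F) (X := X) hO)
  rw [cls_eq_zero hT O (H0.isZero_of_id_eq_zero hO)] at h
  exact eq_neg_of_add_eq_zero_right h.symm

theorem cls_shift (hC : HasMappingCones F C) (hT : H0IsTriangulated F C)
    (h0 : ∃ X : C, 𝟙 X = 0) (X : C) (n : ℤ) :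
    cls F (sh (F := F) n X) = (n.negOnePow : ℤ) • cls F X := by
  have h1 : ∀ n : ℤ, cls F (sh (F := F) (n + 1) X) = -cls F (sh (F := F) n X) := fun n =>
    (cls_eq_of_iso hC hT ((shiftAdd F C n 1).app ⟨X⟩)).trans (cls_shift_one hT h0 _)
  induction n using Int.induction_on with
  | zero => simpa using cls_eq_of_iso hC hT ((shiftZero F C).app ⟨X⟩)
  | succ n ih => rw [h1, ih, Int.negOnePow_succ, Units.val_neg, neg_smul]
  | pred n ih =>
    -- In negative degrees the recursion is read backwards, from `-n` to `-n - 1`.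
    have h2 := h1 (-n - 1)
    rw [sub_add_cancel, ih] at h2
    rw [← neg_eq_iff_eq_neg.2 h2, ← neg_smul, ← Units.val_neg, ← Int.negOnePow_succ,
      ← sub_add_cancel (-(n : ℤ)) 1, Int.negOnePow_succ, sub_add_cancel]
    simp [Int.negOnePow_sub]

end K0

end GrothendieckGroup

/-! ### The automorphism of the quiver algebra and a spanning set of paths. -/

section SwapAutomorphism

/-- The vertex different from a given one. -/
def KSVertex.swap : KSVertex → KSVertex
  | x => y
  | y => x

@[simp]
theorem KSVertex.swap_swap (z : KSVertex) : z.swap.swap = z := by cases z <;> rfl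

/-- The involution of the generators which exchanges the vertices and the arrows. -/
def KSGen.swap : KSGen → KSGen
  | ex => ey
  | ey => ex
  | a => b
  | b => a

@[simp]
theorem KSGen.swap_swap (g : KSGen) : g.swap.swap = g := by cases g <;> rfl

theorem KSVertex.swap_e (z : KSVertex) : z.e.swap = z.swap.e := by cases z <;> rfl

namespace KSAlg

variable {F : Type u} [Field F]

theorem gen_ex_b : gen F KSGen.ex * gen F KSGen.b = 0 := by
  rw [← gen_ey_b, ← mul_assoc, gen_ex_ey, zero_mul]

theorem gen_ey_a : gen F KSGen.ey * gen F KSGen.a = 0 := by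
  rw [← gen_ex_a, ← mul_assoc, gen_ey_ex, zero_mul]

theorem gen_a_ex : gen F KSGen.a * gen F KSGen.ex = 0 := by
  rw [← gen_a_ey, mul_assoc, gen_ey_ex, mul_zero]

theorem gen_b_ey : gen F KSGen.b * gen F KSGen.ey = 0 := by
  rw [← gen_b_ex, mul_assoc, gen_ex_ey, mul_zero]

theorem gen_a_a : gen F KSGen.a * gen F KSGen.a = 0 := by
  nth_rw 2 [← gen_ex_a]
  rw [← mul_assoc, gen_a_ex, zero_mul]

theorem gen_b_b : gen F KSGen.b * gen F KSGen.b = 0 := by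
  nth_rw 2 [← gen_ey_b]
  rw [← mul_assoc, gen_b_ey, zero_mul]

variable (F) in
/-- The automorphism of the quiver algebra which exchanges the vertices and the arrows. It does
not preserve degrees. -/
noncomputable def swap : KSAlg F →ₐ[F] KSAlg F :=
  lift (fun g => gen F g.swap) (by
    intro x y h
    cases h <;> simp only [map_mul, map_add, map_one, map_zero, FreeAlgebra.lift_ι_apply,
        KSGen.swap,
      gen_ex_ex, gen_ey_ey, gen_ex_ey, gen_ey_ex, gen_ex_a, gen_a_ey, gen_ey_b, gen_b_ex,
      gen_a_b_a, gen_b_a_b]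
    rw [add_comm, gen_ex_add_ey])

theorem swap_gen (g : KSGen) : swap F (gen F g) = gen F g.swap := lift_gen _ _ _

theorem algHom_ext {A : Type*} [Ring A] [Algebra F A] {φ ψ : KSAlg F →ₐ[F] A}
    (h : ∀ g, φ (gen F g) = ψ (gen F g)) : φ = ψ := by
  ext r
  induction r using induction with
  | hw l =>
    rw [map_list_prod, map_list_prod, List.map_map, List.map_map]
    exact congrArg (fun f => (l.map f).prod) (funext h)
  | ha r s hr hs => rw [map_add, map_add, hr, hs]
  | hs c r hr => rw [map_smul, map_smul, hr]

theorem swap_swap (r : KSAlg F) : swap F (swap F r) = r :=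
  DFunLike.congr_fun (algHom_ext (φ := (swap F).comp (swap F)) (ψ := AlgHom.id F _) fun g => by
    simp [swap_gen]) r

theorem swap_e (z : KSVertex) : swap F (gen F z.e) = gen F z.swap.e := by
  rw [swap_gen, KSVertex.swap_e]

variable (F) in
/-- The sum of the arrows. -/
noncomputable def arrow : KSAlg F := gen F KSGen.a + gen F KSGen.b

theorem arrow_mul (r : KSAlg F) : arrow F * r = swap F r * arrow F := by
  induction r using induction with
  | hw l =>
    induction l with
    | nil => simp
    | cons g l ih =>
      have h : arrow F * gen F g = swap F (gen F g) * arrow F := by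
        rw [swap_gen]
        cases g <;> simp only [arrow, add_mul, mul_add, KSGen.swap, gen_a_ex, gen_b_ex, gen_a_ey,
          gen_b_ey, gen_a_a, gen_b_b, gen_ey_a, gen_ex_b, gen_ex_a, gen_ey_b, zero_add, add_zero]
      rw [List.map_cons, List.prod_cons, map_mul, ← mul_assoc, h, mul_assoc, ih, mul_assoc]
  | ha r s hr hs => rw [map_add, mul_add, add_mul, hr, hs]
  | hs c r hr => rw [map_smul, mul_smul_comm, smul_mul_assoc, hr]

/-- The algebraic counterpart of sliding a half strand past a vertical strand: a + b acts in the
same way inside any number of twists. -/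
theorem swap_arrow : swap F (arrow F) = arrow F := by
  rw [arrow, map_add, swap_gen, swap_gen, add_comm]
  rfl

theorem gen_mul_gen_of_ne {z z' : KSVertex} (h : z ≠ z') : gen F z.e * gen F z'.e = 0 := by
  cases z <;> cases z'
  · exact absurd rfl h
  · exact gen_ex_ey
  · exact gen_ey_ex
  · exact absurd rfl h

variable (F) in
/-- The representation of the quiver algebra on `R e(x)` in coordinates. -/
noncomputable def matRep : KSAlg F →ₐ[F] Matrix (Fin 3) (Fin 3) F :=
  -- The coordinates refer to the elements e(x), b, ab, in this order.
  lift (fun g => match g with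
    | KSGen.ex => !![1, 0, 0; 0, 0, 0; 0, 0, 1]
    | KSGen.ey => !![0, 0, 0; 0, 1, 0; 0, 0, 0]
    | KSGen.a => !![0, 0, 0; 0, 0, 0; 0, 1, 0]
    | KSGen.b => !![0, 0, 0; 1, 0, 0; 0, 0, 0]) (by
    intro x y h
    cases h <;> simp only [map_mul, map_add, map_one, map_zero, FreeAlgebra.lift_ι_apply] <;>
      ext i j <;> fin_cases i <;> fin_cases j <;> simp [Matrix.mul_apply, Fin.sum_univ_three])

/-- The matrix of ab sends the first coordinate vector to the third. This is the only place where R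
has to be shown nontrivial: the nonvanishing of ba follows by `swap`, and that of the generators
because each of them is, or absorbs, a factor of ab. -/
theorem gen_a_mul_gen_b_ne_zero : gen F KSGen.a * gen F KSGen.b ≠ 0 := by
  intro h
  have h1 := congrArg (fun r => matRep F r 2 0) h
  simp only [map_mul, map_zero, matRep, lift_gen] at h1
  simp [Matrix.mul_apply, Fin.sum_univ_three] at h1

theorem gen_b_mul_gen_a_ne_zero : gen F KSGen.b * gen F KSGen.a ≠ 0 := by
  intro h
  refine gen_a_mul_gen_b_ne_zero (F := F) ?_
  have h1 := congrArg (swap F) h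
  rwa [map_mul, map_zero, swap_gen, swap_gen] at h1

theorem gen_ne_zero (g : KSGen) : gen F g ≠ 0 := by
  intro h
  refine gen_a_mul_gen_b_ne_zero (F := F) ?_
  cases g
  · rw [← gen_ex_a, h, zero_mul, zero_mul]
  · rw [← gen_a_ey, h, mul_zero, zero_mul]
  · rw [h, zero_mul]
  · rw [h, mul_zero]

variable (F) in
/-- The standard spanning set of the quiver algebra, by degrees. -/
def pathSet (n : ℤ) : Set (KSAlg F) :=
  {r | n = 0 ∧ (r = gen F KSGen.ex ∨ r = gen F KSGen.ey ∨ r = gen F KSGen.a) ∨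
    n = 1 ∧ (r = gen F KSGen.b ∨ r = gen F KSGen.a * gen F KSGen.b ∨
      r = gen F KSGen.b * gen F KSGen.a)}

/-- A generator times a path is zero or again a path, of the expected degree. -/
theorem gen_mul_mem_span_pathSet (g : KSGen) {n : ℤ} {r : KSAlg F}
    (hr : r ∈ Submodule.span F (pathSet F n)) :
    gen F g * r ∈ Submodule.span F (pathSet F (g.deg + n)) := by
  induction hr using Submodule.span_induction with
  | zero => rw [mul_zero]; exact zero_mem _
  | add x y _ _ hx hy => rw [mul_add]; exact add_mem hx hy
  | smul a x _ hx => rw [mul_smul_comm]; exact Submodule.smul_mem _ _ hx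
  | mem x hx =>
    have key : gen F g * x = 0 ∨ gen F g * x ∈ pathSet F (g.deg + n) := by
      rcases hx with ⟨rfl, rfl | rfl | rfl⟩ | ⟨rfl, rfl | rfl | rfl⟩ <;> cases g <;>
        simp only [← mul_assoc, gen_ex_ex, gen_ey_ey, gen_ex_ey, gen_ey_ex, gen_ex_a, gen_a_ey,
          gen_ey_b, gen_b_ex, gen_a_b_a, gen_b_a_b, gen_a_a, gen_b_b, gen_ex_b, gen_ey_a, gen_a_ex,
          gen_b_ey, zero_mul, true_or, pathSet, KSGen.deg, Set.mem_ofPred_eq] <;> simp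
    rcases key with h | h
    · rw [h]; exact zero_mem _
    · exact Submodule.subset_span h

theorem one_mem_span_pathSet : (1 : KSAlg F) ∈ Submodule.span F (pathSet F 0) := by
  rw [← gen_ex_add_ey]
  exact add_mem (Submodule.subset_span (Or.inl ⟨rfl, Or.inl rfl⟩))
    (Submodule.subset_span (Or.inl ⟨rfl, Or.inr (Or.inl rfl)⟩))

theorem gr_le_span_pathSet (n : ℤ) : gr F n ≤ Submodule.span F (pathSet F n) := by
  refine Submodule.span_le.2 ?_
  rintro _ ⟨l, rfl, rfl⟩
  induction l with
  | nil => exact one_mem_span_pathSet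
  | cons g l ih =>
    rw [List.map_cons, List.map_cons, List.prod_cons, List.sum_cons]
    exact gen_mul_mem_span_pathSet g ih

theorem finite_pathSet (n : ℤ) : (pathSet F n).Finite := by
  refine Set.Finite.subset (Set.toFinite {gen F KSGen.ex, gen F KSGen.ey, gen F KSGen.a,
    gen F KSGen.b, gen F KSGen.a * gen F KSGen.b, gen F KSGen.b * gen F KSGen.a}) ?_
  rintro r (⟨_, rfl | rfl | rfl⟩ | ⟨_, rfl | rfl | rfl⟩) <;> simp

instance : FiniteDimensional F (KSAlg F) := by
  have h : ⨆ n, gr F n ≤ Submodule.span F (pathSet F 0) ⊔ Submodule.span F (pathSet F 1) := by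
    refine iSup_le fun n => (gr_le_span_pathSet n).trans (Submodule.span_le.2 fun r hr => ?_)
    rcases hr with ⟨rfl, h⟩ | ⟨rfl, h⟩
    · exact Submodule.mem_sup_left (Submodule.subset_span (Or.inl ⟨rfl, h⟩))
    · exact Submodule.mem_sup_right (Submodule.subset_span (Or.inr ⟨rfl, h⟩))
  rw [isInternal_gr.submodule_iSup_eq_top, top_le_iff] at h
  have h0 := FiniteDimensional.span_of_finite F (finite_pathSet (F := F) 0)
  have h1 := FiniteDimensional.span_of_finite F (finite_pathSet (F := F) 1)
  exact Module.finite_def.2 (h ▸ (Submodule.FG.sup (Module.Finite.iff_fg.1 h0)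
      (Module.Finite.iff_fg.1 h1)))

end KSAlg

end SwapAutomorphism

/-! ### Regrading the components at the vertices so that twisted modules are graded. -/

section TwistedGrading

variable {F : Type u} [Field F]

/-- The number of positions by which the component of a module at a vertex is shifted under the
`k`-fold twist. -/
def KSVertex.offset (k : ℕ) : KSVertex → ℤ
  | x => (k / 2 : ℕ)
  | y => ((k + 1) / 2 : ℕ)

theorem KSVertex.iterate_swap_two_mul (m : ℕ) (z : KSVertex) : swap^[2 * m] z = z := by
  rw [Function.iterate_mul, show swap^[2] = id from funext swap_swap, Function.iterate_id, id]

theorem KSGen.iterate_swap_two_mul (m : ℕ) (g : KSGen) : swap^[2 * m] g = g := by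
  rw [Function.iterate_mul, show swap^[2] = id from funext swap_swap, Function.iterate_id, id]

/-- The cocycle identity that makes twisting strictly associative: l twists move the vertex z to
`swap^[l] z`, and the shifts of successive twists add up. It depends only on the parity of l. -/
theorem KSVertex.offset_add (k l : ℕ) (z : KSVertex) :
    offset (k + l) (swap^[l] z) = offset k z + offset l (swap^[l] z) := by
  obtain ⟨m, rfl | rfl⟩ := l.even_or_odd'
  · rw [iterate_swap_two_mul]
    cases z <;> simp only [offset] <;> omega
  · rw [Function.iterate_succ_apply', iterate_swap_two_mul]
    cases z <;> simp only [offset, swap] <;> omega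

/-- The source of a path of length at most one. -/
def KSGen.source : KSGen → KSVertex
  | ex => KSVertex.x
  | ey => KSVertex.y
  | a => KSVertex.y
  | b => KSVertex.x

/-- The target of a path of length at most one. -/
def KSGen.target : KSGen → KSVertex
  | ex => KSVertex.x
  | ey => KSVertex.y
  | a => KSVertex.x
  | b => KSVertex.y

/-- The degree of a swapped generator is wrong by exactly the difference of the offsets at its
target and its source. The offsets are chosen to make this hold. -/
theorem KSGen.deg_iterate_swap (k : ℕ) (g : KSGen) :
    (swap^[k] g).deg + (swap^[k] g).source.offset k = g.deg + (swap^[k] g).target.offset k := by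
  obtain ⟨m, rfl | rfl⟩ := k.even_or_odd'
  · rw [iterate_swap_two_mul]
    cases g <;> simp only [KSVertex.offset, deg, source, target] <;> omega
  · rw [Function.iterate_succ_apply', iterate_swap_two_mul]
    cases g <;> simp only [KSVertex.offset, deg, source, target, swap] <;> omega

namespace KSAlg

theorem target_mul_gen (g : KSGen) : gen F g.target.e * gen F g = gen F g := by
  cases g
  · exact gen_ex_ex
  · exact gen_ey_ey
  · exact gen_ex_a
  · exact gen_ey_b

theorem gen_mul_source (g : KSGen) : gen F g * gen F g.source.e = gen F g := by
  cases g
  · exact gen_ex_ex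
  · exact gen_ey_ey
  · exact gen_a_ey
  · exact gen_b_ex

theorem swap_pow_gen (k : ℕ) (g : KSGen) : (swap F ^ k) (gen F g) = gen F (KSGen.swap^[k] g) := by
  induction k with
  | zero => rfl
  | succ k ih => rw [pow_succ', AlgHom.mul_apply, ih, swap_gen, Function.iterate_succ_apply']

theorem swap_pow_e (k : ℕ) (z : KSVertex) :
    (swap F ^ k) (gen F z.e) = gen F (KSVertex.swap^[k] z).e := by
  induction k with
  | zero => rfl
  | succ k ih => rw [pow_succ', AlgHom.mul_apply, ih, swap_e, Function.iterate_succ_apply']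

theorem swap_pow_arrow_pow (k n : ℕ) : (swap F ^ k) (arrow F ^ n) = arrow F ^ n := by
  induction k with
  | zero => rfl
  | succ k ih => rw [pow_succ', AlgHom.mul_apply, ih, map_pow, swap_arrow]

end KSAlg

namespace DGMod

open KSAlg

variable (X : DGMod F)

theorem act_act (r s : KSAlg F) (v : X.V) : X.act r (X.act s v) = X.act (r * s) v := by
  rw [map_mul]; rfl

theorem act_ex_add_act_ey (v : X.V) :
    X.act (gen F KSVertex.x.e) v + X.act (gen F KSVertex.y.e) v = v := by
  rw [← LinearMap.add_apply, ← map_add]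
  change X.act (gen F KSGen.ex + gen F KSGen.ey) v = v
  rw [gen_ex_add_ey, map_one]
  rfl

theorem mem_of_act_e_mem {S : Submodule F X.V} {v : X.V}
    (h : ∀ z : KSVertex, X.act (gen F z.e) v ∈ S) : v ∈ S := by
  rw [← X.act_ex_add_act_ey v]
  exact add_mem (h _) (h _)

theorem act_e_mem {n : ℤ} {v : X.V} (z : KSVertex) (h : v ∈ X.gr n) :
    X.act (gen F z.e) v ∈ X.gr n := by
  simpa using X.act_mem (e_mem z) h

/-- The grading of the `k`-fold twist of a DG module. -/
def twGr (k : ℕ) (n : ℤ) : Submodule F X.V where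
  carrier := {v | ∀ z : KSVertex, X.act (gen F z.e) v ∈ X.gr (n + z.offset k)}
  add_mem' hv hw z := by rw [map_add]; exact add_mem (hv z) (hw z)
  zero_mem' z := by rw [map_zero]; exact zero_mem _
  smul_mem' c v hv z := by rw [map_smul]; exact Submodule.smul_mem _ c (hv z)

variable {X}

variable (X)

/-- The decomposition of v into e(x)v and e(y)v embeds X into X × X, and the twisted grading is the
restriction of the product grading with each factor shifted by its own offset. -/
theorem isInternal_twGr (k : ℕ) : DirectSum.IsInternal (X.twGr k) := by
  have hp : DirectSum.IsInternal fun n => (X.gr (n + KSVertex.x.offset k)).prod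
      (X.gr (n + KSVertex.y.offset k)) :=
    isInternal_prod (isInternal_reindex X.isInternal _) (isInternal_reindex X.isInternal _)
  have h := isInternal_comap hp
    ((X.act (gen F KSVertex.x.e)).prod (X.act (gen F KSVertex.y.e))) (fun v w h => by
      rw [← X.act_ex_add_act_ey v, ← X.act_ex_add_act_ey w]
      exact congrArg₂ (· + ·) (congrArg Prod.fst h) (congrArg Prod.snd h)) (fun w n => by
      have e := components_map hp hp ((X.act (gen F KSVertex.x.e)).prodMap
        (X.act (gen F KSVertex.y.e))) (fun m v hv => ⟨X.act_e_mem _ hv.1, X.act_e_mem _ hv.2⟩)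
        (((X.act (gen F KSVertex.x.e)).prod (X.act (gen F KSVertex.y.e))) w) n
      have e' : ((X.act (gen F KSVertex.x.e)).prodMap (X.act (gen F KSVertex.y.e)))
          (((X.act (gen F KSVertex.x.e)).prod (X.act (gen F KSVertex.y.e))) w) =
          ((X.act (gen F KSVertex.x.e)).prod (X.act (gen F KSVertex.y.e))) w :=
        Prod.ext ((X.act_act _ _ _).trans (by rw [e_mul_e]; rfl))
          ((X.act_act _ _ _).trans (by rw [e_mul_e]; rfl))
      rw [e'] at e
      generalize components hp (((X.act (gen F KSVertex.x.e)).prod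
        (X.act (gen F KSVertex.y.e))) w) n = c at e ⊢
      have e1 : c.1 = X.act (gen F KSVertex.x.e) c.1 := congrArg Prod.fst e
      have e2 : c.2 = X.act (gen F KSVertex.y.e) c.2 := congrArg Prod.snd e
      -- Taking components commutes with the idempotents, so the first entry of c lies in e(x)X and
      -- the second in e(y)X; hence c is the image of the sum of its entries.
      refine ⟨c.1 + c.2, Prod.ext ?_ ?_⟩
      · change X.act (gen F KSVertex.x.e) (c.1 + c.2) = c.1
        rw [map_add, ← e1, e2, X.act_act, gen_mul_gen_of_ne (by simp), map_zero]
        exact add_zero _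
      · change X.act (gen F KSVertex.y.e) (c.1 + c.2) = c.2
        rw [map_add, ← e2, e1, X.act_act, gen_mul_gen_of_ne (by simp), map_zero]
        exact zero_add _)
  convert h using 2 with n
  ext v
  exact ⟨fun h => ⟨h _, h _⟩, fun h z => by cases z; exacts [h.1, h.2]⟩

variable {X}

theorem gen_act_mem {i n : ℤ} {v : X.V} {g : KSGen} (hi : g.deg + n = i)
    (h : X.act (gen F g.source.e) v ∈ X.gr n) : X.act (gen F g) v ∈ X.gr i := by
  rw [← gen_mul_source, ← X.act_act, ← hi]
  exact X.act_mem (gen_mem_gr g) h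

/-- This says that X, with R acting through the k-th power of `swap`, is a graded module for the
twisted grading. A word is treated one letter at a time, the degrees being balanced by
`KSGen.deg_iterate_swap`. -/
theorem act_swap_pow_mem {k : ℕ} {i j : ℤ} {r : KSAlg F} {v : X.V} (hr : r ∈ KSAlg.gr F i)
    (hv : v ∈ X.twGr k j) : X.act ((swap F ^ k) r) v ∈ X.twGr k (i + j) := by
  induction hr using Submodule.span_induction with
  | zero => rw [map_zero, map_zero]; exact zero_mem _
  | add x y _ _ hx hy => rw [map_add, map_add]; exact add_mem hx hy
  | smul c x _ hx => rw [map_smul, map_smul]; exact Submodule.smul_mem _ _ hx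
  | mem x hx =>
  obtain ⟨l, rfl, rfl⟩ := hx
  induction l with
  | nil => simpa using hv
  | cons g l ih =>
    rw [List.map_cons, List.map_cons, List.prod_cons, List.sum_cons, map_mul, ← X.act_act,
      swap_pow_gen]
    intro z
    -- A generator maps into the component at its target, so there is nothing to check at the other
    -- vertex.
    by_cases hz : z = (KSGen.swap^[k] g).target
    · subst hz
      rw [X.act_act, target_mul_gen]
      refine gen_act_mem ?_ (ih (KSGen.swap^[k] g).source)
      linear_combination KSGen.deg_iterate_swap k g
    · rw [X.act_act, ← target_mul_gen (KSGen.swap^[k] g), ← mul_assoc, gen_mul_gen_of_ne hz,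
        zero_mul, map_zero]
      exact zero_mem _

/-- The component at x receives a times the component at y, and the component at y receives b times
that at x. Passing from k to k + 1 twists changes the offsets so that both contributions have degree
zero, although b has degree one. -/
theorem arrow_act_mem {k : ℕ} {j : ℤ} {v : X.V} (hv : v ∈ X.twGr k j) :
    X.act (arrow F) v ∈ X.twGr (k + 1) j := by
  intro z
  rw [X.act_act, arrow, mul_add]
  cases z
  · change X.act (gen F KSGen.ex * _ + gen F KSGen.ex * _) v ∈ _
    rw [gen_ex_a, gen_ex_b, add_zero]
    exact gen_act_mem (zero_add _) (hv KSVertex.y)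
  · change X.act (gen F KSGen.ey * _ + gen F KSGen.ey * _) v ∈ _
    rw [gen_ey_a, gen_ey_b, zero_add]
    refine gen_act_mem ?_ (hv KSVertex.x)
    simp only [KSGen.deg, KSVertex.offset]
    omega

/-- The left side unfolds membership in the k-fold twisted grading of the l-fold twist, whose
idempotents act through `swap ^ l`. Those only permute the vertices, and the offsets add by
`KSVertex.offset_add`. -/
theorem twGr_twGr {k l : ℕ} {n : ℤ} {v : X.V} :
    (∀ z : KSVertex, X.act ((swap F ^ l) (gen F z.e)) v ∈ X.twGr l (n + z.offset k)) ↔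
      v ∈ X.twGr (k + l) n := by
  have hs : Function.Surjective (KSVertex.swap^[l]) :=
    (Function.Involutive.surjective KSVertex.swap_swap).iterate l
  constructor
  · intro h z
    obtain ⟨z, rfl⟩ := hs z
    have h1 := h z (KSVertex.swap^[l] z)
    rwa [swap_pow_e, X.act_act, e_mul_e, add_assoc, ← KSVertex.offset_add] at h1
  · intro h z z'
    rw [swap_pow_e, X.act_act]
    by_cases hz : z' = KSVertex.swap^[l] z
    · subst hz
      rw [e_mul_e, add_assoc, ← KSVertex.offset_add]
      exact h _
    · rw [gen_mul_gen_of_ne hz, map_zero]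
      exact zero_mem _

theorem mem_twGr_zero {n : ℤ} {v : X.V} : v ∈ X.twGr 0 n ↔ v ∈ X.gr n := by
  have e : ∀ z : KSVertex, n + z.offset 0 = n := fun z => by cases z <;> simp [KSVertex.offset]
  refine ⟨fun h => X.mem_of_act_e_mem fun z => ?_, fun h z => ?_⟩
  · have h1 := h z
    rwa [e] at h1
  · rw [e]
    exact X.act_e_mem z h

theorem map_twGr {Y : DGMod F} {f : X.V →ₗ[F] Y.V} {n : ℤ} (hf : f ∈ homDeg X Y n) {k : ℕ}
    {j : ℤ} {v : X.V} (hv : v ∈ X.twGr k j) : f v ∈ Y.twGr k (n + j) := fun z => by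
  rw [← hf.1, add_assoc]
  exact hf.2 _ _ (hv z)

end DGMod

end TwistedGrading

/-! ### Diagrams act by powers of the sum of the arrows. -/

section DiagramAction

open KSAlg

/-- The number of half strands of an elementary diagram. -/
def Elem.halfStrands : Elem → ℕ
  | cup => 0
  | cap => 0
  | hf => 1

/-- The number of half strands of a stack of generating diagrams. -/
def wordHalfStrands (w : List GenDiag) : ℕ := (w.map (fun g => g.1.halfStrands)).sum

/-- Each local relation has equally many half strands on both sides. Together with the endpoints,
this number is all that the action remembers of a diagram, so it makes the action well defined. -/
theorem LocalRel.wordHalfStrands_eq {x y : List GenDiag} (h : LocalRel x y) :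
    wordHalfStrands x = wordHalfStrands y := by
  cases h <;> simp [wordHalfStrands, Elem.halfStrands, add_comm]

namespace Diag

/-- The number of half strands of a diagram. -/
def halfStrands {k l : ℕ} (f : Diag k l) : ℕ :=
  Quot.lift (fun w => wordHalfStrands w.1) (by
    rintro w₁ w₂ ⟨u, v, x, y, h, h1, h2⟩
    have e := h.wordHalfStrands_eq
    simp only [wordHalfStrands] at e
    simp [wordHalfStrands, h1, h2, e]) f

theorem halfStrands_comp {k l m : ℕ} (f : Diag k l) (g : Diag l m) :
    halfStrands (comp f g) = halfStrands f + halfStrands g := by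
  induction f using ind with | h f hf
  induction g using ind with | h g hg
  change wordHalfStrands (f ++ g) = wordHalfStrands f + wordHalfStrands g
  simp [wordHalfStrands]

theorem halfStrands_tens {k l k' l' : ℕ} (f : Diag k l) (g : Diag k' l') :
    halfStrands (tens f g) = halfStrands f + halfStrands g := by
  induction f using ind with | h f hf
  induction g using ind with | h g hg
  change wordHalfStrands (f ++ shiftWord l g) = wordHalfStrands f + wordHalfStrands g
  simp [wordHalfStrands, shiftWord, Function.comp_def]

theorem halfStrands_one {k l : ℕ} (h : k = l) : halfStrands (one h) = 0 := rfl

end Diag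

variable {F : Type u} [Field F]

/-- An element of the quiver algebra acts as a natural transformation of degree `n` from the
`k`-fold to the `l`-fold twist. -/
def KSAlg.IsTwistMap (k l : ℕ) (n : ℤ) (t : KSAlg F) : Prop :=
  (∀ r, t * (swap F ^ k) r = (swap F ^ l) r * t) ∧
    ∀ (X : DGMod F) (j : ℤ) (v : X.V), v ∈ X.twGr k j → X.act t v ∈ X.twGr l (n + j)

namespace KSAlg.IsTwistMap

theorem zero (k l : ℕ) (n : ℤ) : IsTwistMap k l n (0 : KSAlg F) :=
  ⟨fun r => by rw [zero_mul, mul_zero], fun X j v _ => by rw [map_zero]; exact zero_mem _⟩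

theorem add {k l : ℕ} {n : ℤ} {s t : KSAlg F} (hs : IsTwistMap k l n s)
    (ht : IsTwistMap k l n t) : IsTwistMap k l n (s + t) :=
  ⟨fun r => by rw [add_mul, mul_add, hs.1, ht.1],
    fun X j v hv => by rw [map_add]; exact add_mem (hs.2 X j v hv) (ht.2 X j v hv)⟩

theorem smul {k l : ℕ} {n : ℤ} {t : KSAlg F} (ht : IsTwistMap k l n t) (c : F) :
    IsTwistMap k l n (c • t) :=
  ⟨fun r => by rw [smul_mul_assoc, mul_smul_comm, ht.1],
    fun X j v hv => by rw [map_smul]; exact Submodule.smul_mem _ _ (ht.2 X j v hv)⟩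

theorem mul {k l m : ℕ} {p q : ℤ} {s t : KSAlg F} (hs : IsTwistMap k l p s)
    (ht : IsTwistMap l m q t) : IsTwistMap k m (p + q) (t * s) :=
  ⟨fun r => by rw [mul_assoc, hs.1, ← mul_assoc, ht.1, mul_assoc], fun X j v hv => by
    rw [← X.act_act, add_comm p, add_assoc]
    exact ht.2 X _ _ (hs.2 X j v hv)⟩

theorem swap_pow_add_two (k : ℕ) : swap F ^ (k + 2) = swap F ^ k := by
  rw [pow_add, show swap F ^ 2 = 1 from AlgHom.ext swap_swap, mul_one]

/-- Two further twists change neither the action, as `swap` is an involution, nor the underlying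
space, and they raise the offset by one at both vertices. The identity is thus a twist map of degree
-1, the degree of a cup; read backwards it has the degree of a cap. -/
theorem one_cup (k : ℕ) : IsTwistMap k (k + 2) (-1) (1 : KSAlg F) := by
  refine ⟨fun r => by rw [swap_pow_add_two, one_mul, mul_one], fun X j v hv z => ?_⟩
  have e : -1 + j + z.offset (k + 2) = j + z.offset k := by
    cases z <;> simp only [KSVertex.offset] <;> omega
  rw [e, map_one]
  exact hv z

theorem one_cap (k : ℕ) : IsTwistMap (k + 2) k 1 (1 : KSAlg F) := by
  refine ⟨fun r => by rw [swap_pow_add_two, one_mul, mul_one], fun X j v hv z => ?_⟩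
  have e : 1 + j + z.offset k = j + z.offset (k + 2) := by
    cases z <;> simp only [KSVertex.offset] <;> omega
  rw [e, map_one]
  exact hv z

theorem arrow (k : ℕ) : IsTwistMap k (k + 1) 0 (arrow F) := by
  refine ⟨fun r => by rw [arrow_mul, pow_succ', AlgHom.mul_apply], fun X j v hv => ?_⟩
  rw [zero_add]
  exact DGMod.arrow_act_mem hv

theorem elem (g : Elem) {k : ℕ} (hk : g.src ≤ k) :
    IsTwistMap k (k - g.src + g.tgt) g.deg (KSAlg.arrow F ^ g.halfStrands) := by
  obtain ⟨k, rfl⟩ := Nat.exists_eq_add_of_le' hk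
  rw [Nat.add_sub_cancel]
  cases g with
  | cup =>
    change IsTwistMap k (k + 2) (-1) (KSAlg.arrow F ^ 0)
    rw [pow_zero]
    exact one_cup k
  | cap =>
    change IsTwistMap (k + 2) k 1 (KSAlg.arrow F ^ 0)
    rw [pow_zero]
    exact one_cap k
  | hf =>
    change IsTwistMap k (k + 1) 0 (KSAlg.arrow F ^ 1)
    rw [pow_one]
    exact arrow k

theorem word {k l : ℕ} {w : List GenDiag} (h : Runs k w l) :
    IsTwistMap k l (wordDeg w) (KSAlg.arrow F ^ wordHalfStrands w) := by
  induction w generalizing k with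
  | nil =>
    cases h
    exact ⟨fun r => by rw [wordHalfStrands, List.map_nil, List.sum_nil, pow_zero, one_mul, mul_one],
      fun X j v hv => by simpa [wordDeg, wordHalfStrands] using hv⟩
  | cons g w ih =>
    have h1 := (elem (F := F) g.1 ((Nat.le_add_left _ _).trans h.1)).mul (ih h.2)
    rw [← pow_add, add_comm (wordHalfStrands w)] at h1
    exact h1

theorem diag {k l : ℕ} (x : Diag k l) :
    IsTwistMap k l x.deg (KSAlg.arrow F ^ x.halfStrands) := by
  induction x using Diag.ind with | h w hw
  exact word hw

end KSAlg.IsTwistMap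

namespace QHom

/-- The element of the quiver algebra by which a linear combination of diagrams acts. -/
noncomputable def toAlg (k l : ℕ) : QHom F k l →ₗ[F] KSAlg F :=
  Finsupp.linearCombination F fun x => arrow F ^ x.halfStrands

theorem toAlg_single {k l : ℕ} (x : Diag k l) (c : F) :
    toAlg k l (Finsupp.single x c) = c • arrow F ^ x.halfStrands :=
  Finsupp.linearCombination_single _ _ _

theorem toAlg_one {k l : ℕ} (h : k = l) : toAlg k l (one h : QHom F k l) = 1 := by
  rw [one, toAlg_single, Diag.halfStrands_one, pow_zero, one_smul]

theorem toAlg_comp {k l m : ℕ} (f : QHom F k l) (g : QHom F l m) :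
    toAlg k m (comp f g) = toAlg l m g * toAlg k l f := by
  induction f using Finsupp.induction_linear with
  | zero => simp only [zero_comp, map_zero, mul_zero]
  | add f f' h1 h2 => simp only [add_comp, map_add, mul_add, h1, h2]
  | single f a =>
  induction g using Finsupp.induction_linear with
  | zero => simp only [comp_zero, map_zero, zero_mul]
  | add f f' h1 h2 => simp only [comp_add, map_add, add_mul, h1, h2]
  | single g b =>
    rw [comp_single, toAlg_single, toAlg_single, toAlg_single, Diag.halfStrands_comp,
      smul_mul_smul_comm, ← pow_add, add_comm, mul_comm]

theorem toAlg_tens {k l k' l' : ℕ} (f : QHom F k l) (g : QHom F k' l') :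
    toAlg _ _ (tens f g) = toAlg k l f * toAlg k' l' g := by
  induction f using Finsupp.induction_linear with
  | zero => simp only [zero_tens, map_zero, zero_mul]
  | add f f' h1 h2 => simp only [add_tens, map_add, add_mul, h1, h2]
  | single f a =>
  induction g using Finsupp.induction_linear with
  | zero => simp only [tens_zero, map_zero, mul_zero]
  | add f f' h1 h2 => simp only [tens_add, map_add, mul_add, h1, h2]
  | single g b =>
    rw [tens_single, toAlg_single, toAlg_single, toAlg_single, Diag.halfStrands_tens,
      smul_mul_smul_comm, ← pow_add]

/-- Diagrams act through polynomials in a + b, which `swap` fixes; so a diagram acts on a twisted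
module by the same operator as on the module itself. This is why a tensor product of diagrams acts
simply by a product. -/
theorem swap_pow_toAlg {k l : ℕ} (n : ℕ) (f : QHom F k l) :
    (swap F ^ n) (toAlg k l f) = toAlg k l f := by
  induction f using Finsupp.induction_linear with
  | zero => simp only [map_zero]
  | add f f' h1 h2 => simp only [map_add, h1, h2]
  | single f a => rw [toAlg_single, map_smul, swap_pow_arrow_pow]

theorem isTwistMap_toAlg {k l : ℕ} {n : ℤ} {f : QHom F k l} (hf : f ∈ gr F k l n) :
    IsTwistMap k l n (toAlg k l f) := by
  refine gr_induction (p := fun f => IsTwistMap k l n (toAlg k l f)) ?_ ?_ ?_ hf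
  · rw [map_zero]; exact .zero k l n
  · intro x y hx hy; rw [map_add]; exact hx.add hy
  · intro x a hx
    rw [toAlg_single, ← hx]
    exact (IsTwistMap.diag x).smul a

theorem toAlg_mul_swap_pow {k l : ℕ} (f : QHom F k l) (r : KSAlg F) :
    toAlg k l f * (swap F ^ k) r = (swap F ^ l) r * toAlg k l f := by
  induction f using Finsupp.induction_linear with
  | zero => rw [map_zero, zero_mul, mul_zero]
  | add f g hf hg => rw [map_add, add_mul, mul_add, hf, hg]
  | single x a => exact (isTwistMap_toAlg (single_mem x a rfl)).1 r

end QHom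

end DiagramAction

/-! ### The action of twisted complexes on DG modules by families of twists. -/

section ActionOnModules

open KSAlg DGCategory

variable {F : Type u} [Field F]

section Matrices

variable {V : Type*} [AddCommGroup V] [Module F V] {ι ι' ι'' : Type}

/-- The action of the quiver algebra on a power of `V`, twisted `k i` times in the component `i`. -/
noncomputable def KSAlg.piAct (k : ι → ℕ) (φ : KSAlg F →ₐ[F] Module.End F V) :
    KSAlg F →ₐ[F] Module.End F (ι → V) where
  toFun r := LinearMap.pi fun i => (φ ((swap F ^ k i) r)).comp (LinearMap.proj i)
  map_one' := LinearMap.ext fun v => funext fun i => by simp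
  map_mul' r s := LinearMap.ext fun v => funext fun i => by simp
  map_zero' := LinearMap.ext fun v => funext fun i => by simp
  map_add' r s := LinearMap.ext fun v => funext fun i => by simp
  commutes' c := LinearMap.ext fun v => funext fun i => by simp [Algebra.algebraMap_eq_smul_one]

theorem KSAlg.piAct_apply (k : ι → ℕ) (φ : KSAlg F →ₐ[F] Module.End F V) (r : KSAlg F)
    (v : ι → V) (i : ι) : piAct k φ r v i = φ ((swap F ^ k i) r) (v i) := rfl

namespace QMat

variable [Fintype ι] {k : ι → ℕ} {k' : ι' → ℕ} {k'' : ι'' → ℕ}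

/-- The linear map by which a matrix of combinations of diagrams acts. -/
noncomputable def matAct (φ : KSAlg F →ₐ[F] Module.End F V) (f : QMat F k k') :
    (ι → V) →ₗ[F] (ι' → V) :=
  LinearMap.pi fun j => ∑ i, (φ (QHom.toAlg _ _ (f i j))).comp (LinearMap.proj i)

variable (φ : KSAlg F →ₐ[F] Module.End F V)

theorem matAct_apply (f : QMat F k k') (v : ι → V) (j : ι') :
    matAct φ f v j = ∑ i, φ (QHom.toAlg _ _ (f i j)) (v i) := by
  simp [matAct]

theorem matAct_add (f g : QMat F k k') : matAct φ (f + g) = matAct φ f + matAct φ g := by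
  refine LinearMap.ext fun v => funext fun j => ?_
  simp only [LinearMap.add_apply, Pi.add_apply, matAct_apply, map_add, Finset.sum_add_distrib]

theorem matAct_smul (c : F) (f : QMat F k k') : matAct φ (c • f) = c • matAct φ f := by
  refine LinearMap.ext fun v => funext fun j => ?_
  simp only [LinearMap.smul_apply, Pi.smul_apply, matAct_apply, map_smul, Finset.smul_sum]

theorem matAct_zero : matAct φ (0 : QMat F k k') = 0 := by
  rw [← zero_smul F (0 : QMat F k k'), matAct_smul, zero_smul]

theorem matAct_mul [Fintype ι'] (f : QMat F k k') (g : QMat F k' k'') (v : ι → V) :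
    matAct φ (mul f g) v = matAct φ g (matAct φ f v) := by
  funext j
  simp only [matAct_apply, mul, map_sum, QHom.toAlg_comp, map_mul, LinearMap.sum_apply,
    Module.End.mul_apply]
  exact Finset.sum_comm

theorem matAct_perm (e : ι ≃ ι') (h : ∀ i, k i = k' (e i)) (v : ι → V) (i : ι) :
    matAct φ (perm e h : QMat F k k') v (e i) = v i := by
  rw [matAct_apply, Finset.sum_eq_single i, perm_apply_self, QHom.toAlg_one, map_one]
  · rfl
  · intro j _ hj
    rw [perm_apply_of_ne _ _ (fun hji => hj (e.injective hji)), map_zero, map_zero]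
    rfl
  · simp

theorem matAct_id (v : ι → V) : matAct φ (QMat.id k : QMat F k k) v = v :=
  funext fun i => matAct_perm φ (Equiv.refl ι) (fun _ => rfl) v i

theorem matAct_piAct (f : QMat F k k') (r : KSAlg F) (v : ι → V) :
    matAct φ f (piAct k φ r v) = piAct k' φ r (matAct φ f v) := by
  funext j
  simp only [matAct_apply, piAct_apply, map_sum, ← Module.End.mul_apply, ← map_mul,
    QHom.toAlg_mul_swap_pow]

theorem matAct_compLeft {W : Type*} [AddCommGroup W] [Module F W]
    (ψ : KSAlg F →ₐ[F] Module.End F W) {g : V →ₗ[F] W} (hg : ∀ r v, g (φ r v) = ψ r (g v))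
    (f : QMat F k k') (v : ι → V) :
    matAct ψ f (g.compLeft ι v) = g.compLeft ι' (matAct φ f v) := by
  funext j
  simp only [matAct_apply, LinearMap.compLeft_apply, Function.comp_apply, map_sum, hg]

/-- First g acts inside each block, then f acts on the resulting twisted modules. The twist in
`piAct l'` does not affect the operators of f, by `swap_pow_toAlg`. -/
theorem matAct_tens {κ κ' : Type} [Fintype κ] {l : κ → ℕ} {l' : κ' → ℕ}
    (f : QMat F k k') (g : QMat F l l') (v : ι × κ → V) (i : ι') (j : κ') :
    matAct φ (tens f g) v (i, j) =
      matAct (piAct l' φ) f (fun i => matAct φ g fun j => v (i, j)) i j := by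
  simp only [matAct_apply, tens, QHom.toAlg_tens, Fintype.sum_prod_type, Finset.sum_apply,
    piAct_apply, QHom.swap_pow_toAlg, map_mul, Module.End.mul_apply, map_sum]

end QMat

end Matrices

namespace DGMod

open QMat

variable {X Y Z : DGMod F}

section Isomorphisms

variable [CharP F 2]

/-- The isomorphism of DG modules given by a bijective linear map which preserves the actions and
the degrees. -/
def isoOfLinearEquiv (e : X.V ≃ₗ[F] Y.V) (ha : ∀ r v, e (X.act r v) = Y.act r (e v))
    (hg : ∀ n v, e v ∈ Y.gr n ↔ v ∈ X.gr n) : X ≅ Y where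
  hom := ofLin e.toLinearMap (mem_homSpace (n := 0) ⟨ha, fun i v hv => by
    rw [zero_add]; exact (hg i v).2 hv⟩)
  inv := ofLin e.symm.toLinearMap (mem_homSpace (n := 0) ⟨fun r v => by
    change e.symm _ = X.act r (e.symm v)
    rw [LinearEquiv.symm_apply_eq, ha, LinearEquiv.apply_symm_apply], fun i v hv => by
    change e.symm v ∈ _
    rw [zero_add, ← hg, LinearEquiv.apply_symm_apply]; exact hv⟩)
  hom_inv_id := hom_ext (LinearMap.ext fun v => e.symm_apply_apply v)
  inv_hom_id := hom_ext (LinearMap.ext fun v => e.apply_symm_apply v)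

theorem mem_cycles {f : X ⟶ Y} (h : toLin f ∈ homDeg X Y 0)
    (hd : ∀ v, toLin f (X.d v) = Y.d (toLin f v)) : f ∈ cycles F X Y := by
  refine ⟨h, hom_ext (LinearMap.ext fun v => ?_)⟩
  change Y.d (toLin f v) + toLin f (X.d v) = 0
  rw [hd]
  exact TwI.add_self (F := F) _

variable (e : X.V ≃ₗ[F] Y.V) (ha : ∀ r v, e (X.act r v) = Y.act r (e v))
    (hg : ∀ n v, e v ∈ Y.gr n ↔ v ∈ X.gr n)

theorem isoOfLinearEquiv_hom_mem (hd : ∀ v, e (X.d v) = Y.d (e v)) :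
    (isoOfLinearEquiv e ha hg).hom ∈ cycles F X Y :=
  mem_cycles ⟨ha, fun i v hv => by rw [zero_add]; exact (hg i v).2 hv⟩ hd

theorem isoOfLinearEquiv_inv_mem (hd : ∀ v, e (X.d v) = Y.d (e v)) :
    (isoOfLinearEquiv e ha hg).inv ∈ cycles F Y X :=
  mem_cycles ⟨fun r v => by
    change e.symm _ = X.act r (e.symm v)
    rw [LinearEquiv.symm_apply_eq, ha, LinearEquiv.apply_symm_apply], fun i v hv => by
    change e.symm v ∈ _
    rw [zero_add, ← hg, LinearEquiv.apply_symm_apply]; exact hv⟩ fun v => by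
    change e.symm _ = X.d (e.symm v)
    rw [LinearEquiv.symm_apply_eq, hd, LinearEquiv.apply_symm_apply]

end Isomorphisms

/-- The elements of degree `n` of `A ⊙ X`. -/
noncomputable def actGr (A : TwI F) (X : DGMod F) (n : ℤ) : Submodule F (A.ι → X.V) :=
  Submodule.pi Set.univ fun i => X.twGr (A.k i) (n + A.m i)

theorem mem_actGr {A : TwI F} {n : ℤ} {v : A.ι → X.V} :
    v ∈ actGr A X n ↔ ∀ i, v i ∈ X.twGr (A.k i) (n + A.m i) := by
  simp [actGr, Submodule.mem_pi]

theorem matAct_mem {A B : TwI F} {n j : ℤ} {f : QMat F A.k B.k} (hf : f ∈ TwI.gr A B n)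
    {v : A.ι → X.V} (hv : v ∈ actGr A X j) : matAct X.act f v ∈ actGr B X (n + j) := by
  rw [mem_actGr] at *
  intro i'
  rw [matAct_apply]
  refine Submodule.sum_mem _ fun i _ => ?_
  have h := (QHom.isTwistMap_toAlg (TwI.mem_gr.1 hf i i')).2 X _ _ (hv i)
  have e : n + (B.m i' - A.m i) + (j + A.m i) = n + j + B.m i' := by ring
  rwa [e] at h

theorem compLeft_mem {A : TwI F} {n j : ℤ} {g : X.V →ₗ[F] Y.V} (hg : g ∈ homDeg X Y n)
    {v : A.ι → X.V} (hv : v ∈ actGr A X j) : g.compLeft A.ι v ∈ actGr A Y (n + j) := by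
  rw [mem_actGr] at *
  intro i
  rw [add_assoc]
  exact map_twGr hg (hv i)

theorem matAct_d (A B : TwI F) (f : QMat F A.k B.k) (v : A.ι → X.V) :
    matAct X.act f (X.d.compLeft A.ι v) = X.d.compLeft B.ι (matAct X.act f v) :=
  matAct_compLeft _ _ X.d_act _ _

/-- The differential of `A ⊙ X`. -/
noncomputable def actD (A : TwI F) (X : DGMod F) : (A.ι → X.V) →ₗ[F] (A.ι → X.V) :=
  X.d.compLeft A.ι + matAct X.act A.f

theorem actD_apply (A : TwI F) (v : A.ι → X.V) :
    actD A X v = X.d.compLeft A.ι v + matAct X.act A.f v := rfl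

theorem compLeft_piAct {A : TwI F} {g : X.V →ₗ[F] Y.V} (hg : ∀ r v, g (X.act r v) = Y.act r (g v))
    (r : KSAlg F) (v : A.ι → X.V) :
    g.compLeft A.ι (piAct A.k X.act r v) = piAct A.k Y.act r (g.compLeft A.ι v) :=
  funext fun _ => hg _ _

theorem toLin_act (g : X ⟶ Y) (r : KSAlg F) (v : X.V) :
    toLin g (X.act r v) = Y.act r (toLin g v) :=
  DGBimod.act_of_mem_homSpace g.2 r v

theorem unit_mem (X : DGMod F) (n : ℤ) (v : Unit → X.V) :
    v () ∈ X.gr n ↔ v ∈ actGr (TwI.pow F 0) X n := by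
  refine Iff.trans ?_ mem_actGr.symm
  change _ ↔ ∀ _, v _ ∈ X.twGr 0 (n + 0)
  simp only [add_zero, mem_twGr_zero]
  exact ⟨fun h _ => h, fun h => h ()⟩

theorem unit_d (X : DGMod F) (n : ℕ) (v : Unit → X.V) (i : Unit) :
    actD (TwI.pow F n) X v i = X.d (v i) := by
  change X.d (v i) + matAct X.act (0 : QMat F (TwI.pow F n).k (TwI.pow F n).k) v i = _
  rw [matAct_zero]
  exact add_zero _

variable [CharP F 2]

/-- The DG module `A ⊙ X`: the direct sum of twists of `X` indexed by the summands of `A`. -/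
noncomputable def actObj (A : TwI F) (X : DGMod F) : DGMod F where
  V := A.ι → X.V
  act := piAct A.k X.act
  gr := actGr A X
  isInternal := isInternal_pi fun i => isInternal_reindex (X.isInternal_twGr (A.k i)) (A.m i)
  act_mem hr hv := mem_actGr.2 fun i => by
    rw [add_assoc]
    exact act_swap_pow_mem hr (mem_actGr.1 hv i)
  d := actD A X
  d_mem hv := by
    rw [add_comm]
    exact add_mem (compLeft_mem X.d_mem_homDeg hv) (matAct_mem A.f_mem_gr hv)
  d_act r v := by
    rw [actD_apply, actD_apply, matAct_piAct, map_add]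
    refine congrArg (· + _) (funext fun i => ?_)
    exact X.d_act _ _
  d_d v := by
    have h1 : X.d.compLeft A.ι (X.d.compLeft A.ι v) = 0 := funext fun i => X.d_d _
    rw [actD_apply, actD_apply, map_add, map_add, h1, matAct_d, ← matAct_mul, A.f_sq, matAct_zero,
      LinearMap.zero_apply, zero_add, add_zero]
    exact TwI.add_self (F := F) _

theorem matAct_mem_homDeg {A B : TwI F} {n : ℤ} {f : QMat F A.k B.k} (hf : f ∈ TwI.gr A B n) :
    matAct X.act f ∈ homDeg (actObj A X) (actObj B X) n :=
  ⟨matAct_piAct _ f, fun _ _ hv => matAct_mem hf hv⟩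

theorem compLeft_mem_homDeg (A : TwI F) {n : ℤ} {g : X.V →ₗ[F] Y.V} (hg : g ∈ homDeg X Y n) :
    g.compLeft A.ι ∈ homDeg (actObj A X) (actObj A Y) n :=
  ⟨compLeft_piAct hg.1, fun _ _ hv => compLeft_mem hg hv⟩

theorem matAct_mem_homSpace (X : DGMod F) {A B : TwI F} (f : QMat F A.k B.k) :
    matAct X.act f ∈ HomSpace (actObj A X) (actObj B X) := by
  induction f using homogeneous_induction (TwI.isInternal_gr A B) with
  | hg n f hf => exact mem_homSpace (matAct_mem_homDeg hf)
  | h0 => rw [matAct_zero]; exact zero_mem _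
  | ha f g hf hg => rw [matAct_add]; exact add_mem hf hg

theorem compLeft_mem_homSpace (A : TwI F) {g : X.V →ₗ[F] Y.V} (hg : g ∈ HomSpace X Y) :
    g.compLeft A.ι ∈ HomSpace (actObj A X) (actObj A Y) := by
  refine homSpace_induction (p := fun g => g.compLeft A.ι ∈ HomSpace (actObj A X) (actObj A Y)) hg
    (fun n g hg => mem_homSpace (compLeft_mem_homDeg A hg)) ?_ fun f g hf hg => ?_
  · exact zero_mem (HomSpace (actObj A X) (actObj A Y))
  · exact add_mem hf hg

/-- The morphism `A ⊙ X ⟶ B ⊙ X` given by a morphism `A ⟶ B`. -/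
noncomputable def leftHom {A B : TwI F} (f : A ⟶ B) (X : DGMod F) : actObj A X ⟶ actObj B X :=
  ofLin (matAct X.act f) (matAct_mem_homSpace X f)

/-- The morphism `A ⊙ X ⟶ A ⊙ Y` given by a morphism `X ⟶ Y`. -/
noncomputable def rightHom (A : TwI F) (g : X ⟶ Y) : actObj A X ⟶ actObj A Y :=
  ofLin ((toLin g).compLeft A.ι) (compLeft_mem_homSpace A g.2)

theorem exchange {A B : TwI F} (f : A ⟶ B) (g : X ⟶ Y) (v : A.ι → X.V) :
    toLin (leftHom f Y) (toLin (rightHom A g) v) = toLin (rightHom B g) (toLin (leftHom f X) v) :=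
  matAct_compLeft _ _ (toLin_act g) _ _

theorem d_leftHom {A B : TwI F} (f : A ⟶ B) (X : DGMod F) :
    homD (actObj A X) (actObj B X) (leftHom f X) = leftHom (TwI.d A B f) X := by
  refine hom_ext (LinearMap.ext fun (v : A.ι → X.V) => ?_)
  change actD B X (matAct X.act f v) + matAct X.act f (actD A X v) =
    matAct X.act (mul A.f f + mul f B.f) v
  rw [actD_apply, actD_apply, map_add, matAct_d, matAct_add, LinearMap.add_apply, matAct_mul,
    matAct_mul]
  have h := TwI.add_self (F := F) (X.d.compLeft B.ι (matAct X.act f v))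
  calc _ = (X.d.compLeft B.ι (matAct X.act f v) + X.d.compLeft B.ι (matAct X.act f v)) +
        (matAct X.act f (matAct X.act A.f v) + matAct X.act B.f (matAct X.act f v)) := by abel
    _ = _ := by rw [h, zero_add]

theorem d_rightHom (A : TwI F) (g : X ⟶ Y) :
    homD (actObj A X) (actObj A Y) (rightHom A g) = rightHom A (homD X Y g) := by
  refine hom_ext (LinearMap.ext fun (v : A.ι → X.V) => ?_)
  change actD A Y ((toLin g).compLeft A.ι v) + (toLin g).compLeft A.ι (actD A X v) = _
  rw [actD_apply, actD_apply, map_add, matAct_compLeft _ _ (toLin_act g)]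
  have h := TwI.add_self (F := F) ((toLin g).compLeft A.ι (matAct X.act A.f v))
  calc _ = (Y.d.compLeft A.ι ((toLin g).compLeft A.ι v) +
        (toLin g).compLeft A.ι (X.d.compLeft A.ι v)) +
        ((toLin g).compLeft A.ι (matAct X.act A.f v) +
        (toLin g).compLeft A.ι (matAct X.act A.f v)) := by abel
    _ = _ := by rw [h, add_zero]; rfl

/-! ### The structural isomorphisms -/

/-- Both differentials consist of the differential of X, the contribution of A and that of B; only
the grouping differs. -/
theorem curry_d (A B : TwI F) (X : DGMod F) (v : A.ι × B.ι → X.V) :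
    LinearEquiv.curry F X.V A.ι B.ι (actD (TwI.tensorObj A B) X v) =
      actD A (actObj B X) (LinearEquiv.curry F X.V A.ι B.ι v) := by
  funext i j
  change X.d (v (i, j)) + matAct X.act (tens A.f (QMat.id B.k) + tens (QMat.id A.k) B.f) v (i, j) =
    (X.d (v (i, j)) + matAct X.act B.f (fun j => v (i, j)) j) +
      matAct (piAct B.k X.act) A.f (fun i j => v (i, j)) i j
  rw [matAct_add, LinearMap.add_apply, Pi.add_apply, matAct_tens, matAct_tens, matAct_id]
  simp only [matAct_id]
  abel

/-- Componentwise this is the statement that twists compose, `twGr_twGr`, up to reordering the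
shifts of A and B. -/
theorem curry_mem (A B : TwI F) (X : DGMod F) (n : ℤ) (v : A.ι × B.ι → X.V) :
    LinearEquiv.curry F X.V A.ι B.ι v ∈ actGr A (actObj B X) n ↔
      v ∈ actGr (TwI.tensorObj A B) X n := by
  refine Iff.trans mem_actGr (Iff.trans ?_ mem_actGr.symm)
  have key : ∀ i j, (∀ z : KSVertex, X.act ((swap F ^ B.k j) (gen F z.e)) (v (i, j)) ∈
      X.twGr (B.k j) (n + A.m i + z.offset (A.k i) + B.m j)) ↔
      v (i, j) ∈ X.twGr (A.k i + B.k j) (n + (A.m i + B.m j)) := fun i j => by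
    rw [← twGr_twGr]
    refine forall_congr' fun z => ?_
    have e : n + A.m i + z.offset (A.k i) + B.m j = n + (A.m i + B.m j) + z.offset (A.k i) := by
      ring
    rw [e]
  constructor
  · rintro h ⟨i, j⟩
    exact (key i j).1 fun z => mem_actGr.1 (h i z) j
  · intro h i z
    exact mem_actGr.2 fun j => (key i j).2 (h (i, j)) z

theorem curry_act (A B : TwI F) (X : DGMod F) (r : KSAlg F) (v : A.ι × B.ι → X.V) :
    LinearEquiv.curry F X.V A.ι B.ι (piAct (TwI.tensorObj A B).k X.act r v) =
      piAct A.k (piAct B.k X.act) r (LinearEquiv.curry F X.V A.ι B.ι v) := by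
  funext i j
  change X.act ((swap F ^ (A.k i + B.k j)) r) (v (i, j)) =
    X.act ((swap F ^ B.k j) ((swap F ^ A.k i) r)) (v (i, j))
  rw [add_comm, pow_add, AlgHom.mul_apply]

/-- The isomorphism `(A ⊗ B) ⊙ X ≅ A ⊙ (B ⊙ X)`. -/
noncomputable def actAssoc (A B : TwI F) (X : DGMod F) :
    actObj (TwI.tensorObj A B) X ≅ actObj A (actObj B X) :=
  isoOfLinearEquiv (X := actObj (TwI.tensorObj A B) X) (Y := actObj A (actObj B X))
    (LinearEquiv.curry F X.V A.ι B.ι) (curry_act A B X) (curry_mem A B X)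

/-- The isomorphism `𝟙 ⊙ X ≅ X`. -/
noncomputable def actUnit (X : DGMod F) : actObj (TwI.pow F 0) X ≅ X :=
  isoOfLinearEquiv (X := actObj (TwI.pow F 0) X) (LinearEquiv.funUnique Unit F X.V)
    (fun _ _ => rfl) (fun n v => unit_mem X n v)

/-- The underlying spaces are families indexed by products, and the structural isomorphisms curry or
evaluate them. Each coherence condition therefore says how an identity or permutation matrix acts,
or how a tensor product of matrices does. -/
noncomputable instance : MonoidalLeftAction (TwI F) (DGMod F) where
  actionObj := actObj
  actionHomLeft := leftHom
  actionHomRight A _ _ g := rightHom A g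
  actionAssocIso := actAssoc
  actionUnitIso := actUnit
  actionHom_def _ _ := rfl
  actionHomRight_id _ _ := rfl
  id_actionHomLeft A X := hom_ext (LinearMap.ext fun v => matAct_id X.act v)
  -- Interchange: a matrix of diagrams commutes with a homomorphism applied to every component.
  actionHom_comp {A B C X Y Z} f f' g g' := hom_ext (LinearMap.ext fun v => by
    change toLin (rightHom C g') (toLin (rightHom C g) (matAct X.act (mul f f') v)) =
      toLin (rightHom C g') (toLin (leftHom f' Y) (toLin (rightHom B g) (toLin (leftHom f X) v)))
    exact congrArg (toLin (rightHom C g')) ((congrArg (toLin (rightHom C g))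
      (matAct_mul X.act f f' v)).trans (exchange f' g _).symm))
  actionAssocIso_hom_naturality {A A' B B' X Y} f g h := hom_ext (LinearMap.ext fun v => by
    funext i j
    refine (congrArg (toLin h) (matAct_tens X.act f g v i j)).trans ?_
    exact congrArg (toLin h) (congrFun (congrFun (matAct_compLeft (piAct B.k X.act)
      (piAct B'.k X.act) (matAct_piAct X.act g) f fun i j => v (i, j)) i) j))
  actionUnitIso_hom_naturality _ := rfl
  whiskerLeft_actionHomLeft A B C f X := hom_ext (LinearMap.ext fun v => by
    funext ⟨i, j⟩
    refine (matAct_tens X.act (QMat.id A.k) f v i j).trans ?_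
    rw [matAct_id]
    rfl)
  whiskerRight_actionHomLeft {A B} C f X := hom_ext (LinearMap.ext fun v => by
    funext ⟨i, j⟩
    refine (matAct_tens X.act f (QMat.id C.k) v i j).trans ?_
    simp only [matAct_id]
    rfl)
  associator_actionHom A B C X := hom_ext (LinearMap.ext fun v => by
    funext i j l
    exact matAct_perm (k := (TwI.tensorObj (TwI.tensorObj A B) C).k)
      (k' := (TwI.tensorObj A (TwI.tensorObj B C)).k) X.act (Equiv.prodAssoc A.ι B.ι C.ι)
      (fun _ => add_assoc _ _ _) v ((i, j), l))
  leftUnitor_actionHom A X := hom_ext (LinearMap.ext fun v => by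
    funext i
    exact matAct_perm (k := (TwI.tensorObj (TwI.pow F 0) A).k) X.act (Equiv.punitProd A.ι)
      (fun _ => zero_add _) v ((), i))
  rightUnitor_actionHom A X := hom_ext (LinearMap.ext fun v => by
    funext i
    exact matAct_perm (k := (TwI.tensorObj A (TwI.pow F 0)).k) X.act (Equiv.prodPUnit A.ι)
      (fun _ => add_zero _) v (i, ()))

end DGMod

end ActionOnModules

/-! ### The bimodule M as a twist of the regular bimodule, and its square. -/

section TwistBimodule

open KSAlg DGCategory MulOpposite

variable {F : Type u} [Field F]

namespace KSAlg

theorem mul_ex_add_mul_ey (r : KSAlg F) :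
    r * gen F KSVertex.x.e + r * gen F KSVertex.y.e = r := by
  rw [← mul_add]
  change r * (gen F KSGen.ex + gen F KSGen.ey) = r
  rw [gen_ex_add_ey, mul_one]

theorem mul_e_of_mem_of_ne {z z' : KSVertex} (hz : z ≠ z') {r : KSAlg F} (h : r ∈ leftIdeal F z) :
    r * gen F z'.e = 0 := by
  rw [← mul_e_of_mem h, mul_assoc, gen_mul_gen_of_ne hz, mul_zero]

/-- The bijection from `M` to `R` which sends the sum of the generators to the unit. -/
noncomputable def bimodEquiv (F : Type u) [Field F] : BimodSpace F ≃ₗ[F] KSAlg F where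
  toFun v := v.1 + v.2
  map_add' v w := add_add_add_comm v.1.1 w.1.1 v.2.1 w.2.1
  map_smul' c v := (smul_add c v.1.1 v.2.1).symm
  invFun r := (⟨r * gen F KSVertex.y.e, mul_e_mem _ r⟩, ⟨r * gen F KSVertex.x.e, mul_e_mem _ r⟩)
  left_inv v := Prod.ext (Subtype.ext (by
      change (v.1.1 + v.2.1) * _ = _
      rw [add_mul, mul_e_of_mem v.1.2, mul_e_of_mem_of_ne (by simp) v.2.2, add_zero]))
    (Subtype.ext (by
      change (v.1.1 + v.2.1) * _ = _
      rw [add_mul, mul_e_of_mem v.2.2, mul_e_of_mem_of_ne (by simp) v.1.2, zero_add]))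
  right_inv r := (add_comm _ _).trans (mul_ex_add_mul_ey r)

theorem bimodEquiv_leftAction (r : KSAlg F) (v : BimodSpace F) :
    bimodEquiv F (leftAction F r v) = r * bimodEquiv F v :=
  (mul_add r v.1.1 v.2.1).symm

/-- With u = m + m', the defining relations of M say that u g = swap(g) u for every generator g: for
instance u a = m a = b m' = b u, since b kills m. So right multiplication on M becomes right
multiplication by the swapped generator on R. -/
theorem bimodEquiv_rightGen (g : KSGen) (v : BimodSpace F) :
    bimodEquiv F (rightGen g v) = bimodEquiv F v * gen F g.swap := by
  have h1 : ∀ s, v.1.1 * (gen F KSGen.ex * s) = 0 := fun s => by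
    rw [← mul_assoc]
    exact (congrArg (· * s) (mul_e_of_mem_of_ne (z' := .x) (by simp) v.1.2)).trans (zero_mul s)
  have h2 : ∀ s, v.2.1 * (gen F KSGen.ey * s) = 0 := fun s => by
    rw [← mul_assoc]
    exact (congrArg (· * s) (mul_e_of_mem_of_ne (z' := .y) (by simp) v.2.2)).trans (zero_mul s)
  have h3 : v.1.1 * gen F KSGen.ey = v.1.1 := mul_e_of_mem v.1.2
  have h4 : v.2.1 * gen F KSGen.ex = v.2.1 := mul_e_of_mem v.2.2
  cases g with
  | ex =>
    change v.1.1 + 0 = (v.1.1 + v.2.1) * gen F KSGen.ey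
    rw [add_mul, h3, ← gen_ey_ey, h2]
  | ey =>
    change 0 + v.2.1 = (v.1.1 + v.2.1) * gen F KSGen.ex
    rw [add_mul, h4, ← gen_ex_ex, h1]
  | a =>
    change 0 + v.1.1 * gen F KSGen.b = (v.1.1 + v.2.1) * gen F KSGen.b
    rw [add_mul, ← gen_ey_b, h2, zero_add, add_zero]
  | b =>
    change v.2.1 * gen F KSGen.a + 0 = (v.1.1 + v.2.1) * gen F KSGen.a
    rw [add_mul, ← gen_ex_a, h1, zero_add, add_zero]

theorem bimodEquiv_rightAction (r : KSAlg F) (v : BimodSpace F) :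
    bimodEquiv F (rightAction F (op r) v) = bimodEquiv F v * swap F r := by
  induction r using KSAlg.induction with
  | hw l =>
    induction l generalizing v with
    | nil => simp
    | cons g l ih =>
      rw [List.map_cons, List.prod_cons, rightAction_mul, rightAction_gen, ih, bimodEquiv_rightGen,
        map_mul, swap_gen, mul_assoc]
  | ha s t hs ht =>
    have e : op (s + t) = op s + op t := rfl
    rw [e, map_add, LinearMap.add_apply, map_add, hs, ht, map_add, mul_add]
  | hs c s hs =>
    have e : op (c • s) = c • op s := rfl
    rw [e, map_smul, LinearMap.smul_apply, map_smul, hs, map_smul, mul_smul_comm]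

end KSAlg

namespace DGBimod

open DGMod

variable (F) in
/-- The bijection from `M` to `R` which sends the sum of the generators to the unit. -/
noncomputable def sumEquiv : (M F).V ≃ₗ[F] KSAlg F := bimodEquiv F

theorem sumEquiv_act (r : KSAlg F) (m : (M F).V) :
    sumEquiv F ((M F).act r m) = r * sumEquiv F m := bimodEquiv_leftAction r m

theorem sumEquiv_right (r : KSAlg F) (m : (M F).V) :
    sumEquiv F ((M F).right (op r) m) = sumEquiv F m * swap F r := bimodEquiv_rightAction r m

variable (F) in
/-- The sum of the two generators of `M`. -/
noncomputable def sumGen : (M F).V := (sumEquiv F).symm 1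

theorem sumEquiv_sumGen : sumEquiv F (sumGen F) = 1 := LinearEquiv.apply_symm_apply _ _

/-- The sum of the two generators also generates M as a right module. This allows every factor m to
be moved across the tensor sign. -/
theorem sumGen_right (m : (M F).V) :
    (M F).right (op (swap F (sumEquiv F m))) (sumGen F) = m := by
  apply (sumEquiv F).injective
  rw [sumEquiv_right, swap_swap, sumEquiv_sumGen, one_mul]

/-- The idempotents split the sum into its homogeneous parts: e(x) picks m, of degree 0, and e(y)
picks m', of degree -1. These are the negatives of the offsets of one twist. -/
theorem sumGen_right_mem (z : KSVertex) :
    (M F).right (op (gen F z.e)) (sumGen F) ∈ (M F).gr (-z.offset 1) := by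
  cases z with
  | x =>
    change rightAction F (op (gen F KSGen.ex)) _ ∈ _
    rw [rightAction_gen]
    refine ⟨?_, zero_mem _⟩
    change 1 * gen F KSVertex.y.e ∈ KSAlg.gr F 0
    rw [one_mul]
    exact e_mem _
  | y =>
    change rightAction F (op (gen F KSGen.ey)) _ ∈ _
    rw [rightAction_gen]
    refine ⟨zero_mem _, ?_⟩
    change 1 * gen F KSVertex.x.e ∈ KSAlg.gr F 0
    rw [one_mul]
    exact e_mem _

variable (X : DGMod F)

/-- The bijection from `M ⊗ X` to `X`. -/
noncomputable def twistEquiv : TensSpace (M F) X ≃ₗ[F] X.V :=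
  LinearEquiv.ofLinearMap
    -- With u the sum of the generators, m ⊗ x = u swap(m) ⊗ x = u ⊗ swap(m) x, where m is regarded
    -- as an element of R. Hence m ⊗ x is sent to swap(m) x, and the inverse is x ↦ u ⊗ x.
    (tensLift (M := M F) (X := X)
      (X.act.toLinearMap.comp ((swap F).toLinearMap.comp (sumEquiv F).toLinearMap))
      fun m r x => by
        change X.act (swap F (sumEquiv F ((M F).right (op r) m))) x =
          X.act (swap F (sumEquiv F m)) (X.act r x)
        rw [sumEquiv_right, map_mul, swap_swap, act_act])
    (cls (M F) X (sumGen F))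
    (LinearMap.ext fun x => by
      change X.act (swap F (sumEquiv F (sumGen F))) x = x
      rw [sumEquiv_sumGen, map_one, map_one]
      rfl)
    (tens_ext fun m x => by
      change cls (M F) X (sumGen F) (X.act (swap F (sumEquiv F m)) x) = cls (M F) X m x
      rw [← cls_right, sumGen_right])

theorem twistEquiv_cls (m : (M F).V) (x : X.V) :
    twistEquiv X (cls (M F) X m x) = X.act (swap F (sumEquiv F m)) x := rfl

theorem twistEquiv_symm_apply (x : X.V) :
    (twistEquiv X).symm x = cls (M F) X (sumGen F) x := rfl

theorem twistEquiv_act (r : KSAlg F) (t : TensSpace (M F) X) :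
    twistEquiv X (tensLeft (M F) X r t) = X.act (swap F r) (twistEquiv X t) := by
  induction t using tens_induction with
  | hc m x => rw [tensLeft_cls, twistEquiv_cls, twistEquiv_cls, act_act, ← map_mul, sumEquiv_act]
  | ha s t hs ht => rw [map_add, map_add, map_add, map_add, hs, ht]

theorem e_act_mem_twGr_one {j : ℤ} {x : X.V} (hx : x ∈ X.gr j) (z : KSVertex) :
    X.act (gen F z.e) x ∈ X.twGr 1 (j - z.offset 1) := fun z' => by
  rw [act_act]
  by_cases hz : z' = z
  · subst hz
    rw [sub_add_cancel, e_mul_e]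
    exact X.act_e_mem _ hx
  · rw [gen_mul_gen_of_ne hz, map_zero]
    exact zero_mem _

/-- The swapped element ends in e(z), so only the component of x at z contributes, and in the
twisted grading that component has the single degree j minus its offset. -/
theorem act_swap_mem {z : KSVertex} {i j : ℤ} {r : KSAlg F} (hr : r ∈ KSAlg.gr F i)
    (hr' : r ∈ leftIdeal F z.swap) {x : X.V} (hx : x ∈ X.gr j) :
    X.act (swap F r) x ∈ X.twGr 1 (i + (j - z.offset 1)) := by
  have h := act_swap_pow_mem (k := 1) hr (e_act_mem_twGr_one X hx z)
  rwa [pow_one, act_act, ← KSVertex.swap_swap z, ← swap_e, ← map_mul, mul_e_of_mem hr',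
    KSVertex.swap_swap] at h

/-- One direction splits x at the vertices and the other splits m into its parts in P(y) and
P(x)[1]; neither u nor the identification of M with R is homogeneous as a whole. -/
theorem twistEquiv_mem {n : ℤ} {t : TensSpace (M F) X} :
    twistEquiv X t ∈ X.twGr 1 n ↔ t ∈ tensGr (M F) X n := by
  constructor
  · intro h
    rw [← (twistEquiv X).symm_apply_apply t, twistEquiv_symm_apply]
    generalize twistEquiv X t = x at h
    have key : ∀ z : KSVertex, cls (M F) X (sumGen F) (X.act (gen F z.e) x) ∈ tensGr (M F) X n := by
      intro z
      -- An idempotent crosses the tensor sign: u ⊗ e(z)x = u e(z) ⊗ e(z)x, a product of homogeneous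
      -- elements whose offsets cancel.
      have h1 := cls_mem (sumGen_right_mem z) (h z)
      rwa [cls_right, act_act, e_mul_e, add_comm n, neg_add_cancel_left] at h1
    rw [← X.act_ex_add_act_ey x, map_add]
    exact add_mem (key _) (key _)
  · refine map_mem_of_cls (f := (twistEquiv X).toLinearMap) fun i j m x hn hm hx => ?_
    change X.act (swap F (m.1.1 + m.2.1)) x ∈ _
    rw [map_add, map_add, ← hn]
    refine add_mem ?_ ?_
    · have h := act_swap_mem X (z := .x) hm.1 m.1.2 hx
      simpa [KSVertex.offset] using h
    · have h := act_swap_mem X (z := .y) hm.2 m.2.2 hx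
      have e : i + 1 + (j - KSVertex.y.offset 1) = i + j := by simp [KSVertex.offset]
      rwa [e] at h

theorem twistEquiv_d (t : TensSpace (M F) X) :
    twistEquiv X (tensD (M F) X t) = X.d (twistEquiv X t) := by
  induction t using tens_induction with
  | hc u v =>
    rw [tensD_cls]
    change twistEquiv X (cls (M F) X (0 : (M F).V) v + cls (M F) X u (X.d v)) = _
    rw [map_zero, LinearMap.zero_apply, zero_add, twistEquiv_cls, twistEquiv_cls, X.d_act]
  | ha s t hs ht => rw [map_add, map_add, map_add, map_add, hs, ht]

/-! ### The square of the bimodule -/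

/-- The bijection from `M ⊗ M` to `R`. -/
noncomputable def squareEquiv (F : Type u) [Field F] :
    TensSpace (M F) (M F).toDGMod ≃ₗ[F] KSAlg F :=
  -- The last `swap` turns the composite into u ⊗ v ↦ u swap(v), which is linear for the left and
  -- right actions without any twist.
  (twistEquiv (M F).toDGMod).trans ((sumEquiv F).trans (AlgEquiv.ofAlgHom (swap F) (swap F)
    (AlgHom.ext swap_swap) (AlgHom.ext swap_swap)).toLinearEquiv)

theorem squareEquiv_cls (u v : (M F).V) :
    squareEquiv F (cls (M F) (M F).toDGMod u v) = sumEquiv F u * swap F (sumEquiv F v) := by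
  change swap F (sumEquiv F ((M F).act (swap F (sumEquiv F u)) v)) = _
  rw [sumEquiv_act, map_mul, swap_swap]

theorem squareEquiv_left (r : KSAlg F) (t : TensSpace (M F) (M F).toDGMod) :
    squareEquiv F (tensLeft (M F) (M F).toDGMod r t) = r * squareEquiv F t := by
  induction t using tens_induction with
  | hc u v => rw [tensLeft_cls, squareEquiv_cls, squareEquiv_cls, sumEquiv_act, mul_assoc]
  | ha s t hs ht => rw [map_add, map_add, map_add, hs, ht, mul_add]

theorem squareEquiv_right (r : KSAlg F) (t : TensSpace (M F) (M F).toDGMod) :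
    squareEquiv F (tensRight (M F) (M F) (op r) t) = squareEquiv F t * r := by
  induction t using tens_induction with
  | hc u v =>
    rw [tensRight_cls, squareEquiv_cls, squareEquiv_cls, sumEquiv_right, map_mul, swap_swap,
      mul_assoc]
  | ha s t hs ht => rw [map_add, map_add, map_add, hs, ht, add_mul]

/-- On each block between two vertices `swap` is homogeneous, of a degree given by the offsets. The
proof applies `act_swap_mem` to the unit of the regular module. -/
theorem mul_swap_mem {z : KSVertex} {i j n : ℤ} {r s : KSAlg F} (hr : r ∈ KSAlg.gr F i)
    (hs : s ∈ KSAlg.gr F j) (z' : KSVertex) (hr' : r ∈ leftIdeal F z)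
    (hs' : s ∈ leftIdeal F z'.swap) (hn : i + (j - z'.offset 1 + z.offset 1) = n) :
    r * swap F s ∈ KSAlg.gr F n := by
  have h := act_swap_mem (regular F).toDGMod hs hs' (j := 0) one_mem_gr z
  have h' : gen F z.e * (swap F s * 1) ∈ KSAlg.gr F (j + (0 - z'.offset 1) + z.offset 1) := h
  rw [mul_one] at h'
  have h1 := mul_mem_gr hr h'
  rw [← mul_assoc, mul_e_of_mem hr'] at h1
  convert h1 using 2
  omega

theorem squareEquiv_mem {n : ℤ} {t : TensSpace (M F) (M F).toDGMod} :
    squareEquiv F t ∈ KSAlg.gr F (n + 1) ↔ t ∈ tensGr (M F) (M F).toDGMod n := by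
  constructor
  · intro h
    -- The element corresponding to 1 ∈ R has degree -1, which is the shift in R[1]. It generates
    -- the tensor square as a left module, so the degrees of all other elements are determined by
    -- it.
    have h1 : cls (M F) (M F).toDGMod (sumGen F) (sumGen F) ∈ tensGr (M F) (M F).toDGMod (-1) := by
      rw [← twistEquiv_mem, twistEquiv_cls, sumEquiv_sumGen, map_one, map_one]
      intro z
      have e : -1 + z.offset 1 = -z.swap.offset 1 := by
        cases z <;> simp [KSVertex.offset, KSVertex.swap]
      have e' : (M F).act (gen F z.e) (sumGen F) = (M F).right (op (gen F z.swap.e)) (sumGen F) :=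
          by
        apply (sumEquiv F).injective
        rw [sumEquiv_act, sumEquiv_right, swap_e, KSVertex.swap_swap, sumEquiv_sumGen, one_mul,
          mul_one]
      rw [e]
      exact e' ▸ sumGen_right_mem z.swap
    have h2 : t = tensLeft (M F) (M F).toDGMod (squareEquiv F t)
        (cls (M F) (M F).toDGMod (sumGen F) (sumGen F)) := by
      apply (squareEquiv F).injective
      rw [squareEquiv_left, squareEquiv_cls, sumEquiv_sumGen, map_one, mul_one, mul_one]
    rw [h2]
    refine map_mem_of_cls (f := tensLeft (M F) (M F).toDGMod (squareEquiv F t))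
      (fun i j u v hn hu hv => ?_) h1
    have h3 := cls_mem ((M F).act_mem h hu) hv
    have e : n + 1 + i + j = n := by omega
    rwa [e] at h3
  · refine map_mem_of_cls (f := (squareEquiv F).toLinearMap) fun i j u v hn hu hv => ?_
    subst hn
    change squareEquiv F _ ∈ _
    rw [squareEquiv_cls]
    change (u.1.1 + u.2.1) * swap F (v.1.1 + v.2.1) ∈ _
    rw [map_add, add_mul, mul_add, mul_add]
    -- The four blocks are m ⊗ m, m ⊗ m', m' ⊗ m and m' ⊗ m', with coefficients; in each the offsets
    -- add up to the shift by one.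
    refine add_mem (add_mem ?_ ?_) (add_mem ?_ ?_)
    · exact mul_swap_mem hu.1 hv.1 .x u.1.2 v.1.2 (by simp [KSVertex.offset]; ring)
    · exact mul_swap_mem hu.1 hv.2 .y u.1.2 v.2.2 (by simp [KSVertex.offset]; ring)
    · exact mul_swap_mem hu.2 hv.1 .x u.2.2 v.1.2 (by simp [KSVertex.offset]; ring)
    · exact mul_swap_mem hu.2 hv.2 .y u.2.2 v.2.2 (by simp [KSVertex.offset]; ring)

variable [CharP F 2]

/-- The isomorphism `M ⊗ M ≅ R[1]`. -/
noncomputable def squareIso (F : Type u) [Field F] [CharP F 2] :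
    Iso (tensBimod (M F) (M F)) ((regular F).shift 1) where
  e := squareEquiv F
  map_act := squareEquiv_left
  map_right s t := squareEquiv_right s.unop t
  map_d t := by
    change squareEquiv F (tensD (M F) (M F).toDGMod t) = 0
    induction t using tens_induction with
    | hc u v =>
      rw [tensD_cls]
      change squareEquiv F (cls (M F) (M F).toDGMod (0 : (M F).V) v +
        cls (M F) (M F).toDGMod u (0 : (M F).V)) = 0
      rw [map_zero, map_zero, LinearMap.zero_apply, add_zero, map_zero]
    | ha s t hs ht => rw [map_add, map_add, hs, ht, add_zero]
  map_mem n t := squareEquiv_mem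

/-! ### The action of `Q` -/

/-- The bijection from `Q ⊙ X` to `M ⊗ X`. -/
noncomputable def powOneEquiv : (actObj (TwI.pow F 1) X).V ≃ₗ[F] (tens (M F) X).V :=
  (LinearEquiv.funUnique Unit F X.V).trans (twistEquiv X).symm

theorem powOneEquiv_act (r : KSAlg F) (v : Unit → X.V) :
    powOneEquiv X (piAct (TwI.pow F 1).k X.act r v) =
      tensLeft (M F) X r (powOneEquiv X v) := by
  change (twistEquiv X).symm (X.act (swap F r) (v ())) = tensLeft (M F) X r ((twistEquiv X).symm (v
      ()))
  rw [LinearEquiv.symm_apply_eq, twistEquiv_act, LinearEquiv.apply_symm_apply]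

theorem powOneEquiv_mem (n : ℤ) (v : Unit → X.V) :
    powOneEquiv X v ∈ tensGr (M F) X n ↔ v ∈ actGr (TwI.pow F 1) X n := by
  change (twistEquiv X).symm (v ()) ∈ _ ↔ _
  rw [← twistEquiv_mem, LinearEquiv.apply_symm_apply]
  refine Iff.trans ?_ mem_actGr.symm
  change _ ↔ ∀ _, v _ ∈ X.twGr 1 (n + 0)
  rw [add_zero]
  exact ⟨fun h _ => h, fun h => h ()⟩

theorem powOneEquiv_d (v : Unit → X.V) :
    powOneEquiv X (actD (TwI.pow F 1) X v) = tensD (M F) X (powOneEquiv X v) := by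
  change (twistEquiv X).symm (actD (TwI.pow F 1) X v ()) =
    tensD (M F) X ((twistEquiv X).symm (v ()))
  rw [LinearEquiv.symm_apply_eq, twistEquiv_d, LinearEquiv.apply_symm_apply]
  exact unit_d X 1 v ()

/-- The isomorphism `Q ⊙ X ≅ M ⊗ X`. -/
noncomputable def powOneIso : actObj (TwI.pow F 1) X ≅ tens (M F) X :=
  isoOfLinearEquiv (powOneEquiv X) (powOneEquiv_act X) (powOneEquiv_mem X)

theorem powOneIso_hom_mem : (powOneIso X).hom ∈ cycles F _ _ :=
  isoOfLinearEquiv_hom_mem _ _ _ (powOneEquiv_d X)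

theorem powOneIso_inv_mem : (powOneIso X).inv ∈ cycles F _ _ :=
  isoOfLinearEquiv_inv_mem _ _ _ (powOneEquiv_d X)

theorem powOneIso_naturality {X Y : DGMod F} (f : X ⟶ Y) :
    rightHom (TwI.pow F 1) f ≫ (powOneIso Y).hom = (powOneIso X).hom ≫ tensMap (M F) f := rfl

end DGBimod

namespace DGMod

variable [CharP F 2]

theorem isDGAction : IsDGAction F (TwI F) (DGMod F) where
  add_left f f' X := hom_ext (QMat.matAct_add X.act f f')
  smul_left c f X := hom_ext (QMat.matAct_smul X.act c f)
  add_right _ _ _ _ _ := rfl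
  smul_right _ _ _ _ _ := rfl
  left_mem _ hf := matAct_mem_homDeg hf
  right_mem A _ _ _ _ hg := compLeft_mem_homDeg A hg
  d_left f X := d_leftHom f X
  d_right A _ _ g := d_rightHom A g
  assoc_hom_mem A B X := isoOfLinearEquiv_hom_mem _ (curry_act A B X) (curry_mem A B X)
    (curry_d A B X)
  assoc_inv_mem A B X := isoOfLinearEquiv_inv_mem _ (curry_act A B X) (curry_mem A B X)
    (curry_d A B X)
  unit_hom_mem X := isoOfLinearEquiv_hom_mem _ (fun _ _ => rfl) (unit_mem X)
    fun v => unit_d X 0 v ()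
  unit_inv_mem X := isoOfLinearEquiv_inv_mem _ (fun _ _ => rfl) (unit_mem X)
    fun v => unit_d X 0 v ()

end DGMod

end TwistBimodule

/-! ### Functors of DG categories preserve cones, shifts and generation. -/

section DGFunctors

open DGCategory DGShift Limits

variable {F : Type u} [Field F] [CharP F 2] {C D : Type*} [Category* C] [Preadditive C]
  [Linear F C] [DGCategory F C] [Category* D] [Preadditive D] [Linear F D] [DGCategory F D]

variable (F) in
/-- A functor between DG categories which is additive on morphisms, preserves degrees and commutes
with the differentials. -/
structure IsDGFunctor (G : C ⥤ D) : Prop where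
  map_add {X Y : C} (f g : X ⟶ Y) : G.map (f + g) = G.map f + G.map g
  map_mem {X Y : C} {n : ℤ} {f : X ⟶ Y} : f ∈ gr (F := F) X Y n →
    G.map f ∈ gr (F := F) (G.obj X) (G.obj Y) n
  map_d {X Y : C} (f : X ⟶ Y) :
    d (F := F) (G.obj X) (G.obj Y) (G.map f) = G.map (d (F := F) X Y f)

namespace IsDGFunctor

variable {G : C ⥤ D}

theorem map_zero (hG : IsDGFunctor F G) (X Y : C) : G.map (0 : X ⟶ Y) = 0 := by
  have h := hG.map_add (0 : X ⟶ Y) 0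
  rw [add_zero] at h
  exact left_eq_add.1 h

theorem map_mem_cycles (hG : IsDGFunctor F G) {X Y : C} {f : X ⟶ Y} (hf : f ∈ cycles F X Y) :
    G.map f ∈ cycles F (G.obj X) (G.obj Y) := by
  refine ⟨hG.map_mem hf.1, ?_⟩
  have h : d (F := F) X Y f = 0 := hf.2
  change d (F := F) _ _ (G.map f) = 0
  rw [hG.map_d, h, hG.map_zero]

/-- A cone is described by identities between morphisms, and these are preserved by any functor that
is additive and commutes with degrees and differentials. No comparison with a chosen cone is needed.
-/
theorem isMappingCone (hG : IsDGFunctor F G) {X Y Z : C} {f : X ⟶ Y} {i : Y ⟶ Z} {p : Z ⟶ X}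
    (h : IsMappingCone F f i p) : IsMappingCone F (G.map f) (G.map i) (G.map p) := by
  obtain ⟨s, q, h⟩ := h.exists_coneData
  exact ConeData.isMappingCone
    { f_mem := hG.map_mem h.f_mem
      i_mem := hG.map_mem h.i_mem
      p_mem := hG.map_mem h.p_mem
      s_mem := hG.map_mem h.s_mem
      q_mem := hG.map_mem h.q_mem
      d_f := by rw [hG.map_d, h.d_f, hG.map_zero]
      d_i := by rw [hG.map_d, h.d_i, hG.map_zero]
      d_p := by rw [hG.map_d, h.d_p, hG.map_zero]
      d_s := by rw [hG.map_d, h.d_s, G.map_comp]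
      d_q := by rw [hG.map_d, h.d_q, G.map_comp]
      iq := by rw [← G.map_comp, h.iq, G.map_id]
      sp := by rw [← G.map_comp, h.sp, G.map_id]
      ip := by rw [← G.map_comp, h.ip, hG.map_zero]
      sq := by rw [← G.map_comp, h.sq, hG.map_zero]
      total := by rw [← G.map_comp, ← G.map_comp, ← hG.map_add, h.total, G.map_id] }

theorem id_eq_zero (hG : IsDGFunctor F G) {X : C} (h : 𝟙 X = 0) : 𝟙 (G.obj X) = 0 := by
  rw [← G.map_id, h, hG.map_zero]

theorem isZero (hG : IsDGFunctor F G) {X : C} (h : IsZero (⟨X⟩ : H0 F C)) : IsZero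
    (⟨G.obj X⟩ : H0 F D) := by
  obtain ⟨k, hk, e⟩ := H0.exists_homotopy_of_isZero h
  exact H0.isZero_of_homotopy (G.map k) (hG.map_mem hk) (by rw [hG.map_d, e, G.map_id])

/-- A functor of DG categories commutes with shifts. -/
def shiftIso [DGShift F C] [DGShift F D] (_ : IsDGFunctor F G) (n : ℤ) (X : C) :
    sh (F := F) n (G.obj X) ≅ G.obj (sh (F := F) n X) where
  hom := down (F := F) n (G.obj X) ≫ G.map (up (F := F) n X)
  inv := G.map (down (F := F) n X) ≫ up (F := F) n (G.obj X)
  hom_inv_id := by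
    rw [Category.assoc, ← Category.assoc (G.map _), ← G.map_comp, up_down, G.map_id,
      Category.id_comp, down_up]
  inv_hom_id := by
    rw [Category.assoc, ← Category.assoc (up n _), up_down, Category.id_comp, ← G.map_comp, down_up,
      G.map_id]

variable [DGShift F C] [DGShift F D]

theorem shiftIso_hom_mem (hG : IsDGFunctor F G) (n : ℤ) (X : C) :
    (hG.shiftIso n X).hom ∈ cycles F _ _ := by
  refine mem_cycles_of_degree (comp_mem (down_mem n _) (hG.map_mem (up_mem n X))) (by omega) ?_
  rw [shiftIso, leibniz, d_down, hG.map_d, d_up, hG.map_zero, zero_comp, comp_zero, add_zero]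

theorem shiftIso_inv_mem (hG : IsDGFunctor F G) (n : ℤ) (X : C) :
    (hG.shiftIso n X).inv ∈ cycles F _ _ := by
  refine mem_cycles_of_degree (comp_mem (hG.map_mem (down_mem n X)) (up_mem n _)) (by omega) ?_
  rw [shiftIso, leibniz, d_up, hG.map_d, d_down, hG.map_zero, zero_comp, comp_zero, add_zero]

/-- Every operation that builds generated objects is preserved up to closed isomorphism, so
stability has to be checked only on the generators. -/
theorem dgGenerated (hG : IsDGFunctor F G) {S : C → Prop} {S' : D → Prop}
    (h : ∀ X, S X → DGGenerated F S' (G.obj X))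
    {X : C} (hX : DGGenerated F S X) : DGGenerated F S' (G.obj X) := by
  induction hX with
  | of X hX => exact h X hX
  | zero X hX => exact .zero _ (hG.id_eq_zero hX)
  | iso e h h' _ ih =>
    exact .iso (G.mapIso e) (hG.map_mem_cycles h) (hG.map_mem_cycles h') ih
  | shift n X _ ih =>
    exact .iso (hG.shiftIso n X) (hG.shiftIso_hom_mem n X) (hG.shiftIso_inv_mem n X)
      (.shift n _ ih)
  | cone h _ _ ih ih' => exact .cone (hG.isMappingCone h) ih ih'

end IsDGFunctor

namespace IsDGAction

variable [MonoidalCategory C] [MonoidalLeftAction C D]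

theorem isDGFunctor_right (h : IsDGAction F C D) (A : C) : IsDGFunctor F
    ((curriedAction C D).obj A) where
  map_add := h.add_right A
  map_mem := h.right_mem A
  map_d := h.d_right A

theorem isDGFunctor_left (h : IsDGAction F C D) (X : D) : IsDGFunctor F
    ((curriedAction C D).flip.obj X) where
  map_add f g := h.add_left f g X
  map_mem hf := h.left_mem X hf
  map_d f := h.d_left f X

end IsDGAction

end DGFunctors

/-! ### Mapping cones of DG modules. -/

section ConesOfModules

open DGCategory

variable {F : Type u} [Field F] [CharP F 2]

namespace DGMod

theorem commutes_of_mem_cycles {X Y : DGMod F} {f : X ⟶ Y} (hf : f ∈ cycles F X Y) (v : X.V) :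
    toLin f (X.d v) = Y.d (toLin f v) := by
  have h : homD X Y f = 0 := hf.2
  have h1 : Y.d (toLin f v) + toLin f (X.d v) = 0 := congrArg (fun g => toLin g v) h
  exact (eq_of_add_eq_zero F h1).symm

/-- The mapping cone of a closed homomorphism of degree zero. -/
noncomputable def cone {X Y : DGMod F} (f : X ⟶ Y) (hf : f ∈ cycles F X Y) : DGMod F where
  V := Y.V × X.V
  act :=
    { toFun := fun r => (Y.act r).prodMap (X.act r)
      map_one' := by rw [map_one, map_one]; rfl
      map_mul' := fun r s => by rw [map_mul, map_mul]; rfl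
      map_zero' := by rw [map_zero, map_zero]; rfl
      map_add' := fun r s => by rw [map_add, map_add]; rfl
      commutes' := fun c => by rw [AlgHom.commutes, AlgHom.commutes]; rfl }
  gr n := (Y.gr n).prod (X.gr (n + 1))
  isInternal := isInternal_prod Y.isInternal (isInternal_reindex X.isInternal 1)
  act_mem hr hv := ⟨Y.act_mem hr hv.1, by rw [add_assoc]; exact X.act_mem hr hv.2⟩
  d := ((Y.d.comp (LinearMap.fst F Y.V X.V)) + (toLin f).comp (LinearMap.snd F Y.V X.V)).prod
    (X.d.comp (LinearMap.snd F Y.V X.V))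
  d_mem {n v} hv := by
    refine ⟨add_mem (Y.d_mem hv.1) ?_, X.d_mem hv.2⟩
    have h := hf.1.2 _ _ hv.2
    rwa [zero_add] at h
  d_act r v := Prod.ext (by
      change Y.d (Y.act r v.1) + toLin f (X.act r v.2) = Y.act r (Y.d v.1 + toLin f v.2)
      rw [Y.d_act, toLin_act, map_add]) (X.d_act r v.2)
  d_d v := Prod.ext (by
      change Y.d (Y.d v.1 + toLin f v.2) + toLin f (X.d v.2) = 0
      rw [map_add, Y.d_d, zero_add, commutes_of_mem_cycles hf]
      exact TwI.add_self (F := F) _) (X.d_d v.2)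

theorem exists_isMappingCone {X Y : DGMod F} (f : X ⟶ Y) (hf : f ∈ cycles F X Y) :
    ∃ (i : Y ⟶ cone f hf) (p : cone f hf ⟶ X), IsMappingCone F f i p := by
  have hi : LinearMap.inl F Y.V X.V ∈ homDeg Y (cone f hf) 0 :=
    ⟨fun r v => Prod.ext rfl (map_zero (X.act r)).symm,
      fun n v hv => ⟨by rw [zero_add]; exact hv, zero_mem _⟩⟩
  have hp : LinearMap.snd F Y.V X.V ∈ homDeg (cone f hf) X 1 :=
    ⟨fun r v => rfl, fun n v hv => by rw [add_comm]; exact hv.2⟩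
  have hs : LinearMap.inr F Y.V X.V ∈ homDeg X (cone f hf) (-1) :=
    ⟨fun r v => Prod.ext (map_zero (Y.act r)).symm rfl,
      fun n v hv => ⟨zero_mem _, by rw [neg_add_cancel_comm]; exact hv⟩⟩
  have hq : LinearMap.fst F Y.V X.V ∈ homDeg (cone f hf) Y 0 :=
    ⟨fun r v => rfl, fun n v hv => by rw [zero_add]; exact hv.1⟩
  refine ⟨ofLin (X := Y) (Y := cone f hf) _ (mem_homSpace hi),
    ofLin (X := cone f hf) (Y := X) _ (mem_homSpace hp), ConeData.isMappingCone
    (s := ofLin (X := X) (Y := cone f hf) _ (mem_homSpace hs))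
    (q := ofLin (X := cone f hf) (Y := Y) _ (mem_homSpace hq))
    { f_mem := hf.1
      i_mem := hi
      p_mem := hp
      s_mem := hs
      q_mem := hq
      d_f := hf.2
      d_i := hom_ext (LinearMap.ext fun (v : Y.V) => Prod.ext ?_ ?_)
      d_p := hom_ext (LinearMap.ext fun (v : Y.V × X.V) => ?_)
      d_s := hom_ext (LinearMap.ext fun (v : X.V) => Prod.ext ?_ ?_)
      d_q := hom_ext (LinearMap.ext fun (v : Y.V × X.V) => ?_)
      iq := rfl
      sp := rfl
      ip := rfl
      sq := rfl
      total := hom_ext (LinearMap.ext fun (v : Y.V × X.V) =>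
        Prod.ext (add_zero v.1) (zero_add v.2)) }⟩
  · change (Y.d v + toLin f 0) + Y.d v = 0
    rw [map_zero, add_zero]
    exact TwI.add_self (F := F) _
  · change X.d 0 + 0 = 0
    rw [map_zero, add_zero]
  · exact TwI.add_self (F := F) (X.d v.2)
  · change (Y.d 0 + toLin f v) + 0 = toLin f v
    rw [map_zero, zero_add, add_zero]
  · exact TwI.add_self (F := F) (X.d v)
  · change Y.d v.1 + (Y.d v.1 + toLin f v.2) = toLin f v.2
    rw [← add_assoc, TwI.add_self (F := F) (Y.d v.1), zero_add]

end DGMod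

namespace DGP

/-- Morphisms, degrees and differentials of the full subcategory are those of the ambient category,
so both sides consist of the same data. -/
theorem isMappingCone_iff {X Y Z : DGP F} {f : X ⟶ Y} {i : Y ⟶ Z} {p : Z ⟶ X} :
    IsMappingCone F (toMod f) (toMod i) (toMod p) ↔ IsMappingCone F f i p :=
  ⟨fun h => ⟨h.1, h.2, h.3, h.4, h.5⟩, fun h => ⟨h.1, h.2, h.3, h.4, h.5⟩⟩

theorem hasMappingCones : HasMappingCones F (DGP F) := fun X Y f hf => by
  obtain ⟨i, p, h⟩ := DGMod.exists_isMappingCone (toMod f) hf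
  let Z : DGP F := ⟨DGMod.cone (toMod f) hf, .cone h X.prop Y.prop⟩
  exact ⟨Z, ofMod (Y := Z) i, ofMod (X := Z) p, isMappingCone_iff.1 h⟩

end DGP

end ConesOfModules

/-! ### Mapping cones of one-sided twisted complexes. -/

section ConesOfTwistedComplexes

open DGCategory

variable {F : Type u} [Field F]

namespace QMat

variable {ι ι₁ ι₂ κ : Type} {k : ι → ℕ} {k₁ : ι₁ → ℕ} {k₂ : ι₂ → ℕ} {l : κ → ℕ}

/-- The block matrix `(f g)`. -/
def row (f : QMat F k k₁) (g : QMat F k k₂) : QMat F k (Sum.elim k₁ k₂)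
  | i, Sum.inl j => f i j
  | i, Sum.inr j => g i j

/-- The block matrix with blocks `f` and `g` on top of each other. -/
def col (f : QMat F k₁ k) (g : QMat F k₂ k) : QMat F (Sum.elim k₁ k₂) k
  | Sum.inl i, j => f i j
  | Sum.inr i, j => g i j

theorem mul_row [Fintype κ] (e : QMat F k l) (f : QMat F l k₁) (g : QMat F l k₂) :
    mul e (row f g) = row (mul e f) (mul e g) := by
  funext i j
  cases j <;> rfl

theorem col_mul [Fintype ι] (f : QMat F k₁ k) (g : QMat F k₂ k) (e : QMat F k l) :
    mul (col f g) e = col (mul f e) (mul g e) := by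
  funext i j
  cases i <;> rfl

theorem row_mul_col [Fintype ι₁] [Fintype ι₂] (f : QMat F k k₁) (g : QMat F k k₂)
    (f' : QMat F k₁ l) (g' : QMat F k₂ l) :
    mul (row f g) (col f' g') = mul f f' + mul g g' := by
  funext i j
  exact Fintype.sum_sum_type _

theorem row_add_row (f f' : QMat F k k₁) (g g' : QMat F k k₂) :
    row f g + row f' g' = row (f + f') (g + g') := by
  funext i j
  cases j <;> rfl

theorem col_add_col (f f' : QMat F k₁ k) (g g' : QMat F k₂ k) :
    col f g + col f' g' = col (f + f') (g + g') := by
  funext i j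
  cases i <;> rfl

theorem row_zero : row (0 : QMat F k k₁) (0 : QMat F k k₂) = 0 := by
  funext i j
  cases j <;> rfl

theorem col_zero : col (0 : QMat F k₁ k) (0 : QMat F k₂ k) = 0 := by
  funext i j
  cases i <;> rfl

theorem col_id : col (row (QMat.id k₁) 0) (row 0 (QMat.id k₂)) =
    (QMat.id (Sum.elim k₁ k₂) : QMat F _ _) := by
  classical
  funext i j
  rcases i with i | i <;> rcases j with j | j
  · simp only [col, row, id, perm, Sum.inl.injEq]
    rfl
  · exact (perm_apply_of_ne (F := F) (k₁ := Sum.elim k₁ k₂) (fun i => i) (fun _ => rfl)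
      Sum.inl_ne_inr).symm
  · exact (perm_apply_of_ne (F := F) (k₁ := Sum.elim k₁ k₂) (fun i => i) (fun _ => rfl)
      Sum.inr_ne_inl).symm
  · simp only [col, row, id, perm, Sum.inr.injEq]
    rfl

end QMat

namespace TwI

open QMat

theorem id_eq_zero_of_isEmpty (A : TwI F) [IsEmpty A.ι] : 𝟙 A = 0 := funext fun i => isEmptyElim i

variable (F) in
/-- The empty twisted complex. -/
def empty : TwI F where
  ι := Empty
  lev := Empty.elim
  k := Empty.elim
  m := Empty.elim
  f i := i.elim
  f_mem i := i.elim
  f_lev i := i.elim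
  f_sq := funext fun i => i.elim

variable (F) in
theorem exists_id_eq_zero : ∃ A : TwI F, 𝟙 A = 0 :=
  ⟨empty F, have : IsEmpty (empty F).ι := inferInstanceAs (IsEmpty Empty)
    id_eq_zero_of_isEmpty _⟩

variable [CharP F 2]

theorem mem_cycles_iff {A B : TwI F} {f : A ⟶ B} :
    f ∈ cycles F A B ↔ f ∈ gr A B 0 ∧ QMat.mul A.f f + QMat.mul f B.f = 0 := Iff.rfl

/-- The mapping cone of a closed morphism of degree zero between twisted complexes. -/
noncomputable def cone {A B : TwI F} (f : A ⟶ B) (hf : f ∈ cycles F A B) : TwI F where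
  ι := B.ι ⊕ A.ι
  -- The components of f lead from A to B, so the levels of B are raised above all levels of A. The
  -- sum of the levels of A serves as a bound for each of them.
  lev := Sum.elim (fun j => (∑ i, A.lev i) + 1 + B.lev j) A.lev
  k := Sum.elim B.k A.k
  m := Sum.elim B.m (fun i => A.m i + 1)
  f := col (row B.f 0) (row f A.f)
  f_mem := by
    rintro (i | i) (j | j)
    · exact B.f_mem i j
    · exact zero_mem _
    · have h := mem_gr.1 hf.1 i j
      have e : 1 + (B.m j - (A.m i + 1)) = 0 + (B.m j - A.m i) := by ring
      change f i j ∈ QHom.gr F _ _ (1 + (B.m j - (A.m i + 1)))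
      rwa [e]
    · have h := A.f_mem i j
      have e : 1 + (A.m j + 1 - (A.m i + 1)) = 1 + (A.m j - A.m i) := by ring
      change A.f i j ∈ QHom.gr F _ _ (1 + (A.m j + 1 - (A.m i + 1)))
      rwa [e]
  f_lev := by
    rintro (i | i) (j | j) h
    · exact Nat.add_lt_add_left (B.f_lev i j h) _
    · exact absurd rfl h
    · have h1 : A.lev i ≤ ∑ i, A.lev i :=
        Finset.single_le_sum (f := A.lev) (fun _ _ => Nat.zero_le _) (Finset.mem_univ i)
      change A.lev i < (∑ i, A.lev i) + 1 + B.lev j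
      omega
    · exact A.f_lev i j h
  f_sq := by
    have h : mul f B.f + mul A.f f = 0 := (add_comm _ _).trans (mem_cycles_iff.1 hf).2
    simp only [B.f_sq, A.f_sq, h, QMat.zero_mul, QMat.mul_zero, mul_row, col_mul, row_mul_col,
      row_add_row, row_zero, col_zero, add_zero]

theorem exists_isMappingCone {A B : TwI F} (f : A ⟶ B) (hf : f ∈ cycles F A B) :
    ∃ (i : B ⟶ cone f hf) (p : cone f hf ⟶ A), IsMappingCone F f i p := by
  refine ⟨row (QMat.id B.k) 0, col 0 (QMat.id A.k), ConeData.isMappingCone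
    (s := (row 0 (QMat.id A.k) : QMat F A.k (Sum.elim B.k A.k)))
    (q := (col (QMat.id B.k) 0 : QMat F (Sum.elim B.k A.k) B.k))
    { f_mem := hf.1
      i_mem := mem_gr.2 ?_
      p_mem := mem_gr.2 ?_
      s_mem := mem_gr.2 ?_
      q_mem := mem_gr.2 ?_
      d_f := hf.2
      d_i := ?_
      d_p := ?_
      d_s := ?_
      d_q := ?_
      iq := ?_
      sp := ?_
      ip := ?_
      sq := ?_
      total := ?_ }⟩
  · rintro i (j | j)
    · exact mem_gr.1 (id_mem_gr B) i j
    · exact zero_mem _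
  · rintro (i | i) j
    · exact zero_mem _
    · have h := mem_gr.1 (id_mem_gr A) i j
      have e : 1 + (A.m j - (A.m i + 1)) = 0 + (A.m j - A.m i) := by ring
      change QMat.id A.k i j ∈ QHom.gr F _ _ (1 + (A.m j - (A.m i + 1)))
      rwa [e]
  · rintro i (j | j)
    · exact zero_mem _
    · have h := mem_gr.1 (id_mem_gr A) i j
      have e : -1 + (A.m j + 1 - A.m i) = 0 + (A.m j - A.m i) := by ring
      change QMat.id A.k i j ∈ QHom.gr F _ _ (-1 + (A.m j + 1 - A.m i))
      rwa [e]
  · rintro (i | i) j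
    · exact mem_gr.1 (id_mem_gr B) i j
    · exact zero_mem _
  · change mul B.f (row (QMat.id B.k) 0) + mul (row (QMat.id B.k) 0) (col (row B.f 0)
        (row f A.f)) = 0
    rw [mul_row, row_mul_col, QMat.mul_id, QMat.id_mul, QMat.zero_mul, QMat.mul_zero, add_zero]
    exact add_self (F := F) _
  · change mul (col (row B.f 0) (row f A.f)) (col 0 (QMat.id A.k)) + mul (col 0
        (QMat.id A.k)) A.f = 0
    simp only [QMat.mul_id, QMat.id_mul, QMat.zero_mul, QMat.mul_zero, col_mul, row_mul_col,
      zero_add, add_self (F := F)]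
  · change mul A.f (row 0 (QMat.id A.k)) + mul (row 0 (QMat.id A.k)) (col (row B.f 0) (row f A.f)) =
      mul f (row (QMat.id B.k) 0)
    rw [mul_row, mul_row, row_mul_col, QMat.mul_id, QMat.mul_id, QMat.id_mul, QMat.zero_mul,
      QMat.mul_zero, QMat.mul_zero, zero_add, row_add_row, zero_add]
    exact congrArg _ (add_self (F := F) _)
  · change mul (col (row B.f 0) (row f A.f)) (col (QMat.id B.k) 0) + mul (col (QMat.id B.k) 0) B.f =
      mul (col 0 (QMat.id A.k)) f
    rw [col_mul, col_mul, col_mul, row_mul_col, row_mul_col, QMat.mul_id, QMat.mul_id, QMat.id_mul,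
      QMat.id_mul, QMat.zero_mul, QMat.zero_mul, QMat.zero_mul, QMat.mul_zero, add_zero, add_zero,
      col_add_col, add_zero]
    exact congrArg (fun t => col t f) (add_self (F := F) _)
  · exact (row_mul_col _ _ _ _).trans (by rw [QMat.mul_id, QMat.zero_mul, add_zero]; rfl)
  · exact (row_mul_col _ _ _ _).trans (by rw [QMat.mul_id, QMat.zero_mul, zero_add]; rfl)
  · exact (row_mul_col _ _ _ _).trans (by rw [QMat.mul_zero, QMat.zero_mul, add_zero])
  · exact (row_mul_col _ _ _ _).trans (by rw [QMat.mul_zero, QMat.zero_mul, zero_add])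
  · have h : mul (col (QMat.id B.k) 0) (row (QMat.id B.k) 0) + mul (col 0 (QMat.id A.k))
        (row 0 (QMat.id A.k)) = (QMat.id (Sum.elim B.k A.k) : QMat F _ _) := by
      rw [col_mul, col_mul, QMat.id_mul, QMat.id_mul, QMat.zero_mul, QMat.zero_mul, col_add_col,
        add_zero, zero_add, col_id]
    exact h

theorem hasMappingCones : HasMappingCones F (TwI F) := fun _ _ f hf =>
  ⟨cone f hf, exists_isMappingCone f hf⟩

variable (F) in
theorem h0IsTriangulated : H0IsTriangulated F (TwI F) :=
  _root_.h0IsTriangulated hasMappingCones (exists_id_eq_zero F)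

end TwI

end ConesOfTwistedComplexes

/-! ### Every twisted complex is an iterated cone of shifted powers of Q. -/

section TwistedComplexInduction

open DGCategory

variable {F : Type u} [Field F]

namespace TwI

open QMat

variable (A : TwI F) (i₀ : A.ι)

theorem sum_eq_add_sum_ne {V : Type*} [AddCommMonoid V] {ι : Type*} [Fintype ι] (i₀ : ι)
    [Fintype {i // i ≠ i₀}] (f : ι → V) : ∑ i, f i = f i₀ + ∑ i : {i // i ≠ i₀}, f i := by
  classical
  rw [Fintype.sum_eq_add_sum_subtype_ne f i₀]
  congr!

/-- The summands other than `i₀` of a twisted complex, if no nonzero component of the differential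
ends in the summand `i₀`. -/
noncomputable def peel (h : ∀ j, A.f j i₀ = 0) : TwI F where
  ι := {i // i ≠ i₀}
  fintype := Fintype.ofFinite _
  lev i := A.lev i
  k i := A.k i
  m i := A.m i
  f i j := A.f i j
  f_mem i j := A.f_mem i j
  f_lev i j := A.f_lev i j
  f_sq := by
    let _ : Fintype {i // i ≠ i₀} := Fintype.ofFinite _
    funext i j
    have h1 : ∑ l, QHom.comp (A.f i l) (A.f l j) = 0 := congrFun (congrFun A.f_sq i) j
    rw [sum_eq_add_sum_ne i₀, h, QHom.zero_comp, zero_add] at h1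
    exact h1

variable (h : ∀ j, A.f j i₀ = 0)

/-- The summand of index i₀ is separated in a matrix product. With an identity matrix as one factor
this gives the block decompositions used for the cone structure. -/
theorem mul_apply_eq_add {κ κ' : Type} {k : κ → ℕ} {l : κ' → ℕ} (f : QMat F k A.k)
    (g : QMat F A.k l) (a : κ) (b : κ') :
    mul f g a b = QHom.comp (f a i₀) (g i₀ b) +
      mul (k₂ := (peel A i₀ h).k) (fun a j => f a j.1) (fun j b => g j.1 b) a b :=
  @sum_eq_add_sum_ne _ _ A.ι _ i₀ (peel A i₀ h).fintype fun j => QHom.comp (f a j) (g j b)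

variable {A} in
theorem id_apply_ne {i j : A.ι} (h : i ≠ j) : QMat.id (F := F) A.k i j = 0 :=
  perm_apply_of_ne _ _ h

theorem id_apply_self (i : A.ι) : QMat.id (F := F) A.k i i = QHom.one rfl :=
  perm_apply_self _ _ i

theorem id_peel (i j : (peel A i₀ h).ι) :
    QMat.id (F := F) (peel A i₀ h).k i j = QMat.id (F := F) A.k i.1 j.1 := by
  by_cases hij : i = j
  · subst hij
    rw [id_apply_self, id_apply_self]
    rfl
  · exact (id_apply_ne hij).trans (id_apply_ne fun h => hij (Subtype.ext h)).symm

/-- The components of the differential from the summand `i₀` to the others. -/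
def peelHom : QMat F (pow F (A.k i₀)).k (peel A i₀ h).k := fun _ j => A.f i₀ j.1

/-- The inclusion of the summands other than `i₀`. -/
noncomputable def peelIncl : QMat F (peel A i₀ h).k A.k := fun j l => QMat.id A.k j.1 l

/-- The projection to the summand `i₀`. -/
noncomputable def peelProj : QMat F A.k (pow F (A.k i₀)).k := fun j _ => QMat.id A.k j i₀

/-- The inclusion of the summand `i₀`. -/
noncomputable def peelSection : QMat F (pow F (A.k i₀)).k A.k := fun _ j => QMat.id A.k i₀ j

/-- The projection to the summands other than `i₀`. -/
noncomputable def peelRetr : QMat F A.k (peel A i₀ h).k := fun i j => QMat.id A.k i j.1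

section Products

variable {κ : Type} {k : κ → ℕ}

theorem peelIncl_mul (g : QMat F A.k k) : mul (peelIncl A i₀ h) g = fun
    (j : (peel A i₀ h).ι) => g j.1 :=
  funext fun j => congrFun (QMat.id_mul g) j.1

theorem peelSection_mul (g : QMat F A.k k) : mul (peelSection A i₀) g = fun _ => g i₀ :=
  funext fun _ => congrFun (QMat.id_mul g) i₀

theorem mul_peelRetr (g : QMat F k A.k) : mul g (peelRetr A i₀ h) = fun a
    (j : (peel A i₀ h).ι) => g a j.1 :=
  funext fun a => funext fun j => congrFun (congrFun (QMat.mul_id g) a) j.1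

theorem mul_peelProj (g : QMat F k A.k) : mul g (peelProj A i₀) = fun a _ => g a i₀ :=
  funext fun a => funext fun _ => congrFun (congrFun (QMat.mul_id g) a) i₀

theorem add_mul_peelIncl (g : QMat F k A.k) (a : κ) (b : A.ι) :
    g a b = QHom.comp (g a i₀) (QMat.id A.k i₀ b) +
      mul (fun a (j : (peel A i₀ h).ι) => g a j.1) (peelIncl A i₀ h) a b :=
  (congrFun (congrFun (QMat.mul_id g) a) b).symm.trans (mul_apply_eq_add A i₀ h _ _ a b)

theorem add_peelRetr_mul (g : QMat F A.k k) (a : A.ι) (b : κ) :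
    g a b = QHom.comp (QMat.id A.k a i₀) (g i₀ b) +
      mul (peelRetr A i₀ h) (fun (j : (peel A i₀ h).ι) b => g j.1 b) a b :=
  (congrFun (congrFun (QMat.id_mul g) a) b).symm.trans (mul_apply_eq_add A i₀ h _ _ a b)

end Products

theorem f_mul_peelIncl : mul (peel A i₀ h).f (peelIncl A i₀ h) = fun
    (j : (peel A i₀ h).ι) => A.f j.1 := by
  funext j l
  have e := add_mul_peelIncl A i₀ h A.f j.1 l
  rw [h, QHom.zero_comp, zero_add] at e
  exact e.symm

theorem peelHom_mul_peelIncl : mul (peelHom A i₀ h) (peelIncl A i₀ h) = fun _ => A.f i₀ := by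
  funext j l
  have e := add_mul_peelIncl A i₀ h A.f i₀ l
  rw [h, QHom.zero_comp, zero_add] at e
  exact e.symm

theorem peelHom_mul_f : mul (peelHom A i₀ h) (peel A i₀ h).f = 0 := by
  funext j l
  have e := mul_apply_eq_add A i₀ h A.f A.f i₀ l.1
  rw [h, QHom.zero_comp, zero_add, A.f_sq] at e
  exact e.symm

theorem peelProj_mul {κ : Type} {k : κ → ℕ} (g : QMat F (pow F (A.k i₀)).k k) :
    mul (peelProj A i₀) g = fun a b => QHom.comp (QMat.id A.k a i₀) (g () b) :=
  funext fun _ => funext fun _ => Finset.sum_singleton _ _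

variable [CharP F 2]

/-- If no component of the differential ends in the summand Q^k[m] of index i₀, the remaining
summands form a subcomplex and A is the cone of the components leaving i₀. A cone shifts its source
by one, hence the shift m - 1. -/
theorem isMappingCone_peel : IsMappingCone F (X := shift (A.m i₀ - 1) (pow F (A.k i₀)))
      (Y := peel A i₀ h) (Z := A) (peelHom A i₀ h) (peelIncl A i₀ h) (peelProj A i₀) := by
  have hid := fun i j => mem_gr.1 (id_mem_gr A) i j
  refine ConeData.isMappingCone (X := shift (A.m i₀ - 1) (pow F (A.k i₀))) (Y := peel A i₀ h)
    (Z := A) (s := peelSection A i₀) (q := peelRetr A i₀ h)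
    { f_mem := mem_gr.2 fun _ j => ?_
      i_mem := mem_gr.2 fun i j => hid i.1 j
      p_mem := mem_gr.2 fun i _ => ?_
      s_mem := mem_gr.2 fun _ j => ?_
      q_mem := mem_gr.2 fun i j => hid i j.1
      d_f := ?_
      d_i := ?_
      d_p := ?_
      d_s := ?_
      d_q := ?_
      iq := ?_
      sp := ?_
      ip := ?_
      sq := ?_
      total := ?_ }
  · have e : 0 + (A.m j.1 - (0 + (A.m i₀ - 1))) = 1 + (A.m j.1 - A.m i₀) := by ring
    change A.f i₀ j.1 ∈ QHom.gr F _ _ (0 + (A.m j.1 - (0 + (A.m i₀ - 1))))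
    rw [e]
    exact A.f_mem i₀ j.1
  · have e : 1 + (0 + (A.m i₀ - 1) - A.m i) = 0 + (A.m i₀ - A.m i) := by ring
    change QMat.id A.k i i₀ ∈ QHom.gr F _ _ (1 + (0 + (A.m i₀ - 1) - A.m i))
    rw [e]
    exact hid i i₀
  · have e : -1 + (A.m j - (0 + (A.m i₀ - 1))) = 0 + (A.m j - A.m i₀) := by ring
    change QMat.id A.k i₀ j ∈ QHom.gr F _ _ (-1 + (A.m j - (0 + (A.m i₀ - 1))))
    rw [e]
    exact hid i₀ j
  · change mul 0 (peelHom A i₀ h) + mul (peelHom A i₀ h) (peel A i₀ h).f = 0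
    rw [QMat.zero_mul, peelHom_mul_f, add_zero]
  · change mul (peel A i₀ h).f (peelIncl A i₀ h) + mul (peelIncl A i₀ h) A.f = 0
    rw [f_mul_peelIncl, peelIncl_mul]
    exact add_self (F := F) _
  · change mul A.f (peelProj A i₀) + mul (peelProj A i₀) 0 = 0
    rw [QMat.mul_zero, mul_peelProj]
    exact (add_zero _).trans (funext fun j => funext fun _ => h j)
  · change mul 0 (peelSection A i₀) + mul (peelSection A i₀) A.f =
      mul (peelHom A i₀ h) (peelIncl A i₀ h)
    rw [QMat.zero_mul, peelSection_mul, peelHom_mul_peelIncl]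
    exact zero_add _
  · change mul A.f (peelRetr A i₀ h) + mul (peelRetr A i₀ h) (peel A i₀ h).f =
      mul (peelProj A i₀) (peelHom A i₀ h)
    rw [mul_peelRetr, peelProj_mul]
    funext a j
    have e := add_peelRetr_mul A i₀ h A.f a j.1
    exact (congrArg (· + mul (peelRetr A i₀ h) (peel A i₀ h).f a j) e).trans
      ((add_assoc _ _ _).trans ((congrArg _ (add_self (F := F) _)).trans (add_zero _)))
  · change mul (peelIncl A i₀ h) (peelRetr A i₀ h) = QMat.id (peel A i₀ h).k
    rw [peelIncl_mul]
    exact funext fun i => funext fun j => (id_peel A i₀ h i j).symm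
  · change mul (peelSection A i₀) (peelProj A i₀) = QMat.id (pow F (A.k i₀)).k
    rw [peelSection_mul]
    exact funext fun i => funext fun j => (id_apply_self A i₀).trans
      (id_apply_self (pow F (A.k i₀)) ()).symm
  · change mul (peelIncl A i₀ h) (peelProj A i₀) = 0
    rw [peelIncl_mul]
    exact funext fun i => funext fun j => id_apply_ne i.2
  · change mul (peelSection A i₀) (peelRetr A i₀ h) = 0
    rw [peelSection_mul]
    exact funext fun i => funext fun j => id_apply_ne (Ne.symm j.2)
  · change mul (peelRetr A i₀ h) (peelIncl A i₀ h) + mul (peelProj A i₀) (peelSection A i₀) =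
      QMat.id A.k
    rw [peelProj_mul]
    funext a b
    exact (add_comm _ _).trans (add_peelRetr_mul A i₀ h (QMat.id A.k) a b).symm

/-- By one-sidedness nothing ends in a summand of minimal level, so such a summand can be split off
as the source of a cone; the induction is on the number of summands. -/
theorem induction {p : TwI F → Prop} (hzero : ∀ A : TwI F, 𝟙 A = 0 → p A)
    (hsingle : ∀ (n : ℕ) (m : ℤ), p (shift m (pow F n)))
    (hcone : ∀ {A B C : TwI F} {f : A ⟶ B} {i : B ⟶ C} {q : C ⟶ A}, IsMappingCone F f i q →
      p A → p B → p C) (A : TwI F) : p A := by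
  obtain ⟨n, hn⟩ : ∃ n, Nat.card A.ι = n := ⟨_, rfl⟩
  induction n using Nat.strong_induction_on generalizing A with
  | h n ih =>
  rcases isEmpty_or_nonempty A.ι with hA | hA
  · exact hzero A (id_eq_zero_of_isEmpty A)
  obtain ⟨i₀, hi₀⟩ := Finite.exists_min A.lev
  have h : ∀ j, A.f j i₀ = 0 := fun j => by
    by_contra hj
    exact absurd (A.f_lev j i₀ hj) (not_lt.2 (hi₀ j))
  refine hcone (isMappingCone_peel A i₀ h) (hsingle _ _) (ih _ ?_ _ rfl)
  rw [← hn]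
  exact Finite.card_subtype_lt (x := i₀) (by simp)

end TwI

end TwistedComplexInduction

/-! ### The action restricts to the category generated by P(x) and P(y). -/

section ActionOnGeneratedCategory

open DGCategory KSAlg DGShift

variable {F : Type u} [Field F]

namespace DGMod

/-- The generator `e(z)` of `P(z)`. -/
noncomputable def genP (z : KSVertex) : (P F z).V := ⟨gen F z.e, 1, one_mul _⟩

theorem genP_mem (z : KSVertex) : genP z ∈ (P F z).gr 0 := e_mem (F := F) z

theorem act_genP {z : KSVertex} (v : (P F z).V) : (P F z).act v.1 (genP z) = v :=
  Subtype.ext (mul_e_of_mem v.2)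

theorem swap_mem_leftIdeal {z : KSVertex} {r : KSAlg F} (h : r ∈ leftIdeal F z) :
    swap F r ∈ leftIdeal F z.swap := by
  rw [← mul_e_of_mem h, map_mul, swap_e]
  exact mul_e_mem _ _

/-- The map `swap` carries R e(z) onto the left ideal of the other vertex, and both directions say
that the regrading by offsets accounts for its failure to preserve degrees. This identifies Q ⊙ P(z)
with a shift of the other projective. -/
theorem mem_twGr_one_P {z : KSVertex} {n : ℤ} {v : (P F z).V} :
    swap F v.1 ∈ KSAlg.gr F (n + z.offset 1) ↔ v ∈ (P F z).twGr 1 n := by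
  constructor
  · intro h
    have h1 := DGBimod.act_swap_mem (P F z) h (swap_mem_leftIdeal v.2) (genP_mem z)
    rw [swap_swap, act_genP] at h1
    rwa [zero_sub, add_neg_cancel_right] at h1
  · intro h
    have key : ∀ z' : KSVertex, gen F z'.e * swap F v.1 ∈ KSAlg.gr F (n + z.offset 1) :=
        fun z' => by
      have h1 : gen F z'.swap.e * v.1 ∈ KSAlg.gr F (n + z'.swap.offset 1) := h z'.swap
      have h2 := DGBimod.mul_swap_mem (e_mem (F := F) z') h1 z.swap ⟨1, one_mul _⟩
        (by rw [KSVertex.swap_swap]; exact mul_mem_leftIdeal _ v.2) (n := n + z.offset 1)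
        (by cases z <;> cases z' <;> simp [KSVertex.offset, KSVertex.swap])
      rwa [map_mul, swap_e, KSVertex.swap_swap, ← mul_assoc, e_mul_e] at h2
    have h1 := add_mem (key KSVertex.x) (key KSVertex.y)
    rwa [← add_mul, show gen F KSVertex.x.e + gen F KSVertex.y.e = 1 from gen_ex_add_ey,
      one_mul] at h1

variable [CharP F 2]

/-- The bijection from `Q ⊙ P(z)` to the projective module at the other vertex. -/
noncomputable def powOnePEquiv (z : KSVertex) :
    (actObj (TwI.pow F 1) (P F z)).V ≃ₗ[F] (shift (z.offset 1) (P F z.swap)).V where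
  toFun v := ⟨swap F (v ()).1, swap_mem_leftIdeal (v ()).2⟩
  map_add' v w := Subtype.ext (map_add (swap F) (v ()).1 (w ()).1)
  map_smul' c v := Subtype.ext (map_smul (swap F) c (v ()).1)
  invFun w := fun _ => ⟨swap F w.1, by
    have h := swap_mem_leftIdeal w.2
    rwa [KSVertex.swap_swap] at h⟩
  left_inv v := funext fun _ => Subtype.ext (swap_swap _)
  right_inv w := Subtype.ext (swap_swap _)

theorem powOnePEquiv_act (z : KSVertex) (r : KSAlg F) (v : (actObj (TwI.pow F 1) (P F z)).V) :
    powOnePEquiv z ((actObj (TwI.pow F 1) (P F z)).act r v) =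
      (shift (z.offset 1) (P F z.swap)).act r (powOnePEquiv z v) :=
  Subtype.ext ((map_mul (swap F) _ (v ()).1).trans
    (congrArg (· * swap F (v ()).1) (swap_swap r)))

theorem powOnePEquiv_mem (z : KSVertex) (n : ℤ) (v : (actObj (TwI.pow F 1) (P F z)).V) :
    powOnePEquiv z v ∈ (shift (z.offset 1) (P F z.swap)).gr n ↔
      v ∈ (actObj (TwI.pow F 1) (P F z)).gr n := by
  refine Iff.trans ?_ mem_actGr.symm
  change _ ↔ ∀ _, v _ ∈ (P F z).twGr 1 (n + 0)
  rw [add_zero]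
  exact mem_twGr_one_P.trans ⟨fun h _ => h, fun h => h ()⟩

theorem powOnePEquiv_d (z : KSVertex) (v : (actObj (TwI.pow F 1) (P F z)).V) :
    powOnePEquiv z ((actObj (TwI.pow F 1) (P F z)).d v) =
      (shift (z.offset 1) (P F z.swap)).d (powOnePEquiv z v) := by
  have h : (actObj (TwI.pow F 1) (P F z)).d v = 0 := funext fun i => unit_d (P F z) 1 v i
  rw [h, map_zero]
  rfl

/-- The isomorphism between `Q ⊙ P(z)` and a shift of the projective module at the other vertex. -/
noncomputable def powOnePIso (z : KSVertex) :
    actObj (TwI.pow F 1) (P F z) ≅ shift (z.offset 1) (P F z.swap) :=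
  isoOfLinearEquiv (powOnePEquiv z) (powOnePEquiv_act z) (powOnePEquiv_mem z)

theorem powOnePIso_hom_mem (z : KSVertex) : (powOnePIso (F := F) z).hom ∈ cycles F _ _ :=
  isoOfLinearEquiv_hom_mem _ _ _ (powOnePEquiv_d z)

theorem powOnePIso_inv_mem (z : KSVertex) : (powOnePIso (F := F) z).inv ∈ cycles F _ _ :=
  isoOfLinearEquiv_inv_mem _ _ _ (powOnePEquiv_d z)

end DGMod

namespace TwI

theorem runs_cup (k : ℕ) : Runs k [(Elem.cup, 0)] (k + 2) := ⟨Nat.zero_le k, rfl⟩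

theorem runs_cap (k : ℕ) : Runs (k + 2) [(Elem.cap, 0)] k := ⟨Nat.le_add_left 2 k, rfl⟩

theorem cup_comp_cap (k : ℕ) : QHom.comp (Finsupp.single (Diag.mk _ (runs_cup k)) (1 : F))
    (Finsupp.single (Diag.mk _ (runs_cap k)) 1) = QHom.one rfl := by
  rw [QHom.comp_single, Diag.comp_mk, one_mul]
  exact congrArg (Finsupp.single · 1) (Diag.mk_eq_of_localRel [] [] (.loop 0) _ rfl)

theorem cap_comp_cup (k : ℕ) : QHom.comp (Finsupp.single (Diag.mk _ (runs_cap k)) (1 : F))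
    (Finsupp.single (Diag.mk _ (runs_cup k)) 1) = QHom.one rfl := by
  rw [QHom.comp_single, Diag.comp_mk, one_mul]
  exact congrArg (Finsupp.single · 1) (Diag.mk_eq_of_localRel [] [] (.slide 0) _ rfl)

variable [CharP F 2]

theorem mem_cycles_of_f_eq_zero {A B : TwI F} (hA : A.f = 0) (hB : B.f = 0) {g : A ⟶ B}
    (hg : g ∈ gr A B 0) : g ∈ cycles F A B := by
  refine ⟨hg, ?_⟩
  change QMat.mul A.f g + QMat.mul g B.f = 0
  rw [hA, hB, QMat.zero_mul, QMat.mul_zero, add_zero]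

/-- The isomorphism `Q^k ⊗ Q^l ≅ Q^(k + l)`. -/
noncomputable def powAddIso (k l : ℕ) : tensorObj (pow F k) (pow F l) ≅ pow F (k + l) :=
  permIso _ _ (Equiv.punitProd Unit) fun _ => rfl

theorem tensorObj_pow_f (k l : ℕ) : (tensorObj (pow F k) (pow F l)).f = 0 := by
  change QMat.tens 0 _ + QMat.tens _ 0 = 0
  rw [QMat.zero_tens, QMat.tens_zero]
  exact add_zero _

theorem powAddIso_hom_mem (k l : ℕ) : (powAddIso (F := F) k l).hom ∈ cycles F _ _ :=
  mem_cycles_of_f_eq_zero (tensorObj_pow_f k l) rfl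
    (perm_mem_gr (A := tensorObj (pow F k) (pow F l)) (B := pow F (k + l))
      (h := fun _ => rfl) fun _ => rfl)

theorem powAddIso_inv_mem (k l : ℕ) : (powAddIso (F := F) k l).inv ∈ cycles F _ _ :=
  mem_cycles_of_f_eq_zero rfl (tensorObj_pow_f k l)
    (perm_mem_gr (A := pow F (k + l)) (B := tensorObj (pow F k) (pow F l))
      (h := fun _ => rfl) fun _ => rfl)

/-- The isomorphism `Q^k[1] ≅ Q^(k + 2)` given by a cup and a cap. -/
noncomputable def cupIso (k : ℕ) : shift 1 (pow F k) ≅ pow F (k + 2) where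
  hom := fun _ _ => Finsupp.single (Diag.mk _ (runs_cup k)) 1
  inv := fun _ _ => Finsupp.single (Diag.mk _ (runs_cap k)) 1
  hom_inv_id := funext fun _ => funext fun _ => (Finset.sum_singleton _ _).trans
    ((cup_comp_cap k).trans (id_apply_self (pow F k) ()).symm)
  inv_hom_id := funext fun _ => funext fun _ => (Finset.sum_singleton _ _).trans
    ((cap_comp_cup k).trans (id_apply_self (pow F (k + 2)) ()).symm)

theorem cupIso_hom_mem (k : ℕ) : (cupIso (F := F) k).hom ∈ cycles F _ _ :=
  mem_cycles_of_f_eq_zero (A := shift 1 (pow F k)) (B := pow F (k + 2)) rfl rfl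
    (mem_gr.2 fun _ _ => QHom.single_mem _ _ rfl)

theorem cupIso_inv_mem (k : ℕ) : (cupIso (F := F) k).inv ∈ cycles F _ _ :=
  mem_cycles_of_f_eq_zero (A := pow F (k + 2)) (B := shift 1 (pow F k)) rfl rfl
    (mem_gr.2 fun _ _ => QHom.single_mem _ _ rfl)

end TwI

namespace DGMod

variable [CharP F 2]

/-- The DG modules generated by the projective modules `P(z)`. -/
def IsGeneratedByP (X : DGMod F) : Prop := DGGenerated F (fun X : DGMod F => ∃ z, X = P F z) X

/-- Since Q acts by a DG functor that exchanges the two projectives up to a shift, it preserves what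
they generate. -/
theorem IsGeneratedByP.pow_one {X : DGMod F} (hX : IsGeneratedByP X) :
    IsGeneratedByP (actObj (TwI.pow F 1) X) := by
  refine (isDGAction.isDGFunctor_right (TwI.pow F 1)).dgGenerated ?_ hX
  rintro _ ⟨z, rfl⟩
  exact .iso (powOnePIso z).symm (powOnePIso_inv_mem z) (powOnePIso_hom_mem z)
    (.shift _ _ (.of _ ⟨_, rfl⟩))

theorem IsGeneratedByP.of_iso_left {A B : TwI F} {X : DGMod F} (e : A ≅ B)
    (h : e.hom ∈ cycles F A B) (h' : e.inv ∈ cycles F B A) (hX : IsGeneratedByP (actObj A X)) :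
    IsGeneratedByP (actObj B X) :=
  let hG := isDGAction.isDGFunctor_left X
  .iso (((curriedAction (TwI F) (DGMod F)).flip.obj X).mapIso e) (hG.map_mem_cycles h)
    (hG.map_mem_cycles h') hX

/-- Writing Q^(n+1) as Q^n ⊗ Q reduces to acting by Q^n on Q ⊙ X, so the induction has to range over
all X. -/
theorem IsGeneratedByP.pow (n : ℕ) {X : DGMod F} (hX : IsGeneratedByP X) :
    IsGeneratedByP (actObj (TwI.pow F n) X) := by
  induction n generalizing X with
  | zero =>
    exact .iso (actUnit X).symm (isDGAction.unit_inv_mem X) (isDGAction.unit_hom_mem X) hX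
  | succ n ih =>
    refine IsGeneratedByP.of_iso_left (TwI.powAddIso n 1) (TwI.powAddIso_hom_mem n 1)
      (TwI.powAddIso_inv_mem n 1) ?_
    exact .iso (actAssoc (TwI.pow F n) (TwI.pow F 1) X).symm (isDGAction.assoc_inv_mem _ _ X)
      (isDGAction.assoc_hom_mem _ _ X) (ih hX.pow_one)

/-- For fixed X the assignment A ↦ A ⊙ X is a DG functor, so the claim propagates along the cones
that build A. -/
theorem IsGeneratedByP.actObj (A : TwI F) {X : DGMod F} (hX : IsGeneratedByP X) :
    IsGeneratedByP (actObj A X) := by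
  have hG := isDGAction.isDGFunctor_left X
  induction A using TwI.induction with
  | hzero A hA => exact .zero _ (hG.id_eq_zero hA)
  | hsingle n m =>
    exact .iso (hG.shiftIso m (TwI.pow F n)) (hG.shiftIso_hom_mem m _) (hG.shiftIso_inv_mem m _)
      (.shift m _ (hX.pow n))
  | hcone h hA hB => exact .cone (hG.isMappingCone h) hA hB

end DGMod

namespace DGP

variable [CharP F 2]

/-- The isomorphism in the generated category defined by an isomorphism of DG modules. -/
def ofModIso {X Y : DGP F} (e : X.obj ≅ Y.obj) : X ≅ Y where
  hom := ofMod e.hom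
  inv := ofMod e.inv
  hom_inv_id := e.hom_inv_id
  inv_hom_id := e.inv_hom_id

/-- The subcategory is full and stable under the action, so the coherence conditions are inherited.
-/
noncomputable instance : MonoidalLeftAction (TwI F) (DGP F) where
  actionObj A X := ⟨DGMod.actObj A X.obj, DGMod.IsGeneratedByP.actObj A X.prop⟩
  actionHomLeft f X := DGMod.leftHom f X.obj
  actionHomRight A _ _ g := DGMod.rightHom A (toMod g)
  actionAssocIso A B X := ofModIso (DGMod.actAssoc A B X.obj)
  actionUnitIso X := ofModIso (DGMod.actUnit X.obj)
  actionHom_def _ _ := rfl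
  actionHomRight_id A X := actionHomRight_id A X.obj
  id_actionHomLeft A X := id_actionHomLeft A X.obj
  actionHom_comp f f' g g' := actionHom_comp f f' (toMod g) (toMod g')
  actionAssocIso_hom_naturality f g h :=
    actionAssocIso_hom_naturality f g (toMod h)
  actionUnitIso_hom_naturality _ := rfl
  whiskerLeft_actionHomLeft A _ _ f X := whiskerLeft_actionHomLeft A f X.obj
  whiskerRight_actionHomLeft C f X := whiskerRight_actionHomLeft C f X.obj
  associator_actionHom A B C X := associator_actionHom A B C X.obj
  leftUnitor_actionHom A X := leftUnitor_actionHom A X.obj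
  rightUnitor_actionHom A X := rightUnitor_actionHom A X.obj

theorem isDGAction : IsDGAction F (TwI F) (DGP F) where
  add_left f f' X := DGMod.isDGAction.add_left f f' X.obj
  smul_left c f X := DGMod.isDGAction.smul_left c f X.obj
  add_right A _ _ g g' := DGMod.isDGAction.add_right A (toMod g) (toMod g')
  smul_right A _ _ c g := DGMod.isDGAction.smul_right A c (toMod g)
  left_mem X hf := DGMod.isDGAction.left_mem X.obj hf
  right_mem A _ _ _ g hg := DGMod.isDGAction.right_mem A (g := toMod g) hg
  d_left f X := DGMod.isDGAction.d_left f X.obj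
  d_right A _ _ g := DGMod.isDGAction.d_right A (toMod g)
  assoc_hom_mem A B X := DGMod.isDGAction.assoc_hom_mem A B X.obj
  assoc_inv_mem A B X := DGMod.isDGAction.assoc_inv_mem A B X.obj
  unit_hom_mem X := DGMod.isDGAction.unit_hom_mem X.obj
  unit_inv_mem X := DGMod.isDGAction.unit_inv_mem X.obj

theorem actsByTensor : ActsByTensor (TwI.pow F 1) (DGBimod.M F) :=
  ⟨fun X => DGBimod.powOneIso X.obj, fun X => ⟨DGBimod.powOneIso_hom_mem X.obj,
    DGBimod.powOneIso_inv_mem X.obj⟩, fun _ _ f => DGBimod.powOneIso_naturality (toMod f)⟩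

variable (F) in
-- A zero object arises by letting the empty twisted complex act, since DG functors preserve zero
-- objects.
theorem exists_id_eq_zero : ∃ X : DGP F, 𝟙 X = 0 := by
  obtain ⟨A, hA⟩ := TwI.exists_id_eq_zero F
  exact ⟨A ⊙ₗ P F KSVertex.x, (isDGAction.isDGFunctor_left (P F KSVertex.x)).id_eq_zero hA⟩

variable (F) in
theorem h0IsTriangulated : H0IsTriangulated F (DGP F) :=
  _root_.h0IsTriangulated hasMappingCones (exists_id_eq_zero F)

/-- The isomorphism in the generated category between `Q ⊙ P(z)` and a shift of the projective
module at the other vertex. -/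
noncomputable def powOnePIso (z : KSVertex) :
    TwI.pow F 1 ⊙ₗ P F z ≅ sh (F := F) (z.offset 1) (P F z.swap) :=
  ofModIso (X := TwI.pow F 1 ⊙ₗ P F z) (Y := sh (F := F) (z.offset 1) (P F z.swap))
    (DGMod.powOnePIso z)

end DGP

end ActionOnGeneratedCategory

/-! ### Euler characteristics of the components of a DG module at the vertices. -/

section EulerCharacteristic

open DGCategory KSAlg DGShift Module

variable {F : Type u} [Field F]

namespace DGMod

/-- The part of a DG module at a vertex and in the degrees of a given parity. -/
noncomputable def part (X : DGMod F) (z : KSVertex) (ε : ZMod 2) : Submodule F X.V :=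
  (⨆ (n : ℤ) (_ : (n : ZMod 2) = ε), X.gr n) ⊓ LinearMap.eqLocus (X.act (gen F z.e)) LinearMap.id

theorem mem_part_of_mem {X : DGMod F} {z : KSVertex} {n : ℤ} {ε : ZMod 2} (hn : (n : ZMod 2) = ε)
    {v : X.V} (hv : v ∈ X.gr n) (hz : X.act (gen F z.e) v = v) : v ∈ X.part z ε :=
  ⟨Submodule.mem_iSup_of_mem n (Submodule.mem_iSup_of_mem hn hv), hz⟩

/-- An element of the part equals its own image under e(z), so it is a sum of elements e(z)v with v
homogeneous of the right parity. -/
theorem part_le {X : DGMod F} {z : KSVertex} {ε : ZMod 2} {S : Submodule F X.V}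
    (h : ∀ n : ℤ, (n : ZMod 2) = ε → ∀ v ∈ X.gr n, X.act (gen F z.e) v ∈ S) : X.part z ε ≤ S := by
  rintro v ⟨hv, hz⟩
  have h1 : (⨆ (n : ℤ) (_ : (n : ZMod 2) = ε), X.gr n) ≤ S.comap (X.act (gen F z.e)) :=
    iSup₂_le h
  have h2 : X.act (gen F z.e) v ∈ S := h1 hv
  rwa [show X.act (gen F z.e) v = v from hz] at h2

theorem map_mem_part {X Y : DGMod F} {f : X.V →ₗ[F] Y.V} {n : ℤ} (hf : f ∈ homDeg X Y n)
    {z : KSVertex} {ε ε' : ZMod 2} (hn : (n : ZMod 2) + ε = ε') {v : X.V} (hv : v ∈ X.part z ε) :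
    f v ∈ Y.part z ε' := by
  refine part_le (S := (Y.part z ε').comap f) (fun m hm v hv => ?_) hv
  refine mem_part_of_mem (n := n + m) (by rw [← hn, ← hm, Int.cast_add])
    (hf.2 _ _ (X.act_e_mem z hv)) ?_
  rw [hf.1, act_act, e_mul_e]

/-- The Euler characteristic of the part of a DG module at a vertex. -/
noncomputable def euler (z : KSVertex) (X : DGMod F) : ℤ :=
  finrank F (X.part z 0) - finrank F (X.part z 1)

/-- The sum of the differential and of the contraction whose square vanishes. -/
noncomputable def contractionSum {X : DGMod F} (h : X ⟶ X) : X.V →ₗ[F] X.V :=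
  X.d + toLin h ∘ₗ X.d ∘ₗ toLin h

theorem contractionSum_mem {X : DGMod F} {h : X ⟶ X} (hh : toLin h ∈ homDeg X X (-1))
    {z : KSVertex} {ε ε' : ZMod 2}
    (hε : 1 + ε = ε') {v : X.V} (hv : v ∈ X.part z ε) : contractionSum h v ∈ X.part z ε' := by
  -- The contraction has degree -1 and the differential degree 1, but in `ZMod 2` these coincide;
  -- both exchange the two parities.
  have hε' : -1 + ε = ε' := hε
  refine add_mem (map_mem_part X.d_mem_homDeg (by rw [← hε, Int.cast_one]) hv) ?_
  have h1 := map_mem_part hh (ε' := ε') (n := -1) (by rw [← hε']; norm_num) hv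
  have h2 := map_mem_part X.d_mem_homDeg (ε' := ε) (by rw [← hε', Int.cast_one]; ring) h1
  exact map_mem_part hh (n := -1) (by rw [← hε']; norm_num) h2

section Projectives

/-- For fixed vertices and parity, the block e(z')Re(z) is spanned by a single path t or is zero,
and it suffices to test this on the spanning set of paths. The case t = 0 covers the empty blocks.
-/
theorem finrank_part_P {z z' : KSVertex} {ε : ZMod 2} {n : ℤ} {t : KSAlg F} (ht : t ∈ KSAlg.gr F n)
    (hn : (n : ZMod 2) = ε) (hz : t * gen F z.e = t) (hz' : gen F z'.e * t = t)
    (h : ∀ m : ℤ, (m : ZMod 2) = ε → ∀ r ∈ pathSet F m,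
      gen F z'.e * (r * gen F z.e) ∈ Submodule.span F {t}) :
    finrank F ((P F z).part z' ε) = finrank F (Submodule.span F {t}) := by
  have e : Submodule.map (leftIdeal F z).subtype ((P F z).part z' ε) = Submodule.span F {t} := by
    refine le_antisymm (Submodule.map_le_iff_le_comap.2 ?_) (Submodule.span_le.2 ?_)
    · refine part_le (X := P F z) fun m hm v hv => ?_
      have key : KSAlg.gr F m ≤ (Submodule.span F {t}).comap
          ((LinearMap.mulLeft F (gen F z'.e)).comp (LinearMap.mulRight F (gen F z.e))) :=
        (gr_le_span_pathSet m).trans (Submodule.span_le.2 (h m hm))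
      have h1 : gen F z'.e * (v.1 * gen F z.e) ∈ Submodule.span F {t} := key hv
      rwa [mul_e_of_mem v.2] at h1
    · rintro r hr
      rw [Set.mem_singleton_iff.1 hr]
      exact ⟨⟨t, t, hz⟩, mem_part_of_mem (X := P F z) hn ht (Subtype.ext hz'), rfl⟩
  rw [← e]
  exact (LinearEquiv.finrank_eq (Submodule.equivMapOfInjective _
    (Submodule.subtype_injective (leftIdeal F z)) ((P F z).part z' ε)))

theorem finrank_part_P_of_ne_zero {z z' : KSVertex} {ε : ZMod 2} {n : ℤ} {t : KSAlg F}
    (ht : t ∈ KSAlg.gr F n)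
    (hn : (n : ZMod 2) = ε) (hz : t * gen F z.e = t) (hz' : gen F z'.e * t = t)
    (h : ∀ m : ℤ, (m : ZMod 2) = ε → ∀ r ∈ pathSet F m,
      gen F z'.e * (r * gen F z.e) ∈ Submodule.span F {t}) (h0 : t ≠ 0) :
    finrank F ((P F z).part z' ε) = 1 := by
  rw [finrank_part_P ht hn hz hz' h, finrank_span_singleton h0]

theorem finrank_part_P_of_zero {z z' : KSVertex} {ε : ZMod 2}
    (h : ∀ m : ℤ, (m : ZMod 2) = ε → ∀ r ∈ pathSet F m, gen F z'.e * (r * gen F z.e) = 0) :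
    finrank F ((P F z).part z' ε) = 0 := by
  obtain ⟨n, hn⟩ := ZMod.intCast_surjective ε
  rw [finrank_part_P (t := 0) (zero_mem _) hn (zero_mul _) (mul_zero _) fun m hm r hr => by
    rw [h m hm r hr]; exact zero_mem _, Submodule.span_zero_singleton, finrank_bot]

/-- This and the next six lemmas tabulate the blocks, even part before odd part: e(x)Re(x) has e(x)
and ab, e(y)Re(y) has e(y) and ba, e(y)Re(x) has only the odd b, e(x)Re(y) only the even a. -/
theorem finrank_part_P_self (z : KSVertex) : finrank F ((P F z).part z 0) = 1 := by
  refine finrank_part_P_of_ne_zero (e_mem z) Int.cast_zero (e_mul_e z) (e_mul_e z) ?_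
    (gen_ne_zero z.e)
  rintro m hm r (⟨rfl, rfl | rfl | rfl⟩ | ⟨rfl, _⟩)
  pick_goal 4
  · exact absurd hm (by decide)
  all_goals
    cases z <;> simp only [KSVertex.e, gen_ex_ex, gen_ey_ey, gen_ex_ey, gen_ey_ex, gen_a_ex,
      gen_a_ey, gen_ey_a, mul_zero, zero_mem, Submodule.mem_span_singleton_self]

theorem finrank_part_P_x_x : finrank F ((P F KSVertex.x).part KSVertex.x 1) = 1 := by
  refine finrank_part_P_of_ne_zero (mul_mem_gr (gen_mem_gr KSGen.a) (gen_mem_gr KSGen.b)) rfl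
    ?_ ?_ ?_ gen_a_mul_gen_b_ne_zero
  · rw [mul_assoc]; exact congrArg _ gen_b_ex
  · rw [← mul_assoc]; exact congrArg (· * _) gen_ex_a
  · rintro m hm r (⟨rfl, _⟩ | ⟨rfl, rfl | rfl | rfl⟩)
    · exact absurd hm (by decide)
    all_goals
      simp only [KSVertex.e, mul_assoc, gen_b_ex, gen_ex_b, gen_a_ex, mul_zero, zero_mem]
    rw [← mul_assoc, gen_ex_a]
    exact Submodule.mem_span_singleton_self _

theorem finrank_part_P_y_y : finrank F ((P F KSVertex.y).part KSVertex.y 1) = 1 := by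
  refine finrank_part_P_of_ne_zero (mul_mem_gr (gen_mem_gr KSGen.b) (gen_mem_gr KSGen.a)) rfl
    ?_ ?_ ?_ gen_b_mul_gen_a_ne_zero
  · rw [mul_assoc]; exact congrArg _ gen_a_ey
  · rw [← mul_assoc]; exact congrArg (· * _) gen_ey_b
  · rintro m hm r (⟨rfl, _⟩ | ⟨rfl, rfl | rfl | rfl⟩)
    · exact absurd hm (by decide)
    all_goals
      simp only [KSVertex.e, mul_assoc, gen_b_ey, gen_a_ey, mul_zero, zero_mem]
    rw [← mul_assoc, gen_ey_b]
    exact Submodule.mem_span_singleton_self _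

theorem finrank_part_P_x_y : finrank F ((P F KSVertex.x).part KSVertex.y 1) = 1 := by
  refine finrank_part_P_of_ne_zero (gen_mem_gr KSGen.b) rfl gen_b_ex gen_ey_b ?_
    (gen_ne_zero KSGen.b)
  rintro m hm r (⟨rfl, _⟩ | ⟨rfl, rfl | rfl | rfl⟩)
  · exact absurd hm (by decide)
  all_goals
    simp only [KSVertex.e, mul_assoc, gen_b_ex, gen_ey_b, gen_a_ex, mul_zero, zero_mem,
      Submodule.mem_span_singleton_self]
  rw [← mul_assoc, gen_ey_a, zero_mul]
  exact zero_mem _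

theorem finrank_part_P_y_x : finrank F ((P F KSVertex.y).part KSVertex.x 0) = 1 := by
  refine finrank_part_P_of_ne_zero (gen_mem_gr KSGen.a) Int.cast_zero gen_a_ey gen_ex_a ?_
    (gen_ne_zero KSGen.a)
  rintro m hm r (⟨rfl, rfl | rfl | rfl⟩ | ⟨rfl, _⟩)
  pick_goal 4
  · exact absurd hm (by decide)
  all_goals
    simp only [KSVertex.e, gen_ey_ey, gen_ex_ey, gen_a_ey, gen_ex_a, mul_zero, zero_mem,
      Submodule.mem_span_singleton_self]

theorem finrank_part_P_x_y_zero : finrank F ((P F KSVertex.x).part KSVertex.y 0) = 0 := by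
  refine finrank_part_P_of_zero ?_
  rintro m hm r (⟨rfl, rfl | rfl | rfl⟩ | ⟨rfl, _⟩)
  pick_goal 4
  · exact absurd hm (by decide)
  all_goals
    simp only [KSVertex.e, gen_ex_ex, gen_ey_ex, gen_a_ex, mul_zero]

theorem finrank_part_P_y_x_one : finrank F ((P F KSVertex.y).part KSVertex.x 1) = 0 := by
  refine finrank_part_P_of_zero ?_
  rintro m hm r (⟨rfl, _⟩ | ⟨rfl, rfl | rfl | rfl⟩)
  · exact absurd hm (by decide)
  all_goals
    simp only [KSVertex.e, mul_assoc, gen_b_ey, gen_a_ey, mul_zero]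
  rw [← mul_assoc, gen_ex_b, zero_mul]

theorem euler_P_self (z : KSVertex) : euler z (P F z) = 0 := by
  cases z
  · rw [euler, finrank_part_P_self, finrank_part_P_x_x, sub_self]
  · rw [euler, finrank_part_P_self, finrank_part_P_y_y, sub_self]

theorem euler_P_x : euler KSVertex.y (P F KSVertex.x) = -1 := by
  rw [euler, finrank_part_P_x_y, finrank_part_P_x_y_zero]
  rfl

theorem euler_P_y : euler KSVertex.x (P F KSVertex.y) = 1 := by
  rw [euler, finrank_part_P_y_x, finrank_part_P_y_x_one]
  rfl

end Projectives

variable [CharP F 2]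

section Cones

variable {X Y Z : DGMod F} {f : X ⟶ Y} {i : Y ⟶ Z} {p : Z ⟶ X} {s : X ⟶ Z} {q : Z ⟶ Y}

theorem cone_total (h : ConeData F f i p s q) (v : Z.V) :
    toLin i (toLin q v) + toLin s (toLin p v) = v :=
  congrArg (fun g => toLin g v) h.total

/-- Disregarding differentials, the mapping cone of `f : X ⟶ Y` is the sum of `Y` and `X[1]`. -/
noncomputable def partConeEquiv (h : ConeData F f i p s q) (z : KSVertex) (ε : ZMod 2) :
    Z.part z ε ≃ₗ[F] Y.part z ε × X.part z (ε + 1) where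
  toFun v := (⟨toLin q v.1, map_mem_part h.q_mem (by rw [Int.cast_zero, zero_add]) v.2⟩,
    ⟨toLin p v.1, map_mem_part h.p_mem (by rw [Int.cast_one, add_comm]) v.2⟩)
  map_add' v w := Prod.ext (Subtype.ext (map_add (toLin q) v.1 w.1))
    (Subtype.ext (map_add (toLin p) v.1 w.1))
  map_smul' c v := Prod.ext (Subtype.ext (map_smul (toLin q) c v.1))
    (Subtype.ext (map_smul (toLin p) c v.1))
  invFun w := ⟨toLin i w.1.1 + toLin s w.2.1, add_mem
    (map_mem_part h.i_mem (by rw [Int.cast_zero, zero_add]) w.1.2)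
    (map_mem_part h.s_mem (by push_cast; ring) w.2.2)⟩
  left_inv v := Subtype.ext (cone_total h v.1)
  right_inv w := by
    have h1 : toLin q (toLin i w.1.1) = w.1.1 := congrArg (fun g => toLin g w.1.1) h.iq
    have h2 : toLin p (toLin s w.2.1) = w.2.1 := congrArg (fun g => toLin g w.2.1) h.sp
    have h3 : toLin p (toLin i w.1.1) = 0 := congrArg (fun g => toLin g w.1.1) h.ip
    have h4 : toLin q (toLin s w.2.1) = 0 := congrArg (fun g => toLin g w.2.1) h.sq
    refine Prod.ext (Subtype.ext ?_) (Subtype.ext ?_)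
    · exact (map_add _ _ _).trans (by rw [h1, h4, add_zero])
    · exact (map_add _ _ _).trans (by rw [h2, h3, zero_add])

theorem finite_of_cone (h : ConeData F f i p s q) [FiniteDimensional F X.V]
    [FiniteDimensional F Y.V] : FiniteDimensional F Z.V :=
  Module.Finite.of_surjective ((toLin i).coprod (toLin s)) fun v =>
    ⟨(toLin q v, toLin p v), cone_total h v⟩

/-- Without its differential the cone is Y ⊕ X[1], and the shift exchanges the parities of X. -/
theorem euler_cone (h : IsMappingCone F f i p) [FiniteDimensional F X.V] [FiniteDimensional F Y.V]
    (z : KSVertex) : euler z Y = euler z X + euler z Z := by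
  obtain ⟨s, q, h⟩ := h.exists_coneData
  have h0 := (partConeEquiv h z 0).finrank_eq
  have h1 := (partConeEquiv h z 1).finrank_eq
  rw [finrank_prod] at h0 h1
  rw [zero_add] at h0
  rw [show (1 + 1 : ZMod 2) = 0 from rfl] at h1
  rw [euler, euler, euler, h0, h1]
  push_cast
  ring

end Cones

section Contractible

variable {X : DGMod F} {h : X ⟶ X}

theorem contraction_apply (e : homD X X h = 𝟙 X) (v : X.V) :
    X.d (toLin h v) = v + toLin h (X.d v) := by
  have h1 : X.d (toLin h v) + toLin h (X.d v) = v := congrArg (fun g => toLin g v) e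
  refine eq_of_add_eq_zero F ?_
  rw [add_left_comm, h1]
  exact TwI.add_self (F := F) v

/-- A contraction h satisfies dhd = d, so h' = hdh is again a contraction, and moreover h'² = 0.
Hence (d + h')² = dh' + h'd = 1. With h itself the term h² would remain. -/
theorem contractionSum_contractionSum (e : homD X X h = 𝟙 X) (v : X.V) :
    contractionSum h (contractionSum h v) = v := by
  have k := contraction_apply e
  have k1 : ∀ w, X.d (toLin h (X.d w)) = X.d w := fun w => by rw [k, X.d_d, map_zero, add_zero]
  have k2 : X.d (toLin h (toLin h (X.d (toLin h v)))) = 0 := by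
    rw [k, k1]
    exact TwI.add_self (F := F) _
  change X.d (X.d v + toLin h (X.d (toLin h v))) +
    toLin h (X.d (toLin h (X.d v + toLin h (X.d (toLin h v))))) = v
  rw [map_add, X.d_d, k1, zero_add, map_add (toLin h), map_add X.d, k1, k2, add_zero]
  exact congrArg (fun g => toLin g v) e

/-- The two parts of a contractible DG module at a vertex are isomorphic. -/
noncomputable def partEquivOfContraction (hh : toLin h ∈ homDeg X X (-1)) (e : homD X X h = 𝟙 X)
    (z : KSVertex) : X.part z 0 ≃ₗ[F] X.part z 1 :=
  LinearEquiv.ofLinearMap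
    ((contractionSum h).restrict fun _ hv => contractionSum_mem hh (add_zero 1) hv)
    ((contractionSum h).restrict fun _ hv => contractionSum_mem hh (CharTwo.add_self_eq_zero 1) hv)
    (LinearMap.ext fun v => Subtype.ext (contractionSum_contractionSum e v.1))
    (LinearMap.ext fun v => Subtype.ext (contractionSum_contractionSum e v.1))

theorem euler_eq_zero (hh : toLin h ∈ homDeg X X (-1)) (e : homD X X h = 𝟙 X) (z : KSVertex) :
    euler z X = 0 := by
  rw [euler, (partEquivOfContraction hh e z).finrank_eq, sub_self]

end Contractible

theorem IsGeneratedByP.finiteDimensional {X : DGMod F} (hX : IsGeneratedByP X) :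
    FiniteDimensional F X.V := by
  induction hX with
  | of X hX =>
    obtain ⟨z, rfl⟩ := hX
    exact inferInstanceAs (FiniteDimensional F (leftIdeal F z))
  | zero X hX =>
    have : Subsingleton X.V := ⟨fun v w =>
      (congrArg (fun g => toLin g v) hX).trans (congrArg (fun g => toLin g w) hX).symm⟩
    infer_instance
  | iso e _ _ _ ih =>
    exact Module.Finite.of_surjective (toLin e.hom) fun v =>
      ⟨toLin e.inv v, congrArg (fun g => toLin g v) e.inv_hom_id⟩
  | shift n X _ ih => exact ih
  | cone h _ _ ih ih' =>
    obtain ⟨s, q, h⟩ := h.exists_coneData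
    exact finite_of_cone h

end DGMod

end EulerCharacteristic

/-! ### A DG action induces a biadditive map of Grothendieck groups. -/

section ActionOnGrothendieckGroups

open DGCategory DGShift

namespace K0

variable {F : Type u} [Field F] [CharP F 2] {C D : Type*} [Category* C] [Preadditive C]
  [Linear F C] [DGCategory F C] [DGShift F C] [Category* D] [Preadditive D] [Linear F D]
  [DGCategory F D] [DGShift F D]

theorem addHom_ext {G : Type*} [AddCommGroup G] {f g : K0 F C →+ G}
    (h : ∀ X : C, f (cls F X) = g (cls F X)) : f = g :=
  AddMonoidHom.ext fun a => ind (p := fun a => f a = g a) h (by rw [map_zero, map_zero])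
    (fun a ha => by rw [map_neg, map_neg, ha])
    (fun a b ha hb => by rw [map_add, map_add, ha, hb]) a

theorem mem_of_cls_mem {S : AddSubgroup (K0 F C)} (h : ∀ X : C, cls F X ∈ S) (a : K0 F C) : a ∈ S :=
  ind h (zero_mem _) (fun _ => neg_mem) (fun _ _ => add_mem) a

/-- The homomorphism of Grothendieck groups induced by a functor of DG categories. -/
noncomputable def map (hC : HasMappingCones F C) (hT : H0IsTriangulated F C)
    (hT' : H0IsTriangulated F D) {G : C ⥤ D} (hG : IsDGFunctor F G) : K0 F C →+ K0 F D :=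
  lift hC hT (fun X => cls F (G.obj X)) (fun h => cls_cone (hG.isMappingCone h))
    fun _ h => cls_eq_zero hT' _ (hG.isZero h)

theorem map_cls (hC : HasMappingCones F C) (hT : H0IsTriangulated F C)
    (hT' : H0IsTriangulated F D) {G : C ⥤ D} (hG : IsDGFunctor F G) (X : C) :
    map hC hT hT' hG (cls F X) = cls F (G.obj X) :=
  FreeAbelianGroup.lift_apply_of (fun X => cls F (G.obj X)) X

theorem cls_eq_of_isoOf (hC : HasMappingCones F C) (hT : H0IsTriangulated F C) {X Y : C}
    (e : X ≅ Y) (h : e.hom ∈ cycles F X Y) (h' : e.inv ∈ cycles F Y X) : cls F X = cls F Y :=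
  cls_eq_of_iso hC hT (H0.isoOfIso e h h')

variable [MonoidalCategory C] [MonoidalLeftAction C D]

/-- The biadditive map of Grothendieck groups induced by an action. -/
noncomputable def action (hC : HasMappingCones F C) (hT : H0IsTriangulated F C)
    (hD : HasMappingCones F D) (hT' : H0IsTriangulated F D) (h : IsDGAction F C D) :
    K0 F C →+ K0 F D →+ K0 F D :=
  lift hC hT (fun A => map hD hT' hT' (h.isDGFunctor_right A))
    -- Additivity in A is an equality of homomorphisms in X, tested on classes: A ↦ A ⊙ X preserves
    -- cones.
    (fun hc => addHom_ext fun X => by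
      rw [AddMonoidHom.add_apply, map_cls, map_cls, map_cls]
      exact cls_cone ((h.isDGFunctor_left X).isMappingCone hc))
    fun _ hA => addHom_ext fun X => by
      rw [map_cls]
      exact cls_eq_zero hT' _ ((h.isDGFunctor_left X).isZero hA)

theorem action_cls (hC : HasMappingCones F C) (hT : H0IsTriangulated F C)
    (hD : HasMappingCones F D) (hT' : H0IsTriangulated F D) (h : IsDGAction F C D) (A : C) (X : D) :
    action hC hT hD hT' h (cls F A) (cls F X) = cls F (A ⊙ₗ X) := by
  have h1 : action hC hT hD hT' h (cls F A) = map hD hT' hT' (h.isDGFunctor_right A) :=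
    FreeAbelianGroup.lift_apply_of (fun A => map hD hT' hT' (h.isDGFunctor_right A)) A
  rw [h1]
  exact map_cls hD hT' hT' (h.isDGFunctor_right A) X

end K0

end ActionOnGrothendieckGroups

/-! ### The two Grothendieck groups and the Gaussian action. -/

section GrothendieckGroupOfModules

open DGCategory DGShift DGMod

variable {F : Type u} [Field F] [CharP F 2]

namespace DGP

instance (X : DGP F) : FiniteDimensional F X.obj.V := IsGeneratedByP.finiteDimensional X.prop

variable (F) in
/-- The Euler characteristics at the two vertices, as a homomorphism on the Grothendieck group. -/
noncomputable def eulerHom : K0 F (DGP F) →+ ℤ × ℤ :=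
  K0.lift hasMappingCones (h0IsTriangulated F)
    -- Each projective is detected at the opposite vertex: P(x) has Euler characteristic -1 at y and
    -- 0 at x, while P(y) has 1 at x and 0 at y. Hence the crossed coordinates and the sign.
    (fun X => (-euler KSVertex.y X.obj, euler KSVertex.x X.obj))
    (fun h => Prod.ext (by
      have e := euler_cone (isMappingCone_iff.2 h) KSVertex.y
      exact (congrArg Neg.neg e).trans (neg_add _ _))
      (euler_cone (isMappingCone_iff.2 h) KSVertex.x))
    fun X hX => by
      obtain ⟨h, hh, e⟩ := H0.exists_homotopy_of_isZero hX
      rw [euler_eq_zero (X := X.obj) (h := h) hh e, euler_eq_zero (X := X.obj) (h := h) hh e]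
      rfl

theorem eulerHom_cls (X : DGP F) :
    eulerHom F (K0.cls F X) = (-euler KSVertex.y X.obj, euler KSVertex.x X.obj) :=
  FreeAbelianGroup.lift_apply_of
    (fun X : DGP F => (-euler KSVertex.y X.obj, euler KSVertex.x X.obj)) X

theorem eulerHom_x : eulerHom F (K0.cls F (P F KSVertex.x)) = (1, 0) :=
  (eulerHom_cls _).trans (Prod.ext (congrArg Neg.neg euler_P_x) (euler_P_self KSVertex.x))

theorem eulerHom_y : eulerHom F (K0.cls F (P F KSVertex.y)) = (0, 1) :=
  (eulerHom_cls _).trans (Prod.ext (congrArg Neg.neg (euler_P_self KSVertex.y)) euler_P_y)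

/-- Generation of objects becomes generation of the group: isomorphisms preserve classes, shifts
change them by a sign, and the class of a cone is a difference of classes. -/
theorem cls_mem {S : AddSubgroup (K0 F (DGP F))} (h : ∀ z, K0.cls F (P F z) ∈ S) {X : DGMod F}
    (hX : IsGeneratedByP X) : K0.cls F (⟨X, hX⟩ : DGP F) ∈ S := by
  induction hX with
  | of X hX =>
    obtain ⟨z, rfl⟩ := hX
    exact h z
  | zero X hX =>
    have h1 := K0.cls_eq_zero (h0IsTriangulated F) (⟨X, .zero X hX⟩ : DGP F)
      (H0.isZero_of_id_eq_zero hX)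
    exact h1 ▸ zero_mem S
  | @iso X Y e h h' hX ih =>
    have h1 := K0.cls_eq_of_isoOf hasMappingCones (h0IsTriangulated F)
      (ofModIso (X := ⟨X, hX⟩) (Y := ⟨Y, .iso e h h' hX⟩) e) h h'
    exact h1 ▸ ih
  | shift n X hX ih =>
    have h1 := K0.cls_shift hasMappingCones (h0IsTriangulated F) (exists_id_eq_zero F)
      (⟨X, hX⟩ : DGP F) n
    exact h1 ▸ S.zsmul_mem ih _
  | @cone X Y Z f i p h hX hY ihX ihY =>
    have h1 := K0.cls_cone (isMappingCone_iff (X := ⟨X, hX⟩) (Y := ⟨Y, hY⟩)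
      (Z := ⟨Z, .cone h hX hY⟩) (f := f) (i := i) (p := p) |>.1 h)
    rw [h1] at ihY
    exact (S.add_mem_cancel_left ihX).1 ihY

variable (F) in
/-- The isomorphism between the Grothendieck group and `ℤ x ⊕ ℤ y`. -/
noncomputable def eulerEquiv : K0 F (DGP F) ≃+ ℤ × ℤ :=
  AddEquiv.ofBijective (eulerHom F) (by
    -- The candidate inverse. It is a section of `eulerHom` by the values on the projectives, and it
    -- is surjective because their classes generate.
    let g : ℤ × ℤ →+ K0 F (DGP F) :=
      (zmultiplesHom _ (K0.cls F (P F KSVertex.x))).coprod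
        (zmultiplesHom _ (K0.cls F (P F KSVertex.y)))
    have hg : ∀ v, eulerHom F (g v) = v := fun v => by
      change eulerHom F (v.1 • _ + v.2 • _) = v
      rw [map_add, map_zsmul, map_zsmul, eulerHom_x, eulerHom_y]
      simp
    have hs : Function.Surjective g := fun a => K0.mem_of_cls_mem (S := g.range) (fun X =>
      cls_mem (fun z => by
        cases z
        · exact ⟨(1, 0), by simp [g]⟩
        · exact ⟨(0, 1), by simp [g]⟩) X.prop) a
    refine ⟨fun a b hab => ?_, fun v => ⟨g v, hg v⟩⟩
    obtain ⟨v, rfl⟩ := hs a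
    obtain ⟨w, rfl⟩ := hs b
    rw [hg, hg] at hab
    rw [hab])

theorem eulerEquiv_x : eulerEquiv F (K0.cls F (P F KSVertex.x)) = (1, 0) := eulerHom_x

theorem eulerEquiv_y : eulerEquiv F (K0.cls F (P F KSVertex.y)) = (0, 1) := eulerHom_y

theorem eq_zsmul_add_zsmul (a : K0 F (DGP F)) : a = (eulerEquiv F a).1 • K0.cls F (P F KSVertex.x) +
    (eulerEquiv F a).2 • K0.cls F (P F KSVertex.y) := by
  apply (eulerEquiv F).injective
  rw [map_add, map_zsmul, map_zsmul, eulerEquiv_x, eulerEquiv_y]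
  simp

variable (F) in
/-- The action of the Grothendieck group of the twisted complexes. -/
noncomputable def k0Action : K0 F (TwI F) →+ K0 F (DGP F) →+ K0 F (DGP F) :=
  K0.action TwI.hasMappingCones (TwI.h0IsTriangulated F) hasMappingCones (h0IsTriangulated F)
    isDGAction

theorem k0Action_cls (A : TwI F) (X : DGP F) :
    k0Action F (K0.cls F A) (K0.cls F X) = K0.cls F (A ⊙ₗ X) :=
  K0.action_cls _ _ _ _ _ A X

theorem k0Action_unit (a : K0 F (DGP F)) : k0Action F (K0.cls F (𝟙_ (TwI F))) a = a :=
  DFunLike.congr_fun (K0.addHom_ext (g := AddMonoidHom.id _) fun X => (k0Action_cls _ X).trans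
    (K0.cls_eq_of_isoOf hasMappingCones (h0IsTriangulated F) (actionUnitIso X)
      (isDGAction.unit_hom_mem X) (isDGAction.unit_inv_mem X))) a

theorem k0Action_tensor (A B : TwI F) (a : K0 F (DGP F)) : k0Action F (K0.cls F (A ⊗ B)) a =
    k0Action F (K0.cls F A) (k0Action F (K0.cls F B) a) :=
  DFunLike.congr_fun (K0.addHom_ext (g := (k0Action F (K0.cls F A)).comp (k0Action F (K0.cls F B)))
    fun X => by
      rw [AddMonoidHom.comp_apply, k0Action_cls, k0Action_cls, k0Action_cls]
      exact K0.cls_eq_of_isoOf hasMappingCones (h0IsTriangulated F) (actionAssocIso A B X)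
        (isDGAction.assoc_hom_mem A B X) (isDGAction.assoc_inv_mem A B X)) a

/-- One twist shifts by the offset, which is 0 at x and 1 at y; this is where the minus sign of i y
= -x comes from. -/
theorem k0Action_pow_one (z : KSVertex) : k0Action F (K0.cls F (TwI.pow F 1)) (K0.cls F (P F z)) =
    ((z.offset 1).negOnePow : ℤ) • K0.cls F (P F z.swap) := by
  rw [k0Action_cls, ← K0.cls_shift hasMappingCones (h0IsTriangulated F) (exists_id_eq_zero F)]
  exact K0.cls_eq_of_isoOf hasMappingCones (h0IsTriangulated F) (powOnePIso z)
    (powOnePIso_hom_mem z) (powOnePIso_inv_mem z)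

theorem k0Action_pow_one_x : k0Action F (K0.cls F (TwI.pow F 1)) (K0.cls F (P F KSVertex.x)) =
    K0.cls F (P F KSVertex.y) :=
  (k0Action_pow_one KSVertex.x).trans (one_smul ℤ _)

theorem k0Action_pow_one_y : k0Action F (K0.cls F (TwI.pow F 1)) (K0.cls F (P F KSVertex.y)) =
    -K0.cls F (P F KSVertex.x) :=
  (k0Action_pow_one KSVertex.y).trans (neg_one_smul ℤ _)

end DGP

namespace TwI

open DGP

variable (F) in
/-- The homomorphism from the Gaussian integers to the Grothendieck group which maps the imaginary
unit to the class of `Q`. -/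
noncomputable def gaussHom : GaussianInt →+ K0 F (TwI F) where
  toFun z := z.re • K0.cls F (𝟙_ (TwI F)) + z.im • K0.cls F (pow F 1)
  map_zero' := by simp
  map_add' z w := by
    rw [Zsqrtd.re_add, Zsqrtd.im_add, add_smul, add_smul]
    abel

theorem gaussHom_apply (z : GaussianInt) :
    gaussHom F z = z.re • K0.cls F (𝟙_ (TwI F)) + z.im • K0.cls F (pow F 1) := rfl

theorem eulerEquiv_k0Action (z : GaussianInt) (a : K0 F (DGP F)) :
    eulerEquiv F (k0Action F (gaussHom F z) a) = gaussAct z (eulerEquiv F a) := by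
  have h : k0Action F (K0.cls F (pow F 1)) a = (eulerEquiv F a).1 • K0.cls F (DGP.P F KSVertex.y) -
      (eulerEquiv F a).2 • K0.cls F (DGP.P F KSVertex.x) := by
    refine (congrArg _ (eq_zsmul_add_zsmul a)).trans ?_
    rw [map_add, map_zsmul, map_zsmul, k0Action_pow_one_x, k0Action_pow_one_y, smul_neg,
      ← sub_eq_add_neg]
  rw [gaussHom_apply, map_add, map_zsmul, map_zsmul, AddMonoidHom.add_apply,
      AddMonoidHom.zsmul_apply,
    AddMonoidHom.zsmul_apply, k0Action_unit, h, map_add, map_zsmul, map_zsmul, map_sub, map_zsmul,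
    map_zsmul, eulerEquiv_x, eulerEquiv_y]
  refine Prod.ext ?_ ?_
  · simp [gaussAct]; ring
  · simp [gaussAct]; ring

/-- Cup and cap give Q^(n+2) ≅ Q^n[1], so the class of Q^(n+2) is the negative of that of Q^n. -/
theorem cls_pow_mem {S : AddSubgroup (K0 F (TwI F))} (h0 : K0.cls F (pow F 0) ∈ S)
    (h1 : K0.cls F (pow F 1) ∈ S) (n : ℕ) : K0.cls F (pow F n) ∈ S := by
  induction n using Nat.twoStepInduction with
  | zero => exact h0
  | one => exact h1
  | more n ih _ =>
    rw [← K0.cls_eq_of_isoOf hasMappingCones (h0IsTriangulated F) (cupIso n) (cupIso_hom_mem n)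
      (cupIso_inv_mem n)]
    have h := K0.cls_shift_one (h0IsTriangulated F) (exists_id_eq_zero F) (pow F n)
    exact h ▸ neg_mem ih

theorem cls_mem {S : AddSubgroup (K0 F (TwI F))} (h0 : K0.cls F (pow F 0) ∈ S)
    (h1 : K0.cls F (pow F 1) ∈ S) (A : TwI F) : K0.cls F A ∈ S := by
  induction A using TwI.induction with
  | hzero A hA =>
    rw [K0.cls_eq_zero (h0IsTriangulated F) A (H0.isZero_of_id_eq_zero hA)]
    exact zero_mem S
  | hsingle n m =>
    have h := K0.cls_shift hasMappingCones (h0IsTriangulated F) (exists_id_eq_zero F) (pow F n) m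
    exact h ▸ S.zsmul_mem (cls_pow_mem h0 h1 n) _
  | hcone h hA hB =>
    rw [K0.cls_cone h] at hB
    exact (S.add_mem_cancel_left hA).1 hB

variable (F) in
/-- The isomorphism between the Gaussian integers and the Grothendieck group. -/
noncomputable def gaussEquiv : GaussianInt ≃+ K0 F (TwI F) :=
  AddEquiv.ofBijective (gaussHom F) (by
    refine ⟨fun z w h => ?_, fun a => K0.mem_of_cls_mem (S := (gaussHom F).range)
      (cls_mem ⟨1, ?_⟩ ⟨⟨0, 1⟩, ?_⟩) a⟩
    -- Injectivity is tested on [P(x)]: a Gaussian integer sends (1, 0) to its pair of real and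
    -- imaginary parts, so it can be recovered from its class.
    · have h1 := eulerEquiv_k0Action (F := F) z (K0.cls F (DGP.P F KSVertex.x))
      rw [h, eulerEquiv_k0Action, eulerEquiv_x] at h1
      simp only [gaussAct, mul_one, mul_zero, sub_zero, add_zero, Prod.mk.injEq] at h1
      exact Zsqrtd.ext h1.1.symm h1.2.symm
    · exact (gaussHom_apply 1).trans (by simp; rfl)
    · exact (gaussHom_apply _).trans (by simp))

theorem gaussEquiv_one : gaussEquiv F 1 = K0.cls F (𝟙_ (TwI F)) :=
  (gaussHom_apply 1).trans (by simp)

theorem gaussEquiv_i : gaussEquiv F ⟨0, 1⟩ = K0.cls F (pow F 1) :=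
  (gaussHom_apply _).trans (by simp)

theorem gaussAct_symm (a : K0 F (TwI F)) (b : K0 F (DGP F)) :
    gaussAct ((gaussEquiv F).symm a) (eulerEquiv F b) = eulerEquiv F (k0Action F a b) := by
  obtain ⟨z, rfl⟩ := (gaussEquiv F).surjective a
  rw [AddEquiv.symm_apply_apply]
  exact (eulerEquiv_k0Action z b).symm

/-- A Gaussian integer is determined by its effect on [P(x)], and A ⊗ B acts as A after B; so the
product formula is read off from this single orbit. -/
theorem gaussEquiv_symm_tensor (A B : TwI F) : (gaussEquiv F).symm (K0.cls F (A ⊗ B)) =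
    (gaussEquiv F).symm (K0.cls F A) * (gaussEquiv F).symm (K0.cls F B) := by
  have h := gaussAct_symm (K0.cls F (A ⊗ B)) (K0.cls F (DGP.P F KSVertex.x))
  rw [k0Action_tensor, ← gaussAct_symm, ← gaussAct_symm, eulerEquiv_x] at h
  simp only [gaussAct, mul_one, mul_zero, sub_zero, add_zero, Prod.mk.injEq] at h
  refine Zsqrtd.ext ?_ ?_
  · rw [h.1, Zsqrtd.re_mul]; ring
  · rw [h.2, Zsqrtd.im_mul]; ring

end TwI

end GrothendieckGroupOfModules

/-! ### Projectivity of P(x) and P(y). -/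

section ProjectiveModules

open KSAlg

variable {F : Type u} [Field F]

namespace DGMod

/-- The homomorphism from `P(z)` which maps the generator to the component at `z` of a vector. -/
noncomputable def homOfVector (z : KSVertex) {N : DGMod F} (w : N.V) : (P F z).V →ₗ[F] N.V :=
  (N.act.toLinearMap.flip w).comp (leftIdeal F z).subtype

theorem homOfVector_mem (z : KSVertex) {N : DGMod F} (w : N.V) :
    homOfVector z w ∈ HomSpace (P F z) N := by
  induction w using homogeneous_induction N.isInternal with
  | hg n w hw =>
    refine mem_homSpace (n := n) ⟨fun r v => (N.act_act r v.1 w).symm, fun i v hv => ?_⟩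
    rw [add_comm]
    exact N.act_mem hv hw
  | h0 =>
    have h : homOfVector z (0 : N.V) = 0 := LinearMap.ext fun v => map_zero (N.act v.1)
    rw [h]
    exact zero_mem _
  | ha v w hv hw =>
    have h : homOfVector z (v + w) = homOfVector z v + homOfVector z w :=
      LinearMap.ext fun u => map_add (N.act u.1) v w
    rw [h]
    exact add_mem hv hw

/-- A homomorphism from P(z) is determined by its value at e(z). If it is closed, that value is a
cycle, hence the differential of some w by acyclicity, and r ↦ r w is the required primitive. -/
theorem isProjective_P (z : KSVertex) : (P F z).IsProjective := by
  intro N hN f hf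
  have h0 : N.d (toLin f (genP z)) + toLin f 0 = 0 := congrArg (fun g => toLin g (genP z)) hf
  rw [map_zero, add_zero] at h0
  obtain ⟨w, hw⟩ := hN _ h0
  -- The vector w need be neither homogeneous nor in e(z)N: r w = r e(z) w for r in R e(z), and sums
  -- of homogeneous homomorphisms are allowed.
  refine ⟨ofLin (homOfVector z w) (homOfVector_mem z w), hom_ext (LinearMap.ext fun v => ?_)⟩
  change N.d (N.act v.1 w) + homOfVector z w 0 = toLin f v
  rw [map_zero, add_zero, N.d_act, hw, ← toLin_act, act_genP]

end DGMod

end ProjectiveModules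

theorem theorem2 (F : Type u) [Field F] [CharP F 2] :
    (∀ z : KSVertex, (DGMod.P F z).IsProjective) ∧
    H0IsTriangulated F (TwI F) ∧
    H0IsTriangulated F (DGP F) ∧
    Nonempty (DGBimod.Iso (DGBimod.tensBimod (DGBimod.M F) (DGBimod.M F))
      ((DGBimod.regular F).shift 1)) ∧
    ∃ φ : K0 F (DGP F) ≃+ ℤ × ℤ,
      φ (K0.cls F (DGP.P F KSVertex.x)) = (1, 0) ∧
      φ (K0.cls F (DGP.P F KSVertex.y)) = (0, 1) ∧
      ∃ γ : GaussianInt ≃+ K0 F (TwI F),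
        γ 1 = K0.cls F (𝟙_ (TwI F)) ∧
        γ ⟨0, 1⟩ = K0.cls F (TwI.pow F 1) ∧
        (∀ A B : TwI F, γ.symm (K0.cls F (A ⊗ B)) =
          γ.symm (K0.cls F A) * γ.symm (K0.cls F B)) ∧
        ∃ _ : MonoidalLeftAction (TwI F) (DGP F),
          IsDGAction F (TwI F) (DGP F) ∧
          ActsByTensor (TwI.pow F 1) (DGBimod.M F) ∧
          ∃ κ : K0 F (TwI F) →+ K0 F (DGP F) →+ K0 F (DGP F),
            (∀ (A : TwI F) (X : DGP F), κ (K0.cls F A) (K0.cls F X) = K0.cls F (A ⊙ₗ X)) ∧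
            ∀ (z : GaussianInt) (v : K0 F (DGP F)), φ (κ (γ z) v) = gaussAct z (φ v) :=
  ⟨DGMod.isProjective_P, TwI.h0IsTriangulated F, DGP.h0IsTriangulated F, ⟨DGBimod.squareIso F⟩,
    DGP.eulerEquiv F, DGP.eulerEquiv_x, DGP.eulerEquiv_y, TwI.gaussEquiv F, TwI.gaussEquiv_one,
    TwI.gaussEquiv_i, TwI.gaussEquiv_symm_tensor, inferInstance, DGP.isDGAction, DGP.actsByTensor,
    DGP.k0Action F, DGP.k0Action_cls, TwI.eulerEquiv_k0Action⟩
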